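/- Let $(g,n)$ be a pair of non-negative integers with $2g-2+n>0$. Graphs are finite connected $n$-marked vertex-weighted graphs of genus $g$ (first Betti number plus sum of the vertex weights), and a morphism of such graphs is a weighted edge contraction followed by an isomorphism. A graph is stable if $2h(v)-2+\mathrm{val}(v)>0$ for all vertices $v$; it is quasi-stable if all vertices of weight $0$ have valence at least $2$ and those of weight $0$ and valence $2$ (called exceptional) have two distinct edges and no legs and are pairwise non-adjacent. The stabilization $G^{\mathrm{st}}$ of a quasi-stable graph is obtained by replacing each exceptional vertex and its two edges by one edge (of length the sum of the two lengths, if $G$ is a metric graph). A universal stability condition $\varphi$ of type $(g,n)$ assigns to each stable graph $G$ a function $\varphi_G\colon V(G)\to\mathbb{R}$ with integral sum $|\varphi|$, such that $\varphi_{G_2}(v)=\sum_{w\in\pi^{-1}(v)}\varphi_{G_1}(w)$ for every morphism $\pi\colon G_1\to G_2$. It is extended to quasi-stable graphs $G$ by $0$ on exceptional vertices and by $\varphi_{G^{\mathrm{st}}}$ on the others. It is general if, for each quasi-stable graph $G$ and each $S\subseteq V(G)$, $\varphi_G(S)+\tfrac12|E(S,S^c)|\in\mathbb{Z}$ implies that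 $S$ or $S^c$ consists of exceptional vertices. A divisor $D$ on a quasi-stable graph $G$ is $\varphi$-semistable if it has value $1$ at exceptional vertices, degree $|\varphi|$, and $|D(S)-\varphi_G(S)|\le\tfrac12|E(S,S^c)|$ for all $S\subseteq V(G)$. The topological stack $|\mathcal{M}^{\mathrm{trop}}_{g,n}|$ (resp. $|\mathcal{J}^{\mathrm{trop}}_{g,n}(\varphi)|$) parametrizes continuous families over topological spaces $T$ of stable tropical curves with real edge lengths (resp. of pairs $(\Gamma,D)$ of a quasi-stable tropical curve with real edge lengths and a $\varphi$-semistable divisor on its graph), where a family consists of such an object over each $t\in T$ and of locally compatible specialization morphisms from the graph over $t'$ to the graph over $t$ for $t'$ near $t$ (pushing forward the divisor over $t'$ to the divisor over $t$), such that the length over $t'$ of an edge tends to the length over $t$ of its image (to $0$ if it is contracted) as $t'\to t$. Let $|\Phi^{\mathrm{trop}}|\colon|\mathcal{J}^{\mathrm{trop}}_{g,n}(\varphi)|\to|\mathcal{M}^{\mathrm{trop}}_{g,n}|$ be the forgetful-stabilization morphism $(\Gamma,D)\mapsto\Gamma^{\mathrm{st}}$. Let $\varphi$ be general and let $\overline\Gamma$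 be a stable tropical curve of type $(g,n)$ with real edge lengths. Then the fibre $\star\times_{|\mathcal{M}^{\mathrm{trop}}_{g,n}|}|\mathcal{J}^{\mathrm{trop}}_{g,n}(\varphi)|$ of $|\Phi^{\mathrm{trop}}|$ over $\overline\Gamma$ is canonically homeomorphic to the space $\mathrm{Pic}^{|\varphi|}(\overline\Gamma)$ of linear equivalence classes of divisors of degree $|\varphi|$ on the metric graph $\overline\Gamma$, which is a real torus of dimension $b_1(\overline\Gamma)$. More precisely, the stack $\star\times_{|\mathcal{M}^{\mathrm{trop}}_{g,n}|}|\mathcal{J}^{\mathrm{trop}}_{g,n}(\varphi)|$ is represented by the topological space $\mathrm{Pic}^{|\varphi|}(\overline\Gamma)$: for every topological space $T$ the groupoid of its $T$-points is equivalent, naturally in $T$, to the set of continuous maps $T\to\mathrm{Pic}^{|\varphi|}(\overline\Gamma)$, where at each point of $T$ a triple $(\Gamma,D,\overline\Gamma\cong\Gamma^{\mathrm{st}})$ corresponds to the class of the divisor $\sum_v D(v)\,v$, each vertex $v$ of $\Gamma$ (exceptional or not) being regarded as a point of $\overline\Gamma$. -/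

import Mathlib

open CategoryTheory Topology

/-! ## Graphs -/

/-- An `n`-marked vertex-weighted graph: a finite set `X` (vertices and flags together), an
idempotent root map `r` whose image is the set of vertices, and an involution `i` fixing the
vertices.  The flags are the `x` with `r x ≠ x`; the legs are the flags fixed by `i`, the
half-edges are the `x` with `i x ≠ x`, and the edges are the pairs `{x, i x}` of half-edges.
`h x` is the weight (genus) of the vertex `r x`, and `m` is the marking of the legs. -/
structure MGraph (n : ℕ) where
  X : Type
  finX : Finite X
  r : X → X
  i : X → X
  r_r : ∀ x, r (r x) = r x
  i_i : ∀ x, i (i x) = x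
  i_r : ∀ x, i (r x) = r x
  h : X → ℕ
  h_r : ∀ x, h (r x) = h x
  m : Fin n ≃ {x : X // r x ≠ x ∧ i x = x}

namespace MGraph

variable {n : ℕ}

/-- The vertices of a graph. -/
def V (G : MGraph n) : Type := {x : G.X // G.r x = x}

/-- The valence of a vertex: the number of flags (half-edges and legs) rooted at it. -/
noncomputable def val (G : MGraph n) (v : G.X) : ℕ := {x | G.r x ≠ x ∧ G.r x = v}.ncard

/-- Exceptional vertices: weight zero and valence two. -/
def Exc (G : MGraph n) (v : G.X) : Prop := G.r v = v ∧ G.h v = 0 ∧ G.val v = 2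

/-- A subgraph `S` (a subset stable under `r` and `i`) is connected: it has a vertex, and any two
of its vertices are joined by a path of half-edges of `S`. -/
def ConnOn (G : MGraph n) (S : Set G.X) : Prop :=
  (∃ v ∈ S, G.r v = v) ∧ ∀ v ∈ S, ∀ w ∈ S, G.r v = v → G.r w = w →
    Relation.ReflTransGen (fun a b => ∃ x ∈ S, G.r x = a ∧ G.r (G.i x) = b) v w

/-- First Betti number of a connected subgraph: number of edges minus number of vertices
plus one. -/
noncomputable def b1On (G : MGraph n) (S : Set G.X) : ℤ :=
  ({x | x ∈ S ∧ G.i x ≠ x}.ncard : ℤ) / 2 - ({x | x ∈ S ∧ G.r x = x}.ncard : ℤ) + 1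

/-- Genus of a connected subgraph: first Betti number plus the sum of the vertex weights. -/
noncomputable def genusOn (G : MGraph n) (S : Set G.X) : ℤ :=
  G.b1On S + ∑ᶠ v ∈ {x | x ∈ S ∧ G.r x = x}, (G.h v : ℤ)

/-- Morphisms of `n`-marked vertex-weighted graphs. -/
structure IsMor (G₁ G₂ : MGraph n) (π : G₁.X → G₂.X) : Prop where
  map_r : ∀ x, π (G₁.r x) = G₂.r (π x)
  map_i : ∀ x, π (G₁.i x) = G₂.i (π x)
  flag : ∀ f, G₂.r f ≠ f → ∃! x, π x = f
  mark : ∀ k, π (G₁.m k).1 = (G₂.m k).1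
  conn : ∀ v, G₂.r v = v → G₁.ConnOn {x | π x = v}
  genus : ∀ v, G₂.r v = v → G₁.genusOn {x | π x = v} = G₂.h v

/-- Stable graphs of type `(g, n)`. -/
structure IsStable (g : ℕ) (G : MGraph n) : Prop where
  conn : G.ConnOn Set.univ
  genus : G.genusOn Set.univ = g
  pos : ∀ v, G.r v = v → 2 < 2 * G.h v + G.val v

/-- Quasi-stable graphs of type `(g, n)`, for `(g, n)` hyperbolic: every vertex of weight zero has
valence at least two, and the two flags at an exceptional vertex are half-edges whose opposite
half-edges are rooted at non-exceptional vertices (so an exceptional vertex has two distinct edges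
and no legs, and no two exceptional vertices are adjacent). -/
structure IsQS (g : ℕ) (G : MGraph n) : Prop where
  hyp : 2 < 2 * g + n
  conn : G.ConnOn Set.univ
  genus : G.genusOn Set.univ = g
  two_le : ∀ v, G.r v = v → G.h v = 0 → 2 ≤ G.val v
  exc : ∀ x, G.r x ≠ x → G.Exc (G.r x) → G.i x ≠ x ∧ ¬ G.Exc (G.r (G.i x))

open Classical in
/-- For a flag `x` rooted at an exceptional vertex, the other flag rooted at that vertex. -/
noncomputable def opp (G : MGraph n) (x : G.X) : G.X :=
  if hx : ∃ y, G.r y ≠ y ∧ G.r y = G.r x ∧ y ≠ x then hx.choose else x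

section basic

variable {G : MGraph n}

theorem i_vertex {x : G.X} (hx : G.r x = x) : G.i x = x := by
  rw [← hx, G.i_r, hx]

theorem flag_of_half {x : G.X} (hx : G.i x ≠ x) : G.r x ≠ x := fun h => hx (i_vertex h)

theorem i_half {x : G.X} (hx : G.i x ≠ x) : G.i (G.i x) ≠ G.i x := by
  rw [G.i_i]; exact hx.symm

theorem flag_i {x : G.X} (hx : G.r x ≠ x) : G.r (G.i x) ≠ G.i x := by
  intro h
  have h2 := i_vertex h
  rw [G.i_i] at h2
  rw [← h2] at h
  exact hx h

theorem flags_ncard {v : G.X} (hv : G.Exc v) :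
    ∃ a b, a ≠ b ∧ ∀ x, (G.r x ≠ x ∧ G.r x = v) ↔ (x = a ∨ x = b) := by
  obtain ⟨a, b, hab, h⟩ := Set.ncard_eq_two.1 hv.2.2
  refine ⟨a, b, hab, fun x => ?_⟩
  have : x ∈ {x | G.r x ≠ x ∧ G.r x = v} ↔ x ∈ ({a, b} : Set G.X) := by rw [h]
  simpa using this

theorem opp_spec {x : G.X} (hx : G.r x ≠ x) (he : G.Exc (G.r x)) :
    G.r (G.opp x) ≠ G.opp x ∧ G.r (G.opp x) = G.r x ∧ G.opp x ≠ x := by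
  obtain ⟨a, b, hab, h⟩ := flags_ncard he
  have hex : ∃ y, G.r y ≠ y ∧ G.r y = G.r x ∧ y ≠ x := by
    rcases (h x).1 ⟨hx, rfl⟩ with h1 | h1
    · have := (h b).2 (Or.inr rfl)
      exact ⟨b, this.1, this.2, by rw [h1]; exact hab.symm⟩
    · have := (h a).2 (Or.inl rfl)
      exact ⟨a, this.1, this.2, by rw [h1]; exact hab⟩
  unfold opp
  rw [dif_pos hex]
  exact hex.choose_spec

theorem opp_unique {x y : G.X} (hx : G.r x ≠ x) (he : G.Exc (G.r x)) (hy : G.r y ≠ y)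
    (hr : G.r y = G.r x) (hne : y ≠ x) : G.opp x = y := by
  obtain ⟨a, b, hab, h⟩ := flags_ncard he
  obtain ⟨h1, h2, h3⟩ := opp_spec hx he
  have hx' := (h x).1 ⟨hx, rfl⟩
  have hy' := (h y).1 ⟨hy, hr⟩
  have ho' := (h (G.opp x)).1 ⟨h1, h2⟩
  grind

theorem opp_opp {x : G.X} (hx : G.r x ≠ x) (he : G.Exc (G.r x)) : G.opp (G.opp x) = x := by
  obtain ⟨h1, h2, h3⟩ := opp_spec hx he
  exact opp_unique h1 (h2 ▸ he) hx h2.symm h3.symm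

theorem ncard_flags_rooted (S : Set G.X) (_hS : ∀ v ∈ S, G.r v = v) :
    ({x | G.r x ≠ x ∧ G.r x ∈ S}.ncard : ℤ) = ∑ᶠ v ∈ S, (G.val v : ℤ) := by
  classical
  have := G.finX
  let _ : Fintype G.X := Fintype.ofFinite _
  rw [finsum_mem_eq_finite_toFinset_sum _ (Set.toFinite S)]
  rw [Set.ncard_eq_toFinset_card']
  rw [Finset.card_eq_sum_card_fiberwise (f := G.r) (t := (Set.toFinite S).toFinset)]
  · push_cast
    refine Finset.sum_congr rfl fun v hv => ?_
    simp only [val, Set.ncard_eq_toFinset_card']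
    congr 2
    ext x
    simp only [Finset.mem_filter, Set.mem_toFinset, Set.mem_ofPred_eq]
    have hv' : v ∈ S := by simpa using hv
    constructor
    · rintro ⟨⟨a, b⟩, c⟩; exact ⟨a, c⟩
    · rintro ⟨a, c⟩; exact ⟨⟨a, c ▸ hv'⟩, c⟩
  · intro x hx
    simp at hx ⊢
    exact hx.2

/-- A connected graph with a vertex without flags is a point. -/
theorem eq_of_val_zero (hc : G.ConnOn Set.univ) {v : G.X} (hv : G.r v = v) (h0 : G.val v = 0)
    (x : G.X) : x = v := by
  have := G.finX
  have hno : ∀ y, G.r y = v → y = v := by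
    intro y hy
    by_contra hne
    have h1 : {x | G.r x ≠ x ∧ G.r x = v} = ∅ := (Set.ncard_eq_zero (Set.toFinite _)).1 h0
    have : y ∈ {x | G.r x ≠ x ∧ G.r x = v} := ⟨by rw [hy]; exact Ne.symm hne, hy⟩
    rw [h1] at this
    exact this
  have key : ∀ w, Relation.ReflTransGen
      (fun a b => ∃ x ∈ (Set.univ : Set G.X), G.r x = a ∧ G.r (G.i x) = b) v w → w = v := by
    intro w hw
    induction hw with
    | refl => rfl
    | tail _ h ih =>
      obtain ⟨y, -, h1, h2⟩ := h
      have := hno y (h1.trans ih)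
      rw [← h2, this, i_vertex hv, hv]
  exact hno x (key _ (hc.2 v trivial (G.r x) trivial hv (G.r_r x)))

end basic


theorem even_half (G : MGraph n) (S : Set G.X) (hS : ∀ x ∈ S, G.i x ∈ S) :
    Even ({x | x ∈ S ∧ G.i x ≠ x}.ncard) := by
  classical
  have := G.finX
  let _ : Fintype G.X := Fintype.ofFinite _
  rw [Set.ncard_eq_toFinset_card', ← ZMod.natCast_eq_zero_iff_even]
  have := Finset.sum_involution (s := {x | x ∈ S ∧ G.i x ≠ x}.toFinset)
    (f := fun _ => (1 : ZMod 2)) (fun x _ => G.i x) (by intros; decide)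
    (by intro x hx _; simp at hx; exact hx.2)
    (by intro x hx; simp at hx ⊢; exact ⟨hS x hx.1, by rw [G.i_i]; exact Ne.symm hx.2⟩)
    (by intro x _; exact G.i_i x)
  simpa using this

section mor

variable {g : ℕ} {G₁ G₂ : MGraph n} {π : G₁.X → G₂.X}

theorem IsMor.flag_of_flag (hπ : IsMor G₁ G₂ π) {x : G₁.X} (hx : G₂.r (π x) ≠ π x) :
    G₁.r x ≠ x := fun h => hx (by rw [← hπ.map_r, h])

theorem IsMor.inj (hπ : IsMor G₁ G₂ π) {x y : G₁.X} (hx : G₂.r (π x) ≠ π x) (h : π x = π y) :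
    x = y := (hπ.flag _ hx).unique rfl h.symm

theorem IsMor.half_of_contr (hπ : IsMor G₁ G₂ π) {x : G₁.X} (hx : G₁.r x ≠ x)
    (hc : G₂.r (π x) = π x) : G₁.i x ≠ x := by
  intro hi
  have hk : (G₁.m (G₁.m.symm ⟨x, hx, hi⟩)).1 = x := by simp
  have := hπ.mark (G₁.m.symm ⟨x, hx, hi⟩)
  rw [hk] at this
  rw [this] at hc
  exact (G₂.m (G₁.m.symm ⟨x, hx, hi⟩)).2.1 hc

/-- The flags at a vertex of the target correspond to the non-contracted flags of the fibre. -/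
theorem IsMor.ncard_flags (hπ : IsMor G₁ G₂ π) (w : G₂.X) :
    {x | G₂.r (π x) ≠ π x ∧ G₂.r (π x) = w}.ncard = G₂.val w := by
  unfold val
  have : π '' {x | G₂.r (π x) ≠ π x ∧ G₂.r (π x) = w} = {x | G₂.r x ≠ x ∧ G₂.r x = w} := by
    ext f
    constructor
    · rintro ⟨x, hx, rfl⟩; exact hx
    · rintro ⟨h1, h2⟩
      obtain ⟨x, rfl, -⟩ := hπ.flag f h1
      exact ⟨x, ⟨h1, h2⟩, rfl⟩
  rw [← this, Set.InjOn.ncard_image]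
  intro x hx y _ h
  exact hπ.inj hx.1 h

/-- The vertices lying over an exceptional vertex are exceptional. -/
theorem IsMor.exc_of_exc (hπ : IsMor G₁ G₂ π) (h₁ : IsQS g G₁) {x : G₁.X}
    (he : G₂.Exc (G₂.r (π x))) : G₁.Exc (G₁.r x) := by
  classical
  have := G₁.finX
  set w := G₂.r (π x) with hw
  have hπx : π (G₁.r x) = w := hπ.map_r x
  have hgen := hπ.genus w he.1
  rw [he.2.1] at hgen
  set SV : Set G₁.X := {x | x ∈ {x | π x = w} ∧ G₁.r x = x} with hSV
  have hfl := ncard_flags_rooted SV (fun v hv => hv.2)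
  have hsplit : {x | G₁.r x ≠ x ∧ G₁.r x ∈ SV} =
      {x | x ∈ {x | π x = w} ∧ G₁.i x ≠ x} ∪ {x | G₂.r (π x) ≠ π x ∧ G₂.r (π x) = w} := by
    ext y
    constructor
    · rintro ⟨hy, hy2⟩
      have hy3 : G₂.r (π y) = w := by rw [← hπ.map_r]; exact hy2.1
      by_cases hc : G₂.r (π y) = π y
      · exact Or.inl ⟨hc.symm.trans hy3, hπ.half_of_contr hy hc⟩
      · exact Or.inr ⟨hc, hy3⟩
    · rintro (⟨hy, hy2⟩ | ⟨hy, hy2⟩)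
      · refine ⟨flag_of_half hy2, ?_, G₁.r_r y⟩
        change π (G₁.r y) = w
        rw [hπ.map_r, show π y = w from hy, he.1]
      · refine ⟨hπ.flag_of_flag hy, ?_, G₁.r_r y⟩
        change π (G₁.r y) = w
        rw [hπ.map_r, hy2]
  have hdisj : Disjoint {x | x ∈ {x | π x = w} ∧ G₁.i x ≠ x}
      {x | G₂.r (π x) ≠ π x ∧ G₂.r (π x) = w} := by
    rw [Set.disjoint_left]
    rintro y ⟨hy, -⟩ ⟨hy2, -⟩
    have hy' : π y = w := hy
    exact hy2 (by rw [hy', he.1])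
  have hcard := Set.ncard_union_eq hdisj (Set.toFinite _) (Set.toFinite _)
  rw [← hsplit, hπ.ncard_flags w, he.2.2] at hcard
  have heven := even_half G₁ {x | π x = w} (by
    intro y hy
    have hy' : π y = w := hy
    change π (G₁.i y) = w
    rw [hπ.map_i, hy', i_vertex he.1])
  have hVfin : SV.Finite := Set.toFinite _
  have hVcard : (SV.ncard : ℤ) = ∑ v ∈ hVfin.toFinset, (1 : ℤ) := by
    rw [Set.ncard_eq_toFinset_card _ hVfin]; simp
  unfold genusOn b1On at hgen
  rw [finsum_mem_eq_finite_toFinset_sum _ hVfin] at hgen hfl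
  have hsum : ∑ v ∈ hVfin.toFinset, (2 * (G₁.h v : ℤ) - 2 * 1 + G₁.val v) = 0 := by
    rw [Finset.sum_add_distrib, Finset.sum_sub_distrib, ← Finset.mul_sum, ← Finset.mul_sum,
      ← hVcard, ← hfl]
    rw [← hSV] at hgen
    obtain ⟨k, hk⟩ := heven
    rw [hcard, hk]
    rw [hk] at hgen
    push_cast at hgen ⊢
    omega
  have hzero := (Finset.sum_eq_zero_iff_of_nonneg (fun v hv => by
    have hv' : v ∈ SV := by simpa using hv
    have := h₁.two_le v hv'.2
    by_cases h0 : G₁.h v = 0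
    · have := this h0; omega
    · omega)).1 hsum (G₁.r x) (by simp; exact ⟨hπx, G₁.r_r x⟩)
  by_cases h0 : G₁.h (G₁.r x) = 0
  · exact ⟨G₁.r_r x, h0, by omega⟩
  · exfalso
    have hall := eq_of_val_zero h₁.conn (G₁.r_r x) (by omega)
    obtain ⟨a, b, -, hab⟩ := flags_ncard he
    obtain ⟨hf, -⟩ := (hab a).2 (Or.inl rfl)
    obtain ⟨y, rfl, -⟩ := hπ.flag a hf
    apply hπ.flag_of_flag hf
    rw [hall y, G₁.r_r]

/-- An exceptional vertex without contracted flags has exceptional image. -/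
theorem IsMor.exc_map (hπ : IsMor G₁ G₂ π) {u : G₁.X} (hu : G₁.Exc u)
    (hc : ∀ x, G₁.r x ≠ x → G₁.r x = u → G₂.r (π x) ≠ π x) : G₂.Exc (π u) := by
  have hv : G₂.r (π u) = π u := by rw [← hπ.map_r, hu.1]
  have hvert : ∀ v, Relation.ReflTransGen
      (fun a b => ∃ x ∈ {x | π x = π u}, G₁.r x = a ∧ G₁.r (G₁.i x) = b) u v → v = u := by
    intro v h
    induction h with
    | refl => rfl
    | tail _ h ih =>
      obtain ⟨y, hy, h1, h2⟩ := h
      have hy' : π y = π u := hy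
      by_cases hf : G₁.r y = y
      · rw [← h2, i_vertex hf, h1, ih]
      · exact absurd (by rw [hy', hv]) (hc y hf (h1.trans ih))
  have hroot : ∀ y, π y = π u → G₁.r y = u := fun y hy =>
    hvert _ ((hπ.conn _ hv).2 u rfl _ (by
      change π (G₁.r y) = π u
      rw [hπ.map_r, hy, hv]) hu.1 (G₁.r_r y))
  have hfib : ∀ y, π y = π u → y = u := by
    intro y hy
    have h1 := hroot y hy
    by_cases hf : G₁.r y = y
    · rw [← hf, h1]
    · exact absurd (by rw [hy, hv]) (hc y hf h1)
  have hset : {x | π x = π u} = {u} := by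
    ext y; exact ⟨fun h => hfib y h, fun h => by rw [show y = u from h]; rfl⟩
  have hgen := hπ.genus _ hv
  rw [hset] at hgen
  unfold genusOn b1On at hgen
  have e1 : {x | x ∈ ({u} : Set G₁.X) ∧ G₁.i x ≠ x} = ∅ := by
    ext y
    simp only [Set.mem_singleton_iff, Set.mem_ofPred_eq, Set.mem_empty_iff_false, iff_false]
    rintro ⟨rfl, h⟩
    exact h (i_vertex hu.1)
  have e2 : {x | x ∈ ({u} : Set G₁.X) ∧ G₁.r x = x} = {u} := by
    ext y
    simp only [Set.mem_singleton_iff, Set.mem_ofPred_eq]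
    exact ⟨fun h => h.1, fun h => ⟨h, h ▸ hu.1⟩⟩
  rw [e1, e2, finsum_mem_singleton, hu.2.1] at hgen
  simp at hgen
  refine ⟨hv, by omega, ?_⟩
  rw [← hπ.ncard_flags, ← hu.2.2]
  unfold val
  congr 1
  ext y
  constructor
  · rintro ⟨h1, h2⟩
    refine ⟨hπ.flag_of_flag h1, ?_⟩
    have := hfib (G₁.r y) (by rw [hπ.map_r, h2])
    exact this
  · rintro ⟨h1, h2⟩
    exact ⟨hc y h1 h2, by rw [← hπ.map_r, h2]⟩

end mor


/-! ## Stabilization of quasi-stable graphs -/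

section stab

variable {g : ℕ} {G : MGraph n}

theorem exc_root {v : G.X} (h : G.Exc v) : G.Exc (G.r v) := by rw [h.1]; exact h

/-- The flag `i x` when it is rooted at an exceptional vertex. -/
theorem IsQS.i_flag {x : G.X} (hx : ¬ G.Exc (G.r x)) (he : G.Exc (G.r (G.i x))) :
    G.r (G.i x) ≠ G.i x := by
  intro h
  have h2 := i_vertex h
  rw [G.i_i] at h2
  rw [← h2] at he
  exact hx he

theorem IsQS.opp_root {x : G.X} (hx : ¬ G.Exc (G.r x)) (he : G.Exc (G.r (G.i x))) :
    G.r (G.opp (G.i x)) = G.r (G.i x) := (opp_spec (IsQS.i_flag hx he) he).2.1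

theorem IsQS.opp_flag {x : G.X} (hx : ¬ G.Exc (G.r x)) (he : G.Exc (G.r (G.i x))) :
    G.r (G.opp (G.i x)) ≠ G.opp (G.i x) := (opp_spec (IsQS.i_flag hx he) he).1

theorem IsQS.opp_ne {x : G.X} (hx : ¬ G.Exc (G.r x)) (he : G.Exc (G.r (G.i x))) :
    G.opp (G.i x) ≠ G.i x := (opp_spec (IsQS.i_flag hx he) he).2.2

theorem IsQS.nexc_i_opp (hG : IsQS g G) {x : G.X} (hx : ¬ G.Exc (G.r x))
    (he : G.Exc (G.r (G.i x))) : ¬ G.Exc (G.r (G.i (G.opp (G.i x)))) :=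
  (hG.exc _ (IsQS.opp_flag hx he) (by rw [IsQS.opp_root hx he]; exact he)).2

open Classical in
/-- The involution of the stabilization: a half-edge ending at an exceptional vertex `v` is paired
with the half-edge opposite to the other flag at `v`. -/
noncomputable def stabInv (G : MGraph n) (x : G.X) : G.X :=
  if G.Exc (G.r (G.i x)) then G.i (G.opp (G.i x)) else G.i x

theorem IsQS.nexc_stabInv (hG : IsQS g G) {x : G.X} (hx : ¬ G.Exc (G.r x)) :
    ¬ G.Exc (G.r (G.stabInv x)) := by
  unfold stabInv
  split_ifs with h
  · exact hG.nexc_i_opp hx h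
  · exact h

theorem IsQS.stabInv_stabInv {x : G.X} (hx : ¬ G.Exc (G.r x)) :
    G.stabInv (G.stabInv x) = x := by
  unfold stabInv
  by_cases h : G.Exc (G.r (G.i x))
  · have h3 : G.Exc (G.r (G.i (G.i (G.opp (G.i x))))) := by
      rw [G.i_i, IsQS.opp_root hx h]; exact h
    rw [if_pos h, if_pos h3, G.i_i (G.opp (G.i x)), opp_opp (IsQS.i_flag hx h) h, G.i_i]
  · have h3 : ¬ G.Exc (G.r (G.i (G.i x))) := by rw [G.i_i]; exact hx
    rw [if_neg h, if_neg h3, G.i_i]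

theorem stabInv_of_fix {x : G.X} (hx : ¬ G.Exc (G.r x)) (hi : G.i x = x) : G.stabInv x = x := by
  unfold stabInv
  rw [hi, if_neg hx]

theorem IsQS.stabInv_eq {x : G.X} (hx : ¬ G.Exc (G.r x)) :
    G.stabInv x = x ↔ G.i x = x := by
  refine ⟨fun h => ?_, stabInv_of_fix hx⟩
  unfold stabInv at h
  split_ifs at h with he
  · exact absurd (by rw [← G.i_i (G.opp (G.i x)), h]) (IsQS.opp_ne hx he)
  · exact h

/-- The stabilization of a quasi-stable graph: its vertices are the non-exceptional vertices, its
flags are the flags rooted at non-exceptional vertices. -/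
@[reducible] noncomputable def stab (G : MGraph n) (hG : IsQS g G) : MGraph n where
  X := {x : G.X // ¬ G.Exc (G.r x)}
  finX := by have := G.finX; infer_instance
  r x := ⟨G.r x.1, by rw [G.r_r]; exact x.2⟩
  i x := ⟨G.stabInv x.1, hG.nexc_stabInv x.2⟩
  r_r x := Subtype.ext (G.r_r _)
  i_i x := Subtype.ext (IsQS.stabInv_stabInv x.2)
  i_r x := Subtype.ext (stabInv_of_fix (by rw [G.r_r]; exact x.2) (G.i_r _))
  h x := G.h x.1
  h_r x := G.h_r _
  m := G.m.trans
    { toFun := fun l => ⟨⟨l.1, fun he => (hG.exc _ l.2.1 he).1 l.2.2⟩,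
        fun h => l.2.1 (congrArg Subtype.val h),
        Subtype.ext (stabInv_of_fix (fun he => (hG.exc _ l.2.1 he).1 l.2.2) l.2.2)⟩
      invFun := fun l => ⟨l.1.1, fun h => l.2.1 (Subtype.ext h),
        (IsQS.stabInv_eq l.1.2).1 (congrArg Subtype.val l.2.2)⟩
      left_inv := fun _ => rfl
      right_inv := fun _ => rfl }

/-- The subgraph of the stabilization induced by a subgraph. -/
def stabSub (hG : IsQS g G) (W : Set G.X) : Set (G.stab hG).X :=
  {x | x.1 ∈ W ∧ (G.Exc (G.r (G.i x.1)) → G.opp (G.i x.1) ∈ W)}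

variable {W : Set G.X}

theorem IsQS.connOn_stabSub (hG : IsQS g G) (hr : ∀ x ∈ W, G.r x ∈ W) (hi : ∀ x ∈ W, G.i x ∈ W)
    (hf : ∀ v ∈ W, G.Exc v → ∃ x ∈ W, G.r x ≠ x ∧ G.r x = v) (hW : G.ConnOn W) :
    (G.stab hG).ConnOn (stabSub hG W) := by
  have hvert : ∀ v ∈ W, G.r v = v → ∀ hv : ¬ G.Exc (G.r v),
      (⟨v, hv⟩ : (G.stab hG).X) ∈ stabSub hG W := by
    intro v hvW hrv hv
    refine ⟨hvW, fun he => ?_⟩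
    dsimp only at he
    rw [i_vertex hrv] at he
    exact absurd he hv
  constructor
  · obtain ⟨⟨v, hv, hrv⟩, -⟩ := hW
    by_cases he : G.Exc v
    · obtain ⟨x, hx, hxf, rfl⟩ := hf v hv he
      have := (hG.exc x hxf he).2
      exact ⟨⟨G.r (G.i x), by rw [G.r_r]; exact this⟩,
        hvert _ (hr _ (hi _ hx)) (G.r_r _) _, Subtype.ext (G.r_r _)⟩
    · exact ⟨⟨v, by rw [hrv]; exact he⟩, hvert _ hv hrv _, Subtype.ext hrv⟩
  · rintro ⟨a, ha⟩ haW ⟨b, hb⟩ hbW hra hrb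
    have hra' : G.r a = a := congrArg Subtype.val hra
    have hrb' : G.r b = b := congrArg Subtype.val hrb
    have hpath := hW.2 a haW.1 b hbW.1 hra' hrb'
    have key : ∀ c, Relation.ReflTransGen (fun a b => ∃ x ∈ W, G.r x = a ∧ G.r (G.i x) = b) a c →
        ∀ z : (G.stab hG).X, (z.1 = c ∨ (G.Exc c ∧ ∃ y ∈ W, G.r y ≠ y ∧ G.r y = c ∧
          G.r (G.i y) = z.1)) →
        Relation.ReflTransGen (fun a b => ∃ x ∈ stabSub hG W,
          (G.stab hG).r x = a ∧ (G.stab hG).r ((G.stab hG).i x) = b) ⟨a, ha⟩ z := by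
      intro c hc
      induction hc with
      | refl =>
        rintro z (hz | ⟨he, -⟩)
        · have : z = ⟨a, ha⟩ := Subtype.ext hz
          rw [this]
        · exact absurd (exc_root he) ha
      | @tail c c' _ hstep ih =>
        obtain ⟨x, hxW, hxc, hxc'⟩ := hstep
        by_cases hxv : G.r x = x
        · have hcc : c' = c := by rw [← hxc', i_vertex hxv, hxc]
          rw [hcc]; exact ih
        · intro z hz
          by_cases hec' : G.Exc c'
          · have hixf : G.r (G.i x) ≠ G.i x := flag_i hxv
            have hec : ¬ G.Exc (G.r x) := by
              have := (hG.exc (G.i x) hixf (hxc' ▸ hec')).2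
              rwa [G.i_i] at this
            have hreach := ih ⟨G.r x, by rw [G.r_r]; exact hec⟩ (Or.inl hxc)
            rcases hz with hz | ⟨-, y, hyW, hyf, hyc, hyz⟩
            · exact absurd (by rw [hz]; exact exc_root hec') z.2
            · by_cases hyx : y = G.i x
              · have : z = ⟨G.r x, by rw [G.r_r]; exact hec⟩ := by
                  apply Subtype.ext
                  rw [← hyz, hyx, G.i_i]
                rw [this]; exact hreach
              · have hei : G.Exc (G.r (G.i x)) := hxc' ▸ hec'
                have hopp : G.opp (G.i x) = y :=
                  opp_unique hixf hei hyf (hyc.trans hxc'.symm) hyx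
                refine hreach.tail ⟨⟨x, hec⟩, ⟨hxW, fun _ => ?_⟩, rfl, ?_⟩
                · change G.opp (G.i x) ∈ W
                  rw [hopp]; exact hyW
                · apply Subtype.ext
                  change G.r (G.stabInv x) = z.1
                  unfold stabInv
                  rw [if_pos hei, hopp, hyz]
          · have hz' : z.1 = c' := by
              rcases hz with hz | ⟨he, -⟩
              · exact hz
              · exact absurd he hec'
            by_cases hec : G.Exc c
            · exact ih z (Or.inr ⟨hec, x, hxW, hxv, hxc, hxc'.trans hz'.symm⟩)
            · have hnx : ¬ G.Exc (G.r x) := by rw [hxc]; exact hec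
              have hni : ¬ G.Exc (G.r (G.i x)) := by rw [hxc']; exact hec'
              refine (ih ⟨G.r x, by rw [G.r_r]; exact hnx⟩ (Or.inl hxc)).tail
                ⟨⟨x, hnx⟩, ⟨hxW, fun he => absurd he hni⟩, rfl, ?_⟩
              apply Subtype.ext
              change G.r (G.stabInv x) = z.1
              unfold stabInv
              rw [if_neg hni, hxc', hz']
    exact key b hpath ⟨b, hb⟩ (Or.inl rfl)

theorem IsQS.genusOn_stabSub (hG : IsQS g G) (hr : ∀ x ∈ W, G.r x ∈ W) (hi : ∀ x ∈ W, G.i x ∈ W)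
    (hf : ∀ v ∈ W, G.Exc v → ∃ x ∈ W, G.r x ≠ x ∧ G.r x = v) :
    (G.stab hG).genusOn (stabSub hG W) = G.genusOn W := by
  classical
  have := G.finX
  have hinj : Function.Injective (Subtype.val : (G.stab hG).X → G.X) := Subtype.val_injective
  -- vertices
  set VW : Set G.X := {x | x ∈ W ∧ G.r x = x} with hVW
  set VW' : Set (G.stab hG).X := {x | x ∈ stabSub hG W ∧ (G.stab hG).r x = x} with hVW'
  set EW : Set G.X := {x | x ∈ W ∧ G.Exc x} with hEW
  have hV : VW = Subtype.val '' VW' ∪ EW := by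
    ext x
    constructor
    · rintro ⟨hx, hrx⟩
      by_cases he : G.Exc x
      · exact Or.inr ⟨hx, he⟩
      · have hn : ¬ G.Exc (G.r x) := by rw [hrx]; exact he
        refine Or.inl ⟨⟨x, hn⟩, ⟨⟨hx, fun h => ?_⟩, Subtype.ext hrx⟩, rfl⟩
        dsimp only at h
        rw [i_vertex hrx] at h
        exact absurd h hn
    · rintro (⟨y, ⟨⟨hy, -⟩, hry⟩, rfl⟩ | ⟨hx, he⟩)
      · exact ⟨hy, congrArg Subtype.val hry⟩
      · exact ⟨hx, he.1⟩
  have hVd : Disjoint (Subtype.val '' VW') EW := by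
    rw [Set.disjoint_left]
    rintro _ ⟨y, -, rfl⟩ ⟨-, he⟩
    exact y.2 (exc_root he)
  have hVcard : VW.ncard = VW'.ncard + EW.ncard := by
    rw [hV, Set.ncard_union_eq hVd (Set.toFinite _) (Set.toFinite _),
      Set.ncard_image_of_injective _ hinj]
  have hh : ∑ᶠ v ∈ VW, (G.h v : ℤ) = ∑ᶠ v ∈ VW', ((G.stab hG).h v : ℤ) := by
    rw [hV, finsum_mem_union hVd (Set.toFinite _) (Set.toFinite _),
      finsum_mem_image hinj.injOn]
    have : ∑ᶠ v ∈ EW, (G.h v : ℤ) = 0 := by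
      apply finsum_mem_eq_zero_of_forall_eq_zero
      intro v hv
      rw [hv.2.2.1]; rfl
    rw [this, add_zero]
  -- half-edges
  set HW : Set G.X := {x | x ∈ W ∧ G.i x ≠ x} with hHW
  set HW' : Set (G.stab hG).X := {x | x ∈ stabSub hG W ∧ (G.stab hG).i x ≠ x} with hHW'
  set A : Set G.X := {x | G.r x ≠ x ∧ G.r x ∈ EW ∧ x ∈ W} with hA
  set B : Set G.X := {x | G.r x ≠ x ∧ G.r x ∈ EW ∧ x ∉ W} with hB
  set B' : Set G.X := {x | x ∈ W ∧ ¬ G.Exc (G.r x) ∧ G.Exc (G.r (G.i x)) ∧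
    G.opp (G.i x) ∉ W} with hB'
  have hAB : {x | G.r x ≠ x ∧ G.r x ∈ EW} = A ∪ B := by
    ext x
    by_cases hx : x ∈ W <;> simp [hA, hB, hx]
  have hABd : Disjoint A B := by
    rw [Set.disjoint_left]
    rintro x ⟨-, -, h⟩ ⟨-, -, h'⟩
    exact h' h
  have hcount : (A.ncard : ℤ) + B.ncard = 2 * EW.ncard := by
    have h1 := ncard_flags_rooted EW (fun v hv => hv.2.1)
    rw [hAB, Set.ncard_union_eq hABd (Set.toFinite _) (Set.toFinite _)] at h1
    push_cast at h1
    rw [h1]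
    have h2 : ∑ᶠ v ∈ EW, (G.val v : ℤ) = ∑ᶠ v ∈ EW, (2 : ℤ) := by
      apply finsum_mem_congr rfl
      intro v hv
      rw [hv.2.2.2]; rfl
    rw [h2, finsum_mem_eq_finite_toFinset_sum _ (Set.toFinite EW),
      Set.ncard_eq_toFinset_card _ (Set.toFinite EW)]
    simp [mul_comm]
  have hBB : B'.ncard = B.ncard := by
    have himg : (fun x => G.opp (G.i x)) '' B' = B := by
      ext y
      constructor
      · rintro ⟨x, ⟨hx, hn, he, ho⟩, rfl⟩
        refine ⟨IsQS.opp_flag hn he, ?_, ho⟩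
        dsimp only
        rw [IsQS.opp_root hn he]
        exact ⟨hr _ (hi _ hx), he⟩
      · rintro ⟨hy, ⟨hyW, hye⟩, hyn⟩
        obtain ⟨z, hz, hzf, hzr⟩ := hf _ hyW hye
        have hzy : z ≠ y := by rintro rfl; exact hyn hz
        have hze : G.Exc (G.r z) := by rw [hzr]; exact hye
        have ho : G.opp z = y := opp_unique hzf hze hy hzr.symm hzy.symm
        refine ⟨G.i z, ⟨hi _ hz, (hG.exc z hzf hze).2, ?_, ?_⟩, ?_⟩
        · rw [G.i_i]; exact hze
        · rw [G.i_i, ho]; exact hyn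
        · dsimp only
          rw [G.i_i, ho]
    rw [← himg, Set.InjOn.ncard_image]
    rintro x ⟨hx, hn, he, ho⟩ x' ⟨hx', hn', he', ho'⟩ hxx
    dsimp only at hxx
    have h1 := opp_opp (IsQS.i_flag hn he) he
    rw [hxx, opp_opp (IsQS.i_flag hn' he') he'] at h1
    rw [← G.i_i x, ← h1, G.i_i]
  have hH : HW = Subtype.val '' HW' ∪ (A ∪ B') := by
    ext x
    constructor
    · rintro ⟨hx, hix⟩
      by_cases he : G.Exc (G.r x)
      · exact Or.inr (Or.inl ⟨flag_of_half hix, ⟨hr _ hx, he⟩, hx⟩)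
      · by_cases hb : G.Exc (G.r (G.i x)) ∧ G.opp (G.i x) ∉ W
        · exact Or.inr (Or.inr ⟨hx, he, hb.1, hb.2⟩)
        · refine Or.inl ⟨⟨x, he⟩, ⟨⟨hx, fun h => by_contra fun h' => hb ⟨h, h'⟩⟩, ?_⟩, rfl⟩
          intro h
          exact hix ((IsQS.stabInv_eq he).1 (congrArg Subtype.val h))
    · rintro (⟨y, ⟨⟨hy, -⟩, hry⟩, rfl⟩ | ⟨hx, ⟨-, he⟩, hxW⟩ | ⟨hx, hn, he, -⟩)
      · exact ⟨hy, fun h => hry (Subtype.ext (stabInv_of_fix y.2 h))⟩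
      · exact ⟨hxW, (hG.exc x hx he).1⟩
      · exact ⟨hx, fun h => hn (by rw [h] at he; exact he)⟩
  have hHd1 : Disjoint A B' := by
    rw [Set.disjoint_left]
    rintro x ⟨-, ⟨-, h⟩, -⟩ ⟨-, h', -⟩
    exact h' h
  have hHd : Disjoint (Subtype.val '' HW') (A ∪ B') := by
    rw [Set.disjoint_left]
    rintro _ ⟨y, hy, rfl⟩ (⟨-, ⟨-, h⟩, -⟩ | ⟨-, -, he, ho⟩)
    · exact y.2 h
    · exact ho (hy.1.2 he)
  have hHcard : (HW.ncard : ℤ) = HW'.ncard + 2 * EW.ncard := by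
    rw [hH, Set.ncard_union_eq hHd (Set.toFinite _) (Set.toFinite _),
      Set.ncard_union_eq hHd1 (Set.toFinite _) (Set.toFinite _),
      Set.ncard_image_of_injective _ hinj, hBB]
    push_cast
    omega
  have e1 : (G.stab hG).genusOn (stabSub hG W) = (HW'.ncard : ℤ) / 2 - VW'.ncard + 1 +
      ∑ᶠ v ∈ VW', ((G.stab hG).h v : ℤ) := rfl
  have e2 : G.genusOn W = (HW.ncard : ℤ) / 2 - VW.ncard + 1 + ∑ᶠ v ∈ VW, (G.h v : ℤ) := rfl
  rw [e1, e2, hh, hHcard, hVcard]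
  push_cast
  omega

theorem IsQS.val_stab (hG : IsQS g G) (v : (G.stab hG).X) : (G.stab hG).val v = G.val v.1 := by
  unfold val
  rw [← Set.ncard_image_of_injective _ (Subtype.val_injective : Function.Injective
    (Subtype.val : (G.stab hG).X → G.X))]
  congr 1
  ext x
  constructor
  · rintro ⟨y, ⟨h1, h2⟩, rfl⟩
    exact ⟨fun h => h1 (Subtype.ext h), congrArg Subtype.val h2⟩
  · rintro ⟨h1, h2⟩
    refine ⟨⟨x, fun he => v.2 ?_⟩, ⟨fun h => h1 (congrArg Subtype.val h), Subtype.ext h2⟩, rfl⟩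
    rw [h2] at he
    exact exc_root he

theorem IsQS.stab_isStable (hG : IsQS g G) : IsStable g (G.stab hG) := by
  have hsub : stabSub hG Set.univ = Set.univ := by
    ext x; simp [stabSub]
  have hf : ∀ v ∈ (Set.univ : Set G.X), G.Exc v → ∃ x ∈ (Set.univ : Set G.X),
      G.r x ≠ x ∧ G.r x = v := by
    intro v _ he
    obtain ⟨a, b, -, hab⟩ := flags_ncard he
    exact ⟨a, trivial, (hab a).2 (Or.inl rfl)⟩
  refine ⟨?_, ?_, ?_⟩
  · rw [← hsub]
    exact hG.connOn_stabSub (fun _ _ => Set.mem_univ _) (fun _ _ => Set.mem_univ _) hf hG.conn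
  · rw [← hsub, hG.genusOn_stabSub (fun _ _ => Set.mem_univ _) (fun _ _ => Set.mem_univ _) hf, hG.genus]
  · rintro ⟨v, hv⟩ hrv
    have hrv' : G.r v = v := congrArg Subtype.val hrv
    rw [hG.val_stab]
    change 2 < 2 * G.h v + G.val v
    by_contra hlt
    have h2 := hG.two_le v hrv'
    have hne : ¬ (G.h v = 0 ∧ G.val v = 2) := fun h => hv (exc_root ⟨hrv', h⟩)
    have h1 : G.h v = 1 ∧ G.val v = 0 := by
      by_cases h0 : G.h v = 0
      · have := h2 h0; omega
      · omega
    have hall := eq_of_val_zero hG.conn hrv' h1.2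
    have hn : n = 0 := by
      by_contra hn
      have l := G.m ⟨0, Nat.pos_of_ne_zero hn⟩
      exact l.2.1 (by rw [hall l.1, hrv'])
    have hgen := hG.genus
    unfold genusOn b1On at hgen
    have e1 : {x | x ∈ (Set.univ : Set G.X) ∧ G.i x ≠ x} = ∅ := by
      ext y
      simp only [Set.mem_univ, true_and, Set.mem_ofPred_eq, Set.mem_empty_iff_false, iff_false,
        not_not]
      rw [hall y, i_vertex hrv']
    have e2 : {x | x ∈ (Set.univ : Set G.X) ∧ G.r x = x} = {v} := by
      ext y
      simp only [Set.mem_univ, true_and, Set.mem_singleton_iff, Set.mem_ofPred_eq]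
      exact ⟨fun _ => hall y, fun h => h ▸ hrv'⟩
    rw [e1, e2, finsum_mem_singleton, h1.1] at hgen
    simp at hgen
    have := hG.hyp
    omega

end stab


section stabMap

variable {g : ℕ} {G₁ G₂ G₃ : MGraph n} {π : G₁.X → G₂.X}

open Classical in
/-- The underlying function of the stabilization of a morphism: a half-edge `x` ending at an
exceptional vertex and contracted by `π` is sent to the image of the other half-edge at that
vertex (so that the edge of the stabilization is contracted only if both exceptional edges are),
and everything else is sent to its image under `π`. -/
noncomputable def stabFun (G₁ G₂ : MGraph n) (π : G₁.X → G₂.X) (x : G₁.X) : G₂.X :=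
  if G₁.Exc (G₁.r (G₁.i x)) ∧ G₂.r (π x) = π x then π (G₁.opp (G₁.i x)) else π x

theorem IsMor.nexc (hπ : IsMor G₁ G₂ π) (h₁ : IsQS g G₁) {x : G₁.X}
    (hx : ¬ G₁.Exc (G₁.r x)) : ¬ G₂.Exc (G₂.r (π x)) := fun h => hx (hπ.exc_of_exc h₁ h)

/-- The root of a contracted half-edge and of its opposite have the same image. -/
theorem IsMor.map_r_i (hπ : IsMor G₁ G₂ π) {x : G₁.X} (hc : G₂.r (π x) = π x) :
    π (G₁.r (G₁.i x)) = π x := by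
  rw [hπ.map_r, hπ.map_i, i_vertex hc, hc]

theorem IsMor.opp_map (hπ : IsMor G₁ G₂ π) (h₁ : IsQS g G₁) {x : G₁.X}
    (hx : ¬ G₁.Exc (G₁.r x)) (he : G₁.Exc (G₁.r (G₁.i x))) (hc : G₂.r (π x) ≠ π x)
    (he₂ : G₂.Exc (π (G₁.r (G₁.i x)))) :
    G₂.r (π (G₁.opp (G₁.i x))) ≠ π (G₁.opp (G₁.i x)) ∧
      G₂.opp (G₂.i (π x)) = π (G₁.opp (G₁.i x)) := by
  set y := G₁.opp (G₁.i x) with hy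
  have hyr : G₁.r y = G₁.r (G₁.i x) := IsQS.opp_root hx he
  have hyf : G₂.r (π y) ≠ π y := by
    intro h
    have h3 := hπ.map_r_i h
    have h4 := hπ.nexc h₁ (h₁.nexc_i_opp hx he)
    apply h4
    rw [← hy, ← hπ.map_r, h3, ← h, ← hπ.map_r, hyr]
    exact he₂
  refine ⟨hyf, ?_⟩
  have hif : G₂.r (G₂.i (π x)) ≠ G₂.i (π x) := flag_i hc
  refine opp_unique hif ?_ hyf ?_ ?_
  · rw [← hπ.map_i, ← hπ.map_r]; exact he₂
  · rw [← hπ.map_i, ← hπ.map_r, ← hπ.map_r, hyr]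
  · rw [← hπ.map_i]
    intro h
    exact IsQS.opp_ne hx he (hπ.inj hyf h)

/-- If the image of an exceptional vertex is not exceptional, one of its edges is contracted. -/
theorem IsMor.contr_opp (hπ : IsMor G₁ G₂ π) {x : G₁.X}
    (hx : ¬ G₁.Exc (G₁.r x)) (he : G₁.Exc (G₁.r (G₁.i x))) (hc : G₂.r (π x) ≠ π x)
    (he₂ : ¬ G₂.Exc (π (G₁.r (G₁.i x)))) :
    G₂.r (π (G₁.opp (G₁.i x))) = π (G₁.opp (G₁.i x)) := by
  by_contra hyf
  apply he₂
  apply hπ.exc_map he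
  intro z hz hzr
  by_cases hzi : z = G₁.i x
  · rw [hzi, hπ.map_i]; exact flag_i hc
  · rw [← opp_unique (IsQS.i_flag hx he) he hz hzr hzi]; exact hyf

theorem IsMor.nexc_stabFun (hπ : IsMor G₁ G₂ π) (h₁ : IsQS g G₁) {x : G₁.X}
    (hx : ¬ G₁.Exc (G₁.r x)) : ¬ G₂.Exc (G₂.r (stabFun G₁ G₂ π x)) := by
  unfold stabFun
  split_ifs with h
  · rw [← hπ.map_r, IsQS.opp_root hx h.1, hπ.map_r_i h.2, ← h.2]
    exact hπ.nexc h₁ hx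
  · exact hπ.nexc h₁ hx

/-- The stabilization of a morphism of quasi-stable graphs. -/
noncomputable def stabMap (h₁ : IsQS g G₁) (h₂ : IsQS g G₂) (hπ : IsMor G₁ G₂ π)
    (x : (G₁.stab h₁).X) : (G₂.stab h₂).X :=
  ⟨stabFun G₁ G₂ π x.1, hπ.nexc_stabFun h₁ x.2⟩

theorem stabFun_vertex {x : G₁.X} (hx : ¬ G₁.Exc (G₁.r x)) (hv : G₁.r x = x) :
    stabFun G₁ G₂ π x = π x := by
  unfold stabFun
  rw [if_neg]
  rintro ⟨h, -⟩
  rw [i_vertex hv] at h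
  exact hx h

theorem IsMor.stabFun_r (hπ : IsMor G₁ G₂ π) {x : G₁.X}
    (hx : ¬ G₁.Exc (G₁.r x)) :
    stabFun G₁ G₂ π (G₁.r x) = G₂.r (stabFun G₁ G₂ π x) := by
  rw [stabFun_vertex (by rw [G₁.r_r]; exact hx) (G₁.r_r x)]
  unfold stabFun
  split_ifs with h
  · rw [← hπ.map_r (G₁.opp _), IsQS.opp_root hx h.1, hπ.map_r_i h.2, hπ.map_r, h.2]
  · exact hπ.map_r x

theorem IsMor.stabFun_i (hπ : IsMor G₁ G₂ π) (h₁ : IsQS g G₁) {x : G₁.X}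
    (hx : ¬ G₁.Exc (G₁.r x)) :
    stabFun G₁ G₂ π (G₁.stabInv x) = G₂.stabInv (stabFun G₁ G₂ π x) := by
  by_cases he : G₁.Exc (G₁.r (G₁.i x))
  · have hsx : G₁.stabInv x = G₁.i (G₁.opp (G₁.i x)) := by unfold stabInv; rw [if_pos he]
    have hzi : G₁.i (G₁.stabInv x) = G₁.opp (G₁.i x) := by rw [hsx, G₁.i_i]
    have hze : G₁.Exc (G₁.r (G₁.i (G₁.stabInv x))) := by
      rw [hzi, IsQS.opp_root hx he]; exact he
    have hzo : G₁.opp (G₁.i (G₁.stabInv x)) = G₁.i x := by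
      rw [hzi, opp_opp (IsQS.i_flag hx he) he]
    have hnz := h₁.nexc_stabInv hx
    have hπz : π (G₁.stabInv x) = G₂.i (π (G₁.opp (G₁.i x))) := by rw [hsx, hπ.map_i]
    have hnπ : ¬ G₂.Exc (G₂.r (G₂.i (π (G₁.opp (G₁.i x))))) := by
      rw [← hπz]; exact hπ.nexc h₁ hnz
    by_cases hc : G₂.r (π x) = π x
    · have hL : stabFun G₁ G₂ π x = π (G₁.opp (G₁.i x)) := by
        unfold stabFun; rw [if_pos ⟨he, hc⟩]
      rw [hL]
      have hR : G₂.stabInv (π (G₁.opp (G₁.i x))) = π (G₁.stabInv x) := by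
        unfold stabInv
        rw [if_neg hnπ, if_pos he, hπ.map_i]
      rw [hR]
      unfold stabFun
      split_ifs with h
      · rw [hzo, hπ.map_i, i_vertex hc]
        have h5 := hπ.map_r_i h.2
        rw [hzi, IsQS.opp_root hx he, hπ.map_r_i hc] at h5
        exact h5
      · rfl
    · have hL : stabFun G₁ G₂ π x = π x := by
        unfold stabFun; rw [if_neg (fun h => hc h.2)]
      rw [hL]
      by_cases he₂ : G₂.Exc (π (G₁.r (G₁.i x)))
      · obtain ⟨h5, h6⟩ := hπ.opp_map h₁ hx he hc he₂
        have he3 : G₂.Exc (G₂.r (G₂.i (π x))) := by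
          rw [← hπ.map_i, ← hπ.map_r]; exact he₂
        have hR : G₂.stabInv (π x) = π (G₁.stabInv x) := by
          unfold stabInv
          rw [if_pos he3, if_pos he, h6, hπ.map_i]
        rw [hR]
        unfold stabFun
        rw [if_neg]
        rintro ⟨-, h7⟩
        rw [hπz] at h7
        exact flag_i h5 h7
      · have h5 := hπ.contr_opp hx he hc he₂
        have he3 : ¬ G₂.Exc (G₂.r (G₂.i (π x))) := by
          rw [← hπ.map_i, ← hπ.map_r]; exact he₂
        have hR : G₂.stabInv (π x) = G₂.i (π x) := by
          unfold stabInv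
          rw [if_neg he3]
        rw [hR]
        unfold stabFun
        rw [if_pos, hzo, hπ.map_i]
        refine ⟨hze, ?_⟩
        rw [hπz, i_vertex h5]; exact h5
  · have hsx : G₁.stabInv x = G₁.i x := by unfold stabInv; rw [if_neg he]
    have hL : stabFun G₁ G₂ π x = π x := by
      unfold stabFun; rw [if_neg (fun h => he h.1)]
    have hR : stabFun G₁ G₂ π (G₁.i x) = π (G₁.i x) := by
      unfold stabFun; rw [if_neg]; rintro ⟨h, -⟩; rw [G₁.i_i] at h; exact hx h
    rw [hL, hsx, hR]
    unfold stabInv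
    rw [if_neg, hπ.map_i]
    rw [← hπ.map_i]
    exact hπ.nexc h₁ he

theorem IsMor.stabFun_eq_vertex (hπ : IsMor G₁ G₂ π) {x : G₁.X} (hx : ¬ G₁.Exc (G₁.r x))
    {v : G₂.X} (hv : G₂.r v = v) :
    stabFun G₁ G₂ π x = v ↔
      π x = v ∧ (G₁.Exc (G₁.r (G₁.i x)) → π (G₁.opp (G₁.i x)) = v) := by
  unfold stabFun
  split_ifs with h
  · constructor
    · intro h5
      refine ⟨?_, fun _ => h5⟩
      rw [← hπ.map_r_i h.2, ← IsQS.opp_root hx h.1, hπ.map_r, h5, hv]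
    · intro h5
      exact h5.2 h.1
  · constructor
    · intro h5
      refine ⟨h5, fun he => absurd ⟨he, ?_⟩ h⟩
      rw [h5, hv]
    · exact fun h5 => h5.1

theorem IsMor.stab (hπ : IsMor G₁ G₂ π) (h₁ : IsQS g G₁) (h₂ : IsQS g G₂) :
    IsMor (G₁.stab h₁) (G₂.stab h₂) (stabMap h₁ h₂ hπ) := by
  have hfib : ∀ v : (G₂.stab h₂).X, (G₂.stab h₂).r v = v →
      {x | stabMap h₁ h₂ hπ x = v} = stabSub h₁ {x | π x = v.1} := by
    intro v hv
    have hv' : G₂.r v.1 = v.1 := congrArg Subtype.val hv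
    ext x
    exact Iff.trans Subtype.ext_iff (hπ.stabFun_eq_vertex x.2 hv')
  have hr : ∀ v, G₂.r v = v → ∀ x ∈ {x | π x = v}, G₁.r x ∈ {x | π x = v} := by
    intro v hv x hx
    have hx' : π x = v := hx
    change π (G₁.r x) = v
    rw [hπ.map_r, hx', hv]
  have hi : ∀ v, G₂.r v = v → ∀ x ∈ {x | π x = v}, G₁.i x ∈ {x | π x = v} := by
    intro v hv x hx
    have hx' : π x = v := hx
    change π (G₁.i x) = v
    rw [hπ.map_i, hx', i_vertex hv]
  have hf : ∀ v, G₂.r v = v → ¬ G₂.Exc v → ∀ u ∈ {x | π x = v}, G₁.Exc u →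
      ∃ x ∈ {x | π x = v}, G₁.r x ≠ x ∧ G₁.r x = u := by
    intro v hv hnv u hu he
    have hu' : π u = v := hu
    by_contra hno
    push Not at hno
    apply hnv
    rw [← hu']
    apply hπ.exc_map he
    intro x hx hxu hc
    refine hno x ?_ hx hxu
    change π x = v
    rw [← hc, ← hπ.map_r, hxu, hu']
  refine ⟨fun x => ?_, fun x => ?_, fun f hf => ?_, fun k => ?_, fun v hv => ?_, fun v hv => ?_⟩
  · exact Subtype.ext (hπ.stabFun_r x.2)
  · exact Subtype.ext (hπ.stabFun_i h₁ x.2)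
  · have hff : G₂.r f.1 ≠ f.1 := fun h => hf (Subtype.ext h)
    obtain ⟨x₀, hx₀, -⟩ := hπ.flag f.1 hff
    have huni : ∀ x, π x = f.1 → x = x₀ := fun x hx =>
      hπ.inj (by rw [hx]; exact hff) (hx.trans hx₀.symm)
    have hx₀f : G₁.r x₀ ≠ x₀ := hπ.flag_of_flag (by rw [hx₀]; exact hff)
    by_cases he : G₁.Exc (G₁.r x₀)
    · obtain ⟨ho1, ho2, ho3⟩ := opp_spec hx₀f he
      have hoe : G₁.Exc (G₁.r (G₁.opp x₀)) := by rw [ho2]; exact he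
      have hnx := (h₁.exc _ ho1 hoe).2
      have hx0c : π (G₁.r x₀) = G₂.r f.1 := by rw [hπ.map_r, hx₀]
      have hyc : G₂.r (π (G₁.opp x₀)) = π (G₁.opp x₀) := by
        by_contra hyf
        have h5 : G₂.Exc (π (G₁.r x₀)) := by
          apply hπ.exc_map he
          intro z hz hzr
          by_cases hzi : z = x₀
          · rw [hzi, hx₀]; exact hff
          · rw [← opp_unique hx₀f he hz hzr hzi]; exact hyf
        rw [hx0c] at h5
        exact f.2 h5
      refine ⟨⟨G₁.i (G₁.opp x₀), hnx⟩, Subtype.ext ?_, ?_⟩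
      · change stabFun G₁ G₂ π (G₁.i (G₁.opp x₀)) = f.1
        unfold stabFun
        rw [if_pos, G₁.i_i, opp_opp hx₀f he, hx₀]
        rw [G₁.i_i, hπ.map_i, i_vertex hyc]
        exact ⟨hoe, hyc⟩
      · rintro ⟨x, hx⟩ hxf
        apply Subtype.ext
        change x = G₁.i (G₁.opp x₀)
        have hxf' : stabFun G₁ G₂ π x = f.1 := congrArg Subtype.val hxf
        unfold stabFun at hxf'
        split_ifs at hxf' with h5
        · have h6 := huni _ hxf'
          rw [← h6, opp_opp (IsQS.i_flag hx h5.1) h5.1, G₁.i_i]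
        · rw [huni _ hxf'] at hx
          exact absurd he hx
    · refine ⟨⟨x₀, he⟩, Subtype.ext ?_, ?_⟩
      · change stabFun G₁ G₂ π x₀ = f.1
        unfold stabFun
        rw [if_neg, hx₀]
        rintro ⟨-, h⟩
        rw [hx₀] at h
        exact hff h
      · rintro ⟨x, hx⟩ hxf
        apply Subtype.ext
        change x = x₀
        have hxf' : stabFun G₁ G₂ π x = f.1 := congrArg Subtype.val hxf
        unfold stabFun at hxf'
        split_ifs at hxf' with h5
        · have h6 := huni _ hxf'
          exfalso
          apply he
          rw [← h6, IsQS.opp_root hx h5.1]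
          exact h5.1
        · exact huni _ hxf'
  · apply Subtype.ext
    change stabFun G₁ G₂ π (G₁.m k).1 = (G₂.m k).1
    unfold stabFun
    rw [if_neg, hπ.mark]
    rintro ⟨-, h⟩
    rw [hπ.mark] at h
    exact (G₂.m k).2.1 h
  · have hv' : G₂.r v.1 = v.1 := congrArg Subtype.val hv
    have hnv : ¬ G₂.Exc v.1 := fun h => v.2 (exc_root h)
    rw [hfib v hv]
    exact h₁.connOn_stabSub (hr _ hv') (hi _ hv') (hf _ hv' hnv) (hπ.conn _ hv')
  · have hv' : G₂.r v.1 = v.1 := congrArg Subtype.val hv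
    have hnv : ¬ G₂.Exc v.1 := fun h => v.2 (exc_root h)
    rw [hfib v hv, h₁.genusOn_stabSub (hr _ hv') (hi _ hv') (hf _ hv' hnv), hπ.genus _ hv']

theorem stabFun_comp (h₁ : IsQS g G₁) {π₁ : G₁.X → G₂.X} {π₂ : G₂.X → G₃.X}
    (hπ₁ : IsMor G₁ G₂ π₁) (hπ₂ : IsMor G₂ G₃ π₂) {x : G₁.X} (hx : ¬ G₁.Exc (G₁.r x)) :
    stabFun G₁ G₃ (π₂ ∘ π₁) x = stabFun G₂ G₃ π₂ (stabFun G₁ G₂ π₁ x) := by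
  by_cases he : G₁.Exc (G₁.r (G₁.i x))
  · by_cases hc : G₂.r (π₁ x) = π₁ x
    · have h5 : stabFun G₁ G₂ π₁ x = π₁ (G₁.opp (G₁.i x)) := by
        unfold stabFun; rw [if_pos ⟨he, hc⟩]
      rw [h5]
      have h6 : ¬ G₂.Exc (G₂.r (G₂.i (π₁ (G₁.opp (G₁.i x))))) := by
        rw [← hπ₁.map_i]; exact hπ₁.nexc h₁ (h₁.nexc_i_opp hx he)
      unfold stabFun
      rw [if_pos, if_neg (fun h => h6 h.1)]
      · rfl
      · refine ⟨he, ?_⟩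
        dsimp only [Function.comp]
        rw [← hπ₂.map_r, hc]
    · have h5 : stabFun G₁ G₂ π₁ x = π₁ x := by
        unfold stabFun; rw [if_neg (fun h => hc h.2)]
      rw [h5]
      have h7 : G₂.r (G₂.i (π₁ x)) = π₁ (G₁.r (G₁.i x)) := by rw [← hπ₁.map_i, ← hπ₁.map_r]
      by_cases he₂ : G₂.Exc (π₁ (G₁.r (G₁.i x)))
      · obtain ⟨-, h6⟩ := hπ₁.opp_map h₁ hx he hc he₂
        unfold stabFun
        rw [h7, h6]
        by_cases h8 : G₃.r (π₂ (π₁ x)) = π₂ (π₁ x)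
        · rw [if_pos ⟨he, h8⟩, if_pos ⟨he₂, h8⟩]; rfl
        · rw [if_neg (fun h => h8 h.2), if_neg (fun h => h8 h.2)]; rfl
      · have h6 := hπ₁.contr_opp hx he hc he₂
        have hR : stabFun G₂ G₃ π₂ (π₁ x) = π₂ (π₁ x) := by
          unfold stabFun
          rw [h7, if_neg (fun h => he₂ h.1)]
        rw [hR]
        unfold stabFun
        split_ifs with h8
        · dsimp only [Function.comp] at h8 ⊢
          rw [← h6, ← hπ₁.map_r, IsQS.opp_root hx he, hπ₁.map_r, hπ₁.map_i, hπ₂.map_r,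
            hπ₂.map_i, i_vertex h8.2, h8.2]
        · rfl
  · have h5 : stabFun G₁ G₂ π₁ x = π₁ x := by
      unfold stabFun; rw [if_neg (fun h => he h.1)]
    rw [h5]
    unfold stabFun
    rw [if_neg (fun h => he h.1), if_neg]
    · rfl
    · rintro ⟨h, -⟩
      rw [← hπ₁.map_i] at h
      exact hπ₁.nexc h₁ he h

end stabMap

/-- The identity is a morphism. -/
theorem isMor_id (G : MGraph n) : IsMor G G id := by
  have hset : ∀ v, {x : G.X | id x = v} = {v} := fun v => by ext; simp
  refine ⟨fun _ => rfl, fun _ => rfl, fun f _ => ⟨f, rfl, fun _ h => h⟩, fun _ => rfl,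
    fun v hv => ?_, fun v hv => ?_⟩
  · rw [hset]
    refine ⟨⟨v, rfl, hv⟩, ?_⟩
    rintro a rfl b rfl _ _
    exact Relation.ReflTransGen.refl
  · rw [hset]
    unfold genusOn b1On
    have e1 : {x | x ∈ ({v} : Set G.X) ∧ G.i x ≠ x} = ∅ := by
      ext y
      simp only [Set.mem_singleton_iff, Set.mem_ofPred_eq, Set.mem_empty_iff_false, iff_false]
      rintro ⟨rfl, h⟩
      exact h (i_vertex hv)
    have e2 : {x | x ∈ ({v} : Set G.X) ∧ G.r x = x} = {v} := by
      ext y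
      simp only [Set.mem_singleton_iff, Set.mem_ofPred_eq]
      exact ⟨fun h => h.1, fun h => ⟨h, h ▸ hv⟩⟩
    rw [e1, e2, finsum_mem_singleton]
    simp

end MGraph

/-! ## Universal stability conditions -/

open MGraph

/-- A universal stability condition of type `(g, n)`: a real function on the vertices of each
stable graph of type `(g, n)`, of integral total degree `deg`, compatible with all morphisms. -/
structure UnivStab (g n : ℕ) where
  val : ∀ G : MGraph n, IsStable g G → G.V → ℝ
  deg : ℤ
  sum_eq : ∀ (G : MGraph n) (hG : IsStable g G), ∑ᶠ v, val G hG v = deg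
  compat : ∀ (G₁ G₂ : MGraph n) (h₁ : IsStable g G₁) (h₂ : IsStable g G₂) (π : G₁.X → G₂.X),
    IsMor G₁ G₂ π → ∀ v : G₂.V, val G₂ h₂ v = ∑ᶠ w : {w : G₁.V // π w.1 = v.1}, val G₁ h₁ w.1

/-- The root of an element of `X`, as a vertex. -/
def MGraph.root {n : ℕ} (G : MGraph n) (x : G.X) : G.V := ⟨G.r x, G.r_r x⟩

/-- The number of edges joining a vertex of `S` to a vertex of the complement of `S`. -/
noncomputable def MGraph.cut {n : ℕ} (G : MGraph n) (S : Set G.V) : ℕ :=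
  {x : G.X | G.root x ∈ S ∧ G.root (G.i x) ∉ S}.ncard

namespace UnivStab

variable {g n : ℕ} (φ : UnivStab g n)

open Classical in
/-- The stability condition induced on a quasi-stable graph: zero on exceptional vertices, and
the value on the stabilization at the other ones. -/
noncomputable def onQS {G : MGraph n} (hG : IsQS g G) (v : G.V) : ℝ :=
  if he : G.Exc v.1 then 0
  else φ.val (G.stab hG) hG.stab_isStable
    ⟨⟨v.1, by rw [v.2]; exact he⟩, Subtype.ext v.2⟩

/-- `φ`-semistable (in particular admissible) divisors on a quasi-stable graph. -/
structure Semistable {G : MGraph n} (hG : IsQS g G) (D : G.V → ℤ) : Prop where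
  admissible : ∀ v : G.V, G.Exc v.1 → D v = 1
  degree : ∑ᶠ v, D v = φ.deg
  le : ∀ S : Set G.V, (∑ᶠ v ∈ S, φ.onQS hG v) - (G.cut S : ℝ) / 2 ≤ ((∑ᶠ v ∈ S, D v : ℤ) : ℝ)
  ge : ∀ S : Set G.V, ((∑ᶠ v ∈ S, D v : ℤ) : ℝ) ≤ (∑ᶠ v ∈ S, φ.onQS hG v) + (G.cut S : ℝ) / 2

/-- General universal stability conditions. -/
def IsGeneral : Prop :=
  ∀ (G : MGraph n) (hG : IsQS g G) (S : Set G.V),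
    (∃ k : ℤ, (∑ᶠ v ∈ S, φ.onQS hG v) + (G.cut S : ℝ) / 2 = k) →
      (∀ v ∈ S, G.Exc v.1) ∨ (∀ v ∉ S, G.Exc v.1)

end UnivStab

/-! ## Tropical curves with real edge lengths -/

/-- An `n`-marked tropical curve with real edge lengths.  The metric is recorded as a function on
the half-edges, extended by zero to vertices and legs. -/
structure TCurve (n : ℕ) extends MGraph n where
  len : X → ℝ
  len_i : ∀ x, len (i x) = len x
  len_pos : ∀ x, i x ≠ x → 0 < len x
  len_zero : ∀ x, i x = x → len x = 0

namespace TCurve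

variable {n : ℕ} {g : ℕ}

theorem len_nonneg (C : TCurve n) (x : C.X) : 0 ≤ C.len x := by
  by_cases h : C.i x = x
  · exact (C.len_zero x h).ge
  · exact (C.len_pos x h).le

/-- Isomorphisms of tropical curves. -/
@[ext] structure Iso (C C' : TCurve n) where
  toEquiv : C.X ≃ C'.X
  map_r : ∀ x, toEquiv (C.r x) = C'.r (toEquiv x)
  map_i : ∀ x, toEquiv (C.i x) = C'.i (toEquiv x)
  map_h : ∀ x, C'.h (toEquiv x) = C.h x
  map_m : ∀ k, toEquiv (C.m k).1 = (C'.m k).1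
  map_len : ∀ x, C'.len (toEquiv x) = C.len x

/-- The identity isomorphism. -/
def Iso.refl (C : TCurve n) : Iso C C :=
  ⟨Equiv.refl _, fun _ => rfl, fun _ => rfl, fun _ => rfl, fun _ => rfl, fun _ => rfl⟩

/-- Composition of isomorphisms. -/
def Iso.trans {C C' C'' : TCurve n} (a : Iso C C') (b : Iso C' C'') : Iso C C'' where
  toEquiv := a.toEquiv.trans b.toEquiv
  map_r x := by simp [a.map_r, b.map_r]
  map_i x := by simp [a.map_i, b.map_i]
  map_h x := by simp [a.map_h, b.map_h]
  map_m x := by simp [a.map_m, b.map_m]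
  map_len x := by simp [a.map_len, b.map_len]

open Classical in
/-- The metric of the stabilization: the two edges at an exceptional vertex are merged into
one edge, whose length is the sum of their lengths. -/
noncomputable def stabLen (C : TCurve n) (x : C.X) : ℝ :=
  if C.Exc (C.r (C.i x)) then C.len x + C.len (C.opp (C.i x)) else C.len x

/-- The stabilization of a quasi-stable tropical curve. -/
@[reducible] noncomputable def stab (C : TCurve n) (hC : IsQS g C.toMGraph) : TCurve n where
  toMGraph := C.toMGraph.stab hC
  len x := C.stabLen x.1
  len_i x := by
    change C.stabLen (C.stabInv x.1) = C.stabLen x.1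
    have hx := x.2
    unfold stabLen stabInv
    by_cases he : C.Exc (C.r (C.i x.1))
    · rw [if_pos he, if_pos he, C.i_i, if_pos (by rw [IsQS.opp_root hx he]; exact he),
        opp_opp (IsQS.i_flag hx he) he, C.len_i, C.len_i, add_comm]
    · rw [if_neg he, if_neg he, C.i_i, if_neg hx, C.len_i]
  len_pos x hx := by
    have hi : C.i x.1 ≠ x.1 := fun h => hx (Subtype.ext (stabInv_of_fix x.2 h))
    have h1 := C.len_pos _ hi
    have h2 := C.len_nonneg (C.opp (C.i x.1))
    unfold stabLen
    split_ifs <;> linarith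
  len_zero x hx := by
    have hi : C.i x.1 = x.1 := (IsQS.stabInv_eq x.2).1 (congrArg Subtype.val hx)
    unfold stabLen
    rw [if_neg (by rw [hi]; exact x.2), C.len_zero _ hi]

namespace Iso

variable {C C' : TCurve n} (a : Iso C C')

theorem map_flag (x : C.X) : C'.r (a.toEquiv x) = a.toEquiv x ↔ C.r x = x := by
  rw [← a.map_r]; exact a.toEquiv.injective.eq_iff

theorem map_val (v : C.X) : C'.val (a.toEquiv v) = C.val v := by
  unfold MGraph.val
  rw [← Set.ncard_image_of_injective _ a.toEquiv.injective]
  congr 1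
  ext y
  constructor
  · rintro ⟨h1, h2⟩
    obtain ⟨x, rfl⟩ := a.toEquiv.surjective y
    refine ⟨x, ⟨fun h => h1 ((a.map_flag x).2 h), ?_⟩, rfl⟩
    rw [← a.map_r] at h2
    exact a.toEquiv.injective h2
  · rintro ⟨x, ⟨h1, h2⟩, rfl⟩
    exact ⟨fun h => h1 ((a.map_flag x).1 h), by rw [← a.map_r, h2]⟩

theorem map_exc (v : C.X) : C'.Exc (a.toEquiv v) ↔ C.Exc v := by
  unfold Exc
  rw [a.map_flag, a.map_h, a.map_val]

theorem map_exc_r (x : C.X) : C'.Exc (C'.r (a.toEquiv x)) ↔ C.Exc (C.r x) := by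
  rw [← a.map_r, a.map_exc]

theorem map_opp {x : C.X} (hx : C.r x ≠ x) (he : C.Exc (C.r x)) :
    C'.opp (a.toEquiv x) = a.toEquiv (C.opp x) := by
  obtain ⟨h1, h2, h3⟩ := opp_spec hx he
  refine opp_unique (fun h => hx ((a.map_flag x).1 h)) ((a.map_exc_r x).2 he)
    (fun h => h1 ((a.map_flag _).1 h)) ?_ (fun h => h3 (a.toEquiv.injective h))
  rw [← a.map_r, ← a.map_r, h2]

theorem map_exc_i (x : C.X) : C'.Exc (C'.r (C'.i (a.toEquiv x))) ↔ C.Exc (C.r (C.i x)) := by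
  rw [← a.map_i, a.map_exc_r]

/-- The stabilization of an isomorphism. -/
noncomputable def stab (hC : IsQS g C.toMGraph) (hC' : IsQS g C'.toMGraph) :
    Iso (C.stab hC) (C'.stab hC') where
  toEquiv := a.toEquiv.subtypeEquiv fun x => not_congr (a.map_exc_r x).symm
  map_r x := Subtype.ext (a.map_r x.1)
  map_i x := by
    apply Subtype.ext
    change a.toEquiv (C.stabInv x.1) = C'.stabInv (a.toEquiv x.1)
    unfold stabInv
    by_cases he : C.Exc (C.r (C.i x.1))
    · rw [if_pos he, if_pos ((a.map_exc_i _).2 he), a.map_i, ← a.map_i x.1,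
        a.map_opp (IsQS.i_flag x.2 he) he]
    · rw [if_neg he, if_neg (fun h => he ((a.map_exc_i _).1 h)), a.map_i]
  map_h x := a.map_h x.1
  map_m k := Subtype.ext (a.map_m k)
  map_len x := by
    change C'.stabLen (a.toEquiv x.1) = C.stabLen x.1
    unfold stabLen
    by_cases he : C.Exc (C.r (C.i x.1))
    · rw [if_pos he, if_pos ((a.map_exc_i _).2 he), ← a.map_i x.1,
        a.map_opp (IsQS.i_flag x.2 he) he, a.map_len, a.map_len]
    · rw [if_neg he, if_neg (fun h => he ((a.map_exc_i _).1 h)), a.map_len]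

end Iso

/-- The length of the image of a half-edge under the stabilization of a morphism. -/
theorem stabLen_stabFun {C₁ C₂ : TCurve n} (h₁ : IsQS g C₁.toMGraph)
    {π : C₁.X → C₂.X} (hπ : IsMor C₁.toMGraph C₂.toMGraph π) {x : C₁.X}
    (hx : ¬ C₁.Exc (C₁.r x)) :
    C₂.stabLen (stabFun C₁.toMGraph C₂.toMGraph π x) =
      C₂.len (π x) + (open Classical in
        if C₁.Exc (C₁.r (C₁.i x)) then C₂.len (π (C₁.opp (C₁.i x))) else 0) := by
  have hzero : ∀ y, C₂.r y = y → C₂.len y = 0 := fun y hy => C₂.len_zero _ (i_vertex hy)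
  by_cases he : C₁.Exc (C₁.r (C₁.i x))
  · rw [if_pos he]
    by_cases hc : C₂.r (π x) = π x
    · unfold stabFun
      rw [if_pos ⟨he, hc⟩, hzero _ hc, zero_add]
      unfold stabLen
      rw [if_neg]
      rw [← hπ.map_i]
      exact hπ.nexc h₁ (h₁.nexc_i_opp hx he)
    · unfold stabFun
      rw [if_neg (fun h => hc h.2)]
      have h7 : C₂.r (C₂.i (π x)) = π (C₁.r (C₁.i x)) := by rw [← hπ.map_i, ← hπ.map_r]
      unfold stabLen
      rw [h7]
      by_cases he₂ : C₂.Exc (π (C₁.r (C₁.i x)))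
      · rw [if_pos he₂, (hπ.opp_map h₁ hx he hc he₂).2]
      · rw [if_neg he₂, hzero _ (hπ.contr_opp hx he hc he₂), add_zero]
  · rw [if_neg he, add_zero]
    unfold stabFun
    rw [if_neg (fun h => he h.1)]
    unfold stabLen
    rw [if_neg]
    rw [← hπ.map_i]
    exact hπ.nexc h₁ he

end TCurve

/-! ## Families of tropical curves over a topological space -/

/-- A (continuous) family of `n`-marked tropical curves over a topological space `T`: a tropical
curve for every point, and for every `t` and every `t'` in an open neighbourhood `nhd t` of `t` a
specialization morphism `sp t t'` from the graph at `t'` to the graph at `t`.  The specialization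
morphisms are compatible with each other (locally), and the edge lengths vary continuously: the
length of an edge tends to the length of its specialization, which is zero if it is contracted. -/
structure Fam (n : ℕ) (T : Type*) [TopologicalSpace T] where
  curve : T → TCurve n
  nhd : T → Set T
  isOpen_nhd : ∀ t, IsOpen (nhd t)
  mem_nhd : ∀ t, t ∈ nhd t
  sp : ∀ t t', t' ∈ nhd t → (curve t').X → (curve t).X
  sp_mor : ∀ t t' (h : t' ∈ nhd t), IsMor (curve t').toMGraph (curve t).toMGraph (sp t t' h)
  sp_comp : ∀ t t' (h : t' ∈ nhd t), ∀ᶠ t'' in 𝓝 t', ∀ (h₁ : t'' ∈ nhd t') (h₂ : t'' ∈ nhd t),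
    sp t t'' h₂ = sp t t' h ∘ sp t' t'' h₁
  sp_len : ∀ t, ∀ ε > 0, ∀ᶠ t' in 𝓝 t, ∀ (h : t' ∈ nhd t) (y : (curve t').X),
    |(curve t').len y - (curve t).len (sp t t' h y)| < ε

universe u v

namespace Fam

variable {n : ℕ} {T : Type u} [TopologicalSpace T]

/-- Isomorphisms of families: isomorphisms of the curves at all points, (locally) compatible with
the specialization morphisms. -/
@[ext] structure Iso (F F' : Fam n T) where
  iso : ∀ t, TCurve.Iso (F.curve t) (F'.curve t)
  comm : ∀ t, ∀ᶠ t' in 𝓝 t, ∀ (h : t' ∈ F.nhd t) (h' : t' ∈ F'.nhd t) (x : (F.curve t').X),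
    (iso t).toEquiv (F.sp t t' h x) = F'.sp t t' h' ((iso t').toEquiv x)

/-- The identity isomorphism. -/
def Iso.refl (F : Fam n T) : Iso F F where
  iso _ := TCurve.Iso.refl _
  comm _ := Filter.Eventually.of_forall fun _ _ _ _ => rfl

/-- Composition of isomorphisms. -/
def Iso.trans {F F' F'' : Fam n T} (a : Iso F F') (b : Iso F' F'') : Iso F F'' where
  iso t := (a.iso t).trans (b.iso t)
  comm t := by
    filter_upwards [a.comm t, b.comm t, (F'.isOpen_nhd t).mem_nhds (F'.mem_nhd t)]
      with t' h1 h2 h3 h h' x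
    exact (congrArg _ (h1 h h3 x)).trans (h2 h3 h' _)

/-- Pullback of a family along a continuous map. -/
def pullback {S : Type v} [TopologicalSpace S] (F : Fam n T) (f : C(S, T)) : Fam n S where
  curve s := F.curve (f s)
  nhd s := f ⁻¹' F.nhd (f s)
  isOpen_nhd _ := (F.isOpen_nhd _).preimage f.continuous
  mem_nhd _ := F.mem_nhd _
  sp s s' h := F.sp (f s) (f s') h
  sp_mor _ _ h := F.sp_mor _ _ h
  sp_comp _ s' h := ((f.continuous.tendsto s').eventually (F.sp_comp _ _ h)).mono
    fun _ h3 h₁ h₂ => h3 h₁ h₂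
  sp_len s ε hε := ((f.continuous.tendsto s).eventually (F.sp_len _ ε hε)).mono
    fun _ h3 h y => h3 h y

/-- Pullback of an isomorphism. -/
def Iso.pullback {S : Type v} [TopologicalSpace S] {F F' : Fam n T} (a : Iso F F')
    (f : C(S, T)) : Iso (F.pullback f) (F'.pullback f) where
  iso s := a.iso (f s)
  comm s := ((f.continuous.tendsto s).eventually (a.comm _)).mono fun _ h3 h h' x => h3 h h' x

end Fam

/-- The objects over `T` of the topological stack `|M^trop_{g,n}|`: families of stable tropical
curves of type `(g, n)` over `T`. -/
structure MFam (g n : ℕ) (T : Type*) [TopologicalSpace T] extends Fam n T where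
  stable : ∀ t, IsStable g (curve t).toMGraph

/-- The objects over `T` of the topological stack `|J^trop_{g,n}(φ)|`: families of quasi-stable
tropical curves of type `(g, n)` over `T` together with `φ`-semistable (admissible) divisors on
the underlying graphs, preserved by the specialization morphisms. -/
structure JFam {g n : ℕ} (φ : UnivStab g n) (T : Type*) [TopologicalSpace T] extends
    Fam n T where
  qs : ∀ t, IsQS g (curve t).toMGraph
  D : ∀ t, (curve t).V → ℤ
  ss : ∀ t, φ.Semistable (qs t) (D t)
  push : ∀ t t' (h : t' ∈ nhd t) (v : (curve t).V),
    D t v = ∑ᶠ w : {w : (curve t').V // sp t t' h w.1 = v.1}, D t' w.1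

section families

variable {g n : ℕ} {φ : UnivStab g n} {T : Type u} [TopologicalSpace T]

/-- The groupoid `|M^trop_{g,n}|(T)`. -/
instance : Category (MFam g n T) where
  Hom F F' := Fam.Iso F.toFam F'.toFam
  id F := Fam.Iso.refl _
  comp a b := a.trans b

/-- Isomorphisms in `|J^trop_{g,n}(φ)|(T)`: isomorphisms of families preserving the divisors. -/
@[ext] structure JFam.Hom (F F' : JFam φ T) where
  toIso : Fam.Iso F.toFam F'.toFam
  map_D : ∀ t (v : (F.curve t).V) (v' : (F'.curve t).V),
    (toIso.iso t).toEquiv v.1 = v'.1 → F'.D t v' = F.D t v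

/-- The groupoid `|J^trop_{g,n}(φ)|(T)`. -/
instance : Category (JFam φ T) where
  Hom F F' := JFam.Hom F F'
  id F := ⟨Fam.Iso.refl _, fun t v v' h => by rw [show v' = v from Subtype.ext h.symm]⟩
  comp {F F' F''} a b := ⟨a.toIso.trans b.toIso, fun t v v' h => by
    have hv : (F'.curve t).r ((a.toIso.iso t).toEquiv v.1) = (a.toIso.iso t).toEquiv v.1 := by
      rw [← (a.toIso.iso t).map_r, v.2]
    rw [b.map_D t ⟨_, hv⟩ v' h, a.map_D t v ⟨_, hv⟩ rfl]⟩

/-- The forgetful-stabilization map on objects: stabilize all curves and all specialization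
morphisms. -/
noncomputable def JFam.stab (F : JFam φ T) : MFam g n T where
  curve t := (F.curve t).stab (F.qs t)
  nhd := F.nhd
  isOpen_nhd := F.isOpen_nhd
  mem_nhd := F.mem_nhd
  sp t t' h := stabMap (F.qs t') (F.qs t) (F.sp_mor t t' h)
  sp_mor t t' h := (F.sp_mor t t' h).stab (F.qs t') (F.qs t)
  sp_comp t t' h := (F.sp_comp t t' h).mono fun t'' h3 h₁ h₂ => by
    funext x
    apply Subtype.ext
    change stabFun _ _ (F.sp t t'' h₂) x.1 = stabFun _ _ (F.sp t t' h) (stabFun _ _ _ x.1)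
    rw [h3 h₁ h₂]
    exact stabFun_comp (F.qs t'') (F.sp_mor t' t'' h₁) (F.sp_mor t t' h) x.2
  sp_len t ε hε := (F.sp_len t (ε / 2) (half_pos hε)).mono fun t' h3 h y => by
    change |(F.curve t').stabLen y.1 - (F.curve t).stabLen (stabFun _ _ (F.sp t t' h) y.1)| < ε
    rw [TCurve.stabLen_stabFun (F.qs t') (F.sp_mor t t' h) y.2]
    unfold TCurve.stabLen
    have h4 := h3 h y.1
    split_ifs
    · have h5 := h3 h ((F.curve t').opp ((F.curve t').i y.1))
      rw [abs_lt] at h4 h5 ⊢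
      constructor <;> linarith
    · rw [add_zero]; linarith
  stable t := (F.qs t).stab_isStable

variable (φ T) in
/-- The forgetful-stabilization morphism `|Φ^trop| : |J^trop_{g,n}(φ)| → |M^trop_{g,n}|`,
over `T`. -/
noncomputable def Phi : JFam φ T ⥤ MFam g n T where
  obj F := F.stab
  map {F F'} a :=
    { iso := fun t => (a.toIso.iso t).stab (F.qs t) (F'.qs t)
      comm := fun t => (a.toIso.comm t).mono fun t' h3 h h' x => by
        apply Subtype.ext
        have h3' := h3 h h'
        set θ := a.toIso.iso t
        set θ' := a.toIso.iso t'
        change θ.toEquiv (stabFun _ _ (F.sp t t' h) x.1) =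
          stabFun _ _ (F'.sp t t' h') (θ'.toEquiv x.1)
        unfold stabFun
        by_cases he : (F.curve t').Exc ((F.curve t').r ((F.curve t').i x.1))
        · have ho : (F'.curve t').opp ((F'.curve t').i (θ'.toEquiv x.1)) =
              θ'.toEquiv ((F.curve t').opp ((F.curve t').i x.1)) := by
            rw [← θ'.map_i, θ'.map_opp (IsQS.i_flag x.2 he) he]
          by_cases hc : (F.curve t).r (F.sp t t' h x.1) = F.sp t t' h x.1
          · have hc' : (F'.curve t).r (F'.sp t t' h' (θ'.toEquiv x.1)) =
                F'.sp t t' h' (θ'.toEquiv x.1) := by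
              rw [← h3' x.1]; exact (θ.map_flag _).2 hc
            rw [if_pos ⟨he, hc⟩, if_pos ⟨(θ'.map_exc_i _).2 he, hc'⟩, ho]
            exact h3' _
          · rw [if_neg (fun h => hc h.2), if_neg, h3']
            rintro ⟨-, h5⟩
            rw [← h3'] at h5
            exact hc ((θ.map_flag _).1 h5)
        · rw [if_neg (fun h => he h.1), if_neg (fun h => he ((θ'.map_exc_i _).1 h.1)), h3'] }

/-- The object of `|M^trop_{g,n}|(T)` given by the composite `T → ⋆ → |M^trop_{g,n}|`: the
constant family with value a stable tropical curve `Γ`. -/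
def constFam (Γ : TCurve n) (hΓ : IsStable g Γ.toMGraph) (T : Type u) [TopologicalSpace T] :
    MFam g n T where
  curve _ := Γ
  nhd _ := Set.univ
  isOpen_nhd _ := isOpen_univ
  mem_nhd _ := trivial
  sp _ _ _ := id
  sp_mor _ _ _ := isMor_id _
  sp_comp _ _ _ := Filter.Eventually.of_forall fun _ _ _ => rfl
  sp_len _ ε hε := Filter.Eventually.of_forall fun _ _ _ => by simpa using hε
  stable _ := hΓ

/-- The groupoid of `T`-points of the fibre `⋆ ×_{|M^trop_{g,n}|} |J^trop_{g,n}(φ)|` of the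
forgetful-stabilization morphism over the point `Γ`: its objects are the objects `F` of
`|J^trop_{g,n}(φ)|(T)` with an isomorphism from `|Φ^trop|(F)` to the constant family `Γ`. -/
abbrev FibreOver (φ : UnivStab g n) (Γ : TCurve n) (hΓ : IsStable g Γ.toMGraph)
    (T : Type u) [TopologicalSpace T] :=
  CostructuredArrow (Phi φ T) (constFam Γ hΓ T)

/-- Pullback in `|J^trop_{g,n}(φ)|` along a continuous map. -/
def JFam.pullback {S : Type v} [TopologicalSpace S] (F : JFam φ T) (f : C(S, T)) :
    JFam φ S where
  toFam := F.toFam.pullback f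
  qs s := F.qs (f s)
  D s := F.D (f s)
  ss s := F.ss (f s)
  push s s' h v := F.push (f s) (f s') h v

/-- Pullback in the fibre along a continuous map. -/
noncomputable def FibreOver.pullback {Γ : TCurve n} {hΓ : IsStable g Γ.toMGraph}
    {S : Type v} [TopologicalSpace S] (F : FibreOver φ Γ hΓ T) (f : C(S, T)) :
    FibreOver φ Γ hΓ S :=
  CostructuredArrow.mk (Y := F.left.pullback f)
    (show Fam.Iso ((F.left.pullback f).stab).toFam (constFam Γ hΓ S).toFam from
      Fam.Iso.pullback (F := (F.left.stab).toFam) (F' := (constFam Γ hΓ T).toFam) F.hom f)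

end families

/-! ## The tropical Picard group -/

namespace TCurve

variable {n : ℕ}

/-- Points of the metric graph before gluing: a half-edge with a distance from its root (vertices
and legs contribute intervals of length zero). -/
abbrev PrePt (Γ : TCurve n) : Type := Σ x : Γ.X, Set.Icc (0 : ℝ) (Γ.len x)

/-- The gluing relation: the initial point of a half-edge is its root vertex, and the two
half-edges of an edge parametrize the same segment in opposite directions. -/
inductive PtRel (Γ : TCurve n) : Γ.PrePt → Γ.PrePt → Prop
  | root (x : Γ.X) (a : Set.Icc (0 : ℝ) (Γ.len x)) (b : Set.Icc (0 : ℝ) (Γ.len (Γ.r x))) :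
      a.1 = 0 → PtRel Γ ⟨x, a⟩ ⟨Γ.r x, b⟩
  | flip (x : Γ.X) (a : Set.Icc (0 : ℝ) (Γ.len x)) (b : Set.Icc (0 : ℝ) (Γ.len (Γ.i x))) :
      a.1 + b.1 = Γ.len x → PtRel Γ ⟨x, a⟩ ⟨Γ.i x, b⟩

/-- The (compact) metric graph underlying a tropical curve, with its quotient topology. -/
def Pt (Γ : TCurve n) : Type := Quot Γ.PtRel

instance (Γ : TCurve n) : TopologicalSpace Γ.Pt := inferInstanceAs (TopologicalSpace (Quot _))

/-- The point at distance `a` from the root of `x` along `x`, for `0 ≤ a ≤ Γ.len x`. -/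
noncomputable def pt (Γ : TCurve n) (x : Γ.X) (a : ℝ) : Γ.Pt :=
  Quot.mk _ ⟨x, Set.projIcc 0 (Γ.len x) (Γ.len_nonneg x) a⟩

/-- `D` is the divisor of a rational function `f`, that is a piecewise linear function with
integral slopes.  Here `(x, a)`, for `0 ≤ a < Γ.len x`, is the tangent direction at the point
`Γ.pt x a` pointing away from the root of `x`, and `s x a` is the slope of `f` in this direction;
the divisor of `f` takes at each point the sum of the outgoing slopes. -/
def IsPrincipal (Γ : TCurve n) (D : Γ.Pt →₀ ℤ) : Prop :=
  ∃ (f : Γ.Pt → ℝ) (s : Γ.X → ℝ → ℤ),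
    (∀ x a, 0 ≤ a → a < Γ.len x → ∃ ε > 0, ∀ b, a ≤ b → b ≤ a + ε → b ≤ Γ.len x →
      f (Γ.pt x b) = f (Γ.pt x a) + s x a * (b - a)) ∧
    ∀ p, D p = ∑ᶠ q : {q : Γ.X × ℝ // 0 ≤ q.2 ∧ q.2 < Γ.len q.1 ∧ Γ.pt q.1 q.2 = p},
      s q.1.1 q.1.2

/-- The tropical Picard group: divisors modulo linear equivalence. -/
noncomputable def Pic (Γ : TCurve n) : Type :=
  (Γ.Pt →₀ ℤ) ⧸ AddSubgroup.closure {D : Γ.Pt →₀ ℤ | Γ.IsPrincipal D}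

/-- The class of a divisor. -/
noncomputable def cls (Γ : TCurve n) (D : Γ.Pt →₀ ℤ) : Γ.Pic :=
  (QuotientAddGroup.mk D :
    (Γ.Pt →₀ ℤ) ⧸ AddSubgroup.closure {D : Γ.Pt →₀ ℤ | Γ.IsPrincipal D})

/-- The topology of the tropical Picard group: the finest one for which all the maps
`(p₁, …, pₐ, q₁, …, q_b) ↦ [p₁ + ⋯ + pₐ - q₁ - ⋯ - q_b]` are continuous. -/
noncomputable instance (Γ : TCurve n) : TopologicalSpace Γ.Pic :=
  ⨆ k : ℕ × ℕ, TopologicalSpace.coinduced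
    (fun p : (Fin k.1 → Γ.Pt) × (Fin k.2 → Γ.Pt) =>
      Γ.cls (∑ i, Finsupp.single (p.1 i) 1 - ∑ j, Finsupp.single (p.2 j) 1)) inferInstance

/-- The part `Pic^d` of degree `d` of the tropical Picard group. -/
def PicDeg (Γ : TCurve n) (d : ℤ) : Set Γ.Pic :=
  {c | ∃ D : Γ.Pt →₀ ℤ, (D.sum fun _ m => m) = d ∧ Γ.cls D = c}

/-- The first Betti number of the underlying graph. -/
noncomputable def b1 (Γ : TCurve n) : ℕ := (Γ.b1On Set.univ).toNat

variable {g : ℕ}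

theorem exists_flag {C : TCurve n} {v : C.X} (he : C.Exc v) : ∃ x, C.r x ≠ x ∧ C.r x = v := by
  obtain ⟨a, b, -, h⟩ := flags_ncard he
  exact ⟨a, (h a).2 (Or.inl rfl)⟩

open Classical in
/-- The divisor on `Γ` defined by a divisor `D` on a quasi-stable tropical curve `C` whose
stabilization is identified with `Γ`: the sum of `D v` times `v` over the non-exceptional
vertices `v` and of the points of `Γ` which correspond to the exceptional vertices `v`, i.e. the
points at distance `C.len x` from the other end of the edge of `x`, for any flag `x` at `v`. -/
noncomputable def modelDivisor {C Γ : TCurve n} (hC : IsQS g C.toMGraph) (D : C.V → ℤ)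
    (ψ : Iso (C.stab hC) Γ) : Γ.Pt →₀ ℤ :=
  ∑ᶠ v : C.V,
    if he : C.Exc v.1 then
      Finsupp.single (Γ.pt (ψ.toEquiv ⟨C.i (exists_flag he).choose,
        (hC.exc _ (exists_flag he).choose_spec.1
          (by rw [(exists_flag he).choose_spec.2]; exact he)).2⟩)
        (C.len (exists_flag he).choose)) 1
    else Finsupp.single (Γ.pt (ψ.toEquiv ⟨v.1, by rw [v.2]; exact he⟩) 0) (D v)

end TCurve

/-- The class in `Pic(Γ)` of the divisor on `Γ` defined by the point over `t` of an object of the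
fibre over `Γ`. -/
noncomputable def picClass {g n : ℕ} {φ : UnivStab g n} {Γ : TCurve n}
    {hΓ : IsStable g Γ.toMGraph} {T : Type u} [TopologicalSpace T] (F : FibreOver φ Γ hΓ T)
    (t : T) : Γ.Pic :=
  Γ.cls (TCurve.modelDivisor (F.left.qs t) (F.left.D t)
    (show TCurve.Iso ((F.left.curve t).stab (F.left.qs t)) Γ from
      (show Fam.Iso F.left.stab.toFam (constFam Γ hΓ T).toFam from F.hom).iso t))

/-!
Divisors on the metric graph `Γ` are moved around by *flows*: functions `μ` on the half-edges with
`μ (i x) = -μ x`, the real number `μ x` being the portion of the edge along which a chip is moved.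
Moving chips along a flow gives a divisor class `flowCls μ` of degree zero, which depends additively
on `μ` and vanishes for gradients of functions on the vertices (`flowCls_grad`) and for integral
cycles (`flowCls_cycle`). Conversely, the flows modulo gradients are identified by a period map
(`nonempty_periodMap`) with `ℝ ^ b₁` such that the integral cycles become the standard lattice, and
principal divisors are killed by the resulting Abel-Jacobi map
(`ajDiv_eq_zero_of_isPrincipal`). So the classes of a given degree form a real torus of dimension
`b₁`, a compactness argument giving the homeomorphism `picHomeo`.

A semistable divisor on a quasi-stable curve with stabilization `Γ` amounts to data on `Γ`: the
positions `ν` of the exceptional vertices on the edges (`IsSubdiv`), and the values `D` at the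
vertices of `Γ`. All such data come from flows, `ν` being the fractional part of a flow `μ`, and `D`
being given by the sums of the values of `⌈μ⌉` at the vertices (`flowDiv`, `exists_flow_lift`), and
semistability is a condition `IsSS` on the flow (`isSS_iff`). The main point is that each class of
flows modulo gradients contains a semistable flow, which is unique up to integral cycles if the
stability condition is general:

* Existence (`exists_isSS`): the inequalities are the optimality conditions for the minimum of a
  convex, piecewise linear and coercive energy.
* Uniqueness (`IsSS.unique`): if two semistable flows differ by an integral cycle and a gradient, the
  semistability inequalities become equalities for the set of vertices where the potential is
  maximal; by generality this set contains all vertices.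
* Continuity (`exists_cycle_near`): as the semistable flows form a closed set, compact modulo
  integral cycles, the unique flow depends continuously on the class.

It remains to pass to families. Specializations which induce the identity on the stabilizations and
nearly preserve the lengths move the exceptional vertices by a small amount, or to the nearest
vertex of `Γ`; this is the nearness of the data on `Γ` (`IsNear`, `isNear_of_len`), which is the same
as nearness of flows modulo integral cycles (`isNear_of_flow`, `IsNear.exists_flow`). Hence the class
of the divisor is continuous in a family (`FibreOver.continuous_ajPic`), points of the fibre with the
same classes are uniquely isomorphic (`FibreOver.hom_ext`, `FibreOver.nonempty_hom`,
`FibreOver.eq_of_picClass_eq`), and every continuous map to the torus comes from a family, made of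
standard subdivisions of `Γ` and of the specializations between them (`DivFam.toFibre`,
`exists_divFam`).
-/


/-! ### Flows on a graph -/

namespace MGraph

variable {n : ℕ} {R M : Type*}

noncomputable instance (G : MGraph n) : Fintype G.X := @Fintype.ofFinite _ G.finX

noncomputable instance (G : MGraph n) : Fintype G.V :=
  @Fintype.ofFinite _ (by have := G.finX; unfold V; infer_instance)

noncomputable instance (G : MGraph n) : DecidableEq G.X := Classical.decEq _

noncomputable instance (G : MGraph n) : DecidableEq G.V := Classical.decEq _

theorem root_val {G : MGraph n} (v : G.V) : G.root v.1 = v := Subtype.ext v.2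

theorem root_r {G : MGraph n} (x : G.X) : G.root (G.r x) = G.root x := Subtype.ext (G.r_r x)

/-- The net amount that a function on the half-edges sends out of a vertex. -/
noncomputable def out (G : MGraph n) [AddCommMonoid R] (μ : G.X → R) (v : G.V) : R :=
  ∑ x with G.root x = v, μ x

/-- Flows: functions on the half-edges which change sign with the orientation. -/
def IsFlow (G : MGraph n) [Neg R] (μ : G.X → R) : Prop := ∀ x, μ (G.i x) = -μ x

/-- Integral cycles, that is flows without sources. -/
def IsCycle (G : MGraph n) (h : G.X → ℤ) : Prop := G.IsFlow h ∧ ∀ v, G.out h v = 0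

section flows

variable {G : MGraph n}

theorem IsFlow.eq_zero {μ : G.X → ℝ} (h : G.IsFlow μ) {x : G.X} (hx : G.i x = x) : μ x = 0 := by
  have := h x
  rw [hx] at this
  linarith

theorem IsFlow.eq_zero_int {μ : G.X → ℤ} (h : G.IsFlow μ) {x : G.X} (hx : G.i x = x) :
    μ x = 0 := by
  have := h x
  rw [hx] at this
  omega

theorem IsFlow.cast {h : G.X → ℤ} (hh : G.IsFlow h) : G.IsFlow (fun x => (h x : ℝ)) := fun x => by
  simp [hh x]

theorem IsFlow.add [SubtractionCommMonoid R] {μ ν : G.X → R} (h : G.IsFlow μ) (h' : G.IsFlow ν) :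
    G.IsFlow (fun x => μ x + ν x) := fun x => by
  simp only [h x, h' x, neg_add]

theorem IsFlow.sub [AddCommGroup R] {μ ν : G.X → R} (h : G.IsFlow μ) (h' : G.IsFlow ν) :
    G.IsFlow (fun x => μ x - ν x) := fun x => by
  simp only [h x, h' x]; abel

theorem out_add [AddCommMonoid R] (μ ν : G.X → R) (v : G.V) :
    G.out (fun x => μ x + ν x) v = G.out μ v + G.out ν v := Finset.sum_add_distrib

theorem out_sub [AddCommGroup R] (μ ν : G.X → R) (v : G.V) :
    G.out (fun x => μ x - ν x) v = G.out μ v - G.out ν v := Finset.sum_sub_distrib _ _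

theorem out_sum {ι : Type*} [AddCommMonoid R] (s : Finset ι) (μ : ι → G.X → R) (v : G.V) :
    G.out (fun x => ∑ k ∈ s, μ k x) v = ∑ k ∈ s, G.out (μ k) v := Finset.sum_comm

theorem out_smul [Semiring R] (c : R) (μ : G.X → R) (v : G.V) :
    G.out (fun x => c * μ x) v = c * G.out μ v := (Finset.mul_sum _ _ _).symm

theorem out_cast (h : G.X → ℤ) (v : G.V) : G.out (fun x => (h x : ℝ)) v = (G.out h v : ℤ) := by
  simp [out]

theorem IsCycle.add {h h' : G.X → ℤ} (hh : G.IsCycle h) (hh' : G.IsCycle h') :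
    G.IsCycle (fun x => h x + h' x) :=
  ⟨hh.1.add hh'.1, fun v => by rw [out_add, hh.2, hh'.2, add_zero]⟩

theorem IsCycle.neg {h : G.X → ℤ} (hh : G.IsCycle h) : G.IsCycle (fun x => -h x) :=
  ⟨fun x => by simp only [hh.1 x], fun v => by
    have := hh.2 v
    unfold out at this ⊢
    rw [Finset.sum_neg_distrib, this, neg_zero]⟩

theorem sum_out_smul [Semiring R] [AddCommMonoid M] [Module R M] (μ : G.X → R) (f : G.V → M) :
    ∑ v, G.out μ v • f v = ∑ x, μ x • f (G.root x) := by
  rw [← Finset.sum_fiberwise _ G.root]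
  refine Finset.sum_congr rfl fun v _ => ?_
  rw [out, Finset.sum_smul]
  refine Finset.sum_congr rfl fun x hx => ?_
  rw [(Finset.mem_filter.1 hx).2]

theorem sum_out [AddCommMonoid R] (μ : G.X → R) : ∑ v, G.out μ v = ∑ x, μ x :=
  Finset.sum_fiberwise _ _ _

/-- The involution of a graph as a permutation. -/
def iEquiv (G : MGraph n) : G.X ≃ G.X := ⟨G.i, G.i, G.i_i, G.i_i⟩

theorem sum_i [AddCommMonoid M] (f : G.X → M) : ∑ x, f (G.i x) = ∑ x, f x :=
  Equiv.sum_comp G.iEquiv f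

theorem IsFlow.sum_smul_i [Ring R] [AddCommGroup M] [Module R M] {μ : G.X → R} (hμ : G.IsFlow μ)
    (f : G.X → M) : ∑ x, μ x • f (G.i x) = -∑ x, μ x • f x := by
  rw [← sum_i (fun x => μ x • f x), ← Finset.sum_neg_distrib]
  refine Finset.sum_congr rfl fun x _ => ?_
  rw [hμ x, neg_smul, neg_neg]

/-- The unit flow along a half-edge, from its root to the root of the opposite half-edge. -/
noncomputable def unitFlow (G : MGraph n) (x y : G.X) : ℤ :=
  (if y = x then 1 else 0) - (if y = G.i x then 1 else 0)

theorem i_eq_iff {x y : G.X} : G.i x = y ↔ x = G.i y :=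
  ⟨fun h => by rw [← h, G.i_i], fun h => by rw [h, G.i_i]⟩

theorem unitFlow_isFlow (x : G.X) : G.IsFlow (G.unitFlow x) := fun y => by
  unfold unitFlow
  simp only [i_eq_iff, G.i_i]
  ring

theorem unitFlow_i (x y : G.X) : G.unitFlow (G.i x) y = -G.unitFlow x y := by
  unfold unitFlow
  rw [G.i_i]
  abel

theorem unitFlow_of_fix {x : G.X} (hx : G.i x = x) (y : G.X) : G.unitFlow x y = 0 := by
  unfold unitFlow
  rw [hx, sub_self]

theorem out_unitFlow (x : G.X) (v : G.V) : G.out (G.unitFlow x) v =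
    (if G.root x = v then 1 else 0) - (if G.root (G.i x) = v then 1 else 0) := by
  unfold unitFlow
  rw [out_sub]
  simp [out, Finset.sum_ite_eq', Finset.mem_filter]

theorem nonempty_V (hc : G.ConnOn Set.univ) : Nonempty G.V := by
  obtain ⟨v, -, hv⟩ := hc.1
  exact ⟨⟨v, hv⟩⟩

/-- In a connected graph a unit of flow can be sent from any vertex to any other one, along a path.
-/
theorem exists_path (hc : G.ConnOn Set.univ) (v₀ v : G.V) : ∃ P : G.X → ℤ, G.IsFlow P ∧
    ∀ w, G.out P w = (if v₀ = w then 1 else 0) - (if v = w then 1 else 0) := by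
  have h := hc.2 v₀.1 trivial v.1 trivial v₀.2 v.2
  have key : ∀ b, Relation.ReflTransGen
      (fun a b => ∃ x ∈ (Set.univ : Set G.X), G.r x = a ∧ G.r (G.i x) = b) v₀.1 b →
      ∃ P : G.X → ℤ, G.IsFlow P ∧
        ∀ w, G.out P w = (if v₀ = w then 1 else 0) - (if G.root b = w then 1 else 0) := by
    intro b hb
    induction hb with
    | refl => exact ⟨0, fun x => by simp, fun w => by simp [root_val, out]⟩
    | tail _ hs ih =>
      obtain ⟨x, -, rfl, rfl⟩ := hs
      obtain ⟨P, hP, hPo⟩ := ih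
      refine ⟨fun y => P y + G.unitFlow x y, hP.add (unitFlow_isFlow x), fun w => ?_⟩
      rw [out_add, hPo, out_unitFlow, root_r, root_r]
      ring
  simpa [root_val] using key v.1 h

/-- A choice of an orientation of the edges: exactly one of the two half-edges of each edge is
positively oriented. -/
def Or (G : MGraph n) (x : G.X) : Prop := Fintype.equivFin G.X x < Fintype.equivFin G.X (G.i x)

theorem Or.ne {x : G.X} (h : G.Or x) : G.i x ≠ x := fun h' => by
  unfold Or at h; rw [h'] at h; exact lt_irrefl _ h

theorem Or.not_i {x : G.X} (h : G.Or x) : ¬ G.Or (G.i x) := fun h' => by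
  unfold Or at h h'; rw [G.i_i] at h'; exact lt_asymm h h'

theorem or_or {x : G.X} (h : G.i x ≠ x) : G.Or x ∨ G.Or (G.i x) := by
  unfold Or; rw [G.i_i]
  exact lt_or_gt_of_ne fun h' => h ((Fintype.equivFin G.X).injective h'.symm)

open Classical in
/-- A sum over the half-edges, as a sum over the edges. -/
theorem sum_or [AddCommMonoid M] (f : G.X → M) (hf : ∀ x, G.i x = x → f x = 0) :
    ∑ x, f x = ∑ x with G.Or x, (f x + f (G.i x)) := by
  rw [Finset.sum_add_distrib, ← Finset.sum_filter_add_sum_filter_not Finset.univ G.Or]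
  congr 1
  rw [← Finset.sum_filter_of_ne (p := fun x => G.i x ≠ x) (fun x _ hx h => hx (hf x h))]
  symm
  refine Finset.sum_bij (fun x _ => G.i x) ?_ ?_ ?_ (fun _ _ => rfl)
  · intro x hx
    have hx : G.Or x := by simpa using hx
    simp only [Finset.mem_filter, Finset.mem_univ, true_and]
    exact ⟨hx.not_i, i_half hx.ne⟩
  · intro x _ y _ h
    rw [← G.i_i x, h, G.i_i]
  · intro x hx
    simp only [Finset.mem_filter, Finset.mem_univ, true_and] at hx
    refine ⟨G.i x, ?_, G.i_i x⟩
    simpa using (or_or hx.2).resolve_left hx.1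

open Classical in
/-- A flow is the sum of its values along the oriented edges. -/
theorem IsFlow.eq_sum_or {μ : G.X → ℝ} (hμ : G.IsFlow μ) (y : G.X) :
    μ y = ∑ x with G.Or x, μ x * (G.unitFlow x y : ℝ) := by
  have h1 : ∑ x, μ x * (if y = x then (1 : ℝ) else 0) = μ y := by simp
  rw [← h1, sum_or _ fun x hx => by rw [hμ.eq_zero hx, zero_mul]]
  refine Finset.sum_congr rfl fun x _ => ?_
  rw [hμ x]
  unfold unitFlow
  push_cast
  ring

end flows

end MGraph

namespace TCurve

variable {n : ℕ}

/-- The gradient of a function on the vertices. -/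
noncomputable def grad (Γ : TCurve n) (g : Γ.V → ℝ) (x : Γ.X) : ℝ :=
  (g (Γ.root (Γ.i x)) - g (Γ.root x)) / Γ.len x

variable {Γ : TCurve n}

theorem grad_isFlow (g : Γ.V → ℝ) : Γ.IsFlow (Γ.grad g) := fun x => by
  unfold grad
  rw [Γ.i_i, Γ.len_i]
  ring

theorem len_mul_grad (g : Γ.V → ℝ) (x : Γ.X) :
    Γ.len x * Γ.grad g x = g (Γ.root (Γ.i x)) - g (Γ.root x) := by
  by_cases hx : Γ.i x = x
  · rw [hx, Γ.len_zero x hx]; simp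
  · exact mul_div_cancel₀ _ (Γ.len_pos x hx).ne'

/-- Summation by parts. -/
theorem sum_len_grad_mul (g : Γ.V → ℝ) {μ : Γ.X → ℝ} (hμ : Γ.IsFlow μ) :
    ∑ x, Γ.len x * Γ.grad g x * μ x = -2 * ∑ v, Γ.out μ v * g v := by
  have h1 := sum_out_smul (G := Γ.toMGraph) μ g
  have h2 := hμ.sum_smul_i fun x => g (Γ.root x)
  simp only [smul_eq_mul] at h1 h2
  rw [h1]
  calc ∑ x, Γ.len x * Γ.grad g x * μ x
      = ∑ x, (μ x * g (Γ.root (Γ.i x)) - μ x * g (Γ.root x)) :=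
        Finset.sum_congr rfl fun x _ => by rw [len_mul_grad]; ring
    _ = _ := by rw [Finset.sum_sub_distrib, h2]; ring

theorem grad_eq_zero_of_out {g : Γ.V → ℝ} (h : ∀ v, Γ.out (Γ.grad g) v = 0) : Γ.grad g = 0 := by
  have h1 := sum_len_grad_mul g (grad_isFlow g)
  simp only [h, zero_mul, Finset.sum_const_zero, mul_zero] at h1
  rw [Finset.sum_eq_zero_iff_of_nonneg fun x _ => by
    rw [mul_assoc]; exact mul_nonneg (Γ.len_nonneg x) (mul_self_nonneg _)] at h1
  funext x
  by_cases hx : Γ.i x = x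
  · exact (grad_isFlow g).eq_zero hx
  · have := h1 x (Finset.mem_univ x)
    have hl := (Γ.len_pos x hx).ne'
    simpa [hl] using this

/-- A function with vanishing gradient on a connected graph is constant. -/
theorem grad_eq_zero (hc : Γ.ConnOn Set.univ) {g : Γ.V → ℝ} (h : Γ.grad g = 0) (v w : Γ.V) :
    g v = g w := by
  obtain ⟨P, hP, hPo⟩ := exists_path hc v w
  have h1 := sum_len_grad_mul g hP.cast
  simp only [h, out_cast, hPo] at h1
  simp [sub_mul, Finset.sum_sub_distrib] at h1
  linarith

/-- The gradient as a linear map. -/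
noncomputable def gradL (Γ : TCurve n) : (Γ.V → ℝ) →ₗ[ℝ] (Γ.X → ℝ) where
  toFun := Γ.grad
  map_add' g g' := by funext x; simp only [grad, Pi.add_apply]; ring
  map_smul' c g := by
    funext x; simp only [grad, Pi.smul_apply, smul_eq_mul, RingHom.id_apply]; ring

/-- `MGraph.out` as a linear map. -/
noncomputable def outL (Γ : TCurve n) : (Γ.X → ℝ) →ₗ[ℝ] (Γ.V → ℝ) where
  toFun := Γ.out
  map_add' μ ν := by funext v; exact out_add μ ν v
  map_smul' c μ := by funext v; exact out_smul c μ v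

/-- The sum of the values of a function on the vertices, as a linear map. -/
noncomputable def sumL (Γ : TCurve n) : (Γ.V → ℝ) →ₗ[ℝ] ℝ where
  toFun ρ := ∑ v, ρ v
  map_add' _ _ := Finset.sum_add_distrib
  map_smul' _ _ := (Finset.mul_sum _ _ _).symm

theorem IsFlow_sum_eq_zero {μ : Γ.X → ℝ} (hμ : Γ.IsFlow μ) : ∑ x, μ x = 0 := by
  have := sum_i μ
  simp only [hμ _, Finset.sum_neg_distrib] at this
  linarith

theorem sum_out_eq_zero {μ : Γ.X → ℝ} (hμ : Γ.IsFlow μ) : ∑ v, Γ.out μ v = 0 := by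
  rw [sum_out, IsFlow_sum_eq_zero hμ]

/-- The harmonic functions on a connected metric graph are the constants. -/
theorem ker_out_grad (hc : Γ.ConnOn Set.univ) :
    LinearMap.ker (Γ.outL ∘ₗ Γ.gradL) = ℝ ∙ (fun _ : Γ.V => (1 : ℝ)) := by
  obtain ⟨v₀⟩ := nonempty_V hc
  ext g
  rw [LinearMap.mem_ker, Submodule.mem_span_singleton]
  constructor
  · intro h
    refine ⟨g v₀, funext fun v => ?_⟩
    rw [grad_eq_zero hc (grad_eq_zero_of_out (fun w => congrFun h w)) v v₀]
    simp
  · rintro ⟨a, rfl⟩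
    have : Γ.gradL (a • fun _ : Γ.V => (1 : ℝ)) = 0 := by
      funext x; simp [gradL, grad]
    rw [LinearMap.comp_apply, this, map_zero]

theorem finrank_ker_sum (hc : Γ.ConnOn Set.univ) :
    Module.finrank ℝ (LinearMap.ker Γ.sumL) + 1 = Fintype.card Γ.V := by
  obtain ⟨v₀⟩ := nonempty_V hc
  have h := LinearMap.finrank_range_add_finrank_ker Γ.sumL
  have hr : LinearMap.range Γ.sumL = ⊤ := by
    rw [LinearMap.range_eq_top]
    intro a
    exact ⟨Pi.single v₀ a, by simp [sumL]⟩
  rw [hr, finrank_top, Module.finrank_self, Module.finrank_fintype_fun_eq_card] at h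
  omega

/-- The Poisson equation on a connected metric graph. -/
theorem exists_out_grad (hc : Γ.ConnOn Set.univ) {ρ : Γ.V → ℝ} (hρ : ∑ v, ρ v = 0) :
    ∃ g, ∀ v, Γ.out (Γ.grad g) v = ρ v := by
  obtain ⟨v₀⟩ := nonempty_V hc
  have h := LinearMap.finrank_range_add_finrank_ker (Γ.outL ∘ₗ Γ.gradL)
  have h1 : (fun _ : Γ.V => (1 : ℝ)) ≠ 0 := fun h => by
    have := congrFun h v₀
    simp at this
  rw [ker_out_grad hc, finrank_span_singleton h1, Module.finrank_fintype_fun_eq_card] at h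
  have hle : LinearMap.range (Γ.outL ∘ₗ Γ.gradL) ≤ LinearMap.ker Γ.sumL := by
    rintro _ ⟨g, rfl⟩
    exact sum_out_eq_zero (grad_isFlow g)
  have heq := Submodule.eq_of_le_of_finrank_eq hle (by have := finrank_ker_sum hc; omega)
  have hm : ρ ∈ LinearMap.ker Γ.sumL := hρ
  rw [← heq] at hm
  obtain ⟨g, hg⟩ := hm
  exact ⟨g, fun v => congrFun hg v⟩

/-- The real cycle space. -/
noncomputable def cycles (Γ : TCurve n) : Submodule ℝ (Γ.X → ℝ) where
  carrier := {μ | Γ.IsFlow μ ∧ ∀ v, Γ.out μ v = 0}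
  add_mem' {a b} h h' := ⟨h.1.add h'.1, fun v => by
    have := out_add (G := Γ.toMGraph) a b v
    rw [h.2 v, h'.2 v, add_zero] at this
    exact this⟩
  zero_mem' := ⟨fun x => by simp, fun v => by simp [out]⟩
  smul_mem' c μ h := ⟨fun x => by simp [h.1 x], fun v => by
    have := out_smul (G := Γ.toMGraph) c μ v
    rw [h.2 v, mul_zero] at this
    exact this⟩

/-- The space of real flows. -/
noncomputable def flows (Γ : TCurve n) : Submodule ℝ (Γ.X → ℝ) where
  carrier := {μ | Γ.IsFlow μ}
  add_mem' := fun h h' => h.add h'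
  zero_mem' := fun x => by simp
  smul_mem' c μ h := fun x => by simp [h x]

open Classical in
/-- A flow is determined by its values on the oriented edges. -/
noncomputable def flowsEquiv (Γ : TCurve n) : Γ.flows ≃ₗ[ℝ] ({x // Γ.Or x} → ℝ) where
  toFun μ x := μ.1 x.1
  map_add' _ _ := rfl
  map_smul' _ _ := rfl
  invFun a := ⟨fun y => (if h : Γ.Or y then a ⟨y, h⟩ else 0) -
    (if h : Γ.Or (Γ.i y) then a ⟨Γ.i y, h⟩ else 0), fun y => by simp only [Γ.i_i]; ring⟩
  left_inv μ := by
    ext y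
    by_cases hy : Γ.i y = y
    · have h1 : ¬ Γ.Or y := fun h => h.ne hy
      have h2 : μ.1 y = 0 := IsFlow.eq_zero μ.2 hy
      simp [hy, h1, h2]
    · rcases or_or hy with h | h
      · have := h.not_i
        simp [h, this]
      · have h1 : ¬ Γ.Or y := by have := h.not_i; rwa [Γ.i_i] at this
        have h2 : μ.1 (Γ.i y) = -μ.1 y := μ.2 y
        simp [h, h1, h2]
  right_inv a := by
    funext x
    simp [x.2, x.2.not_i]

open Classical in
theorem ncard_half_edges (Γ : TCurve n) :
    {x : Γ.X | x ∈ (Set.univ : Set Γ.X) ∧ Γ.i x ≠ x}.ncard = 2 * Fintype.card {x // Γ.Or x} := by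
  have h := sum_or (G := Γ.toMGraph) (fun x => if Γ.i x ≠ x then 1 else 0) (by simp)
  have h2 : ∑ x with Γ.Or x, ((if Γ.i x ≠ x then 1 else 0) +
      (if Γ.i (Γ.i x) ≠ Γ.i x then 1 else 0)) = ∑ x with Γ.Or x, 2 :=
    Finset.sum_congr rfl fun x hx => by
      have hx : Γ.Or x := by simpa using hx
      rw [if_pos hx.ne, if_pos (i_half hx.ne)]
  rw [h2, Finset.sum_const, ← Finset.card_filter] at h
  rw [Set.ncard_eq_toFinset_card', Fintype.card_subtype]
  simp only [Set.mem_univ, true_and, Set.toFinset_ofPred]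
  rw [h, smul_eq_mul, mul_comm]

theorem ncard_vertices (Γ : TCurve n) :
    {x : Γ.X | x ∈ (Set.univ : Set Γ.X) ∧ Γ.r x = x}.ncard = Fintype.card Γ.V := by
  simp only [Set.mem_univ, true_and]
  rw [← Nat.card_eq_fintype_card]
  rfl

/-- Every flow is the sum of a cycle and a gradient. -/
theorem exists_cycle_add_grad (hc : Γ.ConnOn Set.univ) {μ : Γ.X → ℝ} (hμ : Γ.IsFlow μ) :
    ∃ h ∈ Γ.cycles, ∃ g, μ = h + Γ.grad g := by
  obtain ⟨g, hg⟩ := exists_out_grad hc (sum_out_eq_zero hμ)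
  refine ⟨fun x => μ x - Γ.grad g x, ⟨hμ.sub (grad_isFlow g), fun v => ?_⟩, g, ?_⟩
  · have := out_sub (G := Γ.toMGraph) μ (Γ.grad g) v
    rw [hg, sub_self] at this
    exact this
  · funext x; simp

/-- The real cycle space has dimension `b₁`: by the Poisson equation, `out` maps the flows onto the
functions with sum zero, so the rank-nullity theorem gives the number of edges minus the number of
vertices plus one. -/
theorem finrank_cycles (hc : Γ.ConnOn Set.univ) : Module.finrank ℝ Γ.cycles = Γ.b1 := by
  classical
  have h := LinearMap.finrank_range_add_finrank_ker (Γ.outL.domRestrict Γ.flows)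
  have hr : LinearMap.range (Γ.outL.domRestrict Γ.flows) = LinearMap.ker Γ.sumL := by
    apply le_antisymm
    · rintro _ ⟨μ, rfl⟩
      exact sum_out_eq_zero μ.2
    · intro ρ hρ
      obtain ⟨g, hg⟩ := exists_out_grad hc hρ
      exact ⟨⟨Γ.grad g, grad_isFlow g⟩, funext hg⟩
  have hk : Module.finrank ℝ (LinearMap.ker (Γ.outL.domRestrict Γ.flows)) =
      Module.finrank ℝ Γ.cycles := by
    refine LinearEquiv.finrank_eq ⟨⟨⟨fun μ => ⟨μ.1.1, μ.1.2, fun v => congrFun μ.2 v⟩,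
      fun _ _ => rfl⟩, fun _ _ => rfl⟩, fun μ => ⟨⟨μ.1, μ.2.1⟩, funext μ.2.2⟩,
      fun _ => rfl, fun _ => rfl⟩
  have h1 := finrank_ker_sum hc
  rw [hr, hk, LinearEquiv.finrank_eq Γ.flowsEquiv, Module.finrank_fintype_fun_eq_card] at h
  have h2 : Γ.b1On Set.univ = Module.finrank ℝ Γ.cycles := by
    unfold b1On
    rw [ncard_half_edges, ncard_vertices]
    push_cast
    omega
  unfold b1
  rw [h2, Int.toNat_natCast]

theorem cycles_disjoint_grad {g : Γ.V → ℝ} (h : Γ.grad g ∈ Γ.cycles) : Γ.grad g = 0 :=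
  grad_eq_zero_of_out h.2

/-- The lattice of integral cycles in the real cycle space. -/
noncomputable def cycleLattice (Γ : TCurve n) : Submodule ℤ Γ.cycles where
  carrier := {μ | ∃ h : Γ.X → ℤ, ∀ x, μ.1 x = h x}
  add_mem' := by
    rintro a b ⟨h, hh⟩ ⟨h', hh'⟩
    exact ⟨fun x => h x + h' x, fun x => by simp [hh, hh']⟩
  zero_mem' := ⟨0, fun x => by simp⟩
  smul_mem' c := by
    rintro a ⟨h, hh⟩
    exact ⟨fun x => c * h x, fun x => by simp [hh]⟩

theorem exists_isCycle {μ : Γ.cycles} (hμ : μ ∈ Γ.cycleLattice) :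
    ∃ h : Γ.X → ℤ, Γ.IsCycle h ∧ ∀ x, μ.1 x = h x := by
  obtain ⟨h, hh⟩ := hμ
  have he : μ.1 = fun x => (h x : ℝ) := funext hh
  refine ⟨h, ⟨fun x => ?_, fun v => ?_⟩, hh⟩
  · have := μ.2.1 x
    simp only [he] at this
    exact_mod_cast this
  · have := μ.2.2 v
    rw [he, out_cast] at this
    exact_mod_cast this

/-- The cycle formed by the half-edge `x` and the chosen paths between the base point and its
ends. -/
noncomputable def cyc (P : Γ.V → Γ.X → ℤ) (x y : Γ.X) : ℤ :=
  P (Γ.root x) y + Γ.unitFlow x y - P (Γ.root (Γ.i x)) y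

theorem cyc_isCycle {v₀ : Γ.V} {P : Γ.V → Γ.X → ℤ} (hP : ∀ v, Γ.IsFlow (P v))
    (hPo : ∀ v w, Γ.out (P v) w = (if v₀ = w then 1 else 0) - (if v = w then 1 else 0))
    (x : Γ.X) : Γ.IsCycle (cyc P x) := by
  refine ⟨((hP _).add (unitFlow_isFlow x)).sub (hP _), fun v => ?_⟩
  have h1 := out_sub (G := Γ.toMGraph) (fun y => P (Γ.root x) y + Γ.unitFlow x y)
    (P (Γ.root (Γ.i x))) v
  rw [out_add, hPo, hPo, out_unitFlow] at h1
  unfold cyc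
  rw [h1]
  ring

/-- The integral cycles span the real cycle space: a cycle `μ` is half the sum over all half-edges
`x` of `μ x` times the integral cycle `TCurve.cyc P x`, since the contributions of the paths `P`
cancel. -/
theorem span_cycleLattice (hc : Γ.ConnOn Set.univ) :
    Submodule.span ℝ (Γ.cycleLattice : Set Γ.cycles) = ⊤ := by
  obtain ⟨v₀⟩ := nonempty_V hc
  choose P hP hPo using exists_path hc v₀
  rw [eq_top_iff]
  rintro μ -
  have hcm : ∀ x, (fun y => (cyc P x y : ℝ)) ∈ Γ.cycles := fun x => by
    have := cyc_isCycle hP hPo x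
    exact ⟨this.1.cast, fun v => by rw [out_cast, this.2]; simp⟩
  have hμ : μ = ∑ x, (1 / 2 * μ.1 x) • (⟨_, hcm x⟩ : Γ.cycles) := by
    apply Subtype.ext
    funext y
    simp only [AddSubmonoidClass.coe_finsetSum, SetLike.val_smul, Finset.sum_apply, Pi.smul_apply,
      smul_eq_mul]
    have h0 := sum_out_smul (G := Γ.toMGraph) μ.1 (fun v => (P v y : ℝ))
    have h1 := IsFlow.sum_smul_i μ.2.1 (fun x => (P (Γ.root x) y : ℝ))
    have h2 := IsFlow.sum_smul_i μ.2.1 (fun x => if y = x then (1 : ℝ) else 0)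
    simp only [μ.2.2, zero_mul, Finset.sum_const_zero, smul_eq_mul] at h0 h1 h2
    rw [← h0] at h1
    have h3 : ∑ x, μ.1 x * (if y = x then (1 : ℝ) else 0) = μ.1 y := by simp
    rw [h3] at h2
    calc μ.1 y = 1 / 2 * (∑ x, μ.1 x * P (Γ.root x) y +
          (∑ x, μ.1 x * (if y = x then (1 : ℝ) else 0) -
            ∑ x, μ.1 x * (if y = Γ.i x then (1 : ℝ) else 0)) -
          ∑ x, μ.1 x * P (Γ.root (Γ.i x)) y) := by
          rw [h1, h2, h3, ← h0]; simp; ring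
      _ = _ := by
          rw [← Finset.sum_sub_distrib, ← Finset.sum_add_distrib, ← Finset.sum_sub_distrib,
            Finset.mul_sum]
          refine Finset.sum_congr rfl fun x _ => ?_
          unfold cyc unitFlow
          push_cast
          ring
  rw [hμ]
  refine Submodule.sum_mem _ fun x _ => Submodule.smul_mem _ _ (Submodule.subset_span ?_)
  exact ⟨cyc P x, fun _ => rfl⟩

instance : DiscreteTopology Γ.cycleLattice := by
  apply discreteTopology_of_isOpen_singleton_zero
  rw [Metric.isOpen_singleton_iff]
  refine ⟨1, one_pos, fun y hy => ?_⟩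
  obtain ⟨h, hh⟩ := y.2
  apply Subtype.ext
  apply Subtype.ext
  funext x
  have h1 : dist (y.1.1 x) 0 < 1 := lt_of_le_of_lt (dist_le_pi_dist y.1.1 0 x) hy
  rw [hh, Real.dist_eq, sub_zero] at h1
  have h2 : |h x| < 1 := by exact_mod_cast h1
  have h3 : h x = 0 := by rw [abs_lt] at h2; omega
  rw [hh, h3]
  simp

/-- A period map: real coordinates on the flows modulo gradients, for which the integral cycles
form the standard lattice. -/
structure PeriodMap (Γ : TCurve n) where
  θ : (Γ.X → ℝ) →ₗ[ℝ] (Fin Γ.b1 → ℝ)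
  grad : ∀ g, θ (Γ.grad g) = 0
  cycle : ∀ h : Γ.X → ℤ, Γ.IsCycle h →
    ∃ m : Fin Γ.b1 → ℤ, θ (fun x => (h x : ℝ)) = fun j => (m j : ℝ)
  exists_cycle : ∀ m : Fin Γ.b1 → ℤ, ∃ h : Γ.X → ℤ, Γ.IsCycle h ∧
    θ (fun x => (h x : ℝ)) = fun j => (m j : ℝ)
  exists_grad : ∀ μ, Γ.IsFlow μ → θ μ = 0 → ∃ g, μ = Γ.grad g
  exists_flow : ∀ t, ∃ μ, Γ.IsFlow μ ∧ θ μ = t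

/-- The space of flows is the direct sum of the cycles and the gradients. A period map is the
projection to the cycles along the gradients, followed by the coordinates with respect to a basis of
the lattice of integral cycles. -/
theorem nonempty_periodMap (hc : Γ.ConnOn Set.univ) : Nonempty Γ.PeriodMap := by
  have : IsZLattice ℝ Γ.cycleLattice := ⟨span_cycleLattice hc⟩
  have : Module.Free ℤ Γ.cycleLattice := ZLattice.module_free ℝ _
  have : Module.Finite ℤ Γ.cycleLattice := ZLattice.module_finite ℝ _
  have hrank : Module.finrank ℤ Γ.cycleLattice = Γ.b1 := by
    rw [ZLattice.rank ℝ, finrank_cycles hc]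
  let b := Module.finBasisOfFinrankEq ℤ Γ.cycleLattice hrank
  let B := b.ofZLatticeBasis ℝ Γ.cycleLattice
  -- `p` projects to the sum of the cycles and the gradients, which is direct
  obtain ⟨p, hp⟩ := LinearMap.exists_leftInverse_of_injective
    (Γ.cycles.subtype.coprod (LinearMap.range Γ.gradL).subtype) (by
      rw [LinearMap.ker_eq_bot']
      rintro ⟨h, ⟨_, ⟨g, rfl⟩⟩⟩ hz
      have hz : h.1 + Γ.grad g = 0 := hz
      have h1 : Γ.grad g ∈ Γ.cycles := by
        rw [← neg_eq_of_add_eq_zero_right hz]; exact Γ.cycles.neg_mem h.2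
      have h2 := cycles_disjoint_grad h1
      rw [h2, add_zero] at hz
      exact Prod.ext (Subtype.ext hz) (Subtype.ext h2))
  have hp1 : ∀ h : Γ.cycles, (p h.1).1 = h := fun h => by
    have := congrArg Prod.fst (LinearMap.congr_fun hp (h, 0))
    simpa using this
  have hp2 : ∀ g, (p (Γ.grad g)).1 = 0 := fun g => by
    have := congrArg Prod.fst (LinearMap.congr_fun hp (0, ⟨Γ.gradL g, ⟨g, rfl⟩⟩))
    simp only [LinearMap.comp_apply, LinearMap.coprod_apply, map_zero, zero_add,
      LinearMap.id_apply] at this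
    exact this
  have hθ : ∀ h : Γ.cycles, (B.equivFun.toLinearMap ∘ₗ LinearMap.fst ℝ _ _ ∘ₗ p) h.1 =
      B.equivFun h := fun h => congrArg B.equivFun (hp1 h)
  refine ⟨⟨B.equivFun.toLinearMap ∘ₗ LinearMap.fst ℝ _ _ ∘ₗ p, fun g => ?_, fun h hh => ?_,
    fun m => ?_, fun μ hμ h0 => ?_, fun t => ?_⟩⟩
  · change B.equivFun (p (Γ.grad g)).1 = 0
    rw [hp2, map_zero]
  · let c : Γ.cycles := ⟨fun x => (h x : ℝ), hh.1.cast, fun v => by rw [out_cast, hh.2]; simp⟩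
    have hcl : c ∈ Γ.cycleLattice := ⟨h, fun _ => rfl⟩
    refine ⟨fun j => b.repr ⟨c, hcl⟩ j, ?_⟩
    refine (hθ c).trans (funext fun j => ?_)
    exact b.ofZLatticeBasis_repr_apply ℝ Γ.cycleLattice ⟨c, hcl⟩ j
  · let c : Γ.cycleLattice := b.equivFun.symm m
    obtain ⟨h, hh, hx⟩ := exists_isCycle c.2
    refine ⟨h, hh, ?_⟩
    rw [← (funext hx : c.1.1 = fun x => (h x : ℝ))]
    refine (hθ c.1).trans (funext fun j => ?_)
    refine (b.ofZLatticeBasis_repr_apply ℝ Γ.cycleLattice c j).trans ?_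
    have : b.repr c j = m j := congrFun (b.equivFun.apply_symm_apply m) j
    rw [this]
  · obtain ⟨h, hh, g, rfl⟩ := exists_cycle_add_grad hc hμ
    have h1 : B.equivFun (p (h + Γ.grad g)).1 = 0 := h0
    rw [map_add, Prod.fst_add, hp1 ⟨h, hh⟩, hp2, add_zero] at h1
    have h2 : (⟨h, hh⟩ : Γ.cycles) = 0 := by simpa using h1
    refine ⟨g, ?_⟩
    rw [show h = 0 from congrArg Subtype.val h2, zero_add]
  · exact ⟨(B.equivFun.symm t).1, (B.equivFun.symm t).2.1,
      (hθ _).trans (B.equivFun.apply_symm_apply t)⟩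

end TCurve

/-! ### Points of a metric graph and principal divisors -/

namespace TCurve

variable {n : ℕ} {Γ : TCurve n}

theorem len_r (x : Γ.X) : Γ.len (Γ.r x) = 0 := Γ.len_zero _ (Γ.i_r x)

/-- A vertex as a point of the metric graph. -/
noncomputable def vpt (Γ : TCurve n) (v : Γ.V) : Γ.Pt := Γ.pt v.1 0

theorem pt_eq_mk (x : Γ.X) {a : ℝ} (ha : a ∈ Set.Icc 0 (Γ.len x)) :
    Γ.pt x a = Quot.mk _ ⟨x, ⟨a, ha⟩⟩ := by
  unfold pt
  rw [Set.projIcc_of_mem _ ha]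

theorem pt_zero (x : Γ.X) : Γ.pt x 0 = Γ.vpt (Γ.root x) := by
  unfold vpt
  rw [pt_eq_mk x ⟨le_rfl, Γ.len_nonneg x⟩, pt_eq_mk _ ⟨le_rfl, Γ.len_nonneg _⟩]
  exact Quot.sound (PtRel.root _ _ _ rfl)

theorem pt_flip (x : Γ.X) {a : ℝ} (h0 : 0 ≤ a) (h1 : a ≤ Γ.len x) :
    Γ.pt (Γ.i x) (Γ.len x - a) = Γ.pt x a := by
  rw [pt_eq_mk x ⟨h0, h1⟩, pt_eq_mk _ ⟨by linarith, by rw [Γ.len_i]; linarith⟩]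
  exact (Quot.sound (PtRel.flip _ _ _ (by simp))).symm

theorem pt_len (x : Γ.X) : Γ.pt x (Γ.len x) = Γ.vpt (Γ.root (Γ.i x)) := by
  rw [← pt_zero, ← pt_flip x (Γ.len_nonneg x) le_rfl, sub_self]

open Classical in
/-- An invariant separating the points of a metric graph: the vertex for the ends of the edges,
the set of all representatives for the interior points. -/
noncomputable def preKey (Γ : TCurve n) (q : Γ.PrePt) : Γ.V ⊕ Set (Γ.X × ℝ) :=
  if q.2.1 = 0 then Sum.inl (Γ.root q.1) else if q.2.1 = Γ.len q.1 then
    Sum.inl (Γ.root (Γ.i q.1)) else Sum.inr {(q.1, q.2.1), (Γ.i q.1, Γ.len q.1 - q.2.1)}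

/-- The invariant is compatible with the identifications defining the points: representatives at the
ends of an edge are sent to the vertex there, and an interior point has exactly two representatives,
exchanged by the involution. -/
theorem preKey_eq {q q' : Γ.PrePt} (h : Γ.PtRel q q') : Γ.preKey q = Γ.preKey q' := by
  induction h with
  | root x a b ha =>
    have hb : b.1 = 0 := le_antisymm (b.2.2.trans_eq (len_r x)) b.2.1
    unfold preKey
    rw [if_pos ha, if_pos hb, root_r]
  | flip x a b hab =>
    obtain ⟨b, hb⟩ := b
    have hb' : b = Γ.len x - a.1 := by dsimp only at hab; linarith
    subst hb'
    unfold preKey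
    dsimp only
    by_cases h0 : a.1 = 0
    · by_cases hL : Γ.len x = 0
      · have hx : Γ.i x = x := by_contra fun h => (Γ.len_pos x h).ne' hL
        rw [if_pos h0, if_pos (by rw [h0, hL, sub_zero]), hx]
      · rw [if_pos h0, if_neg (by rw [h0, sub_zero]; exact hL),
          if_pos (by rw [h0, sub_zero, Γ.len_i]), Γ.i_i]
    · by_cases h1 : a.1 = Γ.len x
      · rw [if_neg h0, if_pos h1, if_pos (by rw [h1, sub_self])]
      · rw [if_neg h0, if_neg h1, if_neg (by rw [sub_eq_zero]; exact Ne.symm h1),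
          if_neg (by rw [Γ.len_i]; intro h; exact h0 (by linarith)), Γ.i_i, Γ.len_i,
          sub_sub_cancel, Set.pair_comm]

/-- `TCurve.preKey` as an invariant of points. -/
noncomputable def ptKey (Γ : TCurve n) : Γ.Pt → Γ.V ⊕ Set (Γ.X × ℝ) :=
  Quot.lift Γ.preKey fun _ _ => preKey_eq

theorem ptKey_vpt (v : Γ.V) : Γ.ptKey (Γ.vpt v) = Sum.inl v := by
  unfold vpt
  rw [pt_eq_mk _ ⟨le_rfl, Γ.len_nonneg _⟩]
  change Γ.preKey _ = _
  unfold preKey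
  rw [if_pos rfl, root_val]

theorem ptKey_pt {x : Γ.X} {a : ℝ} (h0 : 0 < a) (h1 : a < Γ.len x) :
    Γ.ptKey (Γ.pt x a) = Sum.inr {(x, a), (Γ.i x, Γ.len x - a)} := by
  rw [pt_eq_mk _ ⟨h0.le, h1.le⟩]
  change Γ.preKey _ = _
  unfold preKey
  rw [if_neg h0.ne', if_neg h1.ne]

theorem vpt_injective : Function.Injective Γ.vpt := fun v w h => by
  have := congrArg Γ.ptKey h
  rw [ptKey_vpt, ptKey_vpt] at this
  exact Sum.inl_injective this

theorem pt_ne_vpt {x : Γ.X} {a : ℝ} (h0 : 0 < a) (h1 : a < Γ.len x) (v : Γ.V) :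
    Γ.pt x a ≠ Γ.vpt v := fun h => by
  have := congrArg Γ.ptKey h
  rw [ptKey_vpt, ptKey_pt h0 h1] at this
  exact absurd this (by simp)

theorem half_of_len {x : Γ.X} (h : 0 < Γ.len x) : Γ.i x ≠ x := fun h' => h.ne' (Γ.len_zero x h')

theorem pt_eq_pt {x y : Γ.X} {a b : ℝ} (ha : 0 < a) (ha' : a < Γ.len x) (hb : 0 < b)
    (hb' : b < Γ.len y) :
    Γ.pt x a = Γ.pt y b ↔ (y = x ∧ b = a) ∨ (y = Γ.i x ∧ b = Γ.len x - a) := by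
  constructor
  · intro h
    have h1 := congrArg Γ.ptKey h
    rw [ptKey_pt ha ha', ptKey_pt hb hb'] at h1
    have h2 : (y, b) ∈ ({(x, a), (Γ.i x, Γ.len x - a)} : Set (Γ.X × ℝ)) := by
      rw [Sum.inr_injective h1]; simp
    simpa using h2
  · rintro (⟨rfl, rfl⟩ | ⟨rfl, rfl⟩)
    · rfl
    · exact (pt_flip x ha.le ha'.le).symm

theorem pt_eq_pt_same {x : Γ.X} {a b : ℝ} (ha : 0 < a) (ha' : a < Γ.len x) (hb : 0 < b)
    (hb' : b < Γ.len x) : Γ.pt x a = Γ.pt x b ↔ a = b := by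
  rw [pt_eq_pt ha ha' hb hb']
  constructor
  · rintro (⟨-, h⟩ | ⟨h, -⟩)
    · exact h.symm
    · exact absurd h.symm (half_of_len (ha.trans ha'))
  · rintro rfl; exact Or.inl ⟨rfl, rfl⟩

theorem pt_cases (p : Γ.Pt) :
    (∃ v, p = Γ.vpt v) ∨ ∃ x a, Γ.Or x ∧ 0 < a ∧ a < Γ.len x ∧ p = Γ.pt x a := by
  induction p using Quot.ind with
  | mk q =>
    obtain ⟨x, a, ha⟩ := q
    rw [← pt_eq_mk x ha]
    rcases ha.1.eq_or_lt with h0 | h0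
    · exact Or.inl ⟨_, by rw [← h0, pt_zero]⟩
    · rcases ha.2.eq_or_lt with h1 | h1
      · exact Or.inl ⟨_, by rw [h1, pt_len]⟩
      · rcases or_or (half_of_len (h0.trans h1)) with h | h
        · exact Or.inr ⟨x, a, h, h0, h1, rfl⟩
        · exact Or.inr ⟨Γ.i x, Γ.len x - a, h, by linarith, by rw [Γ.len_i]; linarith,
            (pt_flip x h0.le h1.le).symm⟩

/-- The sum of the outgoing slopes at a point. -/
noncomputable def slopeSum (Γ : TCurve n) (s : Γ.X → ℝ → ℤ) (p : Γ.Pt) : ℤ :=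
  ∑ᶠ q : {q : Γ.X × ℝ // 0 ≤ q.2 ∧ q.2 < Γ.len q.1 ∧ Γ.pt q.1 q.2 = p}, s q.1.1 q.1.2

theorem slopeSum_eq (s : Γ.X → ℝ → ℤ) (p : Γ.Pt) (A : Finset (Γ.X × ℝ))
    (hA : ∀ x a, (x, a) ∈ A ↔ 0 ≤ a ∧ a < Γ.len x ∧ Γ.pt x a = p) :
    Γ.slopeSum s p = ∑ q ∈ A, s q.1 q.2 := by
  unfold slopeSum
  rw [← finsum_mem_coe_finset]
  have : (A : Set (Γ.X × ℝ)) = {q | 0 ≤ q.2 ∧ q.2 < Γ.len q.1 ∧ Γ.pt q.1 q.2 = p} := by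
    ext ⟨x, a⟩; simpa using hA x a
  rw [this]
  exact finsum_set_coe_eq_finsum_mem (f := fun q : Γ.X × ℝ => s q.1 q.2) _

open Classical in
/-- The tangent directions at a vertex are the half-edges rooted there. Legs have length zero and do
not contribute. -/
theorem slopeSum_vpt (s : Γ.X → ℝ → ℤ) (v : Γ.V) :
    Γ.slopeSum s (Γ.vpt v) = Γ.out (fun x => if Γ.i x = x then 0 else s x 0) v := by
  rw [slopeSum_eq s _ ((Finset.univ.filter fun x => Γ.root x = v ∧ Γ.i x ≠ x).image
    fun x => (x, (0 : ℝ)))]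
  · rw [Finset.sum_image (by intro x _ y _ h; exact (Prod.ext_iff.1 h).1)]
    unfold out
    rw [Finset.filter_and, Finset.sum_ite, Finset.sum_const_zero, zero_add]
    refine Finset.sum_congr ?_ fun _ _ => rfl
    ext x; simp
  · intro x a
    simp only [Finset.mem_image, Finset.mem_filter, Finset.mem_univ, true_and, Prod.mk.injEq]
    constructor
    · rintro ⟨y, ⟨hy, hi⟩, rfl, rfl⟩
      exact ⟨le_rfl, Γ.len_pos _ hi, by rw [pt_zero, hy]⟩
    · rintro ⟨h0, h1, h2⟩
      rcases h0.eq_or_lt with h | h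
      · subst h
        rw [pt_zero] at h2
        exact ⟨x, ⟨vpt_injective h2, half_of_len h1⟩, rfl, rfl⟩
      · exact absurd h2 (pt_ne_vpt h h1 v)

/-- There are two tangent directions at an interior point of an edge. -/
theorem slopeSum_pt (s : Γ.X → ℝ → ℤ) {x : Γ.X} {a : ℝ} (h0 : 0 < a) (h1 : a < Γ.len x) :
    Γ.slopeSum s (Γ.pt x a) = s x a + s (Γ.i x) (Γ.len x - a) := by
  classical
  rw [slopeSum_eq s _ {(x, a), (Γ.i x, Γ.len x - a)}]
  · rw [Finset.sum_pair]
    intro h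
    exact half_of_len (h0.trans h1) (Prod.ext_iff.1 h).1.symm
  · intro y b
    simp only [Finset.mem_insert, Finset.mem_singleton, Prod.mk.injEq]
    constructor
    · rintro (⟨rfl, rfl⟩ | ⟨rfl, rfl⟩)
      · exact ⟨h0.le, h1, rfl⟩
      · exact ⟨by linarith, by rw [Γ.len_i]; linarith, pt_flip x h0.le h1.le⟩
    · rintro ⟨h2, h3, h4⟩
      rcases h2.eq_or_lt with h | h
      · subst h
        rw [pt_zero] at h4
        exact absurd h4.symm (pt_ne_vpt h0 h1 _)
      · exact (pt_eq_pt h0 h1 h h3).1 h4.symm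

/-- A function has slope `m` to the right of `a`. -/
def RightSlope (F : ℝ → ℝ) (m : ℤ) (a : ℝ) : Prop :=
  ∃ ε > 0, ∀ b, a ≤ b → b ≤ a + ε → F b = F a + m * (b - a)

theorem RightSlope.add {F F' : ℝ → ℝ} {m m' : ℤ} {a : ℝ} (h : RightSlope F m a)
    (h' : RightSlope F' m' a) : RightSlope (fun t => F t + F' t) (m + m') a := by
  obtain ⟨ε, hε, h⟩ := h
  obtain ⟨ε', hε', h'⟩ := h'
  refine ⟨min ε ε', lt_min hε hε', fun b hb hb' => ?_⟩
  dsimp only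
  rw [h b hb (hb'.trans (by gcongr; exact min_le_left _ _)),
    h' b hb (hb'.trans (by gcongr; exact min_le_right _ _))]
  push_cast; ring

theorem RightSlope.neg {F : ℝ → ℝ} {m : ℤ} {a : ℝ} (h : RightSlope F m a) :
    RightSlope (fun t => -F t) (-m) a := by
  obtain ⟨ε, hε, h⟩ := h
  refine ⟨ε, hε, fun b hb hb' => ?_⟩
  dsimp only
  rw [h b hb hb']
  push_cast; ring

open Classical in
theorem rightSlope_max (c a : ℝ) :
    RightSlope (fun t => max (t - c) 0) (if c ≤ a then 1 else 0) a := by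
  by_cases h : c ≤ a
  · refine ⟨1, one_pos, fun b hb _ => ?_⟩
    dsimp only
    rw [if_pos h, max_eq_left (by linarith), max_eq_left (by linarith)]
    push_cast; ring
  · refine ⟨c - a, by linarith, fun b hb hb' => ?_⟩
    dsimp only
    rw [if_neg h, max_eq_right (by linarith), max_eq_right (by linarith)]
    simp

open Classical in
theorem rightSlope_max' (c a : ℝ) :
    RightSlope (fun t => max (c - t) 0) (if a < c then -1 else 0) a := by
  by_cases h : a < c
  · refine ⟨c - a, by linarith, fun b hb hb' => ?_⟩
    dsimp only
    rw [if_pos h, max_eq_left (by linarith), max_eq_left (by linarith)]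
    push_cast; ring
  · refine ⟨1, one_pos, fun b hb hb' => ?_⟩
    dsimp only
    rw [if_neg h, max_eq_right (by linarith), max_eq_right (by linarith)]
    simp

theorem rightSlope_const (c a : ℝ) : RightSlope (fun _ => c) 0 a :=
  ⟨1, one_pos, fun b _ _ => by simp⟩

/-- A compatible collection of piecewise linear functions on the edges defines a principal
divisor. -/
theorem isPrincipal_of (D : Γ.Pt →₀ ℤ) (F : Γ.X → ℝ → ℝ) (s : Γ.X → ℝ → ℤ) (g : Γ.V → ℝ)
    (hg : ∀ x, F x 0 = g (Γ.root x))
    (hF : ∀ x a, 0 ≤ a → a ≤ Γ.len x → F (Γ.i x) (Γ.len x - a) = F x a)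
    (hs : ∀ x a, 0 ≤ a → a < Γ.len x → RightSlope (F x) (s x a) a)
    (hD : ∀ p, D p = Γ.slopeSum s p) : Γ.IsPrincipal D := by
  let f : Γ.Pt → ℝ := Quot.lift (fun q : Γ.PrePt => F q.1 q.2.1) (by
    rintro _ _ (⟨x, a, b, ha⟩ | ⟨x, a, b, hab⟩)
    · have hb : b.1 = 0 := le_antisymm (b.2.2.trans_eq (len_r x)) b.2.1
      dsimp only
      rw [ha, hb, hg, hg, root_r]
    · dsimp only
      rw [show b.1 = Γ.len x - a.1 by linarith, hF x a a.2.1 a.2.2])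
  have hf : ∀ x a, 0 ≤ a → a ≤ Γ.len x → f (Γ.pt x a) = F x a := fun x a h0 h1 => by
    rw [pt_eq_mk x ⟨h0, h1⟩]
  refine ⟨f, s, fun x a h0 h1 => ?_, hD⟩
  obtain ⟨ε, hε, h⟩ := hs x a h0 h1
  refine ⟨ε, hε, fun b hb hb' hb'' => ?_⟩
  rw [hf x b (h0.trans hb) hb'', hf x a h0 h1.le, h b hb hb']

/-! ### The tropical Picard group as a group -/

noncomputable instance : AddCommGroup Γ.Pic :=
  inferInstanceAs (AddCommGroup ((Γ.Pt →₀ ℤ) ⧸ AddSubgroup.closure {D | Γ.IsPrincipal D}))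

/-- The class map as a homomorphism. -/
noncomputable def clsHom (Γ : TCurve n) : (Γ.Pt →₀ ℤ) →+ Γ.Pic :=
  QuotientAddGroup.mk' (AddSubgroup.closure {D | Γ.IsPrincipal D})

theorem clsHom_apply (D : Γ.Pt →₀ ℤ) : Γ.clsHom D = Γ.cls D := rfl

theorem clsHom_eq_zero {D : Γ.Pt →₀ ℤ} (h : Γ.IsPrincipal D) : Γ.clsHom D = 0 :=
  (QuotientAddGroup.eq_zero_iff _).2 (AddSubgroup.subset_closure h)

/-- The class of a point. -/
noncomputable def ptCls (Γ : TCurve n) (p : Γ.Pt) : Γ.Pic := Γ.clsHom (Finsupp.single p 1)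

open Classical in
theorem single_apply_pt (p q : Γ.Pt) :
    (Finsupp.single p 1 : Γ.Pt →₀ ℤ) q = if q = p then 1 else 0 := by
  rw [Finsupp.single_apply]; simp only [eq_comm]

/-- The class relation given by a function supported on one edge: a trapezoid with slope one at the
root of the edge, which bends down by one at `a` and at `b` and back up at `a + b`, where it reaches
zero. -/
theorem ptCls_add_aux {x : Γ.X} {a b : ℝ} (ha : 0 < a) (hb : 0 < b) (hab : a + b ≤ Γ.len x) :
    Γ.ptCls (Γ.pt x a) + Γ.ptCls (Γ.pt x b) =
      Γ.ptCls (Γ.vpt (Γ.root x)) + Γ.ptCls (Γ.pt x (a + b)) := by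
  classical
  have hx := half_of_len (lt_of_lt_of_le (by linarith) hab)
  set L := Γ.len x with hL
  -- the trapezoid, as a function of the distance from the root
  let T : ℝ → ℝ := fun t => t + -max (t - a) 0 + -max (t - b) 0 + max (t - (a + b)) 0
  have hT0 : T 0 = 0 := by
    simp only [T]
    rw [max_eq_right (by linarith), max_eq_right (by linarith), max_eq_right (by linarith)]
    simp
  have hTL : T L = 0 := by
    simp only [T]
    rw [max_eq_left (by linarith), max_eq_left (by linarith), max_eq_left (by linarith)]
    ring
  -- the slopes of the trapezoid in the two directions along the edge
  let S : ℝ → ℤ := fun t => 1 + -(if a ≤ t then 1 else 0) + -(if b ≤ t then 1 else 0) +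
    (if a + b ≤ t then 1 else 0)
  let S' : ℝ → ℤ := fun t => -1 + -(if t < L - a then -1 else 0) + -(if t < L - b then -1 else 0) +
    (if t < L - (a + b) then -1 else 0)
  have hS : ∀ t, RightSlope T (S t) t := fun t =>
    (((show RightSlope (fun t => t) 1 t from ⟨1, one_pos, fun c _ _ => by push_cast; ring⟩).add
      (rightSlope_max a t).neg).add (rightSlope_max b t).neg).add (rightSlope_max (a + b) t)
  have hS' : ∀ t, RightSlope (fun t => T (L - t)) (S' t) t := fun t => by
    have := (((show RightSlope (fun t => L - t) (-1) t from
      ⟨1, one_pos, fun c _ _ => by push_cast; ring⟩).add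
      (rightSlope_max' (L - a) t).neg).add (rightSlope_max' (L - b) t).neg).add
      (rightSlope_max' (L - (a + b)) t)
    have hT : (fun t => T (L - t)) = fun t => L - t + -max (L - a - t) 0 + -max (L - b - t) 0 +
        max (L - (a + b) - t) 0 := by
      funext t
      simp only [T]
      rw [sub_right_comm L t a, sub_right_comm L t b, sub_right_comm L t (a + b)]
    rw [hT]
    exact this
  have hp : Γ.IsPrincipal (Finsupp.single (Γ.vpt (Γ.root x)) 1 + Finsupp.single (Γ.pt x (a + b)) 1 -
      Finsupp.single (Γ.pt x a) 1 - Finsupp.single (Γ.pt x b) 1) := by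
    refine isPrincipal_of _
      (fun y t => if y = x then T t else if y = Γ.i x then T (L - t) else 0)
      (fun y t => if y = x then S t else if y = Γ.i x then S' t else 0) 0 (fun y => ?_)
      (fun y t h0 h1 => ?_) (fun y t h0 h1 => ?_) (fun p => ?_)
    · split_ifs
      · exact hT0
      · rw [sub_zero]; exact hTL
      · rfl
    · by_cases h : y = x
      · subst h
        rw [if_neg hx, if_pos rfl, if_pos rfl, sub_sub_cancel]
      · by_cases h' : y = Γ.i x
        · subst h'
          rw [Γ.i_i, if_pos rfl, if_neg hx, if_pos rfl, Γ.len_i]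
        · rw [if_neg h, if_neg h', if_neg (fun h3 => h' (i_eq_iff.1 h3)),
            if_neg (fun h3 => h (by rw [← Γ.i_i y, h3, Γ.i_i]))]
    · by_cases h : y = x
      · simp only [if_pos h]; exact hS t
      · by_cases h' : y = Γ.i x
        · simp only [if_neg h, if_pos h']; exact hS' t
        · simp only [if_neg h, if_neg h']; exact rightSlope_const _ _
    · simp only [Finsupp.sub_apply, Finsupp.add_apply, single_apply_pt]
      -- the value of the divisor at interior points of the edge
      have hint : ∀ u, 0 < u → u < L → (if Γ.pt x u = Γ.vpt (Γ.root x) then (1 : ℤ) else 0) +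
          (if Γ.pt x u = Γ.pt x (a + b) then 1 else 0) - (if Γ.pt x u = Γ.pt x a then 1 else 0) -
          (if Γ.pt x u = Γ.pt x b then 1 else 0) = S u + S' (L - u) := by
        intro u hu hu'
        rw [if_neg (pt_ne_vpt hu hu' _)]
        have e1 : (Γ.pt x u = Γ.pt x a) = (u = a) :=
          propext (pt_eq_pt_same hu hu' ha (by linarith))
        have e2 : (Γ.pt x u = Γ.pt x b) = (u = b) :=
          propext (pt_eq_pt_same hu hu' hb (by linarith))
        have e3 : (Γ.pt x u = Γ.pt x (a + b)) = (u = a + b) := by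
          rcases hab.eq_or_lt with h | h
          · rw [h, pt_len]
            exact propext ⟨fun h3 => absurd h3 (pt_ne_vpt hu hu' _), fun h3 => by linarith⟩
          · exact propext (pt_eq_pt_same hu hu' (by linarith) h)
        simp only [e1, e2, e3, S, S', sub_lt_sub_iff_left]
        have key : ∀ c : ℝ, (if c ≤ u then (1 : ℤ) else 0) + (if c < u then -1 else 0) =
            if u = c then 1 else 0 := by
          intro c
          rcases lt_trichotomy c u with h | h | h
          · rw [if_pos h.le, if_pos h, if_neg h.ne']; rfl
          · rw [if_pos h.le, if_neg (by rw [h]; exact lt_irrefl _), if_pos h.symm]; rfl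
          · rw [if_neg h.not_ge, if_neg h.asymm, if_neg h.ne]; rfl
        rw [← key a, ← key b, ← key (a + b)]
        ring
      rcases pt_cases p with ⟨w, rfl⟩ | ⟨y, u, -, hu, hu', rfl⟩
      · rw [slopeSum_vpt, if_neg (pt_ne_vpt (x := x) ha (by linarith) w).symm,
          if_neg (pt_ne_vpt (x := x) hb (by linarith) w).symm]
        have h1 : ∀ y, (if Γ.i y = y then 0 else if y = x then S 0 else if y = Γ.i x then S' 0
            else 0) = (if y = x then 1 else 0) +
            (if y = Γ.i x then (if a + b = L then 1 else 0) else 0) := by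
          intro y
          by_cases hy : y = x
          · subst hy
            rw [if_neg hx, if_pos rfl, if_pos rfl, if_neg (Ne.symm hx)]
            simp only [S]
            rw [if_neg (by linarith), if_neg (by linarith), if_neg (by linarith)]
            rfl
          · by_cases hy' : y = Γ.i x
            · subst hy'
              rw [if_neg (i_half hx), if_neg hx, if_pos rfl, if_neg hx, if_pos rfl]
              simp only [S']
              rw [if_pos (by linarith), if_pos (by linarith)]
              by_cases h : a + b = L
              · rw [if_pos h, if_neg (by linarith)]; rfl
              · rw [if_neg h, if_pos (by rw [sub_pos]; exact lt_of_le_of_ne hab h)]; rfl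
            · rw [if_neg hy, if_neg hy', if_neg hy, if_neg hy']; simp
        simp only [h1]
        rw [out_add]
        unfold out
        rw [Finset.sum_ite_eq', Finset.sum_ite_eq']
        simp only [Finset.mem_filter, Finset.mem_univ, true_and, sub_zero]
        congr 1
        · simp only [vpt_injective.eq_iff, eq_comm]
        · rcases hab.eq_or_lt with h | h
          · rw [h, pt_len, if_pos rfl]
            simp only [vpt_injective.eq_iff, eq_comm]
          · rw [if_neg (fun h3 => pt_ne_vpt (by linarith) h w h3.symm), if_neg h.ne]; simp
      · rw [slopeSum_pt _ hu hu']
        by_cases hy : y = x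
        · subst hy
          rw [hint u hu hu', if_pos rfl, if_neg hx, if_pos rfl]
        · by_cases hy' : y = Γ.i x
          · subst hy'
            rw [Γ.len_i] at hu'
            have h3 : Γ.pt (Γ.i x) u = Γ.pt x (L - u) := by
              rw [← pt_flip x (a := L - u) (by linarith) (by linarith), sub_sub_cancel]
            rw [h3, hint _ (by linarith) (by linarith), if_neg hx, if_pos rfl, Γ.i_i, if_pos rfl,
              Γ.len_i, sub_sub_cancel]
            ring
          · have hy1 : Γ.i y ≠ x := fun h3 => hy' (i_eq_iff.1 h3)
            have hy2 : Γ.i y ≠ Γ.i x := fun h3 => hy (by rw [← Γ.i_i y, h3, Γ.i_i])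
            rw [if_neg hy, if_neg hy', if_neg hy1, if_neg hy2]
            have hne : ∀ c, 0 < c → c ≤ L → Γ.pt y u ≠ Γ.pt x c := by
              intro c hc hc' h
              rcases hc'.eq_or_lt with h4 | h4
              · rw [h4, pt_len] at h
                exact pt_ne_vpt hu hu' _ h
              · rcases (pt_eq_pt hu hu' hc h4).1 h with ⟨h5, -⟩ | ⟨h5, -⟩
                · exact hy h5.symm
                · exact hy' (by rw [h5, Γ.i_i])
            rw [if_neg (pt_ne_vpt hu hu' _), if_neg (hne _ (by linarith) hab),
              if_neg (hne _ ha (by linarith)), if_neg (hne _ hb (by linarith))]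
            rfl
  have h := clsHom_eq_zero hp
  rw [map_sub, map_sub, map_add] at h
  unfold ptCls
  rw [sub_sub, sub_eq_zero] at h
  exact h.symm

/-- On the edge `x`, moving two chips from the root by the distances `a` and `b` amounts to moving
one of them by `a + b`. -/
theorem ptCls_add {x : Γ.X} {a b : ℝ} (ha : 0 ≤ a) (hb : 0 ≤ b) (hab : a + b ≤ Γ.len x) :
    Γ.ptCls (Γ.pt x a) + Γ.ptCls (Γ.pt x b) =
      Γ.ptCls (Γ.vpt (Γ.root x)) + Γ.ptCls (Γ.pt x (a + b)) := by
  rcases ha.eq_or_lt with rfl | ha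
  · rw [pt_zero, zero_add]
  · rcases hb.eq_or_lt with rfl | hb
    · rw [pt_zero, add_zero, add_comm]
    · exact ptCls_add_aux ha hb hab

/-- The case of `TCurve.ptCls_add` where one of the chips reaches the other end of the edge. -/
theorem ptCls_add' {x : Γ.X} {a b : ℝ} (ha : 0 ≤ a) (hb : 0 ≤ b) (ha' : a ≤ Γ.len x)
    (hb' : b ≤ Γ.len x) (hab : Γ.len x ≤ a + b) :
    Γ.ptCls (Γ.pt x a) + Γ.ptCls (Γ.pt x b) =
      Γ.ptCls (Γ.vpt (Γ.root (Γ.i x))) + Γ.ptCls (Γ.pt x (a + b - Γ.len x)) := by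
  have := ptCls_add (x := Γ.i x) (a := Γ.len x - a) (b := Γ.len x - b) (by linarith) (by linarith)
    (by rw [Γ.len_i]; linarith)
  rw [pt_flip x ha ha', pt_flip x hb hb'] at this
  rw [this, ← pt_flip x (a := a + b - Γ.len x) (by linarith) (by linarith)]
  congr 3
  ring

/-- The class relation given by the tent function of height `ε` around a vertex. If `ε` is less than
half the length of each edge, the tents at the two ends of a loop do not overlap. -/
theorem sum_ptCls_near (v : Γ.V) {ε : ℝ} (hε : 0 < ε)
    (h2 : ∀ x, Γ.i x ≠ x → 2 * ε < Γ.len x) :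
    ∑ x with Γ.root x = v ∧ Γ.i x ≠ x, (Γ.ptCls (Γ.pt x ε) - Γ.ptCls (Γ.vpt v)) = 0 := by
  classical
  have hp : Γ.IsPrincipal (∑ x with Γ.root x = v ∧ Γ.i x ≠ x,
      (Finsupp.single (Γ.pt x ε) 1 - Finsupp.single (Γ.vpt v) 1)) := by
    refine isPrincipal_of _
      (fun y t => if Γ.i y = y then (if Γ.root y = v then ε else 0) else
        (if Γ.root y = v then max (ε - t) 0 else 0) +
        (if Γ.root (Γ.i y) = v then max (t - (Γ.len y - ε)) 0 else 0))
      (fun y t => (if Γ.root y = v then (if t < ε then -1 else 0) else 0) +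
        (if Γ.root (Γ.i y) = v then (if Γ.len y - ε ≤ t then 1 else 0) else 0))
      (fun w => if w = v then ε else 0) (fun y => ?_)
      (fun y t h0 h1 => ?_) (fun y t h0 h1 => ?_) (fun p => ?_)
    · by_cases hy : Γ.i y = y
      · rw [if_pos hy]
      · rw [if_neg hy, max_eq_left (by linarith : 0 ≤ ε - 0),
          max_eq_right (by linarith [h2 y hy]), sub_zero]
        simp
    · by_cases hy : Γ.i y = y
      · rw [hy, if_pos hy]; simp
      · rw [if_neg hy, if_neg (i_half hy), Γ.i_i, Γ.len_i, add_comm]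
        congr 1
        · split_ifs
          · congr 1; ring
          · rfl
        · split_ifs
          · congr 1; ring
          · rfl
    · have hy := half_of_len (lt_of_le_of_lt h0 h1)
      simp only [if_neg hy]
      refine RightSlope.add ?_ ?_
      · split_ifs
        · have := rightSlope_max' ε t
          rwa [if_pos ‹_›] at this
        · have := rightSlope_max' ε t
          rwa [if_neg ‹_›] at this
        · exact rightSlope_const _ _
      · split_ifs
        · have := rightSlope_max (Γ.len y - ε) t
          rwa [if_pos ‹_›] at this
        · have := rightSlope_max (Γ.len y - ε) t
          rwa [if_neg ‹_›] at this
        · exact rightSlope_const _ _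
    · rw [Finsupp.finsetSum_apply]
      simp only [Finsupp.sub_apply, single_apply_pt]
      rcases pt_cases p with ⟨w, rfl⟩ | ⟨y, u, -, hu, hu', rfl⟩
      · rw [slopeSum_vpt]
        unfold out
        simp only [vpt_injective.eq_iff]
        by_cases hw : w = v
        · subst hw
          rw [Finset.filter_and, ← Finset.filter_and, ← Finset.filter_filter, Finset.sum_filter]
          refine Finset.sum_congr rfl fun y hy => ?_
          have hy := (Finset.mem_filter.1 hy).2
          by_cases hi : Γ.i y = y
          · simp [hi]
          · have h3 := h2 y hi
            rw [if_pos hi, if_neg hi, if_pos hy, if_pos hε, if_pos rfl,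
              if_neg (pt_ne_vpt (x := y) hε (by linarith) w).symm,
              if_neg (by linarith : ¬ (Γ.len y - ε ≤ 0))]
            simp
        · rw [Finset.sum_eq_zero, Finset.sum_eq_zero]
          · intro y hy
            have hy := (Finset.mem_filter.1 hy).2
            by_cases hi : Γ.i y = y
            · simp [hi]
            · have h3 := h2 y hi
              rw [if_neg hi, if_neg (by rw [hy]; exact hw),
                if_neg (by linarith : ¬ (Γ.len y - ε ≤ 0))]
              simp
          · intro y hy
            have hy := (Finset.mem_filter.1 hy).2
            have h3 := h2 y hy.2
            rw [if_neg hw, if_neg (pt_ne_vpt (x := y) hε (by linarith) w).symm]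
            rfl
      · have hy := half_of_len (hu.trans hu')
        have hl := h2 y hy
        rw [slopeSum_pt _ hu hu', Γ.i_i, Γ.len_i]
        simp only [if_neg (pt_ne_vpt hu hu' v), sub_zero]
        have e : ∀ x ∈ Finset.univ.filter (fun x => Γ.root x = v ∧ Γ.i x ≠ x),
            (if Γ.pt y u = Γ.pt x ε then (1 : ℤ) else 0) =
            (if x = y then (if u = ε then 1 else 0) else 0) +
            (if x = Γ.i y then (if u = Γ.len y - ε then 1 else 0) else 0) := by
          intro x hx
          have hx := (Finset.mem_filter.1 hx).2
          have hxl := h2 x hx.2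
          by_cases h1 : x = y
          · subst h1
            rw [if_pos rfl, if_neg (Ne.symm hy), add_zero]
            simp only [pt_eq_pt_same hu hu' hε (by linarith)]
          · by_cases h1' : x = Γ.i y
            · subst h1'
              rw [if_neg hy, if_pos rfl, zero_add]
              have h5 : ε < Γ.len (Γ.i y) := by linarith
              have h4 := pt_eq_pt hu hu' hε h5
              have h6 : (Γ.pt y u = Γ.pt (Γ.i y) ε) = (u = Γ.len y - ε) := by
                rw [h4]
                apply propext
                constructor
                · rintro (⟨h, -⟩ | ⟨-, h⟩)
                  · exact absurd h hy
                  · linarith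
                · intro h
                  exact Or.inr ⟨rfl, by linarith⟩
              simp only [h6]
            · rw [if_neg h1, if_neg h1', if_neg]
              · rfl
              · intro h
                rcases (pt_eq_pt hu hu' hε (by linarith)).1 h with h | h
                · exact h1 h.1
                · exact h1' h.1
        rw [Finset.sum_congr rfl e, Finset.sum_add_distrib, Finset.sum_ite_eq', Finset.sum_ite_eq']
        simp only [Finset.mem_filter, Finset.mem_univ, true_and, hy, i_half hy, ne_eq,
          not_false_eq_true, and_true]
        have k1 : (if u = ε then (1 : ℤ) else 0) = (if u < ε then -1 else 0) +
            (if Γ.len y - ε ≤ Γ.len y - u then 1 else 0) := by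
          rcases lt_trichotomy u ε with h | h | h
          · rw [if_neg h.ne, if_pos h, if_pos (by linarith)]; rfl
          · rw [if_pos h, if_neg h.ge.not_gt, if_pos (by linarith)]; rfl
          · rw [if_neg h.ne', if_neg h.asymm, if_neg (by linarith)]; rfl
        have k2 : (if u = Γ.len y - ε then (1 : ℤ) else 0) =
            (if Γ.len y - ε ≤ u then 1 else 0) + (if Γ.len y - u < ε then -1 else 0) := by
          rcases lt_trichotomy u (Γ.len y - ε) with h | h | h
          · rw [if_neg h.ne, if_neg h.not_ge, if_neg (by linarith)]; rfl
          · rw [if_pos h, if_pos h.ge, if_neg (by linarith)]; rfl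
          · rw [if_neg h.ne', if_pos h.le, if_pos (by linarith)]; rfl
        rw [k1, k2]
        by_cases h1 : Γ.root y = v <;> by_cases h3 : Γ.root (Γ.i y) = v <;>
          (simp [h1, h3]; try ring)
  have h := clsHom_eq_zero hp
  rw [map_sum] at h
  rw [← h]
  exact Finset.sum_congr rfl fun x _ => (map_sub _ _ _).symm

end TCurve

/-! ### Classes of flows -/

namespace TCurve

variable {n : ℕ} {Γ : TCurve n}

/-- The degree zero class obtained by moving a chip along the half-edge `x` by `s` times its
length, where `s` is any real number. -/
noncomputable def edgeCls (Γ : TCurve n) (x : Γ.X) (s : ℝ) : Γ.Pic :=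
  ⌊s⌋ • (Γ.ptCls (Γ.vpt (Γ.root (Γ.i x))) - Γ.ptCls (Γ.vpt (Γ.root x))) +
    (Γ.ptCls (Γ.pt x (Int.fract s * Γ.len x)) - Γ.ptCls (Γ.vpt (Γ.root x)))

theorem edgeCls_of_fix {x : Γ.X} (hx : Γ.i x = x) (s : ℝ) : Γ.edgeCls x s = 0 := by
  unfold edgeCls
  rw [hx, Γ.len_zero x hx, mul_zero, pt_zero]
  simp

theorem fract_mul_len_mem (x : Γ.X) (s : ℝ) :
    0 ≤ Int.fract s * Γ.len x ∧ Int.fract s * Γ.len x ≤ Γ.len x :=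
  ⟨mul_nonneg (Int.fract_nonneg s) (Γ.len_nonneg x),
    mul_le_of_le_one_left (Γ.len_nonneg x) (Int.fract_lt_one s).le⟩

/-- Moving a chip by `s + t` gives the sum of the classes for `s` and `t`; if the fractional parts
add up to at least one, the chip passes through the end of the edge. -/
theorem edgeCls_add (x : Γ.X) (s t : ℝ) :
    Γ.edgeCls x (s + t) = Γ.edgeCls x s + Γ.edgeCls x t := by
  have hs := fract_mul_len_mem x s
  have ht := fract_mul_len_mem x t
  unfold edgeCls
  by_cases h : Int.fract s + Int.fract t < 1
  · have hf : ⌊s + t⌋ = ⌊s⌋ + ⌊t⌋ := by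
      rw [Int.floor_eq_iff]
      have h1 := Int.floor_add_fract s
      have h2 := Int.floor_add_fract t
      have h3 := Int.fract_nonneg s
      have h4 := Int.fract_nonneg t
      push_cast
      constructor <;> linarith
    have hr : Int.fract (s + t) = Int.fract s + Int.fract t := by
      unfold Int.fract
      rw [hf]; push_cast; ring
    have := ptCls_add (x := x) hs.1 ht.1
      (by rw [← add_mul]; exact mul_le_of_le_one_left (Γ.len_nonneg x) h.le)
    rw [hf, hr, add_mul, add_smul, ← sub_eq_zero]
    rw [← sub_eq_zero] at this
    rw [← neg_eq_zero, ← this]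
    abel
  · have hf : ⌊s + t⌋ = ⌊s⌋ + ⌊t⌋ + 1 := by
      rw [Int.floor_eq_iff]
      have h1 := Int.floor_add_fract s
      have h2 := Int.floor_add_fract t
      have h3 := Int.fract_lt_one s
      have h4 := Int.fract_lt_one t
      push_cast
      constructor <;> linarith
    have hr : Int.fract (s + t) = Int.fract s + Int.fract t - 1 := by
      unfold Int.fract
      rw [hf]; push_cast; ring
    have := ptCls_add' (x := x) hs.1 ht.1 hs.2 ht.2
      (by rw [← add_mul]; exact le_mul_of_one_le_left (Γ.len_nonneg x) (not_lt.1 h))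
    rw [hf, hr, sub_mul, add_mul, one_mul, add_smul, add_smul, one_smul, ← sub_eq_zero]
    rw [← sub_eq_zero] at this
    rw [← neg_eq_zero, ← this]
    abel

/-- `TCurve.edgeCls` as a homomorphism. -/
noncomputable def edgeHom (Γ : TCurve n) (x : Γ.X) : ℝ →+ Γ.Pic :=
  AddMonoidHom.mk' (Γ.edgeCls x) (edgeCls_add x)

theorem edgeCls_int (x : Γ.X) (m : ℤ) : Γ.edgeCls x m =
    m • (Γ.ptCls (Γ.vpt (Γ.root (Γ.i x))) - Γ.ptCls (Γ.vpt (Γ.root x))) := by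
  unfold edgeCls
  rw [Int.floor_intCast, Int.fract_intCast, zero_mul, pt_zero, sub_self, add_zero]

theorem edgeCls_of_mem {x : Γ.X} {s : ℝ} (h0 : 0 ≤ s) (h1 : s < 1) : Γ.edgeCls x s =
    Γ.ptCls (Γ.pt x (s * Γ.len x)) - Γ.ptCls (Γ.vpt (Γ.root x)) := by
  unfold edgeCls
  rw [Int.floor_eq_zero_iff.2 ⟨h0, h1⟩, Int.fract_eq_self.2 ⟨h0, h1⟩, zero_smul, zero_add]

theorem edgeCls_sub (x : Γ.X) (s t : ℝ) :
    Γ.edgeCls x (s - t) = Γ.edgeCls x s - Γ.edgeCls x t :=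
  map_sub (Γ.edgeHom x) s t

/-- Moving a chip along the opposite half-edge is moving it backwards. -/
theorem edgeCls_i (x : Γ.X) (s : ℝ) : Γ.edgeCls (Γ.i x) s = -Γ.edgeCls x s := by
  have h1 : ∀ m : ℤ, Γ.edgeCls (Γ.i x) m = -Γ.edgeCls x m := fun m => by
    rw [edgeCls_int, edgeCls_int, Γ.i_i, ← smul_neg, neg_sub]
  rw [← Int.floor_add_fract s, edgeCls_add, edgeCls_add, h1, neg_add]
  congr 1
  rcases (Int.fract_nonneg s).eq_or_lt with h | h
  · rw [← h]
    simpa using h1 0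
  · have hl := Int.fract_lt_one s
    rw [edgeCls_of_mem h.le hl]
    have e : Γ.edgeCls x (Int.fract s) = Γ.edgeCls x 1 - Γ.edgeCls x (1 - Int.fract s) := by
      rw [← edgeCls_sub, sub_sub_cancel]
    rw [e, edgeCls_of_mem (s := 1 - Int.fract s) (by linarith) (by linarith)]
    have h2 := edgeCls_int x 1
    rw [Int.cast_one, one_smul] at h2
    have hm := fract_mul_len_mem x s
    rw [h2, Γ.len_i,
      ← pt_flip x (a := (1 - Int.fract s) * Γ.len x) (by nlinarith) (by nlinarith)]
    rw [show Γ.len x - (1 - Int.fract s) * Γ.len x = Int.fract s * Γ.len x by ring]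
    abel

theorem exists_lt_len (Γ : TCurve n) : ∃ ε > 0, ∀ x, Γ.i x ≠ x → 2 * ε < Γ.len x := by
  have : ∀ x : Γ.X, ∃ ε > 0, Γ.i x ≠ x → 2 * ε < Γ.len x := fun x => by
    by_cases hx : Γ.i x = x
    · exact ⟨1, one_pos, fun h => absurd hx h⟩
    · exact ⟨Γ.len x / 4, by have := Γ.len_pos x hx; linarith,
        fun _ => by have := Γ.len_pos x hx; linarith⟩
  choose e he hx using this
  by_cases hX : Nonempty Γ.X
  · obtain ⟨y, hy⟩ := Finite.exists_min e
    exact ⟨e y, he y, fun x hi => by linarith [hx x hi, hy x]⟩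
  · exact ⟨1, one_pos, fun x => absurd ⟨x⟩ hX⟩

/-- Moving the same distance along all half-edges at a vertex does not change the class. The left
hand side is a homomorphism in `ε` which vanishes for small positive `ε`, hence for all `ε`. -/
theorem sum_edgeCls_root (v : Γ.V) (ε : ℝ) :
    ∑ x with Γ.root x = v, Γ.edgeCls x (ε / Γ.len x) = 0 := by
  classical
  obtain ⟨ε₀, hε₀, hl⟩ := Γ.exists_lt_len
  let f : ℝ →+ Γ.Pic := ∑ x with Γ.root x = v,
    (Γ.edgeHom x).comp (AddMonoidHom.mulRight (Γ.len x)⁻¹)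
  have hf : ∀ ε, f ε = ∑ x with Γ.root x = v, Γ.edgeCls x (ε / Γ.len x) := fun ε => by
    simp only [f, AddMonoidHom.finsetSum_apply]
    rfl
  have h1 : ∀ ε, 0 < ε → ε ≤ ε₀ → f ε = 0 := by
    intro ε h0 hle
    rw [hf, ← sum_ptCls_near v h0 fun x hx => by linarith [hl x hx], ← Finset.filter_filter,
      Finset.sum_filter (s := Finset.univ.filter fun x => Γ.root x = v)]
    refine Finset.sum_congr rfl fun x hx => ?_
    have hx := (Finset.mem_filter.1 hx).2
    by_cases hi : Γ.i x = x
    · rw [edgeCls_of_fix hi, if_neg (by simpa using hi)]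
    · have h2 := hl x hi
      have h3 := Γ.len_pos x hi
      rw [if_pos hi, edgeCls_of_mem (by positivity) (by rw [div_lt_one h3]; linarith),
        div_mul_cancel₀ _ h3.ne', hx]
  have h2 : ∀ ε, 0 < ε → f ε = 0 := by
    intro ε h0
    obtain ⟨N, hN⟩ := exists_nat_gt (ε / ε₀)
    have hN0 : (0 : ℝ) < N := lt_trans (by positivity) hN
    have h3 : ε = N • (ε / N) := by
      rw [nsmul_eq_mul]; field_simp
    rw [h3, map_nsmul, h1 _ (by positivity)
      (by rw [div_le_iff₀ hN0]; rw [div_lt_iff₀ hε₀] at hN; linarith), smul_zero]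
  rw [← hf]
  rcases lt_trichotomy ε 0 with h | h | h
  · rw [← neg_neg ε, map_neg, h2 _ (by linarith), neg_zero]
  · rw [h, map_zero]
  · exact h2 ε h

open Classical in
/-- The degree zero class obtained by moving chips along a real flow. -/
noncomputable def flowCls (Γ : TCurve n) (μ : Γ.X → ℝ) : Γ.Pic :=
  ∑ x with Γ.Or x, Γ.edgeCls x (μ x)

theorem flowCls_add (μ ν : Γ.X → ℝ) :
    Γ.flowCls (fun x => μ x + ν x) = Γ.flowCls μ + Γ.flowCls ν := by
  unfold flowCls
  rw [← Finset.sum_add_distrib]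
  exact Finset.sum_congr rfl fun x _ => edgeCls_add _ _ _

/-- The class of a gradient is zero: it is a sum over the vertices of moves of equal distance along
all half-edges there. -/
theorem flowCls_grad (g : Γ.V → ℝ) : Γ.flowCls (Γ.grad g) = 0 := by
  classical
  have h1 := sum_or (G := Γ.toMGraph) (fun x => Γ.edgeCls x (g (Γ.root x) / Γ.len x))
    fun x hx => edgeCls_of_fix hx _
  rw [← Finset.sum_fiberwise _ Γ.root] at h1
  rw [Finset.sum_eq_zero] at h1
  · unfold flowCls
    rw [← neg_eq_zero, h1, ← Finset.sum_neg_distrib]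
    refine Finset.sum_congr rfl fun x _ => ?_
    unfold grad
    rw [sub_div, edgeCls_sub, edgeCls_i, Γ.len_i]
    abel
  · intro v _
    rw [← sum_edgeCls_root v (g v)]
    refine Finset.sum_congr rfl fun x hx => ?_
    rw [(Finset.mem_filter.1 hx).2]

/-- Along an integral flow the chips move from vertex to vertex. -/
theorem flowCls_int {h : Γ.X → ℤ} (hh : Γ.IsFlow h) :
    Γ.flowCls (fun x => (h x : ℝ)) = -∑ v, Γ.out h v • Γ.ptCls (Γ.vpt v) := by
  classical
  rw [sum_out_smul (G := Γ.toMGraph) h fun v => Γ.ptCls (Γ.vpt v),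
    sum_or (G := Γ.toMGraph) (fun x => h x • Γ.ptCls (Γ.vpt (Γ.root x))) fun x hx => by
      rw [hh.eq_zero_int hx, zero_smul]]
  unfold flowCls
  rw [← Finset.sum_neg_distrib]
  refine Finset.sum_congr rfl fun x _ => ?_
  rw [edgeCls_int, hh x, smul_sub, neg_smul]
  abel

theorem flowCls_cycle {h : Γ.X → ℤ} (hh : Γ.IsCycle h) :
    Γ.flowCls (fun x => (h x : ℝ)) = 0 := by
  rw [flowCls_int hh.1]
  simp [hh.2]

/-! ### The Abel-Jacobi map -/

/-- The degree of a divisor. -/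
noncomputable def degHom (Γ : TCurve n) : (Γ.Pt →₀ ℤ) →+ ℤ :=
  Finsupp.liftAddHom fun _ => AddMonoidHom.id ℤ

theorem degHom_apply (D : Γ.Pt →₀ ℤ) : Γ.degHom D = D.sum fun _ m => m := rfl

/-- A base vertex together with integral flows from it to the other vertices. -/
structure Paths (Γ : TCurve n) where
  base : Γ.V
  P : Γ.V → Γ.X → ℤ
  flow : ∀ v, Γ.IsFlow (P v)
  out : ∀ v w, Γ.out (P v) w = (if base = w then 1 else 0) - (if v = w then 1 else 0)

theorem nonempty_paths (hc : Γ.ConnOn Set.univ) : Nonempty Γ.Paths := by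
  obtain ⟨v₀⟩ := nonempty_V hc
  choose P hP hPo using exists_path hc v₀
  exact ⟨⟨v₀, P, hP, hPo⟩⟩

variable (π : Γ.Paths) (ϖ : Γ.PeriodMap)

/-- A flow from the base vertex to the point at `s` times the length of `x` along `x`. -/
noncomputable def Paths.toPt (x : Γ.X) (s : ℝ) (y : Γ.X) : ℝ :=
  π.P (Γ.root x) y + s * Γ.unitFlow x y

theorem Paths.toPt_isFlow (x : Γ.X) (s : ℝ) : Γ.IsFlow (π.toPt x s) := fun y => by
  unfold toPt
  rw [π.flow, unitFlow_isFlow]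
  push_cast; ring

/-- The real torus with the coordinates given by a period map. -/
abbrev Torus (Γ : TCurve n) : Type := Fin Γ.b1 → UnitAddCircle

/-- The class of a flow in the torus. -/
noncomputable def PeriodMap.toTorus : (Γ.X → ℝ) →+ Γ.Torus where
  toFun μ j := ((ϖ.θ μ j : ℝ) : UnitAddCircle)
  map_zero' := by funext j; simp
  map_add' μ ν := by funext j; simp

theorem PeriodMap.toTorus_grad (g : Γ.V → ℝ) : ϖ.toTorus (Γ.grad g) = 0 := by
  funext j
  simp [toTorus, ϖ.grad]

theorem PeriodMap.toTorus_cycle {h : Γ.X → ℤ} (hh : Γ.IsCycle h) :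
    ϖ.toTorus (fun x => (h x : ℝ)) = 0 := by
  obtain ⟨m, hm⟩ := ϖ.cycle h hh
  funext j
  simp only [toTorus, AddMonoidHom.coe_mk, ZeroHom.coe_mk, hm]
  exact (AddCircle.coe_eq_zero_iff 1).2 ⟨m j, by simp⟩

/-- The kernel of the map from the flows to the torus consists of the sums of integral cycles and
gradients. -/
theorem PeriodMap.exists_of_toTorus_eq_zero {μ : Γ.X → ℝ} (hμ : Γ.IsFlow μ)
    (h : ϖ.toTorus μ = 0) : ∃ h : Γ.X → ℤ, Γ.IsCycle h ∧ ∃ g, ∀ x, μ x = h x + Γ.grad g x := by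
  have h1 : ∀ j, ∃ m : ℤ, ϖ.θ μ j = m := fun j => by
    obtain ⟨m, hm⟩ := (AddCircle.coe_eq_zero_iff 1).1 (congrFun h j)
    exact ⟨m, by rw [← hm]; simp⟩
  choose m hm using h1
  obtain ⟨c, hc, hcm⟩ := ϖ.exists_cycle m
  obtain ⟨g, hg⟩ := ϖ.exists_grad (μ - fun x => (c x : ℝ)) (hμ.sub hc.1.cast) (by
    rw [map_sub, hcm, sub_eq_zero]
    exact funext hm)
  refine ⟨c, hc, g, fun x => ?_⟩
  rw [← hg]; simp

theorem PeriodMap.exists_toTorus (t : Γ.Torus) : ∃ μ, Γ.IsFlow μ ∧ ϖ.toTorus μ = t := by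
  choose a ha using fun j => QuotientAddGroup.mk_surjective (t j)
  obtain ⟨μ, hμ, h⟩ := ϖ.exists_flow a
  refine ⟨μ, hμ, funext fun j => ?_⟩
  rw [← ha j, ← h]
  rfl

/-- The flows to a point for its two representatives differ by an integral cycle. -/
theorem toPt_i (x : Γ.X) (s : ℝ) (y : Γ.X) :
    π.toPt (Γ.i x) (1 - s) y = π.toPt x s y - (cyc π.P x y : ℝ) := by
  unfold Paths.toPt cyc
  rw [unitFlow_i]
  push_cast; ring

/-- The Abel-Jacobi map on points. -/
noncomputable def ajPt : Γ.Pt → Γ.Torus :=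
  Quot.lift (fun q : Γ.PrePt => ϖ.toTorus (π.toPt q.1 (q.2.1 / Γ.len q.1))) (by
    rintro _ _ (⟨x, a, ⟨b, hb⟩, ha⟩ | ⟨x, a, ⟨b, hb⟩, hab⟩)
    · dsimp only
      congr 1
      funext y
      unfold Paths.toPt
      rw [ha, len_r, zero_div, div_zero, root_r, zero_mul, zero_mul]
    · dsimp only at hab ⊢
      by_cases hx : Γ.i x = x
      · congr 1
        funext y
        unfold Paths.toPt
        rw [unitFlow_of_fix hx, unitFlow_i, unitFlow_of_fix hx, hx]; simp
      · have hl := (Γ.len_pos x hx).ne'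
        have h1 : b / Γ.len (Γ.i x) = 1 - a.1 / Γ.len x := by
          rw [Γ.len_i, eq_sub_iff_add_eq, ← add_div, add_comm, hab, div_self hl]
        rw [h1, ← sub_eq_zero, ← map_sub, ← ϖ.toTorus_cycle (cyc_isCycle π.flow π.out x)]
        congr 1
        funext y
        rw [Pi.sub_apply, toPt_i]
        ring)

theorem ajPt_pt (x : Γ.X) {a : ℝ} (h0 : 0 ≤ a) (h1 : a ≤ Γ.len x) :
    ajPt π ϖ (Γ.pt x a) = ϖ.toTorus (π.toPt x (a / Γ.len x)) := by
  rw [pt_eq_mk x ⟨h0, h1⟩]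
  rfl

theorem ajPt_vpt (v : Γ.V) : ajPt π ϖ (Γ.vpt v) = ϖ.toTorus (fun y => (π.P v y : ℝ)) := by
  unfold vpt
  rw [ajPt_pt π ϖ _ le_rfl (Γ.len_nonneg _)]
  congr 1
  funext y
  unfold Paths.toPt
  rw [zero_div, zero_mul, add_zero, root_val]

theorem continuous_ajPt : Continuous (ajPt π ϖ) := by
  refine continuous_quot_lift _ ?_
  refine continuous_sigma fun x => continuous_pi fun j => ?_
  refine (AddCircle.continuous_mk' 1).comp ?_
  have h1 : Continuous fun a : Set.Icc (0 : ℝ) (Γ.len x) => π.toPt x (a.1 / Γ.len x) := by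
    refine continuous_pi fun y => ?_
    unfold Paths.toPt
    fun_prop
  exact (continuous_apply j).comp (ϖ.θ.continuous_of_finiteDimensional.comp h1)

/-- The Abel-Jacobi map on divisors. -/
noncomputable def ajDiv : (Γ.Pt →₀ ℤ) →+ Γ.Torus :=
  Finsupp.liftAddHom fun p => (zmultiplesHom Γ.Torus) (ajPt π ϖ p)

theorem ajDiv_single (p : Γ.Pt) (m : ℤ) : ajDiv π ϖ (Finsupp.single p m) = m • ajPt π ϖ p := by
  simp [ajDiv]

end TCurve

/-! ### Principal divisors in the torus -/

namespace TCurve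

variable {n : ℕ} {Γ : TCurve n}

theorem RightSlope.unique {F : ℝ → ℝ} {m m' : ℤ} {a : ℝ} (h : RightSlope F m a)
    (h' : RightSlope F m' a) : m = m' := by
  obtain ⟨ε, hε, h⟩ := h
  obtain ⟨ε', hε', h'⟩ := h'
  have hm : 0 < min ε ε' := lt_min hε hε'
  have h1 := h (a + min ε ε') (by linarith) (by gcongr; exact min_le_left _ _)
  have h2 := h' (a + min ε ε') (by linarith) (by gcongr; exact min_le_right _ _)
  have h3 : (m : ℝ) * min ε ε' = m' * min ε ε' := by linarith
  exact_mod_cast mul_right_cancel₀ hm.ne' h3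

theorem RightSlope.zsmul {F : ℝ → ℝ} {m : ℤ} {a : ℝ} (h : RightSlope F m a) (k : ℤ) :
    RightSlope (fun t => k * F t) (k * m) a := by
  obtain ⟨ε, hε, h⟩ := h
  refine ⟨ε, hε, fun b hb hb' => ?_⟩
  dsimp only
  rw [h b hb hb']
  push_cast; ring

theorem RightSlope.sum {ι : Type*} (A : Finset ι) {F : ι → ℝ → ℝ} {m : ι → ℤ} {a : ℝ}
    (h : ∀ k ∈ A, RightSlope (F k) (m k) a) :
    RightSlope (fun t => ∑ k ∈ A, F k t) (∑ k ∈ A, m k) a := by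
  classical
  induction A using Finset.induction_on with
  | empty => simpa using rightSlope_const 0 a
  | insert k A hk ih =>
    simp only [Finset.sum_insert hk]
    exact (h k (Finset.mem_insert_self _ _)).add
      (ih fun j hj => h j (Finset.mem_insert_of_mem hj))

/-- A function with vanishing right slope at `0`, and opposite left and right slopes at the
interior points, vanishes identically. -/
theorem eq_zero_of_slopes {H : ℝ → ℝ} {L : ℝ} {σ τ : ℝ → ℤ} (h0 : H 0 = 0) (hσ0 : σ 0 = 0)
    (hR : ∀ a, 0 ≤ a → a < L → RightSlope H (σ a) a)
    (hL : ∀ a, 0 < a → a ≤ L → RightSlope (fun t => H (-t)) (τ a) (-a))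
    (hm : ∀ a, 0 < a → a < L → σ a + τ a = 0) {c : ℝ} (hc0 : 0 ≤ c) (hcL : c ≤ L) : H c = 0 := by
  by_contra hne
  set A : Set ℝ := {c | 0 ≤ c ∧ c ≤ L ∧ H c ≠ 0} with hA
  have hcA : c ∈ A := ⟨hc0, hcL, hne⟩
  have hbdd : BddBelow A := ⟨0, fun a ha => ha.1⟩
  set e := sInf A with he
  have he0 : 0 ≤ e := le_csInf ⟨c, hcA⟩ fun a ha => ha.1
  have hec : e ≤ c := csInf_le hbdd hcA
  have hlt : ∀ b, 0 ≤ b → b < e → H b = 0 := fun b hb hbe => by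
    by_contra h
    exact absurd (csInf_le hbdd ⟨hb, by linarith, h⟩) (not_le.2 hbe)
  -- the function vanishes at `e` and has vanishing left slope there
  have hee : H e = 0 ∧ (0 < e → τ e = 0) := by
    rcases he0.eq_or_lt with h | h
    · exact ⟨by rw [← h, h0], fun h' => absurd h h'.ne⟩
    · obtain ⟨ε, hε, hs⟩ := hL e h (by linarith)
      set δ := min ε e with hδ
      have hδ0 : 0 < δ := lt_min hε h
      have h1 := hs (-e + δ) (by linarith) (by gcongr; exact min_le_left _ _)
      have h2 := hs (-e + δ / 2) (by linarith) (by have := min_le_left ε e; linarith)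
      have h3 : δ ≤ e := min_le_right _ _
      simp only [neg_add_rev, neg_neg, sub_neg_eq_add] at h1 h2
      rw [hlt _ (by linarith) (by linarith)] at h1 h2
      have h4 : (τ e : ℝ) * δ = 0 := by nlinarith
      have h5 : (τ e : ℝ) = 0 := by
        rcases mul_eq_zero.1 h4 with h | h
        · exact h
        · exact absurd h hδ0.ne'
      rw [h5] at h1
      exact ⟨by linarith, fun _ => by exact_mod_cast h5⟩
  rcases (hec.trans hcL).eq_or_lt with heL | heL
  · exact hne (by rw [le_antisymm (by linarith) hec]; exact hee.1)
  · have hσ : σ e = 0 := by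
      rcases he0.eq_or_lt with h | h
      · rw [← h, hσ0]
      · have := hm e h heL
        rw [hee.2 h] at this
        simpa using this
    obtain ⟨ε, hε, hs⟩ := hR e he0 heL
    have : e + ε ≤ e := le_csInf ⟨c, hcA⟩ fun a ha => by
      by_contra hlt'
      push Not at hlt'
      refine ha.2.2 ?_
      rcases lt_or_ge a e with h | h
      · exact hlt a ha.1 h
      · rw [hs a h hlt'.le, hσ, hee.1]; simp
    linarith

/-- The increments of a piecewise linear function on an interval and of its slope, in terms of the
sums of its outgoing slopes at the interior points. -/
theorem interval_formula {F : ℝ → ℝ} {L : ℝ} (hL0 : 0 < L) {σ τ : ℝ → ℤ} (B : Finset ℝ)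
    (hB : ∀ a ∈ B, 0 < a ∧ a < L)
    (hR : ∀ a, 0 ≤ a → a < L → RightSlope F (σ a) a)
    (hL : ∀ a, 0 < a → a ≤ L → RightSlope (fun t => F (-t)) (τ a) (-a)) (m : ℝ → ℤ)
    (hm : ∀ a, 0 < a → a < L → σ a + τ a = m a) (hmB : ∀ a, 0 < a → a < L → m a ≠ 0 → a ∈ B) :
    -τ L = σ 0 + ∑ a ∈ B, m a ∧ F L - F 0 = σ 0 * L + ∑ a ∈ B, m a * (L - a) := by
  classical
  -- the difference to the piecewise linear function with the same initial value and slope and the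
  -- same bends
  let H : ℝ → ℝ := fun t => F t + -(F 0 + σ 0 * t) + -∑ a ∈ B, m a * max (t - a) 0
  have hlin : ∀ c, RightSlope (fun t => F 0 + σ 0 * t) (σ 0) c := fun c =>
    ⟨1, one_pos, fun b _ _ => by ring⟩
  have hlin' : ∀ c, RightSlope (fun t => F 0 + σ 0 * (-t)) (-σ 0) c := fun c =>
    ⟨1, one_pos, fun b _ _ => by push_cast; ring⟩
  have hHR : ∀ c, 0 ≤ c → c < L → RightSlope H
      (σ c + -σ 0 + -∑ a ∈ B, m a * (if a ≤ c then 1 else 0)) c := fun c h0 h1 =>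
    ((hR c h0 h1).add (hlin c).neg).add
      (RightSlope.sum B fun a _ => (rightSlope_max a c).zsmul (m a)).neg
  have hHL : ∀ c, 0 < c → c ≤ L → RightSlope (fun t => H (-t))
      (τ c + -(-σ 0) + -∑ a ∈ B, m a * (if -c < -a then -1 else 0)) (-c) := fun c h0 h1 => by
    have h3 := ((hL c h0 h1).add (hlin' (-c)).neg).add
      (RightSlope.sum B fun a _ => (rightSlope_max' (-a) (-c)).zsmul (m a)).neg
    have h4 : (fun t => H (-t)) = fun t => F (-t) + -(F 0 + σ 0 * -t) +
        -∑ a ∈ B, m a * max (-a - t) 0 := by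
      funext t
      simp only [H]
      congr 2
      refine Finset.sum_congr rfl fun a _ => ?_
      rw [neg_sub_comm]
    rw [h4]
    exact h3
  have hH0 : H 0 = 0 := by
    simp only [H]
    rw [Finset.sum_eq_zero fun a ha => by rw [max_eq_right (by linarith [hB a ha]), mul_zero]]
    ring
  have hH := fun c (h0 : 0 ≤ c) (h1 : c ≤ L) => eq_zero_of_slopes hH0 (by
    rw [Finset.sum_eq_zero fun a ha => by rw [if_neg (by linarith [hB a ha]), mul_zero]]; ring)
    hHR hHL (fun a h0 h1 => by
      have e : ∑ b ∈ B, m b * (if b ≤ a then 1 else 0) + ∑ b ∈ B, m b * (if -a < -b then -1 else 0)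
          = m a := by
        rw [← Finset.sum_add_distrib]
        have : ∀ b ∈ B, m b * (if b ≤ a then 1 else 0) + m b * (if -a < -b then -1 else 0) =
            if b = a then m a else 0 := by
          intro b _
          rcases lt_trichotomy b a with h | h | h
          · rw [if_pos h.le, if_pos (by linarith), if_neg h.ne]; ring
          · rw [if_pos h.le, if_neg (by linarith), if_pos h, h]; ring
          · rw [if_neg h.not_ge, if_neg (by linarith), if_neg h.ne']; ring
        rw [Finset.sum_congr rfl this, Finset.sum_ite_eq']
        split_ifs with h
        · rfl
        · by_contra h'
          exact h (hmB a h0 h1 (Ne.symm h'))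
      have := hm a h0 h1
      linarith) h0 h1
  constructor
  · -- near the right end the difference vanishes, hence so does its left slope
    have h1 : RightSlope (fun t => H (-t)) 0 (-L) :=
      ⟨L, hL0, fun b hb hb' => by
        dsimp only
        rw [hH (-b) (by linarith) (by linarith), neg_neg, hH L hL0.le le_rfl]; simp⟩
    have h2 := (hHL L hL0 le_rfl).unique h1
    rw [Finset.sum_congr rfl fun a ha => by
      rw [if_pos (by linarith [hB a ha] : -L < -a), mul_neg_one], Finset.sum_neg_distrib] at h2
    linarith
  · have h1 := hH L hL0.le le_rfl
    simp only [H] at h1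
    rw [Finset.sum_congr rfl fun a ha => by
      rw [max_eq_left (by linarith [hB a ha])]] at h1
    linarith

variable (π : Γ.Paths) (ϖ : Γ.PeriodMap)

open Classical in
/-- The Abel-Jacobi map kills the principal divisors. For the divisor of `f`, the interior points of
the edge `x` and the slopes at its two ends together contribute, up to integral cycles, minus the
value at `x` of the gradient of the restriction of `f` to the vertices, times the unit flow along
`x`; the sum of these over the edges is minus a gradient. -/
theorem ajDiv_eq_zero_of_isPrincipal {D : Γ.Pt →₀ ℤ} (hD : Γ.IsPrincipal D) :
    ajDiv π ϖ D = 0 := by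
  obtain ⟨f, s, hfs, hDs⟩ := hD
  have hDs : ∀ p, D p = Γ.slopeSum s p := hDs
  set σ : Γ.X → ℤ := fun x => if Γ.i x = x then 0 else s x 0 with hσ
  -- the interior points of the support on a half-edge
  have hfin : ∀ x, {a | (0 < a ∧ a < Γ.len x) ∧ D (Γ.pt x a) ≠ 0}.Finite := fun x => by
    refine Set.Finite.of_finite_image (f := Γ.pt x) (D.support.finite_toSet.subset ?_) ?_
    · rintro _ ⟨a, ha, rfl⟩
      simpa using ha.2
    · rintro a ha b hb h
      exact (pt_eq_pt_same ha.1.1 ha.1.2 hb.1.1 hb.1.2).1 h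
  let B : Γ.X → Finset ℝ := fun x => (hfin x).toFinset
  have hB : ∀ x a, a ∈ B x ↔ (0 < a ∧ a < Γ.len x) ∧ D (Γ.pt x a) ≠ 0 := fun x a => by
    simp [B]
  have hslope : ∀ x a, 0 ≤ a → a < Γ.len x → RightSlope (fun t => f (Γ.pt x t)) (s x a) a := by
    intro x a h0 h1
    obtain ⟨ε, hε, h⟩ := hfs x a h0 h1
    refine ⟨min ε (Γ.len x - a), lt_min hε (by linarith), fun b hb hb' => ?_⟩
    have h2 := min_le_left ε (Γ.len x - a)
    have h3 := min_le_right ε (Γ.len x - a)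
    exact h b hb (by linarith) (by linarith)
  have hform : ∀ x, Γ.Or x → -s (Γ.i x) 0 = s x 0 + ∑ a ∈ B x, D (Γ.pt x a) ∧
      f (Γ.vpt (Γ.root (Γ.i x))) - f (Γ.vpt (Γ.root x)) =
        s x 0 * Γ.len x + ∑ a ∈ B x, D (Γ.pt x a) * (Γ.len x - a) := by
    intro x hx
    have hl := Γ.len_pos x hx.ne
    have := interval_formula (F := fun t => f (Γ.pt x t)) hl (σ := s x)
      (τ := fun a => s (Γ.i x) (Γ.len x - a)) (B x) (fun a ha => ((hB x a).1 ha).1) (hslope x)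
      (fun a h0 h1 => by
        obtain ⟨ε, hε, h⟩ := hslope (Γ.i x) (Γ.len x - a) (by linarith)
          (by rw [Γ.len_i]; linarith)
        refine ⟨min ε a, lt_min hε h0, fun b hb hb' => ?_⟩
        have h2 := min_le_left ε a
        have h3 := min_le_right ε a
        have h4 := h (Γ.len x + b) (by linarith) (by linarith)
        dsimp only at h4 ⊢
        rw [pt_flip x h0.le h1, ← sub_neg_eq_add, pt_flip x (by linarith) (by linarith)] at h4
        rw [h4, neg_neg]
        ring)
      (fun a => D (Γ.pt x a)) (fun a h0 h1 => by rw [hDs, slopeSum_pt s h0 h1])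
      (fun a h0 h1 h => (hB x a).2 ⟨⟨h0, h1⟩, h⟩)
    rwa [sub_self, pt_len, pt_zero] at this
  -- the divisor splits into its parts at the vertices and in the interiors of the edges
  have hDsum : D = ∑ v, Finsupp.single (Γ.vpt v) (D (Γ.vpt v)) +
      ∑ x with Γ.Or x, ∑ a ∈ B x, Finsupp.single (Γ.pt x a) (D (Γ.pt x a)) := by
    ext p
    simp only [Finsupp.add_apply, Finsupp.finsetSum_apply, Finsupp.single_apply]
    rcases pt_cases p with ⟨w, rfl⟩ | ⟨y, u, hy, hu, hu', rfl⟩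
    · simp only [vpt_injective.eq_iff]
      rw [Finset.sum_ite_eq', if_pos (Finset.mem_univ _), Finset.sum_eq_zero, add_zero]
      intro x _
      refine Finset.sum_eq_zero fun a ha => ?_
      rw [if_neg (pt_ne_vpt ((hB x a).1 ha).1.1 ((hB x a).1 ha).1.2 w)]
    · rw [Finset.sum_eq_zero, zero_add, Finset.sum_eq_single y]
      · have : ∀ a ∈ B y, (if Γ.pt y a = Γ.pt y u then D (Γ.pt y a) else 0) =
            if a = u then D (Γ.pt y u) else 0 := by
          intro a ha
          have ha := ((hB y a).1 ha).1
          simp only [pt_eq_pt_same ha.1 ha.2 hu hu']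
          split_ifs with h
          · rw [h]
          · rfl
        rw [Finset.sum_congr rfl this, Finset.sum_ite_eq']
        split_ifs with h
        · rfl
        · by_contra h'
          exact h ((hB y u).2 ⟨⟨hu, hu'⟩, h'⟩)
      · intro x hx hxy
        have hx : Γ.Or x := by simpa using hx
        refine Finset.sum_eq_zero fun a ha => ?_
        have ha := ((hB x a).1 ha).1
        rw [if_neg]
        intro h
        rcases (pt_eq_pt ha.1 ha.2 hu hu').1 h with ⟨h, -⟩ | ⟨h, -⟩
        · exact hxy h.symm
        · rw [h] at hy
          exact hx.not_i hy
      · intro h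
        exact absurd (by simpa using hy) h
      · intro v _
        rw [if_neg (pt_ne_vpt hu hu' v).symm]
  have hsv := sum_out_smul (G := Γ.toMGraph) σ fun v => ϖ.toTorus (fun y => (π.P v y : ℝ))
  have hso := sum_or (G := Γ.toMGraph)
    (fun x => σ x • ϖ.toTorus (fun y => (π.P (Γ.root x) y : ℝ))) fun x hx => by
      simp only [σ]; rw [if_pos hx, zero_smul]
  have hedge : ∀ x, Γ.Or x → (σ x • ϖ.toTorus (fun y => (π.P (Γ.root x) y : ℝ)) +
      σ (Γ.i x) • ϖ.toTorus (fun y => (π.P (Γ.root (Γ.i x)) y : ℝ))) +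
      ∑ a ∈ B x, D (Γ.pt x a) • ϖ.toTorus (π.toPt x (a / Γ.len x)) =
      -ϖ.toTorus (fun y => Γ.grad (fun v => f (Γ.vpt v)) x * Γ.unitFlow x y) := by
    intro x hx
    obtain ⟨h1, h2⟩ := hform x hx
    have hl := Γ.len_pos x hx.ne
    have hc := ϖ.toTorus_cycle (cyc_isCycle π.flow π.out x)
    rw [← add_zero (-ϖ.toTorus _), ← smul_zero (-s (Γ.i x) 0), ← hc]
    simp only [σ]
    rw [if_neg hx.ne, if_neg (i_half hx.ne)]
    simp only [← map_zsmul, ← map_sum, ← map_add, ← map_neg]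
    congr 1
    funext y
    simp only [Pi.add_apply, Finset.sum_apply, zsmul_eq_mul, Pi.neg_apply,
      Pi.mul_apply, Pi.intCast_apply]
    have h3 : (∑ a ∈ B x, (D (Γ.pt x a) : ℝ)) = -s (Γ.i x) 0 - s x 0 := by
      have : ((-s (Γ.i x) 0 : ℤ) : ℝ) = ((s x 0 + ∑ a ∈ B x, D (Γ.pt x a) : ℤ) : ℝ) := by rw [h1]
      push_cast at this
      linarith
    have h4 : ∑ a ∈ B x, (D (Γ.pt x a) : ℝ) * (a / Γ.len x) =
        -s (Γ.i x) 0 - Γ.grad (fun v => f (Γ.vpt v)) x := by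
      simp only [mul_sub, Finset.sum_sub_distrib, ← Finset.sum_mul] at h2
      rw [h3] at h2
      unfold grad
      rw [h2]
      simp only [mul_div_assoc', ← Finset.sum_div]
      field_simp
      ring
    have h5 : ∑ a ∈ B x, (D (Γ.pt x a) : ℝ) * π.toPt x (a / Γ.len x) y =
        (∑ a ∈ B x, (D (Γ.pt x a) : ℝ)) * π.P (Γ.root x) y +
        (∑ a ∈ B x, (D (Γ.pt x a) : ℝ) * (a / Γ.len x)) * Γ.unitFlow x y := by
      rw [Finset.sum_mul, Finset.sum_mul, ← Finset.sum_add_distrib]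
      refine Finset.sum_congr rfl fun a _ => ?_
      unfold Paths.toPt
      ring
    rw [h5, h3, h4]
    unfold cyc
    push_cast
    ring
  rw [hDsum, map_add, map_sum, map_sum]
  simp only [map_sum, ajDiv_single, ajPt_vpt, hDs (Γ.vpt _), slopeSum_vpt]
  rw [hsv, hso, ← Finset.sum_add_distrib]
  have hgr : ϖ.toTorus (∑ x with Γ.Or x, fun y =>
      Γ.grad (fun v => f (Γ.vpt v)) x * (Γ.unitFlow x y : ℝ)) = 0 := by
    rw [← ϖ.toTorus_grad (fun v => f (Γ.vpt v))]
    congr 1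
    funext y
    rw [Finset.sum_apply, (grad_isFlow _).eq_sum_or y]
  rw [← neg_eq_zero, ← hgr, map_sum, ← Finset.sum_neg_distrib]
  refine Finset.sum_congr rfl fun x hx => ?_
  have hx : Γ.Or x := by simpa using hx
  rw [← neg_neg (ϖ.toTorus (fun y => _ * _)), ← hedge x hx]
  congr 2
  refine Finset.sum_congr rfl fun a ha => ?_
  have ha := ((hB x a).1 ha).1
  rw [ajPt_pt π ϖ x ha.1.le ha.2.le]

/-- The Abel-Jacobi map on the tropical Picard group. -/
noncomputable def ajPic : Γ.Pic →+ Γ.Torus :=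
  QuotientAddGroup.lift (AddSubgroup.closure {D | Γ.IsPrincipal D}) (ajDiv π ϖ)
    ((AddSubgroup.closure_le _).2 fun _ hD => ajDiv_eq_zero_of_isPrincipal π ϖ hD)

theorem ajPic_clsHom (D : Γ.Pt →₀ ℤ) : ajPic π ϖ (Γ.clsHom D) = ajDiv π ϖ D := rfl

theorem ajPic_ptCls (p : Γ.Pt) : ajPic π ϖ (Γ.ptCls p) = ajPt π ϖ p := by
  unfold ptCls
  rw [ajPic_clsHom, ajDiv_single, one_smul]

theorem continuous_ajPic : Continuous (ajPic π ϖ) := by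
  refine continuous_iSup_dom.2 fun k => continuous_coinduced_dom.2 ?_
  have : (fun p : (Fin k.1 → Γ.Pt) × (Fin k.2 → Γ.Pt) => ajPic π ϖ
      (Γ.cls (∑ i, Finsupp.single (p.1 i) 1 - ∑ j, Finsupp.single (p.2 j) 1))) =
      fun p => ∑ i, ajPt π ϖ (p.1 i) - ∑ j, ajPt π ϖ (p.2 j) := by
    funext p
    rw [← clsHom_apply, ajPic_clsHom]
    simp [map_sub, map_sum, ajDiv_single]
  change Continuous (fun p : (Fin k.1 → Γ.Pt) × (Fin k.2 → Γ.Pt) => ajPic π ϖ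
      (Γ.cls (∑ i, Finsupp.single (p.1 i) 1 - ∑ j, Finsupp.single (p.2 j) 1)))
  rw [this]
  have h := continuous_ajPt π ϖ
  fun_prop

/-- The Abel-Jacobi map on the class of a flow. -/
theorem ajPic_flowCls {μ : Γ.X → ℝ} (hμ : Γ.IsFlow μ) :
    ajPic π ϖ (Γ.flowCls μ) = ϖ.toTorus μ := by
  classical
  have h1 : μ = ∑ x with Γ.Or x, fun y => μ x * (Γ.unitFlow x y : ℝ) := by
    funext y
    rw [Finset.sum_apply]
    exact hμ.eq_sum_or y
  unfold flowCls
  conv_rhs => rw [h1]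
  rw [map_sum, map_sum]
  refine Finset.sum_congr rfl fun x hx => ?_
  have hx : Γ.Or x := by simpa using hx
  have hl := Γ.len_pos x hx.ne
  have hm := fract_mul_len_mem x (μ x)
  unfold edgeCls
  simp only [map_add, map_zsmul, map_sub, ajPic_ptCls, ajPt_vpt, ajPt_pt π ϖ x hm.1 hm.2]
  rw [mul_div_cancel_right₀ _ hl.ne', ← sub_eq_zero]
  have hc := ϖ.toTorus_cycle (cyc_isCycle π.flow π.out x)
  rw [← smul_zero (-⌊μ x⌋), ← hc]
  simp only [← map_zsmul, ← map_sub, ← map_add]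
  congr 1
  funext y
  simp only [Pi.add_apply, Pi.sub_apply, zsmul_eq_mul, Pi.mul_apply, Pi.intCast_apply]
  unfold Paths.toPt cyc
  have := Int.floor_add_fract (μ x)
  conv_lhs => rw [← this]
  rw [Int.floor_intCast_add, Int.floor_fract, Int.fract_intCast_add, Int.fract_fract]
  push_cast
  ring

/-- Every divisor is equivalent to the sum of a multiple of the base vertex and the class of a
flow. -/
theorem exists_flowCls (D : Γ.Pt →₀ ℤ) : ∃ μ, Γ.IsFlow μ ∧
    Γ.clsHom D = Γ.degHom D • Γ.ptCls (Γ.vpt π.base) + Γ.flowCls μ := by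
  classical
  have hpt : ∀ p, ∃ μ, Γ.IsFlow μ ∧ Γ.ptCls p = Γ.ptCls (Γ.vpt π.base) + Γ.flowCls μ := by
    intro p
    have hP : ∀ v, Γ.flowCls (fun y => (π.P v y : ℝ)) =
        Γ.ptCls (Γ.vpt v) - Γ.ptCls (Γ.vpt π.base) := fun v => by
      rw [flowCls_int (π.flow v)]
      simp [π.out, sub_smul, Finset.sum_sub_distrib]
    rcases pt_cases p with ⟨v, rfl⟩ | ⟨x, a, hx, h0, h1, rfl⟩
    · exact ⟨_, (π.flow v).cast, by rw [hP]; abel⟩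
    · refine ⟨π.toPt x (a / Γ.len x), π.toPt_isFlow x _, ?_⟩
      have hl := h0.trans h1
      have : Γ.flowCls (fun y => a / Γ.len x * (Γ.unitFlow x y : ℝ)) =
          Γ.edgeCls x (a / Γ.len x) := by
        unfold flowCls
        rw [Finset.sum_eq_single x]
        · unfold unitFlow
          dsimp only
          rw [if_pos rfl, if_neg (Ne.symm hx.ne)]
          simp
        · intro y hy hyx
          have hy : Γ.Or y := by simpa using hy
          have hyi : y ≠ Γ.i x := by rintro rfl; exact hx.not_i hy
          unfold unitFlow
          dsimp only
          rw [if_neg hyx, if_neg hyi]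
          rw [sub_zero, Int.cast_zero, mul_zero]
          exact map_zero (Γ.edgeHom y)
        · intro h
          exact absurd (by simpa using hx) h
      unfold Paths.toPt
      rw [flowCls_add, hP, this, edgeCls_of_mem (by positivity) (by rw [div_lt_one hl]; exact h1),
        div_mul_cancel₀ _ hl.ne']
      abel
  induction D using Finsupp.induction_linear with
  | zero => exact ⟨0, fun x => by simp, by
      have := flowCls_grad (Γ := Γ) 0
      have h0 : Γ.grad 0 = 0 := by funext x; simp [grad]
      rw [h0] at this
      simp [this]⟩
  | add D D' h h' =>
    obtain ⟨μ, hμ, h⟩ := h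
    obtain ⟨μ', hμ', h'⟩ := h'
    exact ⟨_, hμ.add hμ', by rw [map_add, map_add, h, h', flowCls_add, add_smul]; abel⟩
  | single p m =>
    obtain ⟨μ, hμ, h⟩ := hpt p
    let φ : (Γ.X → ℝ) →+ Γ.Pic := AddMonoidHom.mk' Γ.flowCls flowCls_add
    refine ⟨fun x => m * μ x, fun x => by simp only [hμ x]; ring, ?_⟩
    have h1 : Γ.flowCls (fun x => m * μ x) = m • Γ.flowCls μ := by
      have := map_zsmul φ m μ
      have e : (m • μ) = fun x => m * μ x := by funext x; simp
      rw [e] at this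
      exact this
    have h2 : Γ.clsHom (Finsupp.single p m) = m • Γ.ptCls p := by
      unfold ptCls
      rw [← map_zsmul, Finsupp.smul_single, smul_eq_mul, mul_one]
    have h3 : Γ.degHom (Finsupp.single p m) = m := by simp [degHom]
    rw [h1, h2, h3, h, smul_add]

theorem flowCls_eq_zero {μ : Γ.X → ℝ} (hμ : Γ.IsFlow μ) (h : ϖ.toTorus μ = 0) :
    Γ.flowCls μ = 0 := by
  obtain ⟨c, hc, g, hx⟩ := ϖ.exists_of_toTorus_eq_zero hμ h
  rw [(funext hx : μ = fun x => c x + Γ.grad g x), flowCls_add, flowCls_cycle hc, flowCls_grad,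
    add_zero]

/-- The tropical Abel-Jacobi theorem: injectivity. -/
theorem ajPic_injOn (d : ℤ) : Set.InjOn (ajPic π ϖ) (Γ.PicDeg d) := by
  rintro _ ⟨D, hD, rfl⟩ _ ⟨D', hD', rfl⟩ h
  rw [← clsHom_apply, ← clsHom_apply] at h ⊢
  have hd : Γ.degHom (D - D') = 0 := by
    rw [map_sub, degHom_apply, degHom_apply, hD, hD', sub_self]
  obtain ⟨μ, hμ, hc⟩ := exists_flowCls π (D - D')
  rw [hd, zero_smul, zero_add] at hc
  rw [← sub_eq_zero, ← map_sub, hc]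
  refine flowCls_eq_zero ϖ hμ ?_
  rw [← ajPic_flowCls π ϖ hμ, ← hc, map_sub, map_sub, h, sub_self]

end TCurve

/-! ### Divisors attached to flows -/

namespace TCurve

variable {n : ℕ} {Γ : TCurve n}

open Classical in
/-- The divisor on a metric graph given by its values at the vertices and, for each half-edge `x`
with `ν x ≠ 0`, one chip at the point at `ν x` times the length of `x` along `x`. -/
noncomputable def divOf (Γ : TCurve n) (D : Γ.V → ℤ) (ν : Γ.X → ℝ) : Γ.Pt →₀ ℤ :=
  ∑ v, Finsupp.single (Γ.vpt v) (D v) +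
    ∑ x with Γ.Or x, if ν x = 0 then 0 else Finsupp.single (Γ.pt x (ν x * Γ.len x)) 1

/-- The values at the vertices of the divisor obtained from `D₀` by moving chips along a flow: on
each edge the chips are moved to the ends of the edge, except for one chip in the interior if the
flow is not integral there. -/
noncomputable def flowDiv (D₀ : Γ.V → ℤ) (μ : Γ.X → ℝ) (v : Γ.V) : ℤ :=
  D₀ v - Γ.out (fun x => ⌈μ x⌉) v

/-- The divisor attached to a flow has the class obtained by moving chips along the flow. -/
theorem clsHom_divOf_flow (D₀ : Γ.V → ℤ) {μ : Γ.X → ℝ} (hμ : Γ.IsFlow μ) :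
    Γ.clsHom (Γ.divOf (flowDiv D₀ μ) fun x => Int.fract (μ x)) =
      ∑ v, D₀ v • Γ.ptCls (Γ.vpt v) + Γ.flowCls μ := by
  classical
  have hs : ∀ v (m : ℤ), Γ.clsHom (Finsupp.single (Γ.vpt v) m) = m • Γ.ptCls (Γ.vpt v) :=
    fun v m => by
      unfold ptCls
      rw [← map_zsmul, Finsupp.smul_single, smul_eq_mul, mul_one]
  unfold divOf flowDiv
  rw [map_add, map_sum, map_sum]
  simp only [hs, sub_smul, Finset.sum_sub_distrib]
  rw [sub_add_eq_add_sub, add_sub_assoc]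
  congr 1
  rw [sum_out_smul (G := Γ.toMGraph) (fun x => ⌈μ x⌉) fun v => Γ.ptCls (Γ.vpt v),
    sum_or (G := Γ.toMGraph) (fun x => ⌈μ x⌉ • Γ.ptCls (Γ.vpt (Γ.root x))) fun x hx => by
      rw [hμ.eq_zero hx, Int.ceil_zero, zero_smul], ← Finset.sum_sub_distrib]
  unfold flowCls
  refine Finset.sum_congr rfl fun x _ => ?_
  rw [hμ x, Int.ceil_neg]
  unfold edgeCls
  split_ifs with h
  · rw [h, zero_mul, pt_zero, map_zero]
    have : (⌈μ x⌉ : ℤ) = ⌊μ x⌋ := by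
      rw [Int.ceil_eq_iff]
      have := Int.floor_add_fract (μ x)
      rw [h] at this
      constructor <;> linarith
    rw [this, smul_sub, neg_smul]
    abel
  · have : (⌈μ x⌉ : ℤ) = ⌊μ x⌋ + 1 := by
      rw [Int.ceil_eq_iff]
      have := Int.floor_add_fract (μ x)
      have h1 := Int.fract_lt_one (μ x)
      have h2 := lt_of_le_of_ne (Int.fract_nonneg (μ x)) (Ne.symm h)
      push_cast
      constructor <;> linarith
    rw [this, smul_sub, neg_smul, add_smul, one_smul]
    unfold ptCls
    abel

open Classical in
theorem degHom_divOf (D : Γ.V → ℤ) (ν : Γ.X → ℝ) : Γ.degHom (Γ.divOf D ν) =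
    ∑ v, D v + ∑ x with Γ.Or x, if ν x = 0 then 0 else 1 := by
  unfold divOf
  rw [map_add, map_sum, map_sum]
  have hs : ∀ p (m : ℤ), Γ.degHom (Finsupp.single p m) = m := fun p m => by simp [degHom]
  simp only [hs]
  congr 1
  refine Finset.sum_congr rfl fun x _ => ?_
  split_ifs
  · exact map_zero _
  · exact hs _ _

/-- On an edge the roundings up of a flow in the two directions add up to one if the flow is not
integral there, and cancel otherwise. -/
theorem sum_ceil {μ : Γ.X → ℝ} (hμ : Γ.IsFlow μ) : ∑ x, ⌈μ x⌉ =
    open Classical in ∑ x with Γ.Or x, if Int.fract (μ x) = 0 then (0 : ℤ) else 1 := by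
  classical
  rw [sum_or _ fun x hx => by rw [hμ.eq_zero hx, Int.ceil_zero]]
  refine Finset.sum_congr rfl fun x _ => ?_
  rw [hμ x, Int.ceil_neg]
  have h0 := Int.floor_add_fract (μ x)
  split_ifs with h
  · have : (⌈μ x⌉ : ℤ) = ⌊μ x⌋ := by
      rw [Int.ceil_eq_iff]
      constructor <;> linarith
    omega
  · have : (⌈μ x⌉ : ℤ) = ⌊μ x⌋ + 1 := by
      rw [Int.ceil_eq_iff]
      have h1 := Int.fract_lt_one (μ x)
      have h2 := lt_of_le_of_ne (Int.fract_nonneg (μ x)) (Ne.symm h)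
      push_cast
      constructor <;> linarith
    omega

theorem degHom_divOf_flow (D₀ : Γ.V → ℤ) {μ : Γ.X → ℝ} (hμ : Γ.IsFlow μ) :
    Γ.degHom (Γ.divOf (flowDiv D₀ μ) fun x => Int.fract (μ x)) = ∑ v, D₀ v := by
  rw [degHom_divOf]
  unfold flowDiv
  rw [Finset.sum_sub_distrib, sum_out, sum_ceil hμ]
  ring

variable (π : Γ.Paths) (ϖ : Γ.PeriodMap)

/-- The divisor `d` times the base vertex. -/
noncomputable def Paths.baseDiv (d : ℤ) (v : Γ.V) : ℤ := if v = π.base then d else 0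

theorem Paths.sum_baseDiv (d : ℤ) : ∑ v, π.baseDiv d v = d := by simp [baseDiv]

/-- An integral flow becomes a cycle when its sources are sent back to the base vertex along the
chosen paths. -/
theorem exists_cycle_of_out (h : Γ.X → ℤ) (hh : Γ.IsFlow h) :
    Γ.IsCycle (fun x => h x + ∑ v, Γ.out h v * π.P v x) := by
  constructor
  · intro x
    dsimp only
    rw [hh x, neg_add, ← Finset.sum_neg_distrib]
    congr 1
    refine Finset.sum_congr rfl fun v _ => ?_
    rw [π.flow v x]; ring
  · intro w
    rw [out_add, out_sum]
    simp only [out_smul, π.out, mul_sub, mul_ite, mul_one, mul_zero, Finset.sum_sub_distrib]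
    have h0 : ∑ v, Γ.out h v = 0 := by
      rw [sum_out]
      have := IsFlow_sum_eq_zero hh.cast
      exact_mod_cast this
    rw [Finset.sum_ite_eq', if_pos (Finset.mem_univ _)]
    split_ifs <;> simp [h0]

/-- A half-edge function with values in `[0, 1)` is compatible with the involution if it consists
of the fractional parts of a flow. -/
def IsFrac (Γ : TCurve n) (ν : Γ.X → ℝ) : Prop :=
  ∀ x, 0 ≤ ν x ∧ ν x < 1 ∧ ν (Γ.i x) = if ν x = 0 then 0 else 1 - ν x

theorem isFrac_fract {μ : Γ.X → ℝ} (hμ : Γ.IsFlow μ) : Γ.IsFrac fun x => Int.fract (μ x) :=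
  fun x => ⟨Int.fract_nonneg _, Int.fract_lt_one _, by
    dsimp only
    rw [hμ x]
    split_ifs with h
    · rw [Int.fract_neg_eq_zero]; exact h
    · rw [Int.fract_neg h]⟩

open Classical in
/-- Every divisor with at most one chip in the interior of each edge arises from a flow. -/
theorem exists_flow_lift {D : Γ.V → ℤ} {ν : Γ.X → ℝ} (hν : Γ.IsFrac ν)
    (hfix : ∀ x, Γ.i x = x → ν x = 0) {d : ℤ}
    (hd : ∑ v, D v + ∑ x with Γ.Or x, (if ν x = 0 then 0 else 1) = d) :
    ∃ μ, Γ.IsFlow μ ∧ (∀ x, Int.fract (μ x) = ν x) ∧ flowDiv (π.baseDiv d) μ = D := by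
  -- `μ₀` has the correct fractional parts; an integral flow `c` corrects the values at the vertices
  let μ₀ : Γ.X → ℝ := fun x => if ν x = 0 then 0 else if Γ.Or x then ν x else ν x - 1
  have hμ₀ : Γ.IsFlow μ₀ := by
    intro x
    simp only [μ₀]
    have h := (hν x).2.2
    by_cases h0 : ν x = 0
    · rw [if_pos h0] at h
      rw [if_pos h0, if_pos h, neg_zero]
    · rw [if_neg h0] at h
      have h1 : ν (Γ.i x) ≠ 0 := by rw [h]; linarith [(hν x).2.1]
      rw [if_neg h0, if_neg h1]
      rcases or_or (fun hx => h0 (hfix x hx)) with ho | ho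
      · rw [if_pos ho, if_neg ho.not_i, h]; ring
      · have h2 : ¬ Γ.Or x := by have := ho.not_i; rwa [Γ.i_i] at this
        rw [if_neg h2, if_pos ho, h]; ring
  have hf₀ : ∀ x, Int.fract (μ₀ x) = ν x := by
    intro x
    have h1 := hν x
    simp only [μ₀]
    split_ifs with h0 h2
    · rw [Int.fract_zero, h0]
    · exact Int.fract_eq_self.2 ⟨h1.1, h1.2.1⟩
    · rw [Int.fract_sub_one]
      exact Int.fract_eq_self.2 ⟨h1.1, h1.2.1⟩
  let ρ : Γ.V → ℤ := fun v => D v - flowDiv (π.baseDiv d) μ₀ v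
  have hρ : ∑ v, ρ v = 0 := by
    have h1 := degHom_divOf_flow (π.baseDiv d) hμ₀
    rw [degHom_divOf, π.sum_baseDiv] at h1
    simp only [hf₀] at h1
    simp only [ρ, Finset.sum_sub_distrib]
    omega
  let c : Γ.X → ℤ := fun x => ∑ v, ρ v * π.P v x
  have hc : Γ.IsFlow c := fun x => by
    simp only [c]
    rw [← Finset.sum_neg_distrib]
    refine Finset.sum_congr rfl fun v _ => ?_
    rw [π.flow v x]; ring
  have hco : ∀ w, Γ.out c w = -ρ w := fun w => by
    simp only [c]
    rw [out_sum]
    simp only [out_smul, π.out, mul_sub, mul_ite, mul_one, mul_zero, Finset.sum_sub_distrib]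
    rw [Finset.sum_ite_eq', if_pos (Finset.mem_univ _)]
    split_ifs <;> simp [hρ]
  refine ⟨fun x => μ₀ x + c x, hμ₀.add hc.cast, fun x => ?_, ?_⟩
  · rw [Int.fract_add_intCast, hf₀]
  · funext v
    unfold flowDiv
    simp only [Int.ceil_add_intCast]
    rw [out_add, hco]
    simp only [ρ]
    unfold flowDiv
    ring

/-- Adding an integral cycle to a flow changes neither its fractional parts nor the values at the
vertices, hence not the associated divisor. -/
theorem flowDiv_add_cycle {D₀ : Γ.V → ℤ} {μ : Γ.X → ℝ} {c : Γ.X → ℤ} (hc : Γ.IsCycle c) :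
    flowDiv D₀ (fun x => μ x + c x) = flowDiv D₀ μ := by
  funext v
  unfold flowDiv
  simp only [Int.ceil_add_intCast]
  rw [out_add, hc.2, add_zero]

/-! ### Semistable flows -/

/-- The half-edges leaving a set of vertices. -/
noncomputable def bdry (Γ : TCurve n) (S : Finset Γ.V) : Finset Γ.X :=
  {x | Γ.root x ∈ S ∧ Γ.root (Γ.i x) ∉ S}

theorem mem_bdry {S : Finset Γ.V} {x : Γ.X} :
    x ∈ Γ.bdry S ↔ Γ.root x ∈ S ∧ Γ.root (Γ.i x) ∉ S := by simp [bdry]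

/-- The net flow out of a set of vertices passes through its boundary. -/
theorem sum_out_eq_bdry {μ : Γ.X → ℝ} (hμ : Γ.IsFlow μ) (S : Finset Γ.V) :
    ∑ v ∈ S, Γ.out μ v = ∑ x ∈ Γ.bdry S, μ x := by
  classical
  have h1 : ∑ v ∈ S, Γ.out μ v = ∑ x with Γ.root x ∈ S, μ x := by
    rw [← Finset.sum_fiberwise_of_maps_to (t := S) (g := Γ.root) (fun x hx => by simpa using hx)]
    refine Finset.sum_congr rfl fun v hv => ?_
    unfold out
    rw [Finset.filter_filter]
    refine Finset.sum_congr ?_ fun _ _ => rfl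
    ext x
    simp only [Finset.mem_filter, Finset.mem_univ, true_and]
    exact ⟨fun h => ⟨h ▸ hv, h⟩, fun h => h.2⟩
  rw [h1, ← Finset.sum_filter_add_sum_filter_not _ fun x => Γ.root (Γ.i x) ∈ S]
  have h2 : ∑ x ∈ Finset.univ.filter (fun x => Γ.root x ∈ S) with Γ.root (Γ.i x) ∈ S, μ x = 0 := by
    rw [Finset.filter_filter]
    have h3 : ∑ x with Γ.root x ∈ S ∧ Γ.root (Γ.i x) ∈ S, μ x =
        ∑ x with Γ.root x ∈ S ∧ Γ.root (Γ.i x) ∈ S, μ (Γ.i x) := by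
      refine Finset.sum_bij (fun x _ => Γ.i x) ?_ ?_ ?_ ?_
      · intro x hx
        simp only [Finset.mem_filter, Finset.mem_univ, true_and, Γ.i_i] at hx ⊢
        exact ⟨hx.2, hx.1⟩
      · intro x _ y _ h
        rw [← Γ.i_i x, h, Γ.i_i]
      · intro x hx
        simp only [Finset.mem_filter, Finset.mem_univ, true_and] at hx
        exact ⟨Γ.i x, by simp [Γ.i_i, hx], Γ.i_i x⟩
      · intro x _
        rw [Γ.i_i]
    simp only [hμ _, Finset.sum_neg_distrib] at h3
    linarith
  rw [h2, zero_add, Finset.filter_filter]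
  rfl

theorem sum_bdry_compl (S : Finset Γ.V) (f : Γ.X → ℝ) :
    ∑ x ∈ Γ.bdry Sᶜ, f x = ∑ x ∈ Γ.bdry S, f (Γ.i x) := by
  refine Finset.sum_bij (fun x _ => Γ.i x) ?_ ?_ ?_ ?_
  · intro x hx
    rw [mem_bdry] at hx ⊢
    rw [Γ.i_i]
    simpa [and_comm] using hx
  · intro x _ y _ h
    rw [← Γ.i_i x, h, Γ.i_i]
  · intro x hx
    refine ⟨Γ.i x, ?_, Γ.i_i x⟩
    rw [mem_bdry] at hx ⊢
    rw [Γ.i_i]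
    simpa [and_comm] using hx
  · intro x _
    rw [Γ.i_i]

/-- Semistability of the divisor `TCurve.flowDiv D₀ μ` with respect to `φ`, in terms of the flow:
only the lower bounds are recorded, the upper bounds are those for the complements. -/
def IsSS (φ : Γ.V → ℝ) (D₀ : Γ.V → ℤ) (μ : Γ.X → ℝ) : Prop :=
  ∀ S : Finset Γ.V, ∑ x ∈ Γ.bdry S, ((⌈μ x⌉ : ℝ) - 1 / 2) ≤ ∑ v ∈ S, ((D₀ v : ℝ) - φ v)

variable {φ : Γ.V → ℝ} {D₀ : Γ.V → ℤ} {μ μ' : Γ.X → ℝ}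

/-- The upper bounds in the semistability condition are the lower bounds for the complementary sets.
-/
theorem IsSS.upper (hμ : Γ.IsFlow μ) (hφ : ∑ v, φ v = ((∑ v, D₀ v : ℤ) : ℝ)) (h : IsSS φ D₀ μ)
    (S : Finset Γ.V) :
    ∑ v ∈ S, ((D₀ v : ℝ) - φ v) ≤ ∑ x ∈ Γ.bdry S, ((⌊μ x⌋ : ℝ) + 1 / 2) := by
  have h1 := h Sᶜ
  rw [sum_bdry_compl] at h1
  have h2 := Finset.sum_add_sum_compl S fun v => (D₀ v : ℝ) - φ v
  rw [Finset.sum_sub_distrib (s := Finset.univ), hφ] at h2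
  push_cast at h2
  have h3 : ∑ x ∈ Γ.bdry S, ((⌊μ x⌋ : ℝ) + 1 / 2) =
      -∑ x ∈ Γ.bdry S, ((⌈μ (Γ.i x)⌉ : ℝ) - 1 / 2) := by
    rw [← Finset.sum_neg_distrib]
    refine Finset.sum_congr rfl fun x _ => ?_
    rw [hμ x, Int.ceil_neg]; push_cast; ring
  rw [h3]
  linarith

theorem IsSS.add_cycle {c : Γ.X → ℤ} (hc : Γ.IsCycle c) (h : IsSS φ D₀ μ) :
    IsSS φ D₀ (fun x => μ x + c x) := fun S => by
  have h1 := sum_out_eq_bdry hc.1.cast S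
  simp only [out_cast, hc.2, Int.cast_zero, Finset.sum_const_zero] at h1
  have h2 : ∑ x ∈ Γ.bdry S, ((⌈μ x + c x⌉ : ℝ) - 1 / 2) =
      ∑ x ∈ Γ.bdry S, ((⌈μ x⌉ : ℝ) - 1 / 2) + ∑ x ∈ Γ.bdry S, (c x : ℝ) := by
    rw [← Finset.sum_add_distrib]
    refine Finset.sum_congr rfl fun x _ => ?_
    rw [Int.ceil_add_intCast]; push_cast; ring
  rw [h2, ← h1, add_zero]
  exact h S

/-- The stability function is general on the graph. -/
def IsGen (φ : Γ.V → ℝ) : Prop :=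
  ∀ S : Finset Γ.V, (∃ k : ℤ, ∑ v ∈ S, φ v + ((Γ.bdry S).card : ℝ) / 2 = k) →
    S = ∅ ∨ S = Finset.univ

/-- Two semistable flows with the same class differ by an integral cycle. This is a maximum
principle: the set where the potential of the difference is maximal has no boundary. -/
theorem IsSS.unique (hφ : ∑ v, φ v = ((∑ v, D₀ v : ℤ) : ℝ)) (hgen : IsGen φ)
    (hμ : Γ.IsFlow μ) (hμ' : Γ.IsFlow μ') (h : IsSS φ D₀ μ) (h' : IsSS φ D₀ μ')
    (ht : ϖ.toTorus μ = ϖ.toTorus μ') : ∃ c : Γ.X → ℤ, Γ.IsCycle c ∧ ∀ x, μ' x = μ x + c x := by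
  classical
  obtain ⟨c, hc, g, hg⟩ := ϖ.exists_of_toTorus_eq_zero (hμ'.sub hμ)
    (by rw [← sub_eq_zero.2 ht.symm, ← map_sub]; rfl)
  refine ⟨c, hc, ?_⟩
  suffices hz : ∀ x, Γ.grad g x = 0 by
    intro x
    have := hg x
    rw [hz] at this
    linarith
  have h1 := h.add_cycle hc
  by_cases hV : Nonempty Γ.V
  swap
  · exact fun x => absurd ⟨Γ.root x⟩ hV
  obtain ⟨v₁, hv₁⟩ := Finite.exists_max g
  -- across the boundary of the set `S` of maxima of the potential, `μ'` is strictly smaller than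
  -- `μ + c`, so that the upper bound for `μ'` and the lower bound for `μ + c` are equalities
  set S : Finset Γ.V := {v | g v = g v₁} with hS
  have hlt : ∀ x ∈ Γ.bdry S, (⌊μ' x⌋ : ℝ) + 1 / 2 ≤ ⌈μ x + c x⌉ - 1 / 2 := by
    intro x hx
    rw [mem_bdry] at hx
    simp only [hS, Finset.mem_filter, Finset.mem_univ, true_and] at hx
    have hx1 : g (Γ.root (Γ.i x)) < g (Γ.root x) := by
      rw [hx.1]
      exact lt_of_le_of_ne (hv₁ _) hx.2
    have hi : Γ.i x ≠ x := fun hi => by rw [hi] at hx1; exact lt_irrefl _ hx1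
    have hneg : Γ.grad g x < 0 := div_neg_of_neg_of_pos (by linarith) (Γ.len_pos x hi)
    have h2 : μ' x < μ x + c x := by linarith [hg x]
    have h3 : ⌊μ' x⌋ < ⌈μ x + c x⌉ := Int.floor_lt_ceil_of_lt h2
    have h4 : ((⌊μ' x⌋ : ℤ) : ℝ) + 1 ≤ (⌈μ x + c x⌉ : ℝ) := by exact_mod_cast h3
    linarith
  have h2 := h'.upper hμ' hφ S
  have h3 := h1 S
  have h4 := Finset.sum_le_sum hlt
  have h5 : ∑ v ∈ S, ((D₀ v : ℝ) - φ v) = ∑ x ∈ Γ.bdry S, ((⌈μ x + c x⌉ : ℝ) - 1 / 2) :=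
    le_antisymm (h2.trans h4) h3
  rcases hgen S ⟨∑ v ∈ S, D₀ v - ∑ x ∈ Γ.bdry S, ⌈μ x + c x⌉ + (Γ.bdry S).card, by
    rw [Finset.sum_sub_distrib, Finset.sum_sub_distrib, Finset.sum_const, nsmul_eq_mul] at h5
    push_cast
    linarith⟩ with h6 | h6
  · have : v₁ ∈ S := by simp [hS]
    rw [h6] at this
    exact absurd this (Finset.notMem_empty _)
  · have hall : ∀ v, g v = g v₁ := fun v => by
      have : v ∈ S := by rw [h6]; exact Finset.mem_univ v
      simpa [hS] using this
    intro x
    unfold grad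
    rw [hall, hall (Γ.root x), sub_self, zero_div]

end TCurve

/-! ### Existence of semistable flows -/

namespace TCurve

/-- The convex function which agrees with `t ^ 2 / 2` at the integers and is affine between
consecutive integers. -/
noncomputable def chord (t : ℝ) : ℝ := (t ^ 2 + Int.fract t * (1 - Int.fract t)) / 2

theorem continuous_chord : Continuous chord := by
  have h : Continuous ((fun y : ℝ => y * (1 - y)) ∘ Int.fract) :=
    ContinuousOn.comp_fract'' (by fun_prop) (by norm_num)
  exact ((continuous_pow 2).add h).div_const 2

theorem le_chord (t : ℝ) : t ^ 2 / 2 ≤ chord t := by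
  have := mul_nonneg (Int.fract_nonneg t) (sub_nonneg.2 (Int.fract_lt_one t).le)
  unfold chord
  linarith

theorem chord_eq {t : ℝ} {m : ℤ} (h0 : (m : ℝ) ≤ t) (h1 : t ≤ m + 1) :
    chord t = (m : ℝ) ^ 2 / 2 + (m + 1 / 2) * (t - m) := by
  unfold chord
  rcases h1.eq_or_lt with h | h
  · have : Int.fract t = 0 := by rw [h]; simp
    rw [this, h]; ring
  · have : Int.fract t = t - m := by
      rw [Int.fract, Int.floor_eq_iff.2 ⟨h0, h⟩]
    rw [this]; ring

theorem chord_neg (t : ℝ) : chord (-t) = chord t := by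
  unfold chord
  by_cases h : Int.fract t = 0
  · rw [h, Int.fract_neg_eq_zero.2 h]; ring
  · rw [Int.fract_neg h]; ring

/-- The left derivative of `TCurve.chord` at `t` is `⌈t⌉ - 1 / 2`, and the function is affine on an
interval to the left of `t`. -/
theorem exists_chord_sub (t : ℝ) : ∃ δ > 0, ∀ ε, 0 ≤ ε → ε ≤ δ →
    chord (t - ε) = chord t - ε * (⌈t⌉ - 1 / 2) := by
  have h1 := Int.ceil_lt_add_one t
  have h2 := Int.le_ceil t
  refine ⟨t - (⌈t⌉ - 1), by linarith, fun ε h h' => ?_⟩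
  rw [chord_eq (m := ⌈t⌉ - 1) (by push_cast; linarith) (by push_cast; linarith),
    chord_eq (t := t) (m := ⌈t⌉ - 1) (by push_cast; linarith) (by push_cast; linarith)]
  push_cast
  ring

variable {n : ℕ} {Γ : TCurve n}

/-- The energy of a flow, relative to a reference flow `ζ`; its minimizers in a class of flows
modulo gradients are the semistable flows. -/
noncomputable def energy (Γ : TCurve n) (ζ μ : Γ.X → ℝ) : ℝ :=
  ∑ x, Γ.len x * (chord (μ x) - μ x * ζ x)

theorem continuous_energy (ζ : Γ.X → ℝ) : Continuous (Γ.energy ζ) :=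
  continuous_finsetSum _ fun x _ => continuous_const.mul
    ((continuous_chord.comp (continuous_apply x)).sub ((continuous_apply x).mul continuous_const))

/-- The energy is coercive on each class modulo gradients, since `TCurve.chord` dominates half the
square. -/
theorem exists_le_energy (ζ η : Γ.X → ℝ) : ∃ a > 0, ∃ b : ℝ, ∀ g : Γ.V → ℝ,
    a * ‖Γ.grad g‖ - b ≤ Γ.energy ζ (fun x => η x + Γ.grad g x) := by
  obtain ⟨ε, hε, hl⟩ := Γ.exists_lt_len
  -- `C` absorbs the linear term and the reference flows when completing the squares
  set C := ∑ x, Γ.len x * (η x ^ 2 + ζ x ^ 2) with hC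
  have hC0 : 0 ≤ C := Finset.sum_nonneg fun x _ =>
    mul_nonneg (Γ.len_nonneg x) (by positivity)
  have h1 : ∀ (g : Γ.V → ℝ), ∑ x, Γ.len x * (Γ.grad g x ^ 2 / 8) - C ≤
      Γ.energy ζ (fun x => η x + Γ.grad g x) := fun g => by
    rw [hC, energy, ← Finset.sum_sub_distrib]
    refine Finset.sum_le_sum fun x _ => ?_
    rw [← mul_sub]
    refine mul_le_mul_of_nonneg_left ?_ (Γ.len_nonneg x)
    have := le_chord (η x + Γ.grad g x)
    nlinarith [sq_nonneg (η x + Γ.grad g x - 2 * ζ x), sq_nonneg (Γ.grad g x + 2 * η x)]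
  refine ⟨ε / 4, by positivity, C + ε / 4, fun g => ?_⟩
  refine le_trans ?_ (h1 g)
  have h2 : ∀ y, ε / 4 * |Γ.grad g y| ≤ ∑ x, Γ.len x * (Γ.grad g x ^ 2 / 8) + ε / 4 := fun y => by
    have h0 : 0 ≤ ∑ x, Γ.len x * (Γ.grad g x ^ 2 / 8) := Finset.sum_nonneg fun x _ =>
      mul_nonneg (Γ.len_nonneg x) (by positivity)
    by_cases hy : Γ.i y = y
    · rw [(grad_isFlow g).eq_zero hy, abs_zero, mul_zero]
      linarith
    · have h3 := Finset.single_le_sum (f := fun x => Γ.len x * (Γ.grad g x ^ 2 / 8))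
        (fun x _ => mul_nonneg (Γ.len_nonneg x) (by positivity)) (Finset.mem_univ y)
      have h4 : 2 * ε * (Γ.grad g y ^ 2 / 8) ≤ Γ.len y * (Γ.grad g y ^ 2 / 8) :=
        mul_le_mul_of_nonneg_right (hl y hy).le (by positivity)
      have h5 : |Γ.grad g y| ≤ Γ.grad g y ^ 2 + 1 := by
        rw [← sq_abs]
        nlinarith [sq_nonneg (|Γ.grad g y| - 1), abs_nonneg (Γ.grad g y)]
      have h6 := mul_le_mul_of_nonneg_left h5 (by positivity : 0 ≤ ε / 4)
      linarith
  have h7 : ‖Γ.grad g‖ ≤ (∑ x, Γ.len x * (Γ.grad g x ^ 2 / 8) + ε / 4) / (ε / 4) := by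
    refine (pi_norm_le_iff_of_nonneg ?_).2 fun y => ?_
    · refine div_nonneg (add_nonneg (Finset.sum_nonneg fun x _ =>
        mul_nonneg (Γ.len_nonneg x) (by positivity)) (by positivity)) (by positivity)
    · rw [le_div_iff₀ (by positivity), mul_comm]
      exact h2 y
  rw [le_div_iff₀ (by positivity)] at h7
  linarith

/-- A coercive continuous function on the finite-dimensional space of gradients has a minimum. -/
theorem exists_energy_min (ζ η : Γ.X → ℝ) : ∃ g : Γ.V → ℝ, ∀ g' : Γ.V → ℝ,
    Γ.energy ζ (fun x => η x + Γ.grad g x) ≤ Γ.energy ζ (fun x => η x + Γ.grad g' x) := by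
  obtain ⟨a, ha, b, hab⟩ := exists_le_energy ζ η
  have hcont : Continuous fun u : LinearMap.range Γ.gradL =>
      Γ.energy ζ (fun x => η x + u.1 x) :=
    (continuous_energy ζ).comp (continuous_pi fun x =>
      continuous_const.add ((continuous_apply x).comp continuous_subtype_val))
  have htend : Filter.Tendsto (fun u : LinearMap.range Γ.gradL =>
      Γ.energy ζ (fun x => η x + u.1 x)) (Filter.cocompact _) Filter.atTop := by
    refine Filter.tendsto_atTop_mono (f := fun u : LinearMap.range Γ.gradL => a * ‖u‖ - b) ?_ ?_
    · rintro ⟨_, g, rfl⟩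
      exact hab g
    · exact Filter.tendsto_atTop_add_const_right _ _
        ((tendsto_norm_cocompact_atTop).const_mul_atTop ha)
  obtain ⟨⟨_, g, rfl⟩, h⟩ := hcont.exists_forall_le htend
  exact ⟨g, fun g' => h ⟨_, g', rfl⟩⟩

/-- Change of the energy of a flow when it is perturbed in the direction of the gradient of the
characteristic function of a set of vertices. -/
theorem exists_energy_add {μ ζ : Γ.X → ℝ} (hμ : Γ.IsFlow μ) (hζ : Γ.IsFlow ζ) (S : Finset Γ.V) :
    ∃ ε > 0, Γ.energy ζ (fun x => μ x + Γ.grad (fun v => if v ∈ S then ε else 0) x) -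
      Γ.energy ζ μ = 2 * ε * (∑ v ∈ S, Γ.out ζ v - ∑ x ∈ Γ.bdry S, ((⌈μ x⌉ : ℝ) - 1 / 2)) := by
  choose δ hδ hch using fun x => exists_chord_sub (μ x)
  have hmin : ∃ ε > 0, ∀ x, Γ.i x ≠ x → ε / Γ.len x ≤ δ x := by
    have : ∀ x : Γ.X, ∃ ε > 0, Γ.i x ≠ x → ε ≤ Γ.len x * δ x := fun x => by
      by_cases hx : Γ.i x = x
      · exact ⟨1, one_pos, fun h => absurd hx h⟩
      · exact ⟨_, mul_pos (Γ.len_pos x hx) (hδ x), fun _ => le_rfl⟩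
    choose e he hx using this
    by_cases hX : Nonempty Γ.X
    · obtain ⟨x₀, hx₀⟩ := Finite.exists_min e
      refine ⟨e x₀, he x₀, fun x h => ?_⟩
      rw [div_le_iff₀' (Γ.len_pos x h)]
      exact (hx₀ x).trans (hx x h)
    · exact ⟨1, one_pos, fun x => absurd ⟨x⟩ hX⟩
  obtain ⟨ε, hε, hle⟩ := hmin
  refine ⟨ε, hε, ?_⟩
  set g : Γ.V → ℝ := fun v => if v ∈ S then ε else 0 with hg
  have hfix : ∀ x, Γ.i x = x → Γ.root (Γ.i x) = Γ.root x := fun x h => by rw [h]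
  -- `β` distributes the changes of the quadratic part of the energy to the half-edges leaving `S`
  let β : Γ.X → ℝ := fun x => if x ∈ Γ.bdry S then -ε * ((⌈μ x⌉ : ℝ) - 1 / 2) else 0
  have hβ : ∀ x, Γ.len x * (chord (μ x + Γ.grad g x) - chord (μ x)) = β x + β (Γ.i x) := by
    intro x
    have hb : x ∈ Γ.bdry S ↔ Γ.root x ∈ S ∧ Γ.root (Γ.i x) ∉ S := mem_bdry
    have hb' : Γ.i x ∈ Γ.bdry S ↔ Γ.root (Γ.i x) ∈ S ∧ Γ.root x ∉ S := by
      rw [mem_bdry, Γ.i_i]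
    have hβx : β x = if Γ.root x ∈ S ∧ Γ.root (Γ.i x) ∉ S then
      -ε * ((⌈μ x⌉ : ℝ) - 1 / 2) else 0 := by simp only [β, hb]
    have hβi : β (Γ.i x) = if Γ.root (Γ.i x) ∈ S ∧ Γ.root x ∉ S then
      -ε * ((⌈μ (Γ.i x)⌉ : ℝ) - 1 / 2) else 0 := by simp only [β, hb']
    rw [hβx, hβi]
    unfold grad
    simp only [hg]
    by_cases h1 : Γ.root x ∈ S <;> by_cases h2 : Γ.root (Γ.i x) ∈ S <;>
      simp only [h1, h2, if_true, if_false, not_true, not_false_iff, and_true, and_false,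
        and_self, sub_self, zero_div, add_zero, mul_zero, zero_sub, sub_zero, zero_add]
    · have hx : Γ.i x ≠ x := fun h => h2 (hfix x h ▸ h1)
      have hl := Γ.len_pos x hx
      rw [neg_div, ← sub_eq_add_neg, hch x _ (by positivity) (hle x hx)]
      field_simp
      ring
    · have hx : Γ.i x ≠ x := fun h => h1 (hfix x h ▸ h2)
      have hl := Γ.len_pos x hx
      have h3 := hle (Γ.i x) (i_half hx)
      rw [Γ.len_i] at h3
      have h4 := hch (Γ.i x) _ (by positivity : 0 ≤ ε / Γ.len x) h3
      rw [hμ x] at h4 ⊢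
      rw [← chord_neg, neg_add, ← sub_eq_add_neg, h4, chord_neg]
      field_simp
      ring
  have h1 : Γ.energy ζ (fun x => μ x + Γ.grad g x) - Γ.energy ζ μ =
      ∑ x, (β x + β (Γ.i x)) - ∑ x, Γ.len x * Γ.grad g x * ζ x := by
    unfold energy
    rw [← Finset.sum_sub_distrib, ← Finset.sum_sub_distrib]
    refine Finset.sum_congr rfl fun x _ => ?_
    rw [← hβ]; ring
  rw [h1, Finset.sum_add_distrib, sum_i, sum_len_grad_mul g hζ]
  have h2 : ∑ x, β x = -ε * ∑ x ∈ Γ.bdry S, ((⌈μ x⌉ : ℝ) - 1 / 2) := by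
    rw [Finset.mul_sum, ← Finset.sum_filter]
    simp
  have h3 : ∑ v, Γ.out ζ v * g v = ε * ∑ v ∈ S, Γ.out ζ v := by
    rw [Finset.mul_sum]
    simp [hg, mul_comm]
  rw [h2, h3]
  ring

variable {φ : Γ.V → ℝ} {D₀ : Γ.V → ℤ}

/-- Every class of flows modulo gradients contains a semistable flow. -/
theorem exists_isSS (hc : Γ.ConnOn Set.univ) (hφ : ∑ v, φ v = ((∑ v, D₀ v : ℤ) : ℝ))
    {η : Γ.X → ℝ} (hη : Γ.IsFlow η) : ∃ g, IsSS φ D₀ (fun x => η x + Γ.grad g x) := by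
  obtain ⟨g₀, hg₀⟩ := exists_out_grad hc (ρ := fun v => (D₀ v : ℝ) - φ v) (by
    rw [Finset.sum_sub_distrib, hφ]; push_cast; ring)
  -- perturbing a minimizer in the direction of `S` shows the inequality for `S`
  obtain ⟨g, hg⟩ := exists_energy_min (Γ.grad g₀) η
  refine ⟨g, fun S => ?_⟩
  obtain ⟨ε, hε, h⟩ := exists_energy_add (hη.add (grad_isFlow g)) (grad_isFlow g₀) S
  have h1 := hg (g + fun v => if v ∈ S then ε else 0)
  have h2 : (fun x => η x + Γ.grad (g + fun v => if v ∈ S then ε else 0) x) =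
      fun x => η x + Γ.grad g x + Γ.grad (fun v => if v ∈ S then ε else 0) x := by
    funext x
    have : Γ.grad (g + fun v => if v ∈ S then ε else 0) x =
        Γ.grad g x + Γ.grad (fun v => if v ∈ S then ε else 0) x :=
      congrFun (Γ.gradL.map_add g fun v => if v ∈ S then ε else 0) x
    rw [this]; ring
  rw [h2] at h1
  simp only [hg₀] at h
  by_contra hlt
  push Not at hlt
  have : 2 * ε * (∑ v ∈ S, ((D₀ v : ℝ) - φ v) -
      ∑ x ∈ Γ.bdry S, ((⌈η x + Γ.grad g x⌉ : ℝ) - 1 / 2)) < 0 :=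
    mul_neg_of_pos_of_neg (by positivity) (by linarith)
  linarith

/-! ### Compactness of the space of semistable flows -/

variable (π : Γ.Paths) (ϖ : Γ.PeriodMap)

/-- The semistable flows are bounded modulo integral cycles. -/
theorem exists_bound (hc : Γ.ConnOn Set.univ) (hφ : ∑ v, φ v = ((∑ v, D₀ v : ℤ) : ℝ)) :
    ∃ M : ℝ, ∀ μ : Γ.X → ℝ, Γ.IsFlow μ → IsSS φ D₀ μ →
      ∃ c : Γ.X → ℤ, Γ.IsCycle c ∧ ∀ x, |μ x - c x| ≤ M := by
  classical
  obtain ⟨π⟩ := nonempty_paths hc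
  set N : ℝ := (Fintype.card Γ.X : ℝ) with hN
  let B : Γ.V → ℝ := fun v => |(D₀ v : ℝ) - φ v| + N + N * (2 * N)
  have hP : ∃ Q : ℝ, ∀ x, ∑ v, B v * |(π.P v x : ℝ)| ≤ Q := by
    obtain ⟨Q, hQ⟩ := (Set.finite_range fun x => ∑ v, B v * |(π.P v x : ℝ)|).bddAbove
    exact ⟨Q, fun x => hQ ⟨x, rfl⟩⟩
  obtain ⟨Q, hQ⟩ := hP
  refine ⟨2 * N + Q, fun μ hμ h => ?_⟩
  -- `k` is the flow rounded down along the oriented edges; its sources are bounded, and subtracting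
  -- flows along the paths `π.P` turns it into the required cycle
  let k : Γ.X → ℤ := fun y => ∑ x with Γ.Or x, ⌊μ x⌋ * Γ.unitFlow x y
  have hk : Γ.IsFlow k := fun y => by
    simp only [k]
    rw [← Finset.sum_neg_distrib]
    refine Finset.sum_congr rfl fun x _ => ?_
    rw [unitFlow_isFlow x y]; ring
  have hcard : ∀ s : Finset Γ.X, (s.card : ℝ) ≤ N := fun s => by
    rw [hN]; exact_mod_cast Finset.card_le_univ s
  have hN0 : 0 ≤ N := Nat.cast_nonneg _
  have hμk : ∀ y, |μ y - k y| ≤ 2 * N := fun y => by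
    have h1 : μ y - k y = ∑ x with Γ.Or x, Int.fract (μ x) * (Γ.unitFlow x y : ℝ) := by
      rw [hμ.eq_sum_or y]
      simp only [k]
      push_cast
      rw [← Finset.sum_sub_distrib]
      refine Finset.sum_congr rfl fun x _ => ?_
      rw [← sub_mul]; rfl
    rw [h1]
    refine (Finset.abs_sum_le_sum_abs _ _).trans ((Finset.sum_le_card_nsmul _ _ 2 ?_).trans ?_)
    · intro x _
      have h2 : |(Γ.unitFlow x y : ℝ)| ≤ 2 := by
        unfold unitFlow
        split_ifs <;> norm_num
      rw [abs_mul, abs_of_nonneg (Int.fract_nonneg _)]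
      calc _ ≤ 1 * (2 : ℝ) := mul_le_mul (Int.fract_lt_one _).le h2 (abs_nonneg _) zero_le_one
        _ = 2 := by norm_num
    · rw [nsmul_eq_mul, mul_comm]
      exact mul_le_mul_of_nonneg_left (hcard _) (by norm_num)
  have hout : ∀ v, |((Γ.out k v : ℤ) : ℝ)| ≤ B v := fun v => by
    have h1 := h {v}
    have h2 := h.upper hμ hφ {v}
    have h3 := sum_out_eq_bdry hμ {v}
    rw [Finset.sum_singleton] at h1 h2 h3
    have h4 : ∑ x ∈ Γ.bdry {v}, μ x ≤ ∑ x ∈ Γ.bdry {v}, ((⌈μ x⌉ : ℝ) - 1 / 2) + N / 2 := by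
      rw [Finset.sum_sub_distrib, Finset.sum_const, nsmul_eq_mul]
      have := Finset.sum_le_sum fun x (_ : x ∈ Γ.bdry {v}) => Int.le_ceil (μ x)
      have := hcard (Γ.bdry {v})
      linarith
    have h5 : ∑ x ∈ Γ.bdry {v}, ((⌊μ x⌋ : ℝ) + 1 / 2) - N / 2 ≤ ∑ x ∈ Γ.bdry {v}, μ x := by
      rw [Finset.sum_add_distrib, Finset.sum_const, nsmul_eq_mul]
      have := Finset.sum_le_sum fun x (_ : x ∈ Γ.bdry {v}) => Int.floor_le (μ x)
      have := hcard (Γ.bdry {v})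
      linarith
    have h6 : |Γ.out (fun y => μ y - k y) v| ≤ N * (2 * N) := by
      unfold MGraph.out
      refine (Finset.abs_sum_le_sum_abs _ _).trans
        ((Finset.sum_le_card_nsmul _ _ (2 * N) fun x _ => hμk x).trans ?_)
      rw [nsmul_eq_mul]
      exact mul_le_mul_of_nonneg_right (hcard _) (by positivity)
    rw [out_sub, out_cast] at h6
    simp only [B]
    rw [abs_le] at h6 ⊢
    have := le_abs_self ((D₀ v : ℝ) - φ v)
    have := neg_abs_le ((D₀ v : ℝ) - φ v)
    constructor <;> linarith
  refine ⟨_, exists_cycle_of_out π k hk, fun x => ?_⟩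
  push_cast
  rw [← sub_sub]
  refine (abs_sub _ _).trans (add_le_add (hμk x) (le_trans ?_ (hQ x)))
  refine (Finset.abs_sum_le_sum_abs _ _).trans (Finset.sum_le_sum fun v _ => ?_)
  rw [abs_mul]
  exact mul_le_mul_of_nonneg_right (hout v) (abs_nonneg _)

theorem PeriodMap.continuous_toTorus : Continuous ϖ.toTorus :=
  continuous_pi fun j => (AddCircle.continuous_mk' 1).comp
    ((continuous_apply j).comp (LinearMap.continuous_of_finiteDimensional ϖ.θ))

/-- Semistability is a closed condition, because rounding up is lower semicontinuous. -/
theorem isClosed_isSS (φ : Γ.V → ℝ) (D₀ : Γ.V → ℤ) : IsClosed {μ : Γ.X → ℝ | IsSS φ D₀ μ} := by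
  rw [← isOpen_compl_iff, isOpen_iff_mem_nhds]
  intro μ hμ
  simp only [IsSS, Set.mem_compl_iff, Set.mem_ofPred_eq, not_forall, not_le] at hμ
  obtain ⟨S, hS⟩ := hμ
  have h1 : ∀ᶠ ν in 𝓝 μ, ∀ x, ⌈μ x⌉ ≤ ⌈ν x⌉ := Filter.eventually_all.2 fun x => by
    have h2 : ((⌈μ x⌉ : ℝ) - 1) < μ x := by linarith [Int.ceil_lt_add_one (μ x)]
    filter_upwards [(continuous_apply x).tendsto μ (lt_mem_nhds h2)] with ν hν
    have h3 : (⌈μ x⌉ : ℝ) - 1 < ν x := hν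
    have h4 : ((⌈μ x⌉ - 1 : ℤ) : ℝ) < ν x := by push_cast; exact h3
    have := Int.lt_ceil.2 h4
    omega
  filter_upwards [h1] with ν hν h
  refine absurd (h S) (not_le.2 (hS.trans_le (Finset.sum_le_sum fun x _ => ?_)))
  have : (⌈μ x⌉ : ℝ) ≤ ⌈ν x⌉ := by exact_mod_cast hν x
  linarith

theorem isClosed_isFlow : IsClosed {μ : Γ.X → ℝ | Γ.IsFlow μ} := by
  simp only [IsFlow, Set.ofPred_forall]
  exact isClosed_iInter fun x => isClosed_eq (continuous_apply _) (continuous_apply x).neg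

/-- Modulo integral cycles, a semistable flow depends continuously on its class. -/
theorem exists_cycle_near (hc : Γ.ConnOn Set.univ) (hφ : ∑ v, φ v = ((∑ v, D₀ v : ℤ) : ℝ))
    (hgen : IsGen φ)
    {μ₀ : Γ.X → ℝ} (hμ₀ : Γ.IsFlow μ₀) (h₀ : IsSS φ D₀ μ₀) {ε : ℝ} (hε : 0 < ε) :
    ∀ᶠ t in 𝓝 (ϖ.toTorus μ₀), ∀ μ, Γ.IsFlow μ → IsSS φ D₀ μ → ϖ.toTorus μ = t →
      ∃ c : Γ.X → ℤ, Γ.IsCycle c ∧ ∀ x, |μ x - c x - μ₀ x| < ε := by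
  obtain ⟨M, hM⟩ := exists_bound hc hφ
  -- the semistable flows which are not `ε`-near to `μ₀` modulo any integral cycle
  let K : Set (Γ.X → ℝ) := {μ | Γ.IsFlow μ} ∩ {μ | IsSS φ D₀ μ} ∩
    (⋂ c : {c : Γ.X → ℤ // Γ.IsCycle c}, ⋃ x, {μ : Γ.X → ℝ | ε ≤ |μ x - c.1 x - μ₀ x|})
  have hK : IsCompact (K ∩ Metric.closedBall 0 (|M|)) := by
    refine (isCompact_closedBall _ _).inter_left
      ((isClosed_isFlow.inter (isClosed_isSS φ D₀)).inter ?_)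
    refine isClosed_iInter fun c => isClosed_iUnion_of_finite fun x => ?_
    exact isClosed_le continuous_const (by fun_prop)
  have hcl := (hK.image ϖ.continuous_toTorus).isClosed
  have hmem : ϖ.toTorus μ₀ ∉ ϖ.toTorus '' (K ∩ Metric.closedBall 0 (|M|)) := by
    rintro ⟨μ, ⟨⟨⟨h1, h2⟩, h3⟩, -⟩, ht⟩
    obtain ⟨c, hc, hx⟩ := h₀.unique ϖ hφ hgen hμ₀ h1 h2 ht.symm
    rw [Set.mem_iInter] at h3
    obtain ⟨x, hx'⟩ := Set.mem_iUnion.1 (h3 ⟨c, hc⟩)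
    have hx' : ε ≤ |μ x - c x - μ₀ x| := hx'
    rw [hx x, show μ₀ x + c x - c x - μ₀ x = 0 by ring, abs_zero] at hx'
    linarith
  filter_upwards [hcl.isOpen_compl.mem_nhds hmem] with t ht μ hμ hss hμt
  by_contra hno
  push Not at hno
  obtain ⟨c, hc, hb⟩ := hM μ hμ hss
  have hneg : Γ.IsCycle (-c) := hc.neg
  refine ht ⟨fun x => μ x + (-c) x, ⟨⟨⟨?_, hss.add_cycle hneg⟩, ?_⟩, ?_⟩, ?_⟩
  · exact hμ.add hneg.1.cast
  · refine Set.mem_iInter.2 fun c' => Set.mem_iUnion.2 ?_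
    obtain ⟨x, hx⟩ := hno (fun x => c x + c'.1 x) (hc.add c'.2)
    refine ⟨x, ?_⟩
    change ε ≤ |μ x + ((-c) x : ℤ) - c'.1 x - μ₀ x|
    rw [Pi.neg_apply]
    have h1 : μ x + ((-c x : ℤ) : ℝ) - c'.1 x - μ₀ x =
        μ x - ((c x + c'.1 x : ℤ) : ℝ) - μ₀ x := by push_cast; ring
    rw [h1]
    exact hx
  · rw [mem_closedBall_zero_iff]
    refine (pi_norm_le_iff_of_nonneg (abs_nonneg M)).2 fun x => ?_
    have := (hb x).trans (le_abs_self M)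
    simpa [sub_eq_add_neg] using this
  · have h1 : (fun x => μ x + ((-c) x : ℤ)) = μ + fun x => (((-c) x : ℤ) : ℝ) := rfl
    rw [h1, map_add, ϖ.toTorus_cycle hneg, add_zero, hμt]

/-! ### The tropical Picard group is a torus -/

/-- Continuity of a difference of sums of points, by the definition of the topology on the tropical
Picard group. -/
theorem continuous_sum_ptCls {Z ι κ : Type*} [TopologicalSpace Z] [Fintype ι] [Fintype κ]
    {p : ι → Z → Γ.Pt} {q : κ → Z → Γ.Pt} (hp : ∀ i, Continuous (p i))
    (hq : ∀ j, Continuous (q j)) :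
    Continuous fun z => ∑ i, Γ.ptCls (p i z) - ∑ j, Γ.ptCls (q j z) := by
  let e := Fintype.equivFin ι
  let e' := Fintype.equivFin κ
  have h1 : Continuous fun r : (Fin (Fintype.card ι) → Γ.Pt) × (Fin (Fintype.card κ) → Γ.Pt) =>
      Γ.cls (∑ i, Finsupp.single (r.1 i) 1 - ∑ j, Finsupp.single (r.2 j) 1) :=
    continuous_iff_coinduced_le.2 (le_iSup (fun k : ℕ × ℕ => TopologicalSpace.coinduced
      (fun p : (Fin k.1 → Γ.Pt) × (Fin k.2 → Γ.Pt) =>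
        Γ.cls (∑ i, Finsupp.single (p.1 i) 1 - ∑ j, Finsupp.single (p.2 j) 1)) inferInstance)
      (Fintype.card ι, Fintype.card κ))
  have h2 : Continuous fun z => ((fun i => p (e.symm i) z, fun j => q (e'.symm j) z) :
      (Fin (Fintype.card ι) → Γ.Pt) × (Fin (Fintype.card κ) → Γ.Pt)) :=
    (continuous_pi fun i => hp _).prodMk (continuous_pi fun j => hq _)
  convert h1.comp h2 using 2 with z
  rw [Function.comp_apply, ← clsHom_apply, map_sub, map_sum, map_sum]
  unfold ptCls
  rw [← e.symm.sum_comp, ← e'.symm.sum_comp]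

theorem continuous_pt (x : Γ.X) : Continuous (Γ.pt x) :=
  continuous_quot_mk.comp (continuous_sigmaMk.comp continuous_projIcc)

theorem edgeCls_of_mem_Icc {x : Γ.X} {s : ℝ} (h0 : 0 ≤ s) (h1 : s ≤ 1) : Γ.edgeCls x s =
    Γ.ptCls (Γ.pt x (s * Γ.len x)) - Γ.ptCls (Γ.vpt (Γ.root x)) := by
  rcases h1.eq_or_lt with rfl | h
  · have := edgeCls_int x 1
    rw [Int.cast_one] at this
    rw [this, one_smul, one_mul, pt_len]
  · exact edgeCls_of_mem h0 h

/-- All classes in the torus are represented by flows in a bounded set, as the coordinates can be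
reduced modulo one. -/
theorem PeriodMap.exists_bounded : ∃ M : ℝ, ∀ t, ∃ μ, Γ.IsFlow μ ∧ ϖ.toTorus μ = t ∧
    ∀ x, |μ x| ≤ M := by
  choose m hm hθ using fun j => ϖ.exists_flow (Pi.single j 1)
  have hP : ∃ Q : ℝ, ∀ x, ∑ j, |m j x| ≤ Q := by
    obtain ⟨Q, hQ⟩ := (Set.finite_range fun x => ∑ j, |m j x|).bddAbove
    exact ⟨Q, fun x => hQ ⟨x, rfl⟩⟩
  obtain ⟨Q, hQ⟩ := hP
  refine ⟨Q, fun t => ?_⟩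
  choose a ha using fun j => QuotientAddGroup.mk_surjective (t j)
  refine ⟨∑ j, Int.fract (a j) • m j, fun x => ?_, ?_, fun x => ?_⟩
  · simp only [Finset.sum_apply, Pi.smul_apply, hm _ x, smul_eq_mul, mul_neg,
      Finset.sum_neg_distrib]
  · funext j
    have h1 : ϖ.θ (∑ j, Int.fract (a j) • m j) j = Int.fract (a j) := by
      rw [map_sum, Finset.sum_apply]
      simp [hθ, Pi.single_apply]
    change ((ϖ.θ (∑ j, Int.fract (a j) • m j) j : ℝ) : UnitAddCircle) = _
    rw [h1, ← ha j, Int.fract, AddCircle.coe_sub]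
    have : ((⌊a j⌋ : ℝ) : UnitAddCircle) = 0 := (AddCircle.coe_eq_zero_iff 1).2 ⟨⌊a j⌋, by simp⟩
    rw [this, sub_zero]
  · rw [Finset.sum_apply]
    refine (Finset.abs_sum_le_sum_abs _ _).trans (le_trans (Finset.sum_le_sum fun j _ => ?_) (hQ x))
    rw [Pi.smul_apply, smul_eq_mul, abs_mul, abs_of_nonneg (Int.fract_nonneg _)]
    exact mul_le_of_le_one_left (abs_nonneg _) (Int.fract_lt_one _).le

theorem clsHom_divOf_baseDiv (d : ℤ) {μ : Γ.X → ℝ} (hμ : Γ.IsFlow μ) :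
    Γ.clsHom (Γ.divOf (flowDiv (π.baseDiv d) μ) fun x => Int.fract (μ x)) =
      d • Γ.ptCls (Γ.vpt π.base) + Γ.flowCls μ := by
  rw [clsHom_divOf_flow _ hμ]
  simp [Paths.baseDiv, ite_smul]

theorem degHom_divOf_baseDiv (d : ℤ) {μ : Γ.X → ℝ} (hμ : Γ.IsFlow μ) :
    Γ.degHom (Γ.divOf (flowDiv (π.baseDiv d) μ) fun x => Int.fract (μ x)) = d := by
  rw [degHom_divOf_flow _ hμ, π.sum_baseDiv]

theorem smul_ptCls_add_flowCls_mem (d : ℤ) {μ : Γ.X → ℝ} (hμ : Γ.IsFlow μ) :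
    d • Γ.ptCls (Γ.vpt π.base) + Γ.flowCls μ ∈ Γ.PicDeg d := by
  rw [← clsHom_divOf_baseDiv π d hμ]
  exact ⟨_, degHom_divOf_baseDiv π d hμ, rfl⟩

theorem ajPic_baseDiv (d : ℤ) {μ : Γ.X → ℝ} (hμ : Γ.IsFlow μ) :
    ajPic π ϖ (d • Γ.ptCls (Γ.vpt π.base) + Γ.flowCls μ) = ϖ.toTorus μ := by
  have h : Γ.IsCycle (π.P π.base) := ⟨π.flow _, fun v => by rw [π.out, sub_self]⟩
  rw [map_add, map_zsmul, ajPic_ptCls, ajPt_vpt, ϖ.toTorus_cycle h, smul_zero, zero_add,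
    ajPic_flowCls π ϖ hμ]

/-- A class is determined by its degree and by any flow with the same image in the torus. -/
theorem eq_of_ajPic_eq {d : ℤ} {c : Γ.Pic} (hcd : c ∈ Γ.PicDeg d) {μ : Γ.X → ℝ}
    (hμ : Γ.IsFlow μ) (h : ϖ.toTorus μ = ajPic π ϖ c) :
    c = d • Γ.ptCls (Γ.vpt π.base) + Γ.flowCls μ :=
  ajPic_injOn π ϖ d hcd (smul_ptCls_add_flowCls_mem π d hμ) (by rw [ajPic_baseDiv π ϖ d hμ, h])

/-- A bounded set of flows represents all classes, and the class of a flow in this set is given by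
moving a fixed number of chips along the half-edges, continuously in the flow. -/
theorem isCompact_picDeg (π : Γ.Paths) (ϖ : Γ.PeriodMap) (d : ℤ) : IsCompact (Γ.PicDeg d) := by
  classical
  obtain ⟨M, hM⟩ := ϖ.exists_bounded
  obtain ⟨N, hN⟩ := exists_nat_gt (max M 0)
  have hN0 : (0 : ℝ) < N := (le_max_right _ _).trans_lt hN
  -- `N` chips are moved along each half-edge `x` by the same part `s x` of its length
  let μ : (Γ.X → Set.Icc (0 : ℝ) 1) → Γ.X → ℝ := fun s x => N * ((s x : ℝ) - s (Γ.i x))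
  have hμ : ∀ s, Γ.IsFlow (μ s) := fun s x => by simp only [μ, Γ.i_i]; ring
  let F : (Γ.X → Set.Icc (0 : ℝ) 1) → Γ.Pic := fun s =>
    d • Γ.ptCls (Γ.vpt π.base) + Γ.flowCls (μ s)
  have hF : ∀ s, F s =
      ∑ i : (Γ.X × Fin N) ⊕ Fin d.toNat,
        Γ.ptCls (i.elim (fun k => Γ.pt k.1 ((s k.1 : ℝ) * Γ.len k.1)) fun _ => Γ.vpt π.base) -
      ∑ j : (Γ.X × Fin N) ⊕ Fin (-d).toNat,
        Γ.ptCls (j.elim (fun k => Γ.vpt (Γ.root k.1)) fun _ => Γ.vpt π.base) := fun s => by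
    have h1 : Γ.flowCls (μ s) = N • ∑ x, Γ.edgeCls x (s x) := by
      rw [sum_or (G := Γ.toMGraph) _ fun x hx => edgeCls_of_fix hx _, Finset.smul_sum]
      refine Finset.sum_congr rfl fun x _ => ?_
      rw [edgeCls_i, ← sub_eq_add_neg, ← edgeCls_sub]
      have := map_nsmul (Γ.edgeHom x) N ((s x : ℝ) - s (Γ.i x))
      rw [nsmul_eq_mul] at this
      exact this
    have h2 : ∀ x, Γ.edgeCls x (s x) = Γ.ptCls (Γ.pt x ((s x : ℝ) * Γ.len x)) -
        Γ.ptCls (Γ.vpt (Γ.root x)) := fun x => edgeCls_of_mem_Icc (s x).2.1 (s x).2.2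
    simp only [F]
    rw [h1]
    simp only [h2, Fintype.sum_sum_type, Sum.elim_inl, Sum.elim_inr, Fintype.sum_prod_type,
      Finset.sum_const, Finset.card_univ, Fintype.card_fin, Finset.smul_sum, smul_sub,
      Finset.sum_sub_distrib]
    have h3 : d • Γ.ptCls (Γ.vpt π.base) = d.toNat • Γ.ptCls (Γ.vpt π.base) -
        (-d).toNat • Γ.ptCls (Γ.vpt π.base) := by
      rw [← natCast_zsmul, ← natCast_zsmul, ← sub_smul, Int.toNat_sub_toNat_neg]
    rw [h3]
    abel
  have hcont : Continuous F := by
    rw [funext hF]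
    refine continuous_sum_ptCls (fun i => ?_) fun j => ?_
    · rcases i with k | k
      · exact (continuous_pt _).comp
          ((continuous_subtype_val.comp (continuous_apply k.1)).mul continuous_const)
      · exact continuous_const
    · exact continuous_const
  convert isCompact_range hcont
  ext c
  constructor
  · intro hcd
    obtain ⟨η, hη, ht, hb⟩ := hM (ajPic π ϖ c)
    have hpos : ∀ x, max (η x) 0 / N ∈ Set.Icc (0 : ℝ) 1 := fun x =>
      ⟨by positivity, by
        rw [div_le_one hN0]
        exact (max_le_max_right 0 ((le_abs_self _).trans (hb x))).trans hN.le⟩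
    refine ⟨fun x => ⟨_, hpos x⟩, ?_⟩
    rw [eq_of_ajPic_eq π ϖ hcd hη ht]
    simp only [F]
    congr 2
    funext x
    simp only [μ, hη x]
    rw [mul_sub, mul_div_cancel₀ _ hN0.ne', mul_div_cancel₀ _ hN0.ne']
    rcases le_total (η x) 0 with h | h
    · rw [max_eq_right h, max_eq_left (by linarith)]; ring
    · rw [max_eq_left h, max_eq_right (by linarith)]; ring
  · rintro ⟨s, rfl⟩
    exact smul_ptCls_add_flowCls_mem π d (hμ s)

/-- The tropical Abel-Jacobi theorem. -/
noncomputable def picHomeo (d : ℤ) : Γ.PicDeg d ≃ₜ Γ.Torus :=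
  haveI : CompactSpace (Γ.PicDeg d) := isCompact_iff_compactSpace.1 (isCompact_picDeg π ϖ d)
  Continuous.homeoOfEquivCompactToT2
    (f := Equiv.ofBijective (fun c : Γ.PicDeg d => ajPic π ϖ c)
      ⟨fun c c' h => Subtype.ext (ajPic_injOn π ϖ d c.2 c'.2 h), fun t => by
        obtain ⟨μ, hμ, h⟩ := ϖ.exists_toTorus t
        exact ⟨⟨_, smul_ptCls_add_flowCls_mem π d hμ⟩, (ajPic_baseDiv π ϖ d hμ).trans h⟩⟩)
    ((continuous_ajPic π ϖ).comp continuous_subtype_val)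

end TCurve

/-! ### Contractions of stars -/

namespace MGraph

variable {n : ℕ} {G G' : MGraph n}

/-- A star, consisting of a vertex `z`, a set `K` of half-edges at `z`, and the opposite half-edges,
rooted at distinct vertices of weight zero, is connected of the same genus as `z`. -/
theorem star_connOn_genusOn {S K : Set G.X} {z : G.X} (hz : G.r z = z) (hK : ∀ x ∈ K, G.r x = z)
    (hKi : ∀ x ∈ K, G.r (G.i x) ≠ z) (hh : ∀ x ∈ K, G.h (G.i x) = 0)
    (hinj : Set.InjOn (fun x => G.r (G.i x)) K)
    (hS : ∀ y, y ∈ S ↔ y = z ∨ y ∈ K ∨ G.i y ∈ K ∨ ∃ x ∈ K, y = G.r (G.i x)) :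
    G.ConnOn S ∧ G.genusOn S = G.h z := by
  classical
  have hi : ∀ x ∈ K, G.i x ≠ x := fun x hx h => hKi x hx (by rw [h, hK x hx])
  have hfl : ∀ x ∈ K, G.r x ≠ x := fun x hx => flag_of_half (hi x hx)
  have hfl' : ∀ x ∈ K, G.r (G.i x) ≠ G.i x := fun x hx => flag_i (hfl x hx)
  have hzS : z ∈ S := (hS z).2 (Or.inl rfl)
  have hvert : ∀ y ∈ S, G.r y = y → y = z ∨ ∃ x ∈ K, y = G.r (G.i x) := by
    intro y hy hr
    rcases (hS y).1 hy with h | h | h | h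
    · exact Or.inl h
    · exact absurd hr (hfl y h)
    · have := hfl' _ h
      rw [G.i_i] at this
      exact absurd hr this
    · exact Or.inr h
  constructor
  · refine ⟨⟨z, hzS, hz⟩, fun v hv w hw hrv hrw => ?_⟩
    have h1 : Relation.ReflTransGen (fun a b => ∃ x ∈ S, G.r x = a ∧ G.r (G.i x) = b) v z := by
      rcases hvert v hv hrv with rfl | ⟨x, hx, rfl⟩
      · exact Relation.ReflTransGen.refl
      · exact Relation.ReflTransGen.single ⟨G.i x, (hS _).2 (by simp [G.i_i, hx]), rfl,
          by rw [G.i_i, hK x hx]⟩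
    have h2 : Relation.ReflTransGen (fun a b => ∃ x ∈ S, G.r x = a ∧ G.r (G.i x) = b) z w := by
      rcases hvert w hw hrw with rfl | ⟨x, hx, rfl⟩
      · exact Relation.ReflTransGen.refl
      · exact Relation.ReflTransGen.single ⟨x, (hS _).2 (by simp [hx]), hK x hx, rfl⟩
    exact h1.trans h2
  · have e1 : {x | x ∈ S ∧ G.i x ≠ x} = K ∪ G.i '' K := by
      ext y
      simp only [Set.mem_ofPred_eq, Set.mem_union, Set.mem_image]
      constructor
      · rintro ⟨hy, hne⟩
        rcases (hS y).1 hy with rfl | h | h | ⟨x, hx, rfl⟩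
        · exact absurd (i_vertex hz) hne
        · exact Or.inl h
        · exact Or.inr ⟨_, h, G.i_i y⟩
        · exact absurd (G.i_r _) hne
      · rintro (h | ⟨x, hx, rfl⟩)
        · exact ⟨(hS y).2 (by simp [h]), hi y h⟩
        · exact ⟨(hS _).2 (by simp [G.i_i, hx]), i_half (hi x hx)⟩
    have e2 : {x | x ∈ S ∧ G.r x = x} = insert z ((fun x => G.r (G.i x)) '' K) := by
      ext y
      simp only [Set.mem_ofPred_eq, Set.mem_insert_iff, Set.mem_image]
      constructor
      · rintro ⟨hy, hr⟩
        rcases hvert y hy hr with h | ⟨x, hx, h⟩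
        · exact Or.inl h
        · exact Or.inr ⟨x, hx, h.symm⟩
      · rintro (rfl | ⟨x, hx, rfl⟩)
        · exact ⟨hzS, hz⟩
        · exact ⟨(hS _).2 (Or.inr (Or.inr (Or.inr ⟨x, hx, rfl⟩))), G.r_r _⟩
    have hz' : z ∉ (fun x => G.r (G.i x)) '' K := by
      rintro ⟨x, hx, h⟩
      exact hKi x hx h
    have hd : Disjoint K (G.i '' K) := by
      rw [Set.disjoint_left]
      rintro _ h ⟨x, hx, rfl⟩
      exact hKi x hx (hK _ h)
    unfold genusOn b1On
    rw [e1, e2, Set.ncard_union_eq hd (Set.toFinite _) (Set.toFinite _),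
      Set.ncard_image_of_injective _ (fun a b h => by rw [← G.i_i a, h, G.i_i]),
      Set.ncard_insert_of_notMem hz' (Set.toFinite _), hinj.ncard_image,
      finsum_mem_insert _ hz' (Set.toFinite _), finsum_mem_image hinj]
    have h0 : ∑ᶠ x ∈ K, (G.h (G.r (G.i x)) : ℤ) = 0 := by
      rw [finsum_mem_congr rfl (g := fun _ => (0 : ℤ)) fun x hx => by rw [G.h_r, hh x hx]; simp]
      simp
    rw [h0]
    push_cast
    omega

end MGraph

namespace TCurve

variable {n : ℕ} {g : ℕ} {C Γ : TCurve n}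

/-- Isomorphisms are morphisms of graphs: the fibres over the vertices are stars without edges. -/
theorem Iso.isMor {C C' : TCurve n} (a : Iso C C') : IsMor C.toMGraph C'.toMGraph a.toEquiv := by
  have hstar : ∀ v, C'.r v = v → C.ConnOn {x | a.toEquiv x = v} ∧
      C.genusOn {x | a.toEquiv x = v} = C'.h v := fun v hv => by
    obtain ⟨w, rfl⟩ := a.toEquiv.surjective v
    rw [a.map_h]
    refine star_connOn_genusOn (K := ∅) ((a.map_flag w).1 hv) ?_ ?_ ?_ ?_ fun y => ?_
    · simp
    · simp
    · simp
    · simp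
    · simp
  exact ⟨a.map_r, a.map_i, fun f _ => ⟨a.toEquiv.symm f, by simp, fun y hy => by simp [← hy]⟩,
    a.map_m, fun v hv => (hstar v hv).1, fun v hv => (hstar v hv).2⟩

/-! ### Subdivisions -/

/-- `C` is obtained from `Γ` by inserting an exceptional vertex on each edge `{x, i x}` with
`ν x ≠ 0`, at `ν x` times the length of `x` along `x`. The map `j` sends a vertex of `Γ` to the
same vertex of `C`, and a flag to the flag of `C` with the same germ. -/
structure IsSubdiv (C Γ : TCurve n) (j : Γ.X → C.X) (ν : Γ.X → ℝ) : Prop where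
  inj : Function.Injective j
  map_r : ∀ x, j (Γ.r x) = C.r (j x)
  map_h : ∀ x, C.h (j x) = Γ.h x
  map_m : ∀ k, j (Γ.m k).1 = (C.m k).1
  nexc : ∀ x, ¬ C.Exc (C.r (j x))
  surj : ∀ z, ¬ C.Exc (C.r z) → ∃ x, j x = z
  exc : ∀ x, C.Exc (C.r (C.i (j x))) ↔ ν x ≠ 0
  i_zero : ∀ x, ν x = 0 → C.i (j x) = j (Γ.i x)
  i_opp : ∀ x, ν x ≠ 0 → C.opp (C.i (j x)) = C.i (j (Γ.i x))
  len : ∀ x, C.len (j x) = if ν x = 0 then Γ.len x else ν x * Γ.len x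
  frac : Γ.IsFrac ν
  fix : ∀ x, Γ.i x = x → ν x = 0

/-- The inclusion of the flags of the stabilization. -/
noncomputable def incl {hC : IsQS g C.toMGraph} (ψ : Iso (C.stab hC) Γ) (x : Γ.X) : C.X :=
  (ψ.toEquiv.symm x).1

open Classical in
/-- The relative position of the exceptional vertex on an edge of the stabilization. -/
noncomputable def param {hC : IsQS g C.toMGraph} (ψ : Iso (C.stab hC) Γ) (x : Γ.X) : ℝ :=
  if C.Exc (C.r (C.i (incl ψ x))) then C.len (incl ψ x) / Γ.len x else 0

/-- A quasi-stable curve is a subdivision of its stabilization. -/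
theorem isSubdiv {hC : IsQS g C.toMGraph} (ψ : Iso (C.stab hC) Γ) :
    IsSubdiv C Γ (incl ψ) (param ψ) := by
  have hψ : ∀ x, ψ.toEquiv (ψ.toEquiv.symm x) = x := ψ.toEquiv.apply_symm_apply
  have hr : ∀ x, incl ψ (Γ.r x) = C.r (incl ψ x) := fun x => by
    have h := ψ.map_r (ψ.toEquiv.symm x)
    rw [hψ] at h
    unfold incl
    rw [← h, Equiv.symm_apply_apply]
  have hi : ∀ x, incl ψ (Γ.i x) = C.stabInv (incl ψ x) := fun x => by
    have h := ψ.map_i (ψ.toEquiv.symm x)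
    rw [hψ] at h
    unfold incl
    rw [← h, Equiv.symm_apply_apply]
  have hlen : ∀ x, Γ.len x = C.stabLen (incl ψ x) := fun x => by
    have h := ψ.map_len (ψ.toEquiv.symm x)
    rw [hψ] at h
    exact h
  have hne : ∀ x, ¬ C.Exc (C.r (incl ψ x)) := fun x => (ψ.toEquiv.symm x).2
  have hhalf : ∀ x, C.Exc (C.r (C.i (incl ψ x))) → C.i (incl ψ x) ≠ incl ψ x :=
    fun x he h => hne x (by rw [h] at he; exact he)
  have hiopp : ∀ x, C.Exc (C.r (C.i (incl ψ x))) →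
      C.opp (C.i (incl ψ x)) = C.i (incl ψ (Γ.i x)) := fun x he => by
    rw [hi]
    unfold stabInv
    rw [if_pos he, C.i_i]
  have hei : ∀ x, C.Exc (C.r (C.i (incl ψ x))) → C.Exc (C.r (C.i (incl ψ (Γ.i x)))) :=
    fun x he => by rw [← hiopp x he, IsQS.opp_root (hne x) he]; exact he
  have hei' : ∀ x, C.Exc (C.r (C.i (incl ψ (Γ.i x)))) → C.Exc (C.r (C.i (incl ψ x))) :=
    fun x he => by have := hei _ he; rwa [Γ.i_i] at this
  have hsum : ∀ x, C.Exc (C.r (C.i (incl ψ x))) →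
      Γ.len x = C.len (incl ψ x) + C.len (incl ψ (Γ.i x)) := fun x he => by
    rw [hlen]
    unfold stabLen
    rw [if_pos he, hiopp x he, C.len_i]
  have hpos : ∀ x, C.Exc (C.r (C.i (incl ψ x))) → 0 < C.len (incl ψ x) := fun x he =>
    C.len_pos _ (hhalf x he)
  have hexc : ∀ x, C.Exc (C.r (C.i (incl ψ x))) ↔ param ψ x ≠ 0 := fun x => by
    unfold param
    constructor
    · intro he
      rw [if_pos he, hsum x he]
      have := hpos x he
      have := hpos _ (hei x he)
      positivity
    · intro h
      by_contra he
      exact h (if_neg he)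
  have hfix : ∀ x, Γ.i x = x → param ψ x = 0 := fun x hx => by
    unfold param
    refine if_neg fun he => ?_
    have h1 := hiopp x he
    rw [hx] at h1
    exact IsQS.opp_ne (hne x) he h1
  refine ⟨fun x y h => ψ.toEquiv.symm.injective (Subtype.ext h), hr, fun x => ?_, fun k => ?_, hne,
    fun z hz => ⟨ψ.toEquiv ⟨z, hz⟩, by unfold incl; rw [Equiv.symm_apply_apply]⟩, hexc,
    fun x hx => ?_, fun x hx => hiopp x ((hexc x).2 hx), fun x => ?_, fun x => ?_, hfix⟩
  · have h := ψ.map_h (ψ.toEquiv.symm x)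
    rw [hψ] at h
    exact h.symm
  · have h := ψ.map_m k
    unfold incl
    rw [← h, Equiv.symm_apply_apply]
    rfl
  · rw [hi]
    unfold stabInv
    rw [if_neg (fun he => (hexc x).1 he hx)]
  · by_cases he : C.Exc (C.r (C.i (incl ψ x)))
    · rw [if_neg ((hexc x).1 he)]
      unfold param
      rw [if_pos he, div_mul_cancel₀]
      rw [hsum x he]
      have := hpos x he
      have := hpos _ (hei x he)
      positivity
    · rw [if_pos (by by_contra h; exact he ((hexc x).2 h)), hlen]
      unfold stabLen
      rw [if_neg he]
  · by_cases he : C.Exc (C.r (C.i (incl ψ x)))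
    · have h1 := hpos x he
      have h2 := hpos _ (hei x he)
      rw [if_neg ((hexc x).1 he)]
      unfold param
      rw [if_pos he, if_pos (hei x he), Γ.len_i, hsum x he]
      refine ⟨by positivity, ?_, ?_⟩
      · rw [div_lt_one (by positivity)]; linarith
      · field_simp; ring
    · have h0 : param ψ x = 0 := if_neg he
      rw [if_pos h0, h0]
      exact ⟨le_rfl, one_pos, if_neg fun h => he (hei' x h)⟩

/-- The vertices and flags of a subdivision: those of the original curve, and, for each half-edge
with an exceptional vertex, the opposite half-edge, and, for each edge with an exceptional vertex,
this vertex. -/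
abbrev SubX (Γ : TCurve n) (ν : Γ.X → ℝ) : Type :=
  Γ.X ⊕ {x : Γ.X // ν x ≠ 0} ⊕ {x : Γ.X // Γ.Or x ∧ ν x ≠ 0}

namespace IsSubdiv

variable {j : Γ.X → C.X} {ν : Γ.X → ℝ} (h : IsSubdiv C Γ j ν)

include h

theorem param_i {x : Γ.X} (hx : ν x ≠ 0) : ν (Γ.i x) ≠ 0 := by
  rw [(h.frac x).2.2, if_neg hx]
  linarith [(h.frac x).2.1]

theorem r_i_opp {x : Γ.X} (hx : ν x ≠ 0) : C.r (C.i (j (Γ.i x))) = C.r (C.i (j x)) := by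
  rw [← h.i_opp x hx, IsQS.opp_root (h.nexc x) ((h.exc x).2 hx)]

theorem i_flag {x : Γ.X} (hx : ν x ≠ 0) : C.r (C.i (j x)) ≠ C.i (j x) :=
  IsQS.i_flag (h.nexc x) ((h.exc x).2 hx)

/-- The two flags at an exceptional vertex. -/
theorem eq_or_of_r_i {x : Γ.X} (hx : ν x ≠ 0) {z : C.X} (hz : C.r z ≠ z)
    (hr : C.r z = C.r (C.i (j x))) : z = C.i (j x) ∨ z = C.i (j (Γ.i x)) := by
  by_cases h1 : z = C.i (j x)
  · exact Or.inl h1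
  · right
    rw [← h.i_opp x hx]
    exact (opp_unique (h.i_flag hx) ((h.exc x).2 hx) hz hr h1).symm

theorem eq_or_of_r_i_eq {x y : Γ.X} (hx : ν x ≠ 0) (hy : ν y ≠ 0)
    (hr : C.r (C.i (j y)) = C.r (C.i (j x))) : y = x ∨ y = Γ.i x := by
  rcases h.eq_or_of_r_i hx (h.i_flag hy) hr with h1 | h1
  · exact Or.inl (h.inj (by rw [← C.i_i (j y), h1, C.i_i]))
  · exact Or.inr (h.inj (by rw [← C.i_i (j y), h1, C.i_i]))

omit h in
/-- The comparison map from the vertices and flags described in terms of `Γ`. -/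
def toFun (_ : IsSubdiv C Γ j ν) : SubX Γ ν → C.X :=
  Sum.elim j (Sum.elim (fun x => C.i (j x.1)) fun x => C.r (C.i (j x.1)))

/-- The vertices and flags of a subdivision are determined by `Γ` and `ν`: the flags at an
exceptional vertex are opposite to flags coming from `Γ`, as exceptional vertices are not adjacent.
-/
theorem bijective_toFun (hC : IsQS g C.toMGraph) : Function.Bijective h.toFun := by
  constructor
  · rintro (x | ⟨x, hx⟩ | ⟨x, ho, hx⟩) (y | ⟨y, hy⟩ | ⟨y, ho', hy⟩) e <;>
      simp only [toFun, Sum.elim_inl, Sum.elim_inr] at e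
    · rw [h.inj e]
    · exact absurd ((h.exc y).2 hy) (e ▸ h.nexc x)
    · refine absurd ((h.exc y).2 hy) ?_
      rw [← C.r_r, ← e]
      exact h.nexc x
    · exact absurd ((h.exc x).2 hx) (e ▸ h.nexc y)
    · have : x = y := h.inj (by rw [← C.i_i (j x), e, C.i_i])
      subst this; rfl
    · exact absurd (by rw [e, C.r_r]) (h.i_flag hx)
    · refine absurd ((h.exc x).2 hx) ?_
      rw [← C.r_r, e]
      exact h.nexc y
    · exact absurd (by rw [← e, C.r_r]) (h.i_flag hy)
    · rcases h.eq_or_of_r_i_eq hy hx e with rfl | rfl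
      · rfl
      · exact absurd ho ho'.not_i
  · intro z
    by_cases hz : C.Exc (C.r z)
    · by_cases hf : C.r z = z
      · obtain ⟨a, ha, hr⟩ := exists_flag hz
        obtain ⟨x, hx⟩ := h.surj (C.i a) (hC.exc a ha (hr ▸ hz)).2
        have ha' : a = C.i (j x) := by rw [hx, C.i_i]
        have hν : ν x ≠ 0 := (h.exc x).1 (by rw [← ha', hr]; exact hz)
        have hi : Γ.i x ≠ x := fun hi => hν (h.fix x hi)
        rcases or_or hi with ho | ho
        · exact ⟨Sum.inr (Sum.inr ⟨x, ho, hν⟩), by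
            simp only [toFun, Sum.elim_inr]; rw [← ha', hr, hf]⟩
        · exact ⟨Sum.inr (Sum.inr ⟨_, ho, h.param_i hν⟩), by
            simp only [toFun, Sum.elim_inr]; rw [h.r_i_opp hν, ← ha', hr, hf]⟩
      · obtain ⟨x, hx⟩ := h.surj (C.i z) (hC.exc z hf hz).2
        have hz' : z = C.i (j x) := by rw [hx, C.i_i]
        exact ⟨Sum.inr (Sum.inl ⟨x, (h.exc x).1 (hz' ▸ hz)⟩), hz'.symm⟩
    · obtain ⟨x, rfl⟩ := h.surj z hz
      exact ⟨Sum.inl x, rfl⟩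

/-- Everything in a subdivision is obtained from the flags of `Γ` by the structure maps. -/
theorem cases (hC : IsQS g C.toMGraph) (z : C.X) :
    (∃ x, z = j x) ∨ (∃ x, ν x ≠ 0 ∧ z = C.i (j x)) ∨
      ∃ x, Γ.Or x ∧ ν x ≠ 0 ∧ z = C.r (C.i (j x)) := by
  obtain ⟨x | x | x, rfl⟩ := (h.bijective_toFun hC).2 z
  · exact Or.inl ⟨x, rfl⟩
  · exact Or.inr (Or.inl ⟨x.1, x.2, rfl⟩)
  · exact Or.inr (Or.inr ⟨x.1, x.2.1, x.2.2, rfl⟩)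

omit h in
/-- A vertex of `Γ`, as a vertex of the subdivision. -/
def vert (h : IsSubdiv C Γ j ν) (v : Γ.V) : C.V := ⟨j v.1, by rw [← h.map_r, v.2]⟩

omit h in
/-- The exceptional vertex on an edge. -/
def mid (_ : IsSubdiv C Γ j ν) (x : Γ.X) : C.V := C.root (C.i (j x))

theorem exc_mid {x : Γ.X} (hx : ν x ≠ 0) : C.Exc (h.mid x).1 := (h.exc x).2 hx

theorem nexc_vert (v : Γ.V) : ¬ C.Exc (h.vert v).1 := by
  have := h.nexc v.1
  rwa [← h.map_r, v.2] at this

theorem root_j (x : Γ.X) : C.root (j x) = h.vert (Γ.root x) := Subtype.ext (h.map_r x).symm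

theorem vert_injective : Function.Injective h.vert := fun _ _ e =>
  Subtype.ext (h.inj (congrArg Subtype.val e))

omit h in
/-- The vertices of a subdivision. -/
noncomputable def vertEquiv (h : IsSubdiv C Γ j ν) (hC : IsQS g C.toMGraph) :
    Γ.V ⊕ {x : Γ.X // Γ.Or x ∧ ν x ≠ 0} ≃ C.V :=
  Equiv.ofBijective (Sum.elim h.vert fun x => h.mid x.1) (by
    constructor
    · rintro (v | x) (w | y) e
      · exact congrArg Sum.inl (h.vert_injective e)
      · have e : h.vert v = h.mid y.1 := e
        exact absurd (e ▸ h.exc_mid y.2.2) (h.nexc_vert v)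
      · have e : h.mid x.1 = h.vert w := e
        exact absurd (e ▸ h.exc_mid x.2.2) (h.nexc_vert w)
      · have := (h.bijective_toFun hC).1 (a₁ := Sum.inr (Sum.inr x)) (a₂ := Sum.inr (Sum.inr y))
          (congrArg Subtype.val e)
        simpa using this
    · rintro ⟨z, hz⟩
      rcases h.cases hC z with ⟨x, rfl⟩ | ⟨x, hx, rfl⟩ | ⟨x, ho, hx, rfl⟩
      · exact ⟨Sum.inl ⟨x, h.inj (by rw [h.map_r, hz])⟩, rfl⟩
      · exact absurd hz (h.i_flag hx)
      · exact ⟨Sum.inr ⟨x, ho, hx⟩, rfl⟩)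

open Classical in
/-- A sum over the vertices of a subdivision, as a sum over the vertices of `Γ` and a sum over the
subdivided edges. -/
theorem sum_V (hC : IsQS g C.toMGraph) {M : Type*} [AddCommMonoid M] (f : C.V → M) :
    ∑ᶠ v, f v = ∑ v, f (h.vert v) +
      ∑ x with Γ.Or x, if ν x = 0 then 0 else f (h.mid x) := by
  rw [finsum_eq_sum_of_fintype, ← (h.vertEquiv hC).sum_comp, Fintype.sum_sum_type]
  congr 1
  have h1 : ∑ x with Γ.Or x, (if ν x = 0 then 0 else f (h.mid x)) =
      ∑ x with Γ.Or x ∧ ν x ≠ 0, f (h.mid x) := by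
    rw [← Finset.filter_filter, Finset.sum_filter (p := fun x => ν x ≠ 0)]
    refine Finset.sum_congr rfl fun x _ => ?_
    by_cases hx : ν x = 0 <;> simp [hx]
  rw [h1]
  exact (Finset.sum_subtype (Finset.univ.filter fun x => Γ.Or x ∧ ν x ≠ 0) (by simp)
    fun x => f (h.mid x)).symm

end IsSubdiv

end TCurve

/-! ### Semistable divisors on subdivisions -/

theorem MGraph.cut_compl {n : ℕ} (G : MGraph n) (S : Set G.V) : G.cut Sᶜ = G.cut S := by
  unfold cut
  rw [← Set.ncard_image_of_injective _ (f := G.i) fun a b h => by rw [← G.i_i a, h, G.i_i]]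
  congr 1
  ext y
  constructor
  · rintro ⟨x, ⟨h1, h2⟩, rfl⟩
    exact ⟨by simpa using h2, by rw [G.i_i]; exact h1⟩
  · rintro ⟨h1, h2⟩
    exact ⟨G.i y, ⟨h2, by rw [G.i_i]; simpa using h1⟩, G.i_i y⟩

namespace TCurve

variable {n : ℕ} {g : ℕ} {C Γ : TCurve n}

open Classical in
/-- The half-edges of `Γ` whose initial half leaves a set of vertices `S` when exceptional vertices
are inserted at `ν`. -/
noncomputable def leave (Γ : TCurve n) (ν : Γ.X → ℝ) (S : Finset Γ.V) : Finset Γ.X :=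
  {x | Γ.root x ∈ S ∧ (ν x = 0 → Γ.root (Γ.i x) ∉ S)}

/-- Semistability of the divisor with values `D` at the vertices of `Γ` on the subdivision at `ν`,
in terms of `Γ`. -/
def IsSSData (φ : Γ.V → ℝ) (D : Γ.V → ℤ) (ν : Γ.X → ℝ) : Prop :=
  ∀ S : Finset Γ.V, ∑ v ∈ S, φ v ≤ ∑ v ∈ S, (D v : ℝ) + ((Γ.leave ν S).card : ℝ) / 2

/-- Semistability of a flow is semistability of the divisor attached to it. The function `⌈μ x⌉`,
minus one half where `μ x` is not integral, is a flow, so that its net value out of a set of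
vertices is the sum over the boundary. -/
theorem isSS_iff {φ : Γ.V → ℝ} {D₀ : Γ.V → ℤ} {μ : Γ.X → ℝ} (hμ : Γ.IsFlow μ) :
    IsSS φ D₀ μ ↔ IsSSData φ (flowDiv D₀ μ) fun x => Int.fract (μ x) := by
  classical
  refine forall_congr' fun S => ?_
  -- `b` counts the exceptional vertices, and `a` is a flow by the choice of the correction term
  let b : Γ.X → ℝ := fun x => if Int.fract (μ x) = 0 then 0 else 1
  let a : Γ.X → ℝ := fun x => ⌈μ x⌉ - b x / 2
  have hflow : Γ.IsFlow a := fun x => by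
    simp only [a, b, hμ x, Int.ceil_neg, Int.fract_neg_eq_zero]
    have h0 := Int.floor_add_fract (μ x)
    push_cast
    split_ifs with h
    · have : (⌈μ x⌉ : ℤ) = ⌊μ x⌋ := by
        rw [Int.ceil_eq_iff]
        constructor <;> linarith
      rw [this]; ring
    · have : (⌈μ x⌉ : ℤ) = ⌊μ x⌋ + 1 := by
        rw [Int.ceil_eq_iff]
        have h1 := Int.fract_lt_one (μ x)
        have h2 := lt_of_le_of_ne (Int.fract_nonneg (μ x)) (Ne.symm h)
        push_cast
        constructor <;> linarith
      rw [this]; push_cast; ring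
  have h1 : ((Γ.leave (fun x => Int.fract (μ x)) S).card : ℝ) =
      ∑ x with Γ.root x ∈ S, b x + ∑ x ∈ Γ.bdry S, (1 - b x) := by
    unfold leave bdry
    rw [Finset.card_filter, Finset.sum_filter, Finset.sum_filter, ← Finset.sum_add_distrib]
    push_cast
    refine Finset.sum_congr rfl fun x _ => ?_
    simp only [b]
    by_cases h1 : Γ.root x ∈ S <;> by_cases h2 : Int.fract (μ x) = 0 <;>
      by_cases h3 : Γ.root (Γ.i x) ∈ S <;> simp [h1, h2, h3]
  have h2 : ∑ v ∈ S, ((Γ.out (fun x => ⌈μ x⌉) v : ℤ) : ℝ) =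
      ∑ x ∈ Γ.bdry S, a x + (∑ x with Γ.root x ∈ S, b x) / 2 := by
    rw [← sum_out_eq_bdry hflow]
    have h3 : ∑ v ∈ S, Γ.out b v = ∑ x with Γ.root x ∈ S, b x := by
      rw [← Finset.sum_fiberwise_of_maps_to (t := S) (g := Γ.root) (fun x hx => by simpa using hx)]
      refine Finset.sum_congr rfl fun v hv => ?_
      unfold MGraph.out
      rw [Finset.filter_filter]
      refine Finset.sum_congr ?_ fun _ _ => rfl
      ext x
      simp only [Finset.mem_filter, Finset.mem_univ, true_and]
      exact ⟨fun h => ⟨h ▸ hv, h⟩, fun h => h.2⟩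
    rw [← h3, Finset.sum_div, ← Finset.sum_add_distrib]
    refine Finset.sum_congr rfl fun v _ => ?_
    rw [← out_cast]
    unfold MGraph.out
    rw [Finset.sum_div, ← Finset.sum_add_distrib]
    refine Finset.sum_congr rfl fun x _ => ?_
    simp only [a]
    ring
  have h3 : ∑ x ∈ Γ.bdry S, ((⌈μ x⌉ : ℝ) - 1 / 2) =
      ∑ x ∈ Γ.bdry S, a x - (∑ x ∈ Γ.bdry S, (1 - b x)) / 2 := by
    rw [Finset.sum_div, ← Finset.sum_sub_distrib]
    refine Finset.sum_congr rfl fun x _ => ?_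
    simp only [a]
    ring
  have h4 : ∑ v ∈ S, ((flowDiv D₀ μ v : ℤ) : ℝ) =
      ∑ v ∈ S, (D₀ v : ℝ) - ∑ v ∈ S, ((Γ.out (fun x => ⌈μ x⌉) v : ℤ) : ℝ) := by
    unfold flowDiv
    push_cast
    rw [Finset.sum_sub_distrib]
  have h5 : ∑ v ∈ S, ((D₀ v : ℝ) - φ v) = ∑ v ∈ S, (D₀ v : ℝ) - ∑ v ∈ S, φ v :=
    Finset.sum_sub_distrib _ _
  rw [h4, h1, h2, h3, h5]
  constructor <;> intro h <;> linarith

namespace IsSubdiv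

variable {j : Γ.X → C.X} {ν : Γ.X → ℝ} (h : IsSubdiv C Γ j ν)

include h

theorem root_i_zero {x : Γ.X} (hx : ν x = 0) :
    C.root (C.i (j x)) = h.vert (Γ.root (Γ.i x)) := by
  rw [h.i_zero x hx, h.root_j]

theorem mid_mem_vert_image {x : Γ.X} (hx : ν x ≠ 0) (S : Set Γ.V) : h.mid x ∉ h.vert '' S := by
  rintro ⟨v, -, hv⟩
  exact h.nexc_vert v (hv ▸ h.exc_mid hx)

/-- The edges leaving a set of vertices of `Γ`, without exceptional vertices, in the subdivision. -/
theorem cut_vert (S : Finset Γ.V) : C.cut (h.vert '' (S : Set Γ.V)) = (Γ.leave ν S).card := by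
  classical
  have h1 : {z | C.root z ∈ h.vert '' (S : Set Γ.V) ∧ C.root (C.i z) ∉ h.vert '' (S : Set Γ.V)} =
      j '' (Γ.leave ν S : Set Γ.X) := by
    have key : ∀ x, (C.root (j x) ∈ h.vert '' (S : Set Γ.V) ∧
        C.root (C.i (j x)) ∉ h.vert '' (S : Set Γ.V)) ↔ x ∈ Γ.leave ν S := fun x => by
      rw [h.root_j, h.vert_injective.mem_set_image]
      unfold leave
      simp only [Finset.mem_filter, Finset.mem_univ, true_and, Finset.mem_coe]
      refine and_congr_right fun _ => ?_
      by_cases hx : ν x = 0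
      · rw [h.root_i_zero hx, h.vert_injective.mem_set_image]
        simp [hx]
      · have : C.root (C.i (j x)) ∉ h.vert '' (S : Set Γ.V) := h.mid_mem_vert_image hx _
        simp [hx, this]
    ext z
    constructor
    · rintro ⟨h1, h2⟩
      obtain ⟨v, hv, he⟩ := h1
      obtain ⟨x, rfl⟩ := h.surj z (by
        have := h.nexc_vert v
        rwa [he] at this)
      exact ⟨x, (key x).1 ⟨⟨v, hv, he⟩, h2⟩, rfl⟩
    · rintro ⟨x, hx, rfl⟩
      exact (key x).2 hx
  unfold cut
  rw [h1, Set.ncard_image_of_injective _ h.inj, Set.ncard_coe_finset]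

open Classical in
/-- Adding exceptional vertices to a set of vertices decreases the number of edges leaving it by at
most two for each of them. -/
theorem card_leave_le (S : Set C.V) :
    (Γ.leave ν {v | h.vert v ∈ S}).card ≤ C.cut S +
      2 * ∑ x with Γ.Or x, if ν x = 0 then 0 else if h.mid x ∈ S then 1 else 0 := by
  let A : Finset Γ.X := {x | C.root (j x) ∈ S ∧ C.root (C.i (j x)) ∉ S}
  let B : Finset Γ.X := {x | ν x ≠ 0 ∧ h.mid x ∈ S}
  have h1 : Γ.leave ν {v | h.vert v ∈ S} ⊆ A ∪ B := by
    intro x hx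
    simp only [leave, A, B, Finset.mem_filter, Finset.mem_univ, true_and, Finset.mem_union,
      h.root_j] at hx ⊢
    by_cases hm : C.root (C.i (j x)) ∈ S
    · right
      refine ⟨fun h0 => hx.2 h0 ?_, hm⟩
      rwa [h.root_i_zero h0] at hm
    · exact Or.inl ⟨hx.1, hm⟩
  have h2 : A.card ≤ C.cut S := by
    unfold cut
    rw [← Finset.card_image_of_injective A h.inj, ← Set.ncard_coe_finset]
    refine Set.ncard_le_ncard ?_ (Set.toFinite _)
    intro z hz
    obtain ⟨x, hx, rfl⟩ := Finset.mem_image.1 (Finset.mem_coe.1 hz)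
    simpa [A] using hx
  have h3 : B.card =
      2 * ∑ x with Γ.Or x, if ν x = 0 then 0 else if h.mid x ∈ S then 1 else 0 := by
    have h4 : B.card = ∑ x, if ν x = 0 then 0 else if h.mid x ∈ S then 1 else 0 := by
      simp only [B]
      rw [Finset.card_filter]
      refine Finset.sum_congr rfl fun x _ => ?_
      by_cases hx : ν x = 0 <;> simp [hx]
    rw [h4, sum_or (G := Γ.toMGraph) _ fun x hx => by rw [if_pos (h.fix x hx)], Finset.mul_sum]
    refine Finset.sum_congr rfl fun x _ => ?_
    by_cases hx : ν x = 0
    · have : ν (Γ.i x) = 0 := by rw [(h.frac x).2.2, if_pos hx]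
      rw [if_pos hx, if_pos this, mul_zero, add_zero]
    · have : h.mid (Γ.i x) = h.mid x := Subtype.ext (h.r_i_opp hx)
      rw [if_neg hx, if_neg (h.param_i hx), this]
      ring
  calc _ ≤ (A ∪ B).card := Finset.card_le_card h1
    _ ≤ A.card + B.card := Finset.card_union_le _ _
    _ ≤ _ := by rw [h3]; omega

theorem sum_vert_image {M : Type*} [AddCommMonoid M] (S : Finset Γ.V) (f : C.V → M) :
    ∑ᶠ v ∈ h.vert '' (S : Set Γ.V), f v = ∑ v ∈ S, f (h.vert v) := by
  rw [finsum_mem_image h.vert_injective.injOn, finsum_mem_coe_finset]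

open Classical in
theorem sum_mem_V (hC : IsQS g C.toMGraph) {M : Type*} [AddCommMonoid M] (S : Set C.V)
    (f : C.V → M) : ∑ᶠ v ∈ S, f v = ∑ v with h.vert v ∈ S, f (h.vert v) +
      ∑ x with Γ.Or x, if ν x = 0 then 0 else if h.mid x ∈ S then f (h.mid x) else 0 := by
  rw [finsum_mem_def, h.sum_V hC]
  simp only [Set.indicator_apply]
  rw [← Finset.sum_filter]

end IsSubdiv

section stability

variable {φ : UnivStab g n} {hC : IsQS g C.toMGraph} (ψ : Iso (C.stab hC) Γ)

/-- The extension of the stability condition to a subdivision of `Γ` has the values of the stability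
condition on `Γ`, by compatibility with the isomorphism from the stabilization to `Γ`. -/
theorem onQS_vert (hΓ : IsStable g Γ.toMGraph) (v : Γ.V) :
    φ.onQS hC ((isSubdiv ψ).vert v) = φ.val Γ.toMGraph hΓ v := by
  have hv := (isSubdiv ψ).nexc_vert v
  unfold UnivStab.onQS
  rw [dif_neg hv, φ.compat _ _ hC.stab_isStable hΓ ψ.toEquiv ψ.isMor v]
  have hw : ∀ w : {w : (C.stab hC).V // ψ.toEquiv w.1 = v.1},
      w.1.1 = ψ.toEquiv.symm v.1 := fun w => ψ.toEquiv.eq_symm_apply.2 w.2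
  have hroot : (C.stab hC).r (ψ.toEquiv.symm v.1) = ψ.toEquiv.symm v.1 := by
    apply ψ.toEquiv.injective
    rw [ψ.map_r, Equiv.apply_symm_apply, v.2]
  rw [finsum_eq_single _ ⟨⟨ψ.toEquiv.symm v.1, hroot⟩, Equiv.apply_symm_apply _ _⟩
    fun w hw' => absurd (Subtype.ext (Subtype.ext (hw w))) hw']
  rfl

theorem onQS_mid {x : Γ.X} (hx : param ψ x ≠ 0) : φ.onQS hC ((isSubdiv ψ).mid x) = 0 := by
  unfold UnivStab.onQS
  rw [dif_pos ((isSubdiv ψ).exc_mid hx)]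

theorem sum_val (hΓ : IsStable g Γ.toMGraph) :
    ∑ v, φ.val Γ.toMGraph hΓ v = (φ.deg : ℝ) := by
  rw [← φ.sum_eq Γ.toMGraph hΓ, finsum_eq_sum_of_fintype]

/-- The semistability inequalities for `Γ` are those for the sets of non-exceptional vertices. -/
theorem isSSData_of_semistable (hΓ : IsStable g Γ.toMGraph) {D : C.V → ℤ}
    (hD : φ.Semistable hC D) :
    IsSSData (φ.val Γ.toMGraph hΓ) (fun v => D ((isSubdiv ψ).vert v)) (param ψ) := fun S => by
  have h := hD.le ((isSubdiv ψ).vert '' (S : Set Γ.V))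
  rw [(isSubdiv ψ).cut_vert, (isSubdiv ψ).sum_vert_image, (isSubdiv ψ).sum_vert_image] at h
  simp only [onQS_vert ψ hΓ] at h
  push_cast at h
  linarith

open Classical in
/-- The degree of a semistable divisor is the sum of its values at the vertices of `Γ` plus the
number of subdivided edges. -/
theorem semistable_sum {D : C.V → ℤ} (hD : φ.Semistable hC D) :
    ∑ v, D ((isSubdiv ψ).vert v) +
      ∑ x with Γ.Or x, (if param ψ x = 0 then 0 else 1) = φ.deg := by
  rw [← hD.degree, (isSubdiv ψ).sum_V hC]
  congr 1
  refine Finset.sum_congr rfl fun x _ => ?_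
  by_cases hx : param ψ x = 0
  · rw [if_pos hx, if_pos hx]
  · rw [if_neg hx, if_neg hx, hD.admissible _ ((isSubdiv ψ).exc_mid hx)]

open Classical in
/-- The semistability inequalities for the sets of non-exceptional vertices imply the others: an
exceptional vertex carries one chip, which compensates for the two edges at it. -/
theorem semistable_of_isSSData (hΓ : IsStable g Γ.toMGraph) {D : C.V → ℤ}
    (hadm : ∀ v : C.V, C.Exc v.1 → D v = 1)
    (hdeg : ∑ v, D ((isSubdiv ψ).vert v) +
      ∑ x with Γ.Or x, (if param ψ x = 0 then 0 else 1) = φ.deg)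
    (hss : IsSSData (φ.val Γ.toMGraph hΓ) (fun v => D ((isSubdiv ψ).vert v)) (param ψ)) :
    φ.Semistable hC D := by
  have hmid : ∀ x, param ψ x ≠ 0 → D ((isSubdiv ψ).mid x) = 1 := fun x hx =>
    hadm _ ((isSubdiv ψ).exc_mid hx)
  have hdeg' : ∑ᶠ v, D v = φ.deg := by
    rw [(isSubdiv ψ).sum_V hC, ← hdeg]
    congr 1
    refine Finset.sum_congr rfl fun x _ => ?_
    by_cases hx : param ψ x = 0
    · rw [if_pos hx, if_pos hx]
    · rw [if_neg hx, if_neg hx, hmid x hx]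
  have hφ : ∀ S : Set C.V, ∑ᶠ v ∈ S, φ.onQS hC v =
      ∑ v with (isSubdiv ψ).vert v ∈ S, φ.val Γ.toMGraph hΓ v := fun S => by
    rw [(isSubdiv ψ).sum_mem_V hC]
    simp only [onQS_vert ψ hΓ]
    rw [Finset.sum_eq_zero (s := Finset.univ.filter Γ.Or), add_zero]
    intro x _
    by_cases hx : param ψ x = 0
    · rw [if_pos hx]
    · rw [if_neg hx, onQS_mid ψ hx, ite_self]
  have hle : ∀ S : Set C.V, (∑ᶠ v ∈ S, φ.onQS hC v) - (C.cut S : ℝ) / 2 ≤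
      ((∑ᶠ v ∈ S, D v : ℤ) : ℝ) := fun S => by
    have h1 := hss {v | (isSubdiv ψ).vert v ∈ S}
    have h2 := (isSubdiv ψ).card_leave_le S
    have h3 : ∑ᶠ v ∈ S, D v = ∑ v with (isSubdiv ψ).vert v ∈ S, D ((isSubdiv ψ).vert v) +
        ((∑ x with Γ.Or x, if param ψ x = 0 then 0 else
          if (isSubdiv ψ).mid x ∈ S then 1 else 0 : ℕ) : ℤ) := by
      rw [(isSubdiv ψ).sum_mem_V hC]
      push_cast
      congr 1
      refine Finset.sum_congr rfl fun x _ => ?_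
      by_cases hx : param ψ x = 0
      · rw [if_pos hx, if_pos hx]
      · rw [if_neg hx, if_neg hx, hmid x hx]
    rw [h3, hφ]
    have h4 : ((Γ.leave (param ψ) {v | (isSubdiv ψ).vert v ∈ S}).card : ℝ) ≤ C.cut S +
        2 * ((∑ x with Γ.Or x, if param ψ x = 0 then 0 else
          if (isSubdiv ψ).mid x ∈ S then 1 else 0 : ℕ) : ℝ) := by exact_mod_cast h2
    rw [Int.cast_add, Int.cast_natCast, Int.cast_sum]
    linarith
  -- the upper bounds are the lower bounds for the complements
  have htot : ∀ {M : Type} [AddCommGroup M] (f : C.V → M) (S : Set C.V),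
      ∑ᶠ v ∈ S, f v + ∑ᶠ v ∈ Sᶜ, f v = ∑ᶠ v, f v := fun f S => by
    rw [← finsum_mem_union disjoint_compl_right (Set.toFinite _) (Set.toFinite _),
      Set.union_compl_self, finsum_mem_univ]
  refine ⟨hadm, hdeg', hle, fun S => ?_⟩
  have h1 := hle Sᶜ
  rw [cut_compl] at h1
  have h2 := htot D S
  have h3 := htot (φ.onQS hC) S
  have h4 : ∑ᶠ v, φ.onQS hC v = (φ.deg : ℝ) := by
    rw [← sum_val (φ := φ) hΓ, ← finsum_mem_univ, hφ]
    simp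
  rw [hdeg'] at h2
  rw [h4, ← h2] at h3
  push_cast at h3
  linarith

/-- On a trivial subdivision of `Γ` there are no exceptional vertices, so that generality excludes
all sets of vertices but the empty set and the whole. -/
theorem isGen_of_isGeneral (hφ : φ.IsGeneral) (hΓ : IsStable g Γ.toMGraph)
    (h0 : ∀ x, param ψ x = 0) : IsGen (φ.val Γ.toMGraph hΓ) := by
  classical
  rintro S ⟨k, hk⟩
  have h1 := hφ C.toMGraph hC ((isSubdiv ψ).vert '' (S : Set Γ.V)) ⟨k, by
    rw [(isSubdiv ψ).cut_vert, (isSubdiv ψ).sum_vert_image, ← hk]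
    simp only [onQS_vert ψ hΓ]
    congr 4
    ext x
    simp [leave, mem_bdry, h0]⟩
  rcases h1 with h1 | h1
  · left
    rw [Finset.eq_empty_iff_forall_notMem]
    intro v hv
    exact (isSubdiv ψ).nexc_vert v (h1 _ ⟨v, hv, rfl⟩)
  · right
    rw [Finset.eq_univ_iff_forall]
    intro v
    by_contra hv
    refine (isSubdiv ψ).nexc_vert v (h1 _ fun h2 => hv ?_)
    exact ((isSubdiv ψ).vert_injective.mem_set_image).1 h2

/-- The divisor on `Γ` defined by a divisor on a subdivision: the position of an exceptional vertex
does not depend on which of its two flags is used to compute it. -/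
theorem modelDivisor_eq (D : C.V → ℤ) :
    modelDivisor hC D ψ = Γ.divOf (fun v => D ((isSubdiv ψ).vert v)) (param ψ) := by
  have h := isSubdiv ψ
  unfold modelDivisor divOf
  rw [h.sum_V hC]
  congr 1
  · refine Finset.sum_congr rfl fun v _ => ?_
    rw [dif_neg (h.nexc_vert v)]
    congr 1
    unfold vpt
    congr 1
    exact ψ.toEquiv.apply_symm_apply v.1
  · refine Finset.sum_congr rfl fun x _ => ?_
    by_cases hx : param ψ x = 0
    · rw [if_pos hx, if_pos hx]
    · rw [if_neg hx, if_neg hx, dif_pos (h.exc_mid hx)]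
      congr 1
      have hpt : ∀ (z : C.X) (hz : ¬ C.Exc (C.r z)) (w : Γ.X) (a : ℝ), z = incl ψ w →
          Γ.pt (ψ.toEquiv ⟨z, hz⟩) a = Γ.pt w a := by
        rintro z hz w a rfl
        congr 1
        exact ψ.toEquiv.apply_symm_apply w
      have hν := h.frac x
      suffices key : ∀ (y : C.X) (hy : C.r y ≠ y) (hr : C.r y = C.r (C.i (incl ψ x)))
          (hz : ¬ C.Exc (C.r (C.i y))),
          Γ.pt (ψ.toEquiv ⟨C.i y, hz⟩) (C.len y) = Γ.pt x (param ψ x * Γ.len x) from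
        key _ (exists_flag (h.exc_mid hx)).choose_spec.1
          (exists_flag (h.exc_mid hx)).choose_spec.2 _
      intro y hy hr hz
      rcases h.eq_or_of_r_i hx hy hr with hy' | hy'
      · rw [hpt _ _ x _ (by rw [hy', C.i_i]), hy', C.len_i, h.len x, if_neg hx]
      · have hx' := h.param_i hx
        rw [hpt _ _ (Γ.i x) _ (by rw [hy', C.i_i]), hy', C.len_i, h.len, if_neg hx', Γ.len_i,
          hν.2.2, if_neg hx]
        have h1 := Γ.len_nonneg x
        have h2 := pt_flip x (a := param ψ x * Γ.len x) (mul_nonneg hν.1 h1)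
          (mul_le_of_le_one_left h1 hν.2.1.le)
        rw [← h2]
        congr 1
        ring

end stability

end TCurve

/-! ### The standard subdivisions -/

namespace TCurve

variable {n : ℕ} {g : ℕ} {Γ : TCurve n}

/-- The inverse of an isomorphism. -/
noncomputable def Iso.symm {C C' : TCurve n} (a : Iso C C') : Iso C' C where
  toEquiv := a.toEquiv.symm
  map_r x := by rw [Equiv.symm_apply_eq, a.map_r, Equiv.apply_symm_apply]
  map_i x := by rw [Equiv.symm_apply_eq, a.map_i, Equiv.apply_symm_apply]
  map_h x := by rw [← a.map_h, Equiv.apply_symm_apply]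
  map_m k := by rw [Equiv.symm_apply_eq, a.map_m]
  map_len x := by rw [← a.map_len, Equiv.apply_symm_apply]

/-- Relative positions of exceptional vertices on the edges of `Γ`, the value zero meaning that
there is no exceptional vertex. -/
structure Pos (Γ : TCurve n) where
  ν : Γ.X → ℝ
  frac : Γ.IsFrac ν
  fix : ∀ x, Γ.i x = x → ν x = 0

namespace Pos

variable (s : Γ.Pos)

theorem ν_i {x : Γ.X} : s.ν (Γ.i x) = 0 ↔ s.ν x = 0 := by
  have h := s.frac x
  rw [h.2.2]
  split_ifs with h0
  · simp [h0]
  · simp only [h0, iff_false]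
    linarith

theorem ν_r (x : Γ.X) : s.ν (Γ.r x) = 0 := s.fix _ (Γ.i_r x)

open Classical in
/-- The positively oriented half-edge of the edge of a half-edge. -/
noncomputable def orient (x : {x : Γ.X // s.ν x ≠ 0}) : {x : Γ.X // Γ.Or x ∧ s.ν x ≠ 0} :=
  if h : Γ.Or x.1 then ⟨x.1, h, x.2⟩ else
    ⟨Γ.i x.1, (or_or fun hi => x.2 (s.fix _ hi)).resolve_left h, fun hi => x.2 (s.ν_i.1 hi)⟩

theorem orient_of_or (x : {x : Γ.X // Γ.Or x ∧ s.ν x ≠ 0}) : s.orient ⟨x.1, x.2.2⟩ = x :=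
  dif_pos x.2.1

theorem orient_i {x : Γ.X} (hx : s.ν x ≠ 0) (hx' : s.ν (Γ.i x) ≠ 0) :
    s.orient ⟨Γ.i x, hx'⟩ = s.orient ⟨x, hx⟩ := by
  unfold orient
  rcases or_or (fun hi => hx (s.fix x hi)) with h | h
  · simp [h, h.not_i, Γ.i_i]
  · have h1 := h.not_i
    rw [Γ.i_i] at h1
    simp [h, h1]

theorem orient_val (x : {x : Γ.X // s.ν x ≠ 0}) :
    (s.orient x).1 = x.1 ∨ (s.orient x).1 = Γ.i x.1 := by
  unfold orient
  split_ifs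
  · exact Or.inl rfl
  · exact Or.inr rfl

open Classical in
/-- The graph obtained by inserting exceptional vertices. -/
noncomputable def graph : MGraph n where
  X := SubX Γ s.ν
  finX := inferInstance
  r := Sum.elim (fun x => .inl (Γ.r x)) (Sum.elim (fun x => .inr (.inr (s.orient x)))
    fun x => .inr (.inr x))
  i := Sum.elim (fun x => if hx : s.ν x = 0 then .inl (Γ.i x) else .inr (.inl ⟨x, hx⟩))
    (Sum.elim (fun x => .inl x.1) fun x => .inr (.inr x))
  r_r := by
    rintro (x | x | x)
    · simp [Γ.r_r]
    · simp
    · simp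
  i_i := by
    rintro (x | x | x)
    · by_cases hx : s.ν x = 0
      · simp [hx, s.ν_i.2 hx, Γ.i_i]
      · simp [hx]
    · simp [x.2]
    · simp
  i_r := by
    rintro (x | x | x)
    · simp [s.ν_r, Γ.i_r]
    · simp
    · simp
  h := Sum.elim Γ.h fun _ => 0
  h_r := by
    rintro (x | x | x)
    · simp [Γ.h_r]
    · simp
    · simp
  m := Γ.m.trans (Equiv.ofBijective
    (fun l => ⟨.inl l.1, by
      simpa using l.2.1, by simp [s.fix l.1 l.2.2, l.2.2]⟩) (by
      constructor
      · intro l l' h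
        simpa [Subtype.ext_iff] using h
      · rintro ⟨x | x | x, hr, hi⟩
        · by_cases hx : s.ν x = 0
          · simp [hx] at hr hi
            exact ⟨⟨x, hr, hi⟩, rfl⟩
          · simp [hx] at hi
        · simp at hi
        · simp at hr))

/-- The curve obtained by inserting exceptional vertices. -/
noncomputable def curve : TCurve n where
  toMGraph := s.graph
  len := Sum.elim (fun x => open Classical in if s.ν x = 0 then Γ.len x else s.ν x * Γ.len x)
    (Sum.elim (fun x => s.ν x.1 * Γ.len x.1) fun _ => 0)
  len_i := by
    rintro (x | x | x)
    · by_cases hx : s.ν x = 0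
      · simp [graph, hx, s.ν_i.2 hx, Γ.len_i]
      · simp [graph, hx]
    · simp [graph, x.2]
    · simp [graph]
  len_pos := by
    have h : ∀ x, s.ν x ≠ 0 → 0 < s.ν x * Γ.len x := fun x hx =>
      mul_pos (lt_of_le_of_ne (s.frac x).1 (Ne.symm hx)) (Γ.len_pos x fun hi => hx (s.fix x hi))
    rintro (x | x | x) hi
    · by_cases hx : s.ν x = 0
      · simp [graph, hx] at hi ⊢
        exact Γ.len_pos x hi
      · simp only [Sum.elim_inl, if_neg hx]
        exact h x hx
    · exact h x.1 x.2
    · simp [graph] at hi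
  len_zero := by
    rintro (x | x | x) hi
    · by_cases hx : s.ν x = 0
      · simp [graph, hx] at hi ⊢
        exact Γ.len_zero x hi
      · simp [graph, hx] at hi
    · simp [graph] at hi
    · simp

/-- A flag or vertex of the original curve. -/
def old (x : Γ.X) : s.curve.X := Sum.inl x

/-- The half-edge with root at an exceptional vertex opposite to a half-edge of the original
curve. -/
def flag (x : Γ.X) (hx : s.ν x ≠ 0) : s.curve.X := Sum.inr (Sum.inl ⟨x, hx⟩)

/-- The exceptional vertex on an edge. -/
def mid (x : {x : Γ.X // Γ.Or x ∧ s.ν x ≠ 0}) : s.curve.X := Sum.inr (Sum.inr x)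

theorem r_old (x : Γ.X) : s.curve.r (s.old x) = s.old (Γ.r x) := rfl

theorem r_flag (x : Γ.X) (hx) : s.curve.r (s.flag x hx) = s.mid (s.orient ⟨x, hx⟩) := rfl

theorem r_mid (x) : s.curve.r (s.mid x) = s.mid x := rfl

theorem i_old_zero {x : Γ.X} (hx : s.ν x = 0) : s.curve.i (s.old x) = s.old (Γ.i x) :=
  dif_pos hx

theorem i_old {x : Γ.X} (hx : s.ν x ≠ 0) : s.curve.i (s.old x) = s.flag x hx := dif_neg hx

theorem i_flag (x : Γ.X) (hx) : s.curve.i (s.flag x hx) = s.old x := rfl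

theorem i_mid (x) : s.curve.i (s.mid x) = s.mid x := rfl

theorem len_old (x : Γ.X) : s.curve.len (s.old x) =
    open Classical in if s.ν x = 0 then Γ.len x else s.ν x * Γ.len x := rfl

theorem old_injective : Function.Injective s.old := Sum.inl_injective

theorem old_ne_mid {x y} : s.old x ≠ s.mid y := Sum.inl_ne_inr

theorem old_ne_flag {x y hy} : s.old x ≠ s.flag y hy := Sum.inl_ne_inr

theorem flag_ne_mid {x hx y} : s.flag x hx ≠ s.mid y := fun h => by
  simpa using Sum.inr_injective h

theorem flag_inj {x y hx hy} : s.flag x hx = s.flag y hy ↔ x = y := by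
  refine ⟨fun h => ?_, fun h => by subst h; rfl⟩
  exact congrArg Subtype.val (Sum.inl_injective (Sum.inr_injective h))

theorem mid_injective : Function.Injective s.mid := fun _ _ h =>
  Sum.inr_injective (Sum.inr_injective h)

theorem cases (z : s.curve.X) :
    (∃ x, z = s.old x) ∨ (∃ x hx, z = s.flag x hx) ∨ ∃ x, z = s.mid x := by
  rcases z with x | x | x
  · exact Or.inl ⟨x, rfl⟩
  · exact Or.inr (Or.inl ⟨x.1, x.2, rfl⟩)
  · exact Or.inr (Or.inr ⟨x, rfl⟩)

theorem val_old (v : Γ.X) : s.curve.val (s.old v) = Γ.val v := by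
  unfold val
  rw [← Set.ncard_image_of_injective _ s.old_injective]
  congr 1
  ext z
  rcases s.cases z with ⟨x, rfl⟩ | ⟨x, hx, rfl⟩ | ⟨x, rfl⟩
  · rw [s.old_injective.mem_set_image]
    simp only [Set.mem_ofPred_eq, r_old, s.old_injective.eq_iff, ne_eq]
  · simp [r_flag, s.old_ne_mid.symm, s.old_ne_flag]
  · simp [r_mid, s.old_ne_mid]

/-- The flags at an exceptional vertex are the ones opposite to the two halves of the subdivided
edge. -/
theorem exc_mid (x) : s.curve.Exc (s.mid x) := by
  have hx := x.2.2
  have hx' : s.ν (Γ.i x.1) ≠ 0 := fun h => hx (s.ν_i.1 h)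
  refine ⟨rfl, rfl, ?_⟩
  have h1 : {z | s.curve.r z ≠ z ∧ s.curve.r z = s.mid x} = {s.flag x.1 hx, s.flag _ hx'} := by
    ext z
    rcases s.cases z with ⟨y, rfl⟩ | ⟨y, hy, rfl⟩ | ⟨y, rfl⟩
    · simp [r_old, s.old_ne_mid, s.old_ne_flag]
    · simp only [Set.mem_ofPred_eq, r_flag, s.mid_injective.eq_iff, Set.mem_insert_iff,
        Set.mem_singleton_iff, flag_inj]
      constructor
      · rintro ⟨-, rfl⟩
        rcases s.orient_val ⟨y, hy⟩ with h | h
        · exact Or.inl h.symm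
        · right; rw [h, Γ.i_i]
      · rintro (rfl | rfl)
        · exact ⟨s.flag_ne_mid.symm, s.orient_of_or x⟩
        · exact ⟨s.flag_ne_mid.symm, (s.orient_i hx _).trans (s.orient_of_or x)⟩
    · simp [r_mid, s.flag_ne_mid.symm]
  unfold val
  rw [h1, Set.ncard_pair]
  rw [ne_eq, flag_inj]
  exact fun h => hx (s.fix _ h.symm)

theorem nexc_old (hΓ : IsStable g Γ.toMGraph) (x : Γ.X) : ¬ s.curve.Exc (s.old x) := by
  rintro ⟨h1, h2, h3⟩
  have hr : Γ.r x = x := s.old_injective h1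
  rw [s.val_old] at h3
  have h4 : Γ.h x = 0 := h2
  have := hΓ.pos x hr
  omega

theorem nexc_r_old (hΓ : IsStable g Γ.toMGraph) (x : Γ.X) :
    ¬ s.curve.Exc (s.curve.r (s.old x)) := s.nexc_old hΓ _

theorem exc_r_flag {x hx} : s.curve.Exc (s.curve.r (s.flag x hx)) := s.exc_mid _

theorem opp_flag {x : Γ.X} (hx : s.ν x ≠ 0) (hx' : s.ν (Γ.i x) ≠ 0) :
    s.curve.opp (s.flag x hx) = s.flag _ hx' := by
  refine opp_unique ?_ s.exc_r_flag ?_ ?_ ?_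
  · exact s.flag_ne_mid.symm
  · exact s.flag_ne_mid.symm
  · rw [r_flag, r_flag, s.orient_i hx]
  · rw [ne_eq, flag_inj]
    exact fun h => hx (s.fix _ h)

/-- Each half-edge of the original curve gives a path of length one or two in the subdivision. -/
theorem connOn (hc : Γ.ConnOn Set.univ) : s.curve.ConnOn Set.univ := by
  have hstep : ∀ x, Relation.ReflTransGen (fun a b => ∃ z ∈ (Set.univ : Set s.curve.X),
      s.curve.r z = a ∧ s.curve.r (s.curve.i z) = b) (s.old (Γ.r x)) (s.old (Γ.r (Γ.i x))) := by
    intro x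
    by_cases hx : s.ν x = 0
    · exact .single ⟨s.old x, trivial, rfl, by rw [s.i_old_zero hx]; rfl⟩
    · have hx' : s.ν (Γ.i x) ≠ 0 := fun h => hx (s.ν_i.1 h)
      refine .head (b := s.mid (s.orient ⟨x, hx⟩)) ⟨s.old x, trivial, rfl, ?_⟩
        (.single ⟨s.flag (Γ.i x) hx', trivial, ?_, rfl⟩)
      · rw [s.i_old hx]; rfl
      · rw [r_flag, s.orient_i hx]
  have hpath : ∀ a b, Relation.ReflTransGen (fun a b => ∃ x ∈ (Set.univ : Set Γ.X), Γ.r x = a ∧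
      Γ.r (Γ.i x) = b) a b → Relation.ReflTransGen (fun a b => ∃ z ∈ (Set.univ : Set s.curve.X),
      s.curve.r z = a ∧ s.curve.r (s.curve.i z) = b) (s.old a) (s.old b) := by
    intro a b h
    induction h with
    | refl => exact .refl
    | tail _ h ih =>
      obtain ⟨x, -, rfl, rfl⟩ := h
      exact ih.trans (hstep x)
  have hends : ∀ z, s.curve.r z = z → ∃ v, Γ.r v = v ∧
      Relation.ReflTransGen (fun a b => ∃ z ∈ (Set.univ : Set s.curve.X),
        s.curve.r z = a ∧ s.curve.r (s.curve.i z) = b) (s.old v) z ∧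
      Relation.ReflTransGen (fun a b => ∃ z ∈ (Set.univ : Set s.curve.X),
        s.curve.r z = a ∧ s.curve.r (s.curve.i z) = b) z (s.old v) := by
    intro z hz
    rcases s.cases z with ⟨y, rfl⟩ | ⟨y, hy, rfl⟩ | ⟨y, rfl⟩
    · exact ⟨y, s.old_injective hz, .refl, .refl⟩
    · exact absurd hz.symm s.flag_ne_mid
    · have h1 : s.curve.r (s.flag y.1 y.2.2) = s.mid y := by rw [r_flag, s.orient_of_or]
      exact ⟨Γ.r y.1, Γ.r_r _, .single ⟨s.old y.1, trivial, rfl, by rw [s.i_old y.2.2, h1]⟩,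
        .single ⟨s.flag y.1 y.2.2, trivial, h1, rfl⟩⟩
  constructor
  · obtain ⟨⟨v, -, hv⟩, -⟩ := hc
    exact ⟨s.old v, trivial, by rw [r_old, hv]⟩
  · intro z _ w _ hz hw
    obtain ⟨a, ha, -, h1⟩ := hends z hz
    obtain ⟨b, hb, h2, -⟩ := hends w hw
    exact h1.trans ((hpath a b (hc.2 a trivial b trivial ha hb)).trans h2)

/-- Each subdivided edge contributes one more edge and one more vertex of weight zero. -/
theorem genusOn : s.curve.genusOn Set.univ = Γ.genusOn Set.univ := by
  classical
  have e1 : {z : s.curve.X | z ∈ Set.univ ∧ s.curve.i z ≠ z} =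
      s.old '' {x | x ∈ Set.univ ∧ Γ.i x ≠ x} ∪
      Set.range (fun x : {x : Γ.X // s.ν x ≠ 0} => s.flag x.1 x.2) := by
    ext z
    rcases s.cases z with ⟨y, rfl⟩ | ⟨y, hy, rfl⟩ | ⟨y, rfl⟩
    · simp only [Set.mem_univ, true_and, Set.mem_ofPred_eq, Set.mem_union,
        s.old_injective.mem_set_image, Set.mem_range, s.old_ne_flag.symm, exists_false, or_false]
      by_cases hy : s.ν y = 0
      · rw [s.i_old_zero hy, ne_eq, s.old_injective.eq_iff]
      · rw [s.i_old hy]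
        exact iff_of_true s.old_ne_flag.symm fun h => hy (s.fix y h)
    · simp only [Set.mem_univ, true_and, Set.mem_ofPred_eq, i_flag]
      exact iff_of_true s.old_ne_flag (Or.inr ⟨⟨y, hy⟩, rfl⟩)
    · simp only [Set.mem_univ, true_and, Set.mem_ofPred_eq, i_mid, ne_eq, not_true, false_iff]
      rintro (⟨x, -, h⟩ | ⟨x, h⟩)
      · exact s.old_ne_mid h
      · exact s.flag_ne_mid h
  have e2 : {z : s.curve.X | z ∈ Set.univ ∧ s.curve.r z = z} =
      s.old '' {x | x ∈ Set.univ ∧ Γ.r x = x} ∪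
      Set.range s.mid := by
    ext z
    rcases s.cases z with ⟨y, rfl⟩ | ⟨y, hy, rfl⟩ | ⟨y, rfl⟩
    · simp only [Set.mem_univ, true_and, Set.mem_ofPred_eq, Set.mem_union,
        s.old_injective.mem_set_image, Set.mem_range, s.old_ne_mid.symm, exists_false, or_false,
        r_old, s.old_injective.eq_iff]
    · simp only [Set.mem_univ, true_and, Set.mem_ofPred_eq, r_flag]
      refine iff_of_false s.flag_ne_mid.symm ?_
      rintro (⟨x, -, h⟩ | ⟨x, h⟩)
      · exact s.old_ne_flag h
      · exact s.flag_ne_mid h.symm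
    · simp only [Set.mem_univ, true_and, Set.mem_ofPred_eq, r_mid]
      exact iff_of_true trivial (Or.inr ⟨y, rfl⟩)
  have d1 : Disjoint (s.old '' {x | x ∈ Set.univ ∧ Γ.i x ≠ x})
      (Set.range (fun x : {x : Γ.X // s.ν x ≠ 0} => s.flag x.1 x.2)) := by
    rw [Set.disjoint_left]
    rintro _ ⟨x, -, rfl⟩ ⟨y, h⟩
    exact s.old_ne_flag h.symm
  have d2 : Disjoint (s.old '' {x | x ∈ Set.univ ∧ Γ.r x = x}) (Set.range s.mid) := by
    rw [Set.disjoint_left]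
    rintro _ ⟨x, -, rfl⟩ ⟨y, h⟩
    exact s.old_ne_mid h.symm
  have hfin : Finite s.curve.X := s.curve.finX
  have c1 : (Set.range (fun x : {x : Γ.X // s.ν x ≠ 0} => s.flag x.1 x.2)).ncard =
      2 * (Set.range s.mid).ncard := by
    rw [Set.ncard_range_of_injective fun x y h => Subtype.ext (s.flag_inj.1 h),
      Set.ncard_range_of_injective s.mid_injective, Nat.card_eq_fintype_card,
      Nat.card_eq_fintype_card, Fintype.card_subtype, Fintype.card_subtype]
    have h := sum_or (G := Γ.toMGraph) (fun x => if s.ν x ≠ 0 then 1 else 0) fun x hx => by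
      simp [s.fix x hx]
    rw [Finset.card_filter, h, ← Finset.filter_filter, Finset.card_filter, Finset.mul_sum]
    refine Finset.sum_congr rfl fun x _ => ?_
    by_cases hx : s.ν x = 0
    · simp [hx, s.ν_i.2 hx]
    · simp [hx, s.ν_i]
  unfold MGraph.genusOn b1On
  rw [e1, e2, Set.ncard_union_eq d1 (Set.toFinite _) (Set.toFinite _),
    Set.ncard_union_eq d2 (Set.toFinite _) (Set.toFinite _),
    Set.ncard_image_of_injective _ s.old_injective, Set.ncard_image_of_injective _ s.old_injective,
    finsum_mem_union d2 (Set.toFinite _) (Set.toFinite _), finsum_mem_image s.old_injective.injOn,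
    finsum_mem_range s.mid_injective, c1]
  have h0 : ∑ᶠ x, (s.curve.h (s.mid x) : ℤ) = 0 := by
    have : ∀ x, s.curve.h (s.mid x) = 0 := fun _ => rfl
    simp only [this, Nat.cast_zero, finsum_zero]
  rw [h0]
  have h1 : ∀ x, s.curve.h (s.old x) = Γ.h x := fun _ => rfl
  simp only [h1]
  push_cast
  omega

theorem isQS (hgn : 2 < 2 * g + n) (hΓ : IsStable g Γ.toMGraph) : IsQS g s.curve.toMGraph := by
  refine ⟨hgn, s.connOn hΓ.conn, s.genusOn.trans hΓ.genus, fun z hz h0 => ?_, fun z hz he => ?_⟩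
  · rcases s.cases z with ⟨y, rfl⟩ | ⟨y, hy, rfl⟩ | ⟨y, rfl⟩
    · have hr : Γ.r y = y := s.old_injective hz
      have h1 : Γ.h y = 0 := h0
      have := hΓ.pos y hr
      rw [s.val_old]
      omega
    · exact absurd hz.symm s.flag_ne_mid
    · exact (s.exc_mid y).2.2.ge
  · rcases s.cases z with ⟨y, rfl⟩ | ⟨y, hy, rfl⟩ | ⟨y, rfl⟩
    · exact absurd he (s.nexc_old hΓ _)
    · exact ⟨s.old_ne_flag, s.nexc_old hΓ _⟩
    · exact absurd rfl hz

/-- The stabilization of a standard subdivision. -/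
noncomputable def stabIso (hgn : 2 < 2 * g + n) (hΓ : IsStable g Γ.toMGraph) :
    Iso (s.curve.stab (s.isQS hgn hΓ)) Γ := Iso.symm
  { toEquiv := Equiv.ofBijective (fun x => ⟨s.old x, s.nexc_old hΓ _⟩) (by
      constructor
      · intro x y h
        exact s.old_injective (congrArg Subtype.val h)
      · rintro ⟨z, hz⟩
        rcases s.cases z with ⟨y, rfl⟩ | ⟨y, hy, rfl⟩ | ⟨y, rfl⟩
        · exact ⟨y, rfl⟩
        · exact absurd s.exc_r_flag hz
        · exact absurd (s.exc_mid y) hz)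
    map_r := fun x => rfl
    map_i := fun x => by
      apply Subtype.ext
      change s.old (Γ.i x) = s.curve.stabInv (s.old x)
      unfold stabInv
      by_cases hx : s.ν x = 0
      · rw [s.i_old_zero hx, if_neg (s.nexc_r_old hΓ _)]
      · have hx' : s.ν (Γ.i x) ≠ 0 := fun h => hx (s.ν_i.1 h)
        rw [s.i_old hx, if_pos s.exc_r_flag, s.opp_flag hx hx', i_flag]
    map_h := fun x => rfl
    map_m := fun k => rfl
    map_len := fun x => by
      change s.curve.stabLen (s.old x) = Γ.len x
      unfold stabLen
      by_cases hx : s.ν x = 0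
      · rw [s.i_old_zero hx, if_neg (s.nexc_r_old hΓ _), len_old, if_pos hx]
      · have hx' : s.ν (Γ.i x) ≠ 0 := fun h => hx (s.ν_i.1 h)
        rw [s.i_old hx, if_pos s.exc_r_flag, s.opp_flag hx hx', len_old, if_neg hx]
        change s.ν x * Γ.len x + s.ν (Γ.i x) * Γ.len (Γ.i x) = Γ.len x
        rw [(s.frac x).2.2, if_neg hx, Γ.len_i]
        ring }

theorem incl_stabIso (hgn : 2 < 2 * g + n) (hΓ : IsStable g Γ.toMGraph) (x : Γ.X) :
    incl (s.stabIso hgn hΓ) x = s.old x := rfl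

theorem param_stabIso (hgn : 2 < 2 * g + n) (hΓ : IsStable g Γ.toMGraph) :
    param (s.stabIso hgn hΓ) = s.ν := by
  classical
  funext x
  unfold param
  rw [incl_stabIso]
  by_cases hx : s.ν x = 0
  · rw [s.i_old_zero hx, if_neg (s.nexc_r_old hΓ _), hx]
  · have := Γ.len_pos x fun hi => hx (s.fix x hi)
    rw [s.i_old hx, if_pos s.exc_r_flag, len_old, if_neg hx, mul_div_cancel_right₀ _ this.ne']

end Pos

end TCurve

namespace TCurve

variable {n : ℕ} {g : ℕ} {C C' Γ : TCurve n}

/-- Every subdivision is isomorphic to a standard one. -/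
noncomputable def IsSubdiv.iso {s : Γ.Pos} {j : Γ.X → C.X} (h : IsSubdiv C Γ j s.ν)
    (hC : IsQS g C.toMGraph) : Iso s.curve C where
  toEquiv := Equiv.ofBijective h.toFun (h.bijective_toFun hC)
  map_r z := by
    rcases s.cases z with ⟨x, rfl⟩ | ⟨x, hx, rfl⟩ | ⟨x, rfl⟩
    · exact h.map_r x
    · change C.r (C.i (j (s.orient ⟨x, hx⟩).1)) = C.r (C.i (j x))
      rcases s.orient_val ⟨x, hx⟩ with e | e
      · rw [e]
      · rw [e]; exact h.r_i_opp hx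
    · exact (C.r_r _).symm
  map_i z := by
    rcases s.cases z with ⟨x, rfl⟩ | ⟨x, hx, rfl⟩ | ⟨x, rfl⟩
    · by_cases hx : s.ν x = 0
      · rw [s.i_old_zero hx]
        exact (h.i_zero x hx).symm
      · rw [s.i_old hx]
        rfl
    · exact (C.i_i _).symm
    · exact (C.i_r _).symm
  map_h z := by
    rcases s.cases z with ⟨x, rfl⟩ | ⟨x, hx, rfl⟩ | ⟨x, rfl⟩
    · exact h.map_h x
    · change C.h (C.i (j x)) = 0
      rw [← C.h_r]
      exact ((h.exc x).2 hx).2.1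
    · change C.h (C.r (C.i (j x.1))) = 0
      exact ((h.exc x.1).2 x.2.2).2.1
  map_m k := h.map_m k
  map_len z := by
    rcases s.cases z with ⟨x, rfl⟩ | ⟨x, hx, rfl⟩ | ⟨x, rfl⟩
    · exact h.len x
    · change C.len (C.i (j x)) = s.ν x * Γ.len x
      rw [C.len_i, h.len, if_neg hx]
    · exact C.len_zero _ (C.i_r _)

/-- Two subdivisions of `Γ` at the same positions are isomorphic over `Γ`. -/
theorem IsSubdiv.exists_iso {j : Γ.X → C.X} {j' : Γ.X → C'.X} {ν : Γ.X → ℝ}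
    (h : IsSubdiv C Γ j ν) (h' : IsSubdiv C' Γ j' ν) (hC : IsQS g C.toMGraph)
    (hC' : IsQS g C'.toMGraph) : ∃ a : Iso C C', ∀ x, a.toEquiv (j x) = j' x := by
  let s : Γ.Pos := ⟨ν, h.frac, h.fix⟩
  have h : IsSubdiv C Γ j s.ν := h
  have h' : IsSubdiv C' Γ j' s.ν := h'
  refine ⟨(h.iso hC).symm.trans (h'.iso hC'), fun x => ?_⟩
  change (h'.iso hC').toEquiv ((h.iso hC).toEquiv.symm (j x)) = j' x
  have : (h.iso hC).toEquiv.symm (j x) = s.old x := by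
    rw [Equiv.symm_apply_eq]; rfl
  rw [this]
  rfl

/-- Maps out of a subdivision compatible with the root maps and the involutions are determined by
their values at the flags of the original curve. -/
theorem IsSubdiv.map_ext {j : Γ.X → C.X} {ν : Γ.X → ℝ} (h : IsSubdiv C Γ j ν)
    (hC : IsQS g C.toMGraph) {a b : C.X → C'.X} (har : ∀ z, a (C.r z) = C'.r (a z))
    (hai : ∀ z, a (C.i z) = C'.i (a z)) (hbr : ∀ z, b (C.r z) = C'.r (b z))
    (hbi : ∀ z, b (C.i z) = C'.i (b z)) (hab : ∀ x, a (j x) = b (j x)) (z : C.X) : a z = b z := by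
  rcases h.cases hC z with ⟨x, rfl⟩ | ⟨x, -, rfl⟩ | ⟨x, -, -, rfl⟩
  · exact hab x
  · rw [hai, hbi, hab]
  · rw [har, hai, hbr, hbi, hab]

/-! ### Specializations of subdivisions -/

/-- The half-edge `x` of the subdivision at `ν'`, ending at an exceptional vertex, is contracted when
the subdivision specializes to the one at `ν`, where this exceptional vertex moves to the root
of `x`. -/
def Contr (ν ν' : Γ.X → ℝ) (x : Γ.X) : Prop := ν x = 0 ∧ 0 < ν' x ∧ ν' x < 1 / 2

/-- If an exceptional vertex moves to an end of its edge, exactly one of the two half-edges at it is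
contracted, the midpoint being excluded. -/
theorem contr_i {ν ν' : Γ.X → ℝ} (hf : Γ.IsFrac ν) (hf' : Γ.IsFrac ν') {x : Γ.X} (h0 : ν x = 0)
    (h1 : ν' x ≠ 0) (h2 : ν' x ≠ 1 / 2) : Contr ν ν' (Γ.i x) ↔ ¬ Contr ν ν' x := by
  unfold Contr
  rw [(hf x).2.2, (hf' x).2.2, if_pos h0, if_neg h1]
  have h3 := hf' x
  have h4 := lt_of_le_of_ne h3.1 (Ne.symm h1)
  simp only [h0, true_and, h4]
  constructor
  · rintro ⟨-, h⟩ h'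
    linarith
  · intro h
    exact ⟨by linarith, by linarith [lt_of_le_of_ne (not_lt.1 h) (Ne.symm h2)]⟩

theorem Contr.not_i {ν ν' : Γ.X → ℝ} (hf' : Γ.IsFrac ν') {x : Γ.X}
    (h : Contr ν ν' x) : ¬ Contr ν ν' (Γ.i x) := by
  rintro ⟨-, -, h3⟩
  rw [(hf' x).2.2, if_neg h.2.1.ne'] at h3
  linarith [h.2.2]

open Classical in
/-- A specialization of subdivisions of `Γ`: nearby subdivisions specialize by contracting the
short half-edges at the exceptional vertices near a vertex. -/
structure IsSpec {j : Γ.X → C.X} {j' : Γ.X → C'.X} {ν ν' : Γ.X → ℝ} (_ : IsSubdiv C Γ j ν)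
    (_ : IsSubdiv C' Γ j' ν') (σ : C'.X → C.X) : Prop where
  map_r : ∀ z, σ (C'.r z) = C.r (σ z)
  map_i : ∀ z, σ (C'.i z) = C.i (σ z)
  map_j : ∀ x, σ (j' x) = if Contr ν ν' x then C.r (j x) else j x
  ne_zero : ∀ x, ν x ≠ 0 → ν' x ≠ 0
  ne_half : ∀ x, ν x = 0 → ν' x ≠ 1 / 2

namespace IsSpec

variable {j : Γ.X → C.X} {j' : Γ.X → C'.X} {ν ν' : Γ.X → ℝ} {h : IsSubdiv C Γ j ν}
  {h' : IsSubdiv C' Γ j' ν'} {σ : C'.X → C.X}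

theorem map_vert (hσ : IsSpec h h' σ) (v : Γ.V) : σ (h'.vert v).1 = (h.vert v).1 := by
  have h0 : ν' v.1 = 0 := h'.fix _ (i_vertex v.2)
  exact (hσ.map_j v.1).trans (if_neg fun hc => hc.2.1.ne' h0)

theorem map_mid_of_ne (hσ : IsSpec h h' σ) {x : Γ.X} (hx : ν x ≠ 0) :
    σ (h'.mid x).1 = (h.mid x).1 := by
  change σ (C'.r (C'.i (j' x))) = _
  rw [hσ.map_r, hσ.map_i, hσ.map_j, if_neg fun hc => hx hc.1]
  rfl

theorem map_mid_of_contr (hσ : IsSpec h h' σ) {x : Γ.X} (hx : Contr ν ν' x) :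
    σ (h'.mid x).1 = (h.vert (Γ.root x)).1 := by
  change σ (C'.r (C'.i (j' x))) = j (Γ.r x)
  rw [hσ.map_r, hσ.map_i, hσ.map_j, if_pos hx, C.i_r, C.r_r, h.map_r]

theorem map_mid_of_contr_i (hσ : IsSpec h h' σ) {x : Γ.X} (hx : Contr ν ν' (Γ.i x)) :
    σ (h'.mid x).1 = (h.vert (Γ.root (Γ.i x))).1 := by
  have h0 : ν' x ≠ 0 := by
    have := h'.param_i hx.2.1.ne'
    rwa [Γ.i_i] at this
  rw [← hσ.map_mid_of_contr hx]
  exact congrArg σ (h'.r_i_opp h0).symm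

/-- Push-forward of a divisor under a specialization, at a vertex of `Γ`. -/
theorem sum_fibre_vert (hσ : IsSpec h h' σ) (hC' : IsQS g C'.toMGraph) {D' : C'.V → ℤ}
    (hD' : ∀ v : C'.V, C'.Exc v.1 → D' v = 1) (v : Γ.V) :
    ∑ᶠ w : {w : C'.V // σ w.1 = (h.vert v).1}, D' w.1 = D' (h'.vert v) +
      open Classical in ∑ x with Γ.root x = v, if Contr ν ν' x then 1 else 0 := by
  classical
  refine (finsum_subtype_eq_finsum_cond (f := D') fun w => σ w.1 = (h.vert v).1).trans ?_
  refine (h'.sum_mem_V hC' {w | σ w.1 = (h.vert v).1} D').trans ?_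
  congr 1
  · have : (Finset.univ.filter fun w => h'.vert w ∈ {w : C'.V | σ w.1 = (h.vert v).1}) = {v} := by
      ext w
      simp only [Set.mem_ofPred_eq, Finset.mem_filter, Finset.mem_univ, true_and,
        Finset.mem_singleton, hσ.map_vert]
      exact ⟨fun e => h.vert_injective (Subtype.ext e), fun e => by rw [e]⟩
    rw [this, Finset.sum_singleton]
  · rw [Finset.sum_filter (p := fun x => Γ.root x = v), sum_or (G := Γ.toMGraph) _ fun x hx => by
      have hc : ¬ Contr ν ν' x := fun hc => hc.2.1.ne' (h'.fix x hx)
      simp only [hc, if_false, ite_self]]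
    have hvert : ∀ w, (h.vert w).1 = (h.vert v).1 ↔ w = v := fun w =>
      ⟨fun e => h.vert_injective (Subtype.ext e), fun e => by rw [e]⟩
    refine Finset.sum_congr rfl fun x _ => ?_
    by_cases h0 : ν' x = 0
    · have h1 : ν' (Γ.i x) = 0 := by rw [(h'.frac x).2.2, if_pos h0]
      have hc : ¬ Contr ν ν' x := fun hc => hc.2.1.ne' h0
      have hc' : ¬ Contr ν ν' (Γ.i x) := fun hc => hc.2.1.ne' h1
      simp only [h0, hc, hc', if_true, if_false, ite_self, add_zero]
    · have h1 := hD' _ (h'.exc_mid h0)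
      by_cases hx : ν x = 0
      · have hci := contr_i h.frac h'.frac hx h0 (hσ.ne_half x hx)
        by_cases hc : Contr ν ν' x
        · have hm : h'.mid x ∈ {w : C'.V | σ w.1 = (h.vert v).1} ↔ Γ.root x = v := by
            rw [Set.mem_ofPred_eq, hσ.map_mid_of_contr hc, hvert]
          have hc' := hc.not_i h'.frac
          simp only [h0, h1, hm, hc, hc', if_true, if_false, ite_self, add_zero]
        · have hc' := hci.2 hc
          have hm : h'.mid x ∈ {w : C'.V | σ w.1 = (h.vert v).1} ↔ Γ.root (Γ.i x) = v := by
            rw [Set.mem_ofPred_eq, hσ.map_mid_of_contr_i hc', hvert]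
          simp only [h0, h1, hm, hc, hc', if_true, if_false, ite_self, zero_add]
      · have hx' := h.param_i hx
        have hm : h'.mid x ∉ {w : C'.V | σ w.1 = (h.vert v).1} := by
          rw [Set.mem_ofPred_eq, hσ.map_mid_of_ne hx]
          intro e
          exact h.nexc_vert v (e ▸ h.exc_mid hx)
        have hc : ¬ Contr ν ν' x := fun hc => hx hc.1
        have hc' : ¬ Contr ν ν' (Γ.i x) := fun hc => hx' hc.1
        simp only [h0, hm, hc, hc', if_false, ite_self, add_zero]

/-- Push-forward of a divisor under a specialization, at an exceptional vertex. -/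
theorem sum_fibre_mid (hσ : IsSpec h h' σ) (hC' : IsQS g C'.toMGraph)
    {D' : C'.V → ℤ} (hD' : ∀ v : C'.V, C'.Exc v.1 → D' v = 1) {x : Γ.X} (hx : ν x ≠ 0) :
    ∑ᶠ w : {w : C'.V // σ w.1 = (h.mid x).1}, D' w.1 = 1 := by
  have hx' := hσ.ne_zero x hx
  rw [finsum_eq_single _ ⟨h'.mid x, hσ.map_mid_of_ne hx⟩]
  · exact hD' _ (h'.exc_mid hx')
  · rintro ⟨w, hw⟩ hne
    obtain ⟨v | y, rfl⟩ := (h'.vertEquiv hC').surjective w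
    · have hw : σ (h'.vert v).1 = (h.mid x).1 := hw
      rw [hσ.map_vert] at hw
      exact absurd (hw ▸ h.exc_mid hx) (h.nexc_vert v)
    · have hw : σ (h'.mid y.1).1 = (h.mid x).1 := hw
      have hy : ν y.1 ≠ 0 := by
        intro h0
        by_cases hc : Contr ν ν' y.1
        · rw [hσ.map_mid_of_contr hc] at hw
          exact h.nexc_vert _ (hw ▸ h.exc_mid hx)
        · rw [hσ.map_mid_of_contr_i ((contr_i h.frac h'.frac h0 y.2.2
            (hσ.ne_half _ h0)).2 hc)] at hw
          exact h.nexc_vert _ (hw ▸ h.exc_mid hx)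
      rw [hσ.map_mid_of_ne hy] at hw
      refine absurd (Subtype.ext (Subtype.ext ?_)) hne
      change (h'.mid y.1).1 = (h'.mid x).1
      rcases h.eq_or_of_r_i_eq hx hy hw with e | e
      · rw [e]
      · rw [e]; exact h'.r_i_opp hx'

end IsSpec

namespace Pos

variable (s s' : Γ.Pos)

open Classical in
/-- The image of a flag of the original curve under the specialization. -/
noncomputable def spOld (x : Γ.X) : s.curve.X :=
  if Contr s.ν s'.ν x then s.old (Γ.r x) else s.old x

/-- The specialization of standard subdivisions. -/
noncomputable def sp : s'.curve.X → s.curve.X :=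
  Sum.elim (s.spOld s') (Sum.elim (fun x => s.curve.i (s.spOld s' x.1))
    fun x => s.curve.r (s.curve.i (s.spOld s' x.1)))

variable {s s'}

theorem spOld_contr {x : Γ.X} (h : Contr s.ν s'.ν x) : s.spOld s' x = s.old (Γ.r x) := if_pos h

theorem spOld_not {x : Γ.X} (h : ¬ Contr s.ν s'.ν x) : s.spOld s' x = s.old x := if_neg h

theorem spOld_zero {x : Γ.X} (h : s'.ν x = 0) : s.spOld s' x = s.old x :=
  if_neg fun hc => hc.2.1.ne' h

theorem spOld_fix {x : Γ.X} (h : Γ.i x = x) : s.spOld s' x = s.old x := spOld_zero (s'.fix x h)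

theorem i_old_r (x : Γ.X) : s.curve.i (s.old (Γ.r x)) = s.old (Γ.r x) := by
  rw [s.i_old_zero (s.ν_r x), Γ.i_r]

/-- The specialization commutes with the involutions. -/
theorem sp_i (h1 : ∀ x, s.ν x ≠ 0 → s'.ν x ≠ 0) (z : s'.curve.X) :
    s.sp s' (s'.curve.i z) = s.curve.i (s.sp s' z) := by
  rcases s'.cases z with ⟨x, rfl⟩ | ⟨x, hx, rfl⟩ | ⟨x, rfl⟩
  · by_cases hx : s'.ν x = 0
    · have hx0 : s.ν x = 0 := by by_contra h; exact h1 x h hx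
      rw [s'.i_old_zero hx]
      change s.spOld s' _ = s.curve.i (s.spOld s' x)
      rw [spOld_zero hx, spOld_zero (s'.ν_i.2 hx), s.i_old_zero hx0]
    · rw [s'.i_old hx]
      rfl
  · exact (s.curve.i_i _).symm
  · exact (s.curve.i_r _).symm

/-- The image of an exceptional vertex can be computed from both half-edges of its edge. -/
theorem r_i_spOld_i (h2 : ∀ x, s.ν x = 0 → s'.ν x ≠ 1 / 2) {x : Γ.X} (hx : s'.ν x ≠ 0) :
    s.curve.r (s.curve.i (s.spOld s' (Γ.i x))) = s.curve.r (s.curve.i (s.spOld s' x)) := by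
  have key : ∀ x, s'.ν x ≠ 0 → s.ν x = 0 → Contr s.ν s'.ν x →
      s.curve.r (s.curve.i (s.spOld s' (Γ.i x))) = s.curve.r (s.curve.i (s.spOld s' x)) := by
    intro x hx h0 hc
    rw [spOld_contr hc, spOld_not (hc.not_i s'.frac), i_old_r, s.i_old_zero (s.ν_i.2 h0), Γ.i_i,
      r_old, r_old, Γ.r_r]
  by_cases h0 : s.ν x = 0
  · by_cases hc : Contr s.ν s'.ν x
    · exact key x hx h0 hc
    · have := key (Γ.i x) (fun h => hx (s'.ν_i.1 h)) (s.ν_i.2 h0)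
        ((contr_i s.frac s'.frac h0 hx (h2 x h0)).2 hc)
      rw [Γ.i_i] at this
      exact this.symm
  · have h0' : s.ν (Γ.i x) ≠ 0 := fun h => h0 (s.ν_i.1 h)
    rw [spOld_not fun hc => h0 hc.1, spOld_not fun hc => h0' hc.1, s.i_old h0, s.i_old h0', r_flag,
      r_flag, s.orient_i h0]

/-- The specialization commutes with the root maps. -/
theorem sp_r (h2 : ∀ x, s.ν x = 0 → s'.ν x ≠ 1 / 2) (z : s'.curve.X) :
    s.sp s' (s'.curve.r z) = s.curve.r (s.sp s' z) := by
  rcases s'.cases z with ⟨x, rfl⟩ | ⟨x, hx, rfl⟩ | ⟨x, rfl⟩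
  · change s.spOld s' (Γ.r x) = s.curve.r (s.spOld s' x)
    rw [spOld_fix (Γ.i_r x)]
    by_cases hc : Contr s.ν s'.ν x
    · rw [spOld_contr hc, r_old, Γ.r_r]
    · rw [spOld_not hc, r_old]
  · change s.curve.r (s.curve.i (s.spOld s' (s'.orient ⟨x, hx⟩).1)) =
      s.curve.r (s.curve.i (s.spOld s' x))
    rcases s'.orient_val ⟨x, hx⟩ with e | e
    · rw [e]
    · rw [e]
      exact r_i_spOld_i h2 hx
  · exact (s.curve.r_r _).symm

theorem spOld_inj {x y : Γ.X} (hf : s.curve.r (s.spOld s' x) ≠ s.spOld s' x)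
    (h : s.spOld s' x = s.spOld s' y) : x = y := by
  have h1 : ∀ x, s.curve.r (s.spOld s' x) ≠ s.spOld s' x → ¬ Contr s.ν s'.ν x := fun x hf hc => by
    rw [spOld_contr hc, r_old, Γ.r_r] at hf
    exact hf rfl
  have hx := h1 x hf
  rw [h] at hf
  have hy := h1 y hf
  rw [spOld_not hx, spOld_not hy] at h
  exact s.old_injective h

theorem spOld_ne_i (h2 : ∀ x, s.ν x = 0 → s'.ν x ≠ 1 / 2) {x y : Γ.X} (hy : s'.ν y ≠ 0)
    (hf : s.curve.r (s.spOld s' x) ≠ s.spOld s' x) : s.spOld s' x ≠ s.curve.i (s.spOld s' y) := by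
  intro h
  have hx : ¬ Contr s.ν s'.ν x := fun hc => by
    rw [spOld_contr hc, r_old, Γ.r_r] at hf
    exact hf rfl
  have hc : ¬ Contr s.ν s'.ν y := fun hc => by
    rw [h, spOld_contr hc, i_old_r, r_old, Γ.r_r] at hf
    exact hf rfl
  rw [spOld_not hx, spOld_not hc] at h
  by_cases h0 : s.ν y = 0
  · rw [s.i_old_zero h0] at h
    rw [s.old_injective h] at hx
    exact hx ((contr_i s.frac s'.frac h0 hy (h2 y h0)).2 hc)
  · rw [s.i_old h0] at h
    exact s.old_ne_flag h

/-- Distinct elements have distinct images, unless these images are vertices. -/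
theorem sp_inj (h2 : ∀ x, s.ν x = 0 → s'.ν x ≠ 1 / 2)
    {z w : s'.curve.X} (hf : s.curve.r (s.sp s' z) ≠ s.sp s' z)
    (h : s.sp s' z = s.sp s' w) : z = w := by
  have hf' := hf
  rw [h] at hf'
  have hi : ∀ u, s.curve.r (s.curve.i u) ≠ s.curve.i u → s.curve.r u ≠ u := fun u hu => by
    have := flag_i hu
    rwa [s.curve.i_i] at this
  rcases s'.cases z with ⟨x, rfl⟩ | ⟨x, hx, rfl⟩ | ⟨x, rfl⟩
  · rcases s'.cases w with ⟨y, rfl⟩ | ⟨y, hy, rfl⟩ | ⟨y, rfl⟩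
    · rw [spOld_inj hf h]
    · exact absurd h (spOld_ne_i h2 hy hf)
    · exact absurd (s.curve.r_r _) hf'
  · rcases s'.cases w with ⟨y, rfl⟩ | ⟨y, hy, rfl⟩ | ⟨y, rfl⟩
    · exact absurd h.symm (spOld_ne_i h2 hx hf')
    · have h3 : s.spOld s' x = s.spOld s' y := by
        have := congrArg s.curve.i h
        change s.curve.i (s.curve.i (s.spOld s' x)) = s.curve.i (s.curve.i (s.spOld s' y)) at this
        rwa [s.curve.i_i, s.curve.i_i] at this
      have := spOld_inj (hi _ hf) h3
      subst this
      rfl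
    · exact absurd (s.curve.r_r _) hf'
  · exact absurd (s.curve.r_r _) hf

/-- Every flag is in the image: if its own half-edge is contracted, it is the image of the half-edge
on the other side of the exceptional vertex. -/
theorem exists_sp_eq (h1 : ∀ x, s.ν x ≠ 0 → s'.ν x ≠ 0)
    (f : s.curve.X) (hf : s.curve.r f ≠ f) : ∃ z, s.sp s' z = f := by
  have hold : ∀ y, ∃ z, s.sp s' z = s.old y := fun y => by
    by_cases hc : Contr s.ν s'.ν y
    · have hy : s'.ν (Γ.i y) ≠ 0 := fun h => hc.2.1.ne' (s'.ν_i.1 h)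
      refine ⟨s'.flag (Γ.i y) hy, ?_⟩
      change s.curve.i (s.spOld s' (Γ.i y)) = s.old y
      rw [spOld_not (hc.not_i s'.frac), s.i_old_zero (s.ν_i.2 hc.1), Γ.i_i]
    · exact ⟨s'.old y, spOld_not hc⟩
  rcases s.cases f with ⟨y, rfl⟩ | ⟨y, hy, rfl⟩ | ⟨y, rfl⟩
  · exact hold y
  · obtain ⟨z, hz⟩ := hold y
    exact ⟨s'.curve.i z, by rw [sp_i h1, hz, s.i_old hy]⟩
  · exact absurd rfl hf

/-- The fibres of a specialization over the vertices are stars. -/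
theorem sp_fibre (h1 : ∀ x, s.ν x ≠ 0 → s'.ν x ≠ 0) (h2 : ∀ x, s.ν x = 0 → s'.ν x ≠ 1 / 2)
    (v : s.curve.X) (hv : s.curve.r v = v) : s'.curve.ConnOn {z | s.sp s' z = v} ∧
      s'.curve.genusOn {z | s.sp s' z = v} = s.curve.h v := by
  have hcz : ∀ {x}, Contr s.ν s'.ν x → s'.ν x ≠ 0 := fun hc => hc.2.1.ne'
  have hmid : ∀ x, s.sp s' (s'.mid x) = s.curve.r (s.curve.i (s.spOld s' x.1)) := fun _ => rfl
  rcases s.cases v with ⟨w, rfl⟩ | ⟨w, hw, rfl⟩ | ⟨w, rfl⟩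
  -- over a vertex of `Γ`, the rays of the star are the contracted half-edges at this vertex
  · have hrw : Γ.r w = w := s.old_injective hv
    refine star_connOn_genusOn (z := s'.old w)
      (K := s'.old '' {x | Contr s.ν s'.ν x ∧ Γ.r x = w}) ?_ ?_ ?_ ?_ ?_ ?_
    · rw [r_old, hrw]
    · rintro _ ⟨x, ⟨-, hx⟩, rfl⟩
      rw [r_old, hx]
    · rintro _ ⟨x, ⟨hc, -⟩, rfl⟩
      rw [s'.i_old (hcz hc)]
      exact s'.old_ne_mid.symm
    · rintro _ ⟨x, ⟨hc, -⟩, rfl⟩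
      rw [s'.i_old (hcz hc)]
      rfl
    · rintro _ ⟨x, ⟨hc, -⟩, rfl⟩ _ ⟨y, ⟨hc', -⟩, rfl⟩ e
      dsimp only at e
      rw [s'.i_old (hcz hc), s'.i_old (hcz hc'), r_flag, r_flag, s'.mid_injective.eq_iff] at e
      have e := congrArg Subtype.val e
      have hxy : x = y ∨ x = Γ.i y := by
        rcases s'.orient_val ⟨x, hcz hc⟩ with a | a <;> rcases s'.orient_val ⟨y, hcz hc'⟩ with b | b
        · rw [a, b] at e; exact Or.inl e
        · rw [a, b] at e; exact Or.inr e
        · rw [a, b] at e; right; rw [← show Γ.i x = y from e, Γ.i_i]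
        · rw [a, b] at e; left; rw [← Γ.i_i x, show Γ.i x = Γ.i y from e, Γ.i_i]
      rcases hxy with rfl | rfl
      · rfl
      · exact absurd hc (hc'.not_i s'.frac)
    · intro z
      rcases s'.cases z with ⟨x, rfl⟩ | ⟨x, hx, rfl⟩ | ⟨x, rfl⟩
      · change s.spOld s' x = s.old w ↔ _
        by_cases hc : Contr s.ν s'.ν x
        · rw [spOld_contr hc, s.old_injective.eq_iff, s'.old_injective.eq_iff,
            s'.old_injective.mem_set_image, s'.i_old (hcz hc)]
          constructor
          · exact fun h => Or.inr (Or.inl ⟨hc, h⟩)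
          · rintro (rfl | h | ⟨y, -, h⟩ | ⟨_, ⟨y, ⟨hy, -⟩, rfl⟩, h⟩)
            · exact hrw
            · exact h.2
            · exact absurd h s'.old_ne_flag
            · rw [s'.i_old (hcz hy)] at h
              exact absurd h s'.old_ne_mid
        · rw [spOld_not hc, s.old_injective.eq_iff, s'.old_injective.eq_iff,
            s'.old_injective.mem_set_image]
          constructor
          · exact Or.inl
          · rintro (h | h | ⟨y, ⟨hy, -⟩, h⟩ | ⟨_, ⟨y, ⟨hy, -⟩, rfl⟩, h⟩)
            · exact h
            · exact absurd h.1 hc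
            · by_cases h0 : s'.ν x = 0
              · rw [s'.i_old_zero h0] at h
                rw [s'.old_injective h] at hy
                exact absurd (s'.ν_i.2 h0) (hcz hy)
              · rw [s'.i_old h0] at h
                exact absurd h s'.old_ne_flag
            · rw [s'.i_old (hcz hy)] at h
              exact absurd h s'.old_ne_mid
      · change s.curve.i (s.spOld s' x) = s.old w ↔ _
        rw [i_flag, s'.old_injective.mem_set_image]
        constructor
        · intro h
          by_cases hc : Contr s.ν s'.ν x
          · rw [spOld_contr hc, i_old_r, s.old_injective.eq_iff] at h
            exact Or.inr (Or.inr (Or.inl ⟨hc, h⟩))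
          · have h' : s.spOld s' x = s.old w := by
              rw [← s.curve.i_i (s.spOld s' x), h, ← hrw, i_old_r]
            rw [spOld_not hc, s.old_injective.eq_iff] at h'
            rw [h', ← hrw, s'.ν_r] at hx
            exact absurd rfl hx
        · rintro (h | ⟨y, -, h⟩ | h | ⟨_, ⟨y, ⟨hy, -⟩, rfl⟩, h⟩)
          · exact absurd h.symm s'.old_ne_flag
          · exact absurd h s'.old_ne_flag
          · rw [spOld_contr h.1, i_old_r, h.2]
          · rw [s'.i_old (hcz hy)] at h
            exact absurd h s'.flag_ne_mid
      · rw [Set.mem_ofPred_eq, hmid]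
        have hxi : s'.curve.r (s'.curve.i (s'.old x.1)) = s'.mid x := by
          rw [s'.i_old x.2.2, r_flag, s'.orient_of_or]
        have hx' : s'.ν (Γ.i x.1) ≠ 0 := fun h => x.2.2 (s'.ν_i.1 h)
        have hxi' : s'.curve.r (s'.curve.i (s'.old (Γ.i x.1))) = s'.mid x := by
          rw [s'.i_old hx', r_flag, s'.orient_i x.2.2 hx', s'.orient_of_or]
        constructor
        · intro h
          by_cases hc : Contr s.ν s'.ν x.1
          · rw [spOld_contr hc, i_old_r, r_old, Γ.r_r, s.old_injective.eq_iff] at h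
            exact Or.inr (Or.inr (Or.inr ⟨_, ⟨x.1, ⟨hc, h⟩, rfl⟩, hxi.symm⟩))
          · rw [spOld_not hc] at h
            by_cases h0 : s.ν x.1 = 0
            · rw [s.i_old_zero h0, r_old, s.old_injective.eq_iff] at h
              exact Or.inr (Or.inr (Or.inr ⟨_, ⟨Γ.i x.1,
                ⟨(contr_i s.frac s'.frac h0 x.2.2 (h2 _ h0)).2 hc, h⟩, rfl⟩, hxi'.symm⟩))
            · rw [s.i_old h0] at h
              exact absurd h.symm s.old_ne_mid
        · rintro (h | ⟨y, -, h⟩ | ⟨y, -, h⟩ | ⟨_, ⟨y, ⟨hy, hyw⟩, rfl⟩, h⟩)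
          · exact absurd h.symm s'.old_ne_mid
          · exact absurd h s'.old_ne_mid
          · exact absurd h s'.old_ne_mid
          · rw [← hmid, h, sp_r h2, sp_i h1]
            change s.curve.r (s.curve.i (s.spOld s' y)) = s.old w
            rw [spOld_contr hy, i_old_r, r_old, Γ.r_r, hyw]
  · exact absurd hv.symm s.flag_ne_mid
  -- over an exceptional vertex, the fibre is a single vertex
  · refine star_connOn_genusOn (z := s'.mid ⟨w.1, w.2.1, h1 _ w.2.2⟩) (K := ∅) rfl ?_ ?_ ?_ ?_ ?_
    · simp
    · simp
    · simp
    · simp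
    · intro z
      simp only [Set.mem_ofPred_eq, Set.mem_empty_iff_false, false_and, exists_false, or_false]
      have hold : ∀ x, ∃ y, s.spOld s' x = s.old y := fun x => by
        unfold spOld
        split_ifs
        · exact ⟨_, rfl⟩
        · exact ⟨_, rfl⟩
      rcases s'.cases z with ⟨x, rfl⟩ | ⟨x, hx, rfl⟩ | ⟨x, rfl⟩
      · refine iff_of_false (fun h => ?_) s'.old_ne_mid
        obtain ⟨y, hy⟩ := hold x
        exact s.old_ne_mid (hy.symm.trans h)
      · refine iff_of_false (fun h => ?_) s'.flag_ne_mid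
        have h : s.curve.i (s.spOld s' x) = s.mid w := h
        obtain ⟨y, hy⟩ := hold x
        rw [← s.curve.i_i (s.spOld s' x), h, i_mid] at hy
        exact s.old_ne_mid hy.symm
      · rw [hmid, s'.mid_injective.eq_iff]
        constructor
        · intro h
          have h0 : s.ν x.1 ≠ 0 := fun h0 => by
            by_cases hc : Contr s.ν s'.ν x.1
            · rw [spOld_contr hc, i_old_r] at h
              exact s.old_ne_mid h
            · rw [spOld_not hc, s.i_old_zero h0] at h
              exact s.old_ne_mid h
          rw [spOld_not fun hc => h0 hc.1, s.i_old h0, r_flag, s.mid_injective.eq_iff] at h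
          have h3 := s.orient_of_or ⟨x.1, x.2.1, h0⟩
          rw [← h, h3]
        · rintro rfl
          rw [spOld_not fun hc => w.2.2 hc.1, s.i_old w.2.2, r_flag, s.orient_of_or w]

/-- The specialization is a morphism of graphs as soon as no exceptional vertex disappears and none
that moves to an end is at a midpoint. -/
theorem isMor_sp (h1 : ∀ x, s.ν x ≠ 0 → s'.ν x ≠ 0) (h2 : ∀ x, s.ν x = 0 → s'.ν x ≠ 1 / 2) :
    IsMor s'.curve.toMGraph s.curve.toMGraph (s.sp s') where
  map_r := sp_r h2
  map_i := sp_i h1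
  flag f hf := by
    obtain ⟨z, rfl⟩ := exists_sp_eq h1 f hf
    exact ⟨z, rfl, fun w hw => (sp_inj h2 hf hw.symm).symm⟩
  mark k := spOld_fix (Γ.m k).2.2
  conn v hv := (sp_fibre h1 h2 v hv).1
  genus v hv := (sp_fibre h1 h2 v hv).2

end Pos

end TCurve

/-! ### Nearby divisors -/

namespace TCurve

variable {n : ℕ} {g : ℕ} {C C' Γ : TCurve n}

open Classical in
/-- The pair `(D', ν')` of a divisor on the vertices and of positions of exceptional vertices is
`ε`-near to `(D, ν)`: the exceptional vertices at `ν` move by less than `ε`, the other ones are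
closer than `ε` to the ends of their edges, and moving them to these ends turns `D'` into `D`. -/
structure IsNear (D : Γ.V → ℤ) (ν : Γ.X → ℝ) (D' : Γ.V → ℤ) (ν' : Γ.X → ℝ) (ε : ℝ) : Prop where
  ne : ∀ x, ν x ≠ 0 → |ν' x - ν x| < ε
  zero : ∀ x, ν x = 0 → ν' x < ε ∨ 1 - ε < ν' x
  div : ∀ v, D v = D' v + ∑ x with Γ.root x = v, if Contr ν ν' x then 1 else 0

/-- `ε` is smaller than the distances from the exceptional vertices at `ν` to the ends of their
edges. -/
structure IsSmall (ν : Γ.X → ℝ) (ε : ℝ) : Prop where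
  pos : 0 < ε
  le : ε ≤ 1 / 4
  ne : ∀ x, ν x ≠ 0 → ε ≤ ν x ∧ ε ≤ 1 - ν x

/-- There are arbitrarily small such `ε`, because there are only finitely many edges. -/
theorem exists_isSmall {ν : Γ.X → ℝ} (hν : Γ.IsFrac ν) {δ : ℝ} (hδ : 0 < δ) :
    ∃ ε ≤ δ, IsSmall ν ε := by
  have h : ∀ x, 0 < if ν x = 0 then 1 else min (ν x) (1 - ν x) := fun x => by
    split_ifs with h
    · exact one_pos
    · exact lt_min (lt_of_le_of_ne (hν x).1 (Ne.symm h)) (by linarith [(hν x).2.1])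
  obtain ⟨e, he, hle⟩ : ∃ e > 0, ∀ x, e ≤ if ν x = 0 then 1 else min (ν x) (1 - ν x) := by
    rcases isEmpty_or_nonempty Γ.X with _ | _
    · exact ⟨1, one_pos, fun x => isEmptyElim x⟩
    · obtain ⟨y, hy⟩ := Finite.exists_min fun x => if ν x = 0 then 1 else min (ν x) (1 - ν x)
      exact ⟨_, h y, hy⟩
  refine ⟨min δ (min (1 / 4) e), min_le_left _ _, ⟨lt_min hδ (lt_min (by norm_num) he),
    (min_le_right _ _).trans (min_le_left _ _), fun x hx => ?_⟩⟩
  have h1 := hle x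
  rw [if_neg hx, le_min_iff] at h1
  have h2 : min δ (min (1 / 4) e) ≤ e := (min_le_right _ _).trans (min_le_right _ _)
  exact ⟨h2.trans h1.1, h2.trans h1.2⟩

namespace IsNear

variable {D D' : Γ.V → ℤ} {ν ν' : Γ.X → ℝ} {ε : ℝ}

theorem ne_zero (h : IsNear D ν D' ν' ε) (hε : IsSmall ν ε) (x : Γ.X) (hx : ν x ≠ 0) :
    ν' x ≠ 0 := fun h0 => by
  have h1 := h.ne x hx
  rw [h0, zero_sub, abs_neg] at h1
  linarith [(hε.ne x hx).1, le_abs_self (ν x)]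

theorem ne_half (h : IsNear D ν D' ν' ε) (hε : ε ≤ 1 / 4) (x : Γ.X) (hx : ν x = 0) :
    ν' x ≠ 1 / 2 := fun h0 => by
  rcases h.zero x hx with h1 | h1 <;> linarith

end IsNear

/-- The behaviour of the chips on an edge under a small change of a flow. -/
theorem near_of_abs_lt {μ μ' : Γ.X → ℝ} {ε : ℝ} (hε : IsSmall (fun x => Int.fract (μ x)) ε)
    {x : Γ.X} (h : |μ' x - μ x| < ε) :
    (Int.fract (μ x) ≠ 0 → Int.fract (μ' x) - Int.fract (μ x) = μ' x - μ x) ∧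
    (Int.fract (μ x) = 0 → Int.fract (μ' x) < ε ∨ 1 - ε < Int.fract (μ' x)) ∧
    ⌈μ' x⌉ = ⌈μ x⌉ + open Classical in
      if Contr (fun x => Int.fract (μ x)) (fun x => Int.fract (μ' x)) x then 1 else 0 := by
  have h1 := Int.floor_add_fract (μ x)
  have h2 := Int.floor_add_fract (μ' x)
  have hlt := Int.fract_lt_one (μ x)
  have hlt' := Int.fract_lt_one (μ' x)
  have h0 := Int.fract_nonneg (μ x)
  have h0' := Int.fract_nonneg (μ' x)
  have h4 := hε.le
  rw [abs_lt] at h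
  by_cases hx : Int.fract (μ x) = 0
  · refine ⟨fun h => absurd hx h, fun _ => ?_, ?_⟩
    · by_cases hm : ⌊μ' x⌋ = ⌊μ x⌋
      · left
        rw [hm] at h2
        linarith
      · right
        have : ⌊μ' x⌋ = ⌊μ x⌋ - 1 := by
          refine (Int.floor_eq_iff.2 ⟨?_, ?_⟩)
          · push_cast; linarith
          · push_cast
            by_contra hge
            push Not at hge
            exact hm (Int.floor_eq_iff.2 ⟨by linarith, by linarith⟩)
        rw [this] at h2
        push_cast at h2
        linarith
    · have hc : ⌈μ x⌉ = ⌊μ x⌋ := Int.ceil_eq_iff.2 ⟨by linarith, by linarith⟩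
      unfold Contr
      simp only [hx, true_and]
      split_ifs with hf
      · have : ⌊μ' x⌋ = ⌊μ x⌋ := by
          rw [Int.floor_eq_iff]
          have h5 : ((⌊μ x⌋ - 1 : ℤ) : ℝ) < ⌊μ' x⌋ := by push_cast; linarith
          have h6 : ⌊μ x⌋ - 1 < ⌊μ' x⌋ := by exact_mod_cast h5
          have h7 : ((⌊μ x⌋ : ℤ) : ℝ) ≤ ⌊μ' x⌋ := by exact_mod_cast (by omega : ⌊μ x⌋ ≤ ⌊μ' x⌋)
          constructor <;> linarith
        rw [hc, Int.ceil_eq_iff]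
        rw [this] at h2
        push_cast
        constructor <;> linarith
      · rw [hc, add_zero, Int.ceil_eq_iff]
        refine ⟨by linarith, ?_⟩
        by_contra hgt
        push Not at hgt
        have : ⌊μ' x⌋ = ⌊μ x⌋ := Int.floor_eq_iff.2 ⟨by linarith, by linarith⟩
        rw [this] at h2
        exact hf ⟨by linarith, by linarith⟩
  · have h5 := hε.ne x hx
    have hm : ⌊μ' x⌋ = ⌊μ x⌋ := Int.floor_eq_iff.2 ⟨by linarith [h5.1], by linarith [h5.2]⟩
    refine ⟨fun _ => ?_, fun h => absurd h hx, ?_⟩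
    · rw [hm] at h2; linarith
    · rw [if_neg fun hc => hx hc.1, add_zero]
      have hc : ⌈μ x⌉ = ⌊μ x⌋ + 1 := Int.ceil_eq_iff.2
        ⟨by push_cast; linarith [lt_of_le_of_ne h0 (Ne.symm hx)], by push_cast; linarith⟩
      rw [hc, Int.ceil_eq_iff]
      push_cast
      constructor <;> linarith [h5.1, h5.2]

/-- The effect on the divisor of a change of the rounded values of a flow. -/
theorem flowDiv_eq_add {D₀ : Γ.V → ℤ} {μ μ' : Γ.X → ℝ} {c : Γ.X → ℤ}
    (h : ∀ x, ⌈μ' x⌉ = ⌈μ x⌉ + c x) (v : Γ.V) :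
    flowDiv D₀ μ v = flowDiv D₀ μ' v + ∑ x with Γ.root x = v, c x := by
  unfold flowDiv
  simp only [h]
  rw [out_add]
  unfold MGraph.out
  ring

/-- Small changes of a flow lead to small changes of the associated divisor. -/
theorem isNear_of_flow {D₀ : Γ.V → ℤ} {μ μ' : Γ.X → ℝ} {ε : ℝ}
    (hε : IsSmall (fun x => Int.fract (μ x)) ε) (h : ∀ x, |μ' x - μ x| < ε) :
    IsNear (flowDiv D₀ μ) (fun x => Int.fract (μ x)) (flowDiv D₀ μ') (fun x => Int.fract (μ' x))
      ε where
  ne x hx := by rw [(near_of_abs_lt hε (h x)).1 hx]; exact h x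
  zero x hx := (near_of_abs_lt hε (h x)).2.1 hx
  div v := flowDiv_eq_add (fun x => (near_of_abs_lt hε (h x)).2.2) v

/-- Small changes of a divisor are induced by small changes of flows. -/
theorem IsNear.exists_flow {D₀ D' : Γ.V → ℤ} {μ ν' : Γ.X → ℝ} {ε : ℝ} (hμ : Γ.IsFlow μ)
    (hε : IsSmall (fun x => Int.fract (μ x)) ε) (hν' : Γ.IsFrac ν')
    (h : IsNear (flowDiv D₀ μ) (fun x => Int.fract (μ x)) D' ν' ε) :
    ∃ μ', Γ.IsFlow μ' ∧ (∀ x, Int.fract (μ' x) = ν' x) ∧ flowDiv D₀ μ' = D' ∧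
      ∀ x, |μ' x - μ x| < ε := by
  classical
  -- the displacement of the chip on each edge, which enters an edge without exceptional vertex from
  -- the nearer end
  let δ : Γ.X → ℝ := fun x => if Int.fract (μ x) ≠ 0 then ν' x - Int.fract (μ x) else
    if ν' x < 1 / 2 then ν' x else ν' x - 1
  have hδ : Γ.IsFlow δ := fun x => by
    have h1 := (isFrac_fract hμ x).2.2
    have h2 := (hν' x).2.2
    simp only [δ] at h1 ⊢
    by_cases hx : Int.fract (μ x) = 0
    · rw [if_pos hx] at h1
      have h3 := h.ne_half hε.le x hx
      by_cases hx' : ν' x = 0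
      · rw [if_pos hx'] at h2
        simp [hx, h1, hx', h2]
      · rw [if_neg hx'] at h2
        rw [if_neg (not_not.2 hx), if_neg (not_not.2 h1), h2]
        by_cases h4 : ν' x < 1 / 2
        · rw [if_pos h4, if_neg (by linarith)]; ring
        · rw [if_neg h4, if_pos (by linarith [lt_of_le_of_ne (not_lt.1 h4) (Ne.symm h3)])]; ring
    · rw [if_neg hx] at h1
      rw [if_neg (h.ne_zero hε x hx)] at h2
      rw [if_pos hx, if_pos (by rw [h1]; linarith [Int.fract_lt_one (μ x)]), h1, h2]
      ring
  have habs : ∀ x, |δ x| < ε := fun x => by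
    simp only [δ]
    by_cases hx : Int.fract (μ x) = 0
    · rw [if_neg (not_not.2 hx)]
      have h4 := hε.le
      have h5 := hν' x
      rcases h.zero x hx with h3 | h3
      · rw [if_pos (by linarith), abs_of_nonneg h5.1]; exact h3
      · rw [if_neg (by linarith), abs_of_neg (by linarith)]; linarith
    · rw [if_pos hx]
      exact h.ne x hx
  have hfr : ∀ x, Int.fract (μ x + δ x) = ν' x := fun x => by
    have h5 := hν' x
    have h6 := Int.floor_add_fract (μ x)
    rw [Int.fract_eq_iff]
    refine ⟨h5.1, h5.2.1, ?_⟩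
    simp only [δ]
    split_ifs with h7 h8
    · exact ⟨⌊μ x⌋, by linarith⟩
    · exact ⟨⌊μ x⌋, by linarith [not_not.1 h7]⟩
    · exact ⟨⌊μ x⌋ - 1, by push_cast; linarith [not_not.1 h7]⟩
  have habs' : ∀ x, |μ x + δ x - μ x| < ε := fun x => by rw [add_sub_cancel_left]; exact habs x
  refine ⟨fun x => μ x + δ x, hμ.add hδ, hfr, ?_, habs'⟩
  funext v
  have h1 := (isNear_of_flow (D₀ := D₀) (μ' := fun x => μ x + δ x) hε habs').div v
  simp only [hfr] at h1
  exact add_right_cancel (h1.symm.trans (h.div v))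

/-! ### Specializations of curves with a given stabilization -/

theorem exists_le_len (Γ : TCurve n) : ∃ m > 0, ∀ x, Γ.i x ≠ x → m ≤ Γ.len x := by
  obtain ⟨ε, hε, h⟩ := Γ.exists_lt_len
  exact ⟨2 * ε, by positivity, fun x hx => (h x hx).le⟩

section

variable {hC : IsQS g C.toMGraph} {hC' : IsQS g C'.toMGraph} {ψ : Iso (C.stab hC) Γ}
  {ψ' : Iso (C'.stab hC') Γ} {σ : C'.X → C.X}

theorem map_incl_of_stabFun (hs : ∀ x, stabFun C'.toMGraph C.toMGraph σ (incl ψ' x) = incl ψ x)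
    {x : Γ.X} (hx : param ψ' x = 0) : σ (incl ψ' x) = incl ψ x := by
  rw [← hs x]
  unfold stabFun
  rw [if_neg fun h => (((isSubdiv ψ').exc x).1 h.1) hx]

/-- The possible images of a half-edge under a specialization inducing the identity on the
stabilizations. -/
theorem map_incl_cases (hσ : IsMor C'.toMGraph C.toMGraph σ)
    (hs : ∀ x, stabFun C'.toMGraph C.toMGraph σ (incl ψ' x) = incl ψ x) (x : Γ.X) :
    σ (incl ψ' x) = incl ψ x ∨
      σ (incl ψ' x) = C.r (incl ψ x) ∧ param ψ x = 0 ∧ param ψ' x ≠ 0 := by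
  by_cases hx : C'.Exc (C'.r (C'.i (incl ψ' x))) ∧ C.r (σ (incl ψ' x)) = σ (incl ψ' x)
  · right
    have h0 : param ψ' x ≠ 0 := ((isSubdiv ψ').exc x).1 hx.1
    have h1 := hs x
    unfold stabFun at h1
    rw [if_pos hx, (isSubdiv ψ').i_opp x h0] at h1
    refine ⟨?_, ?_, h0⟩
    · rw [← hx.2, ← hσ.map_r, ← (isSubdiv ψ').map_r, ← (isSubdiv ψ).map_r]
      exact map_incl_of_stabFun hs ((isSubdiv ψ').fix _ (Γ.i_r x))
    · by_contra hne
      have h2 := ((isSubdiv ψ).exc x).2 hne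
      rw [← h1, ← hσ.map_i, C'.i_i] at h2
      exact (isSubdiv ψ').nexc _ (hσ.exc_of_exc hC' h2)
  · left
    rw [← hs x]
    unfold stabFun
    rw [if_neg hx]

variable {m ε : ℝ}

/-- The possible behaviours of a half-edge under a specialization inducing the identity on the
stabilizations and changing lengths by less than `ε` times a lower bound `m` for the lengths of the
edges: the exceptional vertex on its edge stays, there is none, it moves to the root, or it moves to
the other end. -/
theorem len_incl_cases (hσ : IsMor C'.toMGraph C.toMGraph σ)
    (hs : ∀ x, stabFun C'.toMGraph C.toMGraph σ (incl ψ' x) = incl ψ x)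
    (hm : ∀ x, Γ.i x ≠ x → m ≤ Γ.len x) (hε : 0 < ε)
    (hl : ∀ y, |C'.len y - C.len (σ y)| < ε * m) (x : Γ.X) :
    (param ψ x ≠ 0 ∧ param ψ' x ≠ 0 ∧ |param ψ' x - param ψ x| < ε ∧ σ (incl ψ' x) = incl ψ x) ∨
    (param ψ x = 0 ∧ param ψ' x = 0 ∧ σ (incl ψ' x) = incl ψ x) ∨
    (param ψ x = 0 ∧ 0 < param ψ' x ∧ param ψ' x < ε ∧ σ (incl ψ' x) = C.r (incl ψ x)) ∨
    (param ψ x = 0 ∧ 1 - ε < param ψ' x ∧ σ (incl ψ' x) = incl ψ x) := by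
  have hL : ∀ {a : ℝ}, Γ.i x ≠ x → |a * Γ.len x| < ε * m → |a| < ε := fun {a} hi h => by
    have h1 := Γ.len_pos x hi
    rw [abs_mul, abs_of_pos h1] at h
    refine lt_of_mul_lt_mul_right (h.trans_le ?_) h1.le
    exact mul_le_mul_of_nonneg_left (hm x hi) hε.le
  have hlen := (isSubdiv ψ).len x
  have hlen' := (isSubdiv ψ').len x
  have hlx := hl (incl ψ' x)
  have hfix : param ψ' x ≠ 0 → Γ.i x ≠ x := fun h hi => h ((isSubdiv ψ').fix x hi)
  have hfr := (isSubdiv ψ').frac x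
  rcases map_incl_cases hσ hs x with h1 | ⟨h1, h0, h0'⟩
  · by_cases h0' : param ψ' x = 0
    · by_cases h0 : param ψ x = 0
      · exact Or.inr (Or.inl ⟨h0, h0', h1⟩)
      · have h2 := ((isSubdiv ψ).exc x).2 h0
        rw [← h1, ← hσ.map_i] at h2
        exact absurd h0' (((isSubdiv ψ').exc x).1 (hσ.exc_of_exc hC' h2))
    · rw [if_neg h0'] at hlen'
      rw [h1, hlen', hlen] at hlx
      by_cases h0 : param ψ x = 0
      · right; right; right
        rw [if_pos h0] at hlx
        have h2 : |param ψ' x - 1| < ε := hL (hfix h0') (by convert hlx using 2; ring)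
        exact ⟨h0, by linarith [(abs_lt.1 h2).1], h1⟩
      · left
        rw [if_neg h0, ← sub_mul] at hlx
        exact ⟨h0, h0', hL (hfix h0') hlx, h1⟩
  · right; right; left
    rw [if_neg h0'] at hlen'
    rw [h1, hlen', C.len_zero _ (C.i_r _), sub_zero] at hlx
    have h2 := hL (hfix h0') hlx
    rw [abs_of_nonneg hfr.1] at h2
    exact ⟨h0, lt_of_le_of_ne hfr.1 (Ne.symm h0'), h2, h1⟩

/-- A specialization inducing the identity on the stabilizations, and nearly preserving the lengths,
is the standard one. -/
theorem isSpec_of_len (hσ : IsMor C'.toMGraph C.toMGraph σ)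
    (hs : ∀ x, stabFun C'.toMGraph C.toMGraph σ (incl ψ' x) = incl ψ x)
    (hm : ∀ x, Γ.i x ≠ x → m ≤ Γ.len x) (hε : 0 < ε) (hε' : ε ≤ 1 / 4)
    (hl : ∀ y, |C'.len y - C.len (σ y)| < ε * m) :
    IsSpec (isSubdiv ψ) (isSubdiv ψ') σ where
  map_r := hσ.map_r
  map_i := hσ.map_i
  map_j x := by
    rcases len_incl_cases hσ hs hm hε hl x with h | h | h | h
    · rw [if_neg fun hc => h.1 hc.1]; exact h.2.2.2
    · rw [if_neg fun hc => hc.2.1.ne' h.2.1]; exact h.2.2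
    · rw [if_pos ⟨h.1, h.2.1, by linarith⟩]; exact h.2.2.2
    · rw [if_neg fun hc => by linarith [hc.2.2]]; exact h.2.2
  ne_zero x hx := by
    rcases len_incl_cases hσ hs hm hε hl x with h | h | h | h
    · exact h.2.1
    · exact absurd h.1 hx
    · exact absurd h.1 hx
    · exact absurd h.1 hx
  ne_half x hx := by
    rcases len_incl_cases hσ hs hm hε hl x with h | h | h | h
    · exact absurd hx h.1
    · rw [h.2.1]; norm_num
    · linarith
    · linarith

/-- A specialization inducing the identity on the stabilizations, and nearly preserving the
lengths, relates nearby divisors. -/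
theorem isNear_of_len (hσ : IsMor C'.toMGraph C.toMGraph σ)
    (hs : ∀ x, stabFun C'.toMGraph C.toMGraph σ (incl ψ' x) = incl ψ x)
    (hm : ∀ x, Γ.i x ≠ x → m ≤ Γ.len x) (hε : 0 < ε) (hε' : ε ≤ 1 / 4)
    (hl : ∀ y, |C'.len y - C.len (σ y)| < ε * m) {D : C.V → ℤ} {D' : C'.V → ℤ}
    (hD' : ∀ v : C'.V, C'.Exc v.1 → D' v = 1)
    (hp : ∀ v : C.V, D v = ∑ᶠ w : {w : C'.V // σ w.1 = v.1}, D' w.1) :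
    IsNear (fun v => D ((isSubdiv ψ).vert v)) (param ψ) (fun v => D' ((isSubdiv ψ').vert v))
      (param ψ') ε where
  ne x hx := by
    rcases len_incl_cases hσ hs hm hε hl x with h | h | h | h
    · exact h.2.2.1
    · exact absurd h.1 hx
    · exact absurd h.1 hx
    · exact absurd h.1 hx
  zero x hx := by
    rcases len_incl_cases hσ hs hm hε hl x with h | h | h | h
    · exact absurd hx h.1
    · left; rw [h.2.1]; exact hε
    · exact Or.inl h.2.2.1
    · exact Or.inr h.2.1
  div v := (hp _).trans
    ((isSpec_of_len hσ hs hm hε hε' hl).sum_fibre_vert hC' hD' v)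

end

/-- A specialization of subdivisions induces the identity on the stabilizations. -/
theorem IsSpec.stabFun_eq {j : Γ.X → C.X} {j' : Γ.X → C'.X} {ν ν' : Γ.X → ℝ}
    {h : IsSubdiv C Γ j ν} {h' : IsSubdiv C' Γ j' ν'} {σ : C'.X → C.X} (hσ : IsSpec h h' σ)
    (x : Γ.X) : stabFun C'.toMGraph C.toMGraph σ (j' x) = j x := by
  unfold stabFun
  by_cases hc : Contr ν ν' x
  · have h0 : ν' x ≠ 0 := hc.2.1.ne'
    have h1 : σ (j' x) = C.r (j x) := (hσ.map_j x).trans (if_pos hc)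
    have h2 : ν (Γ.i x) = 0 := by rw [(h.frac x).2.2, if_pos hc.1]
    rw [if_pos ⟨(h'.exc x).2 h0, by rw [h1, C.r_r]⟩, h'.i_opp x h0, hσ.map_i, hσ.map_j,
      if_neg (hc.not_i h'.frac), h.i_zero _ h2, Γ.i_i]
  · have h1 : σ (j' x) = j x := (hσ.map_j x).trans (if_neg hc)
    rw [h1, if_neg]
    rintro ⟨he, hr⟩
    have h2 : Γ.r x = x := h.inj (by rw [h.map_r, hr])
    exact (h'.exc x).1 he (h'.fix x (i_vertex h2))

end TCurve

/-! ### Points of the fibre as families of divisors -/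


namespace FibreOver

variable {g n : ℕ} {φ : UnivStab g n} {Γ : TCurve n} {hΓ : IsStable g Γ.toMGraph}
  {T : Type u} [TopologicalSpace T] (F : FibreOver φ Γ hΓ T)

/-- The curve over a point. -/
noncomputable abbrev curve (t : T) : TCurve n := F.left.curve t

/-- The identification of the stabilization of the curve over a point with `Γ`. -/
noncomputable def stabIso (t : T) : TCurve.Iso ((F.curve t).stab (F.left.qs t)) Γ :=
  (show Fam.Iso F.left.stab.toFam (constFam Γ hΓ T).toFam from F.hom).iso t

/-- The positions of the exceptional vertices of the curve over a point. -/
noncomputable def pos (t : T) : Γ.X → ℝ := TCurve.param (F.stabIso t)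

/-- The vertices and flags of `Γ` in the curve over a point. -/
noncomputable def old (t : T) : Γ.X → (F.curve t).X := TCurve.incl (F.stabIso t)

theorem isSubdiv (t : T) : TCurve.IsSubdiv (F.curve t) Γ (F.old t) (F.pos t) :=
  TCurve.isSubdiv (F.stabIso t)

/-- The values at the vertices of `Γ` of the divisor over a point. -/
noncomputable def div (t : T) (v : Γ.V) : ℤ := F.left.D t ((F.isSubdiv t).vert v)

theorem picClass_eq (t : T) : picClass F t = Γ.clsHom (Γ.divOf (F.div t) (F.pos t)) :=
  congrArg Γ.cls (TCurve.modelDivisor_eq (F.stabIso t) (F.left.D t))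

/-- The divisor over a point is semistable, expressed on `Γ`. -/
theorem isSSData (t : T) : TCurve.IsSSData (φ.val Γ.toMGraph hΓ) (F.div t) (F.pos t) :=
  TCurve.isSSData_of_semistable (F.stabIso t) hΓ (F.left.ss t)

open Classical in
theorem sum_div (t : T) :
    ∑ v, F.div t v + ∑ x with Γ.Or x, (if F.pos t x = 0 then 0 else 1) = φ.deg :=
  TCurve.semistable_sum (F.stabIso t) (F.left.ss t)

theorem picClass_mem (t : T) : picClass F t ∈ Γ.PicDeg φ.deg := by
  refine ⟨_, ?_, (F.picClass_eq t).symm⟩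
  rw [← TCurve.degHom_apply, TCurve.degHom_divOf, F.sum_div]

/-- A flow from which the divisor over a point arises. -/
theorem exists_flow (π : Γ.Paths) (t : T) : ∃ μ, Γ.IsFlow μ ∧
    (fun x => Int.fract (μ x)) = F.pos t ∧ TCurve.flowDiv (π.baseDiv φ.deg) μ = F.div t := by
  obtain ⟨μ, h1, h2, h3⟩ := TCurve.exists_flow_lift π (F.isSubdiv t).frac (F.isSubdiv t).fix
    (F.sum_div t)
  exact ⟨μ, h1, funext h2, h3⟩

/-- The specialization morphisms induce the identity on the stabilizations. -/
theorem eventually_stabFun (t : T) : ∀ᶠ t' in 𝓝 t, ∀ h : t' ∈ F.left.nhd t, ∀ x,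
    stabFun (F.curve t').toMGraph (F.curve t).toMGraph (F.left.sp t t' h) (F.old t' x) =
      F.old t x := by
  have h1 := (show Fam.Iso F.left.stab.toFam (constFam Γ hΓ T).toFam from F.hom).comm t
  filter_upwards [h1] with t' h2 h x
  have h3 := h2 h trivial ((F.stabIso t').toEquiv.symm x)
  have h4 : (F.stabIso t).toEquiv (stabMap (F.left.qs t') (F.left.qs t) (F.left.sp_mor t t' h)
      ((F.stabIso t').toEquiv.symm x)) = x := h3.trans ((F.stabIso t').toEquiv.apply_symm_apply x)
  exact congrArg Subtype.val ((Equiv.eq_symm_apply _).2 h4)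

/-- Nearby divisors in a family. -/
theorem eventually_isNear (t : T) {ε : ℝ} (hε : 0 < ε) (hε' : ε ≤ 1 / 4) : ∀ᶠ t' in 𝓝 t,
    TCurve.IsNear (F.div t) (F.pos t) (F.div t') (F.pos t') ε ∧ ∀ h : t' ∈ F.left.nhd t,
      TCurve.IsSpec (F.isSubdiv t) (F.isSubdiv t') (F.left.sp t t' h) := by
  obtain ⟨m, hm0, hm⟩ := Γ.exists_le_len
  filter_upwards [F.eventually_stabFun t, F.left.sp_len t (ε * m) (mul_pos hε hm0),
    (F.left.isOpen_nhd t).mem_nhds (F.left.mem_nhd t)] with t' h1 h2 h3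
  exact ⟨TCurve.isNear_of_len (F.left.sp_mor t t' h3) (h1 h3) hm hε hε' (h2 h3)
    (F.left.ss t').admissible (F.left.push t t' h3),
    fun h => TCurve.isSpec_of_len (F.left.sp_mor t t' h) (h1 h) hm hε hε' (h2 h)⟩

variable (π : Γ.Paths) (ϖ : Γ.PeriodMap)

theorem picClass_eq_flow {t : T} {μ : Γ.X → ℝ} (hμ : Γ.IsFlow μ)
    (hf : (fun x => Int.fract (μ x)) = F.pos t)
    (hD : TCurve.flowDiv (π.baseDiv φ.deg) μ = F.div t) :
    TCurve.ajPic π ϖ (picClass F t) = ϖ.toTorus μ := by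
  rw [F.picClass_eq, ← hD, ← hf, TCurve.clsHom_divOf_baseDiv π _ hμ, TCurve.ajPic_baseDiv π ϖ _ hμ]

/-- The class of the divisor varies continuously: a nearby divisor arises from a nearby flow. -/
theorem continuous_ajPic : Continuous fun t => TCurve.ajPic π ϖ (picClass F t) := by
  rw [continuous_iff_continuousAt]
  intro t
  obtain ⟨μ, hμ, hf, hD⟩ := F.exists_flow π t
  change Filter.Tendsto _ _ (𝓝 (TCurve.ajPic π ϖ (picClass F t)))
  rw [F.picClass_eq_flow π ϖ hμ hf hD]
  intro U hU
  rw [Filter.mem_map]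
  obtain ⟨δ, hδ, hU'⟩ := Metric.mem_nhds_iff.1 (ϖ.continuous_toTorus.continuousAt hU)
  obtain ⟨ε, hεδ, hε⟩ := TCurve.exists_isSmall (F.isSubdiv t).frac hδ
  filter_upwards [F.eventually_isNear t hε.pos hε.le] with t' ht'
  rw [← hf] at hε
  have hnear := ht'.1
  rw [← hf, ← hD] at hnear
  obtain ⟨μ', hμ', hf', hD', hlt⟩ := hnear.exists_flow hμ hε (F.isSubdiv t').frac
  change TCurve.ajPic π ϖ (picClass F t') ∈ U
  rw [F.picClass_eq_flow π ϖ hμ' (funext hf') hD']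
  refine hU' ?_
  rw [Metric.mem_ball, dist_pi_lt_iff hδ]
  exact fun x => (hlt x).trans_le hεδ

/-- The morphism from the base of a point of the fibre to the tropical Picard group. -/
noncomputable def toPic : C(T, Γ.PicDeg φ.deg) where
  toFun t := ⟨picClass F t, F.picClass_mem t⟩
  continuous_toFun := by
    obtain ⟨π⟩ := TCurve.nonempty_paths hΓ.conn
    obtain ⟨ϖ⟩ := TCurve.nonempty_periodMap hΓ.conn
    exact (TCurve.picHomeo π ϖ φ.deg).isInducing.continuous_iff.2 (F.continuous_ajPic π ϖ)

end FibreOver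

/-! ### Divisors are determined by their classes -/

namespace TCurve

variable {n : ℕ} {g : ℕ} {Γ : TCurve n}

/-- A general universal stability condition is general on `Γ`, by generality on the trivial
subdivision. -/
theorem isGen {φ : UnivStab g n} (hgn : 2 < 2 * g + n) (hφ : φ.IsGeneral)
    (hΓ : IsStable g Γ.toMGraph) : IsGen (φ.val Γ.toMGraph hΓ) := by
  let s : Γ.Pos := ⟨fun _ => 0, fun _ => by simp, fun _ _ => rfl⟩
  exact isGen_of_isGeneral (s.stabIso hgn hΓ) hφ hΓ fun x => by rw [s.param_stabIso]

end TCurve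

namespace FibreOver

variable {g n : ℕ} {φ : UnivStab g n} {Γ : TCurve n} {hΓ : IsStable g Γ.toMGraph}
  {T : Type u} [TopologicalSpace T] {F F' : FibreOver φ Γ hΓ T}

theorem sum_val_eq (hΓ : IsStable g Γ.toMGraph) (π : Γ.Paths) :
    ∑ v, φ.val Γ.toMGraph hΓ v = ((∑ v, π.baseDiv φ.deg v : ℤ) : ℝ) := by
  rw [TCurve.sum_val, π.sum_baseDiv]

/-- Points of the fibre with the same class consist of the same divisor on the same subdivision of
`Γ`: semistable flows for them differ by an integral cycle. -/
theorem eq_of_picClass_eq (hgn : 2 < 2 * g + n) (hφ : φ.IsGeneral) {t : T}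
    (h : picClass F t = picClass F' t) : F.pos t = F'.pos t ∧ F.div t = F'.div t := by
  obtain ⟨π⟩ := TCurve.nonempty_paths hΓ.conn
  obtain ⟨ϖ⟩ := TCurve.nonempty_periodMap hΓ.conn
  obtain ⟨μ, hμ, hf, hD⟩ := F.exists_flow π t
  obtain ⟨μ', hμ', hf', hD'⟩ := F'.exists_flow π t
  have h1 := (TCurve.isSS_iff hμ).2 (by rw [hf, hD]; exact F.isSSData t)
  have h2 := (TCurve.isSS_iff hμ').2 (by rw [hf', hD']; exact F'.isSSData t)
  obtain ⟨c, hc, hcx⟩ := h1.unique ϖ (sum_val_eq hΓ π) (TCurve.isGen hgn hφ hΓ) hμ hμ' h2 (by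
    rw [← F.picClass_eq_flow π ϖ hμ hf hD, h, F'.picClass_eq_flow π ϖ hμ' hf' hD'])
  have h3 : μ' = fun x => μ x + c x := funext hcx
  rw [← hf, ← hf', ← hD, ← hD', h3, TCurve.flowDiv_add_cycle hc]
  simp only [Int.fract_add_intCast, and_self]

/-! ### Morphisms in the fibre -/

/-- Morphisms in the fibre commute with the inclusions of the flags of `Γ`. -/
theorem hom_old (f : F ⟶ F') (t : T) (x : Γ.X) :
    (f.left.toIso.iso t).toEquiv (F.old t x) = F'.old t x := by
  have h1 : (Phi φ T).map f.left ≫ F'.hom = F.hom := CostructuredArrow.w f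
  have h2 : ∀ y, (F'.stabIso t).toEquiv (((f.left.toIso.iso t).stab (F.left.qs t)
      (F'.left.qs t)).toEquiv y) = (F.stabIso t).toEquiv y := fun y => by
    have h3 := congrArg (fun a : Fam.Iso F.left.stab.toFam (constFam Γ hΓ T).toFam =>
      (a.iso t).toEquiv y) h1
    exact h3
  have h3 := h2 ((F.stabIso t).toEquiv.symm x)
  rw [Equiv.apply_symm_apply] at h3
  exact congrArg Subtype.val ((Equiv.eq_symm_apply _).2 h3)

/-- The class of the divisor is invariant under isomorphism. -/
theorem picClass_eq_of_hom (f : F ⟶ F') (t : T) : picClass F t = picClass F' t := by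
  have h1 : F.pos t = F'.pos t := by
    funext x
    unfold pos TCurve.param
    have h2 := hom_old f t x
    have h3 : TCurve.incl (F'.stabIso t) x = (f.left.toIso.iso t).toEquiv
      (TCurve.incl (F.stabIso t) x) := h2.symm
    rw [h3, (f.left.toIso.iso t).map_len]
    split_ifs with h4 h5 h5
    · rfl
    · exact absurd (((f.left.toIso.iso t).map_exc_i _).2 h4) h5
    · exact absurd (((f.left.toIso.iso t).map_exc_i _).1 h5) h4
    · rfl
  have h2 : F.div t = F'.div t := by
    funext v
    exact (f.left.map_D t _ _ (hom_old f t v.1)).symm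
  rw [F.picClass_eq, F'.picClass_eq, h1, h2]

/-- There is at most one morphism between two points of the fibre: it is determined on the flags of
`Γ`, and these generate the subdivisions. -/
theorem hom_ext (f f' : F ⟶ F') : f = f' := by
  refine CostructuredArrow.hom_ext _ _ (JFam.Hom.ext (Fam.Iso.ext (funext fun t =>
    TCurve.Iso.ext (Equiv.ext fun z => ?_))))
  exact (F.isSubdiv t).map_ext (F.left.qs t) (f.left.toIso.iso t).map_r
    (f.left.toIso.iso t).map_i (f'.left.toIso.iso t).map_r (f'.left.toIso.iso t).map_i
    (fun x => (hom_old f t x).trans (hom_old f' t x).symm) z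

/-- Points of the fibre given by the same data on `Γ` are isomorphic: the isomorphisms of the
subdivisions over `Γ` commute with the specializations, which are determined by the data. -/
theorem nonempty_hom (h : ∀ t, F.pos t = F'.pos t) (h' : ∀ t, F.div t = F'.div t) :
    Nonempty (F ⟶ F') := by
  have hs : ∀ t, TCurve.IsSubdiv (F'.curve t) Γ (F'.old t) (F.pos t) := fun t => by
    rw [h]; exact F'.isSubdiv t
  choose a ha using fun t =>
    (F.isSubdiv t).exists_iso (hs t) (F.left.qs t) (F'.left.qs t)
  let A : Fam.Iso F.left.toFam F'.left.toFam :=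
    { iso := a
      comm := fun t => by
        filter_upwards [F.eventually_isNear t (ε := 1 / 4) (by norm_num) le_rfl,
          F'.eventually_isNear t (ε := 1 / 4) (by norm_num) le_rfl] with t' h1 h2 k k' z
        have h1 := h1.2 k
        have h2 := h2.2 k'
        refine (F.isSubdiv t').map_ext (F.left.qs t')
          (a := fun z => (a t).toEquiv (F.left.sp t t' k z))
          (b := fun z => F'.left.sp t t' k' ((a t').toEquiv z)) ?_ ?_ ?_ ?_ ?_ z
        · intro z; rw [h1.map_r, (a t).map_r]
        · intro z; rw [h1.map_i, (a t).map_i]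
        · intro z; rw [(a t').map_r, h2.map_r]
        · intro z; rw [(a t').map_i, h2.map_i]
        · intro x
          rw [ha, h1.map_j, h2.map_j, h, h]
          split_ifs
          · rw [(a t).map_r, ha]
          · rw [ha] }
  let B : F.left ⟶ F'.left := JFam.Hom.mk A fun t v v' e => by
    obtain ⟨w | x, rfl⟩ := ((F.isSubdiv t).vertEquiv (F.left.qs t)).surjective v
    · have e : (a t).toEquiv (F.old t w.1) = v'.1 := e
      rw [ha] at e
      have e' : v' = (F'.isSubdiv t).vert w := Subtype.ext e.symm
      rw [e']
      exact (congrFun (h' t) w).symm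
    · have e : (a t).toEquiv ((F.isSubdiv t).mid x.1).1 = v'.1 := e
      have h1 := (F.isSubdiv t).exc_mid x.2.2
      have h2 : (F'.curve t).Exc v'.1 := by rw [← e, (a t).map_exc]; exact h1
      exact ((F'.left.ss t).admissible _ h2).trans ((F.left.ss t).admissible _ h1).symm
  refine ⟨CostructuredArrow.homMk B (Fam.Iso.ext (funext fun t =>
    TCurve.Iso.ext (Equiv.ext fun y => ?_)))⟩
  change (F'.stabIso t).toEquiv (((a t).stab (F.left.qs t) (F'.left.qs t)).toEquiv y) =
    (F.stabIso t).toEquiv y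
  obtain ⟨x, rfl⟩ := (F.stabIso t).toEquiv.symm.surjective y
  rw [Equiv.apply_symm_apply, ← Equiv.eq_symm_apply]
  exact Subtype.ext (ha t x)

end FibreOver

/-! ### Construction of families -/

namespace TCurve

variable {n : ℕ} {g : ℕ} {Γ : TCurve n}

namespace Pos

variable (s : Γ.Pos)

theorem isSubdiv (hgn : 2 < 2 * g + n) (hΓ : IsStable g Γ.toMGraph) :
    IsSubdiv s.curve Γ s.old s.ν := by
  have h := TCurve.isSubdiv (s.stabIso hgn hΓ)
  rw [s.param_stabIso] at h
  exact h

/-- The specialization of standard subdivisions, as a specialization of subdivisions. -/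
theorem isSpec (hgn : 2 < 2 * g + n) (hΓ : IsStable g Γ.toMGraph) {s s' : Γ.Pos}
    (h1 : ∀ x, s.ν x ≠ 0 → s'.ν x ≠ 0) (h2 : ∀ x, s.ν x = 0 → s'.ν x ≠ 1 / 2) :
    IsSpec (s.isSubdiv hgn hΓ) (s'.isSubdiv hgn hΓ) (s.sp s') where
  map_r := sp_r h2
  map_i := sp_i h1
  map_j x := by
    change s.spOld s' x = _
    unfold spOld
    rfl
  ne_zero := h1
  ne_half := h2

/-- The divisor on a standard subdivision with given values at the vertices of `Γ` and value one at
the exceptional vertices. -/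
def div (D : Γ.V → ℤ) (v : s.curve.V) : ℤ :=
  Sum.elim (fun x : Γ.X => D (Γ.root x)) (fun _ => 1) v.1

theorem div_vert (hgn : 2 < 2 * g + n) (hΓ : IsStable g Γ.toMGraph) (D : Γ.V → ℤ) (v : Γ.V) :
    s.div D ((s.isSubdiv hgn hΓ).vert v) = D v := congrArg D (root_val v)

theorem div_exc (hΓ : IsStable g Γ.toMGraph) (D : Γ.V → ℤ) (v : s.curve.V) (hv : s.curve.Exc v.1) :
    s.div D v = 1 := by
  obtain ⟨z, hz⟩ := v
  rcases s.cases z with ⟨x, rfl⟩ | ⟨x, hx, rfl⟩ | ⟨x, rfl⟩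
  · exact absurd hv (s.nexc_old hΓ x)
  · rfl
  · rfl

/-- The specialization changes the lengths by little if the positions of the exceptional vertices
are close. -/
theorem abs_len_sub_lt {s s' : Γ.Pos} {δ M ε : ℝ} (h1 : ∀ x, s.ν x ≠ 0 → s'.ν x ≠ 0)
    (hM : ∀ x, Γ.len x ≤ M) (hδ : δ ≤ 1 / 4) (hδ0 : 0 < δ) (hε : δ * M < ε)
    (hne : ∀ x, s.ν x ≠ 0 → |s'.ν x - s.ν x| < δ)
    (hzero : ∀ x, s.ν x = 0 → s'.ν x < δ ∨ 1 - δ < s'.ν x) (z : s'.curve.X) :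
    |s'.curve.len z - s.curve.len (s.sp s' z)| < ε := by
  have hL : ∀ {a : ℝ} (x : Γ.X), |a| ≤ δ → |a * Γ.len x| < ε := fun {a} x h => by
    rw [abs_mul, abs_of_nonneg (Γ.len_nonneg x)]
    exact (mul_le_mul h (hM x) (Γ.len_nonneg x) hδ0.le).trans_lt hε
  have key : ∀ x, |s'.curve.len (s'.old x) - s.curve.len (s.spOld s' x)| < ε := fun x => by
    have hfr := s'.frac x
    by_cases hc : Contr s.ν s'.ν x
    · rw [spOld_contr hc, s.curve.len_zero _ (i_old_r x), sub_zero, len_old, if_neg hc.2.1.ne']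
      refine hL x ?_
      rw [abs_of_nonneg hfr.1]
      rcases hzero x hc.1 with h | h
      · exact h.le
      · linarith [hc.2.2]
    · rw [spOld_not hc, len_old, len_old]
      by_cases h0 : s.ν x = 0
      · rw [if_pos h0]
        by_cases h0' : s'.ν x = 0
        · rw [if_pos h0', sub_self, ← zero_mul (Γ.len x)]
          exact hL x (by rw [abs_zero]; exact hδ0.le)
        · rw [if_neg h0', show s'.ν x * Γ.len x - Γ.len x = (s'.ν x - 1) * Γ.len x by ring]
          refine hL x ?_
          rw [abs_of_nonpos (by linarith)]
          rcases hzero x h0 with h | h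
          · exact absurd ⟨h0, lt_of_le_of_ne hfr.1 (Ne.symm h0'), by linarith⟩ hc
          · linarith
      · rw [if_neg h0, if_neg (h1 x h0), ← sub_mul]
        exact hL x (hne x h0).le
  rcases s'.cases z with ⟨x, rfl⟩ | ⟨x, hx, rfl⟩ | ⟨x, rfl⟩
  · exact key x
  · have h3 := key x
    rw [← s'.curve.len_i, ← s.curve.len_i, s'.i_old hx] at h3
    exact h3
  · have h3 : s.curve.i (s.sp s' (s'.mid x)) = s.sp s' (s'.mid x) := by
      rw [← sp_i h1]; rfl
    rw [s'.curve.len_zero _ rfl, s.curve.len_zero _ h3, sub_zero, abs_zero]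
    exact (mul_nonneg hδ0.le ((Γ.len_nonneg x.1).trans (hM x.1))).trans_lt hε

/-- Specializations of standard subdivisions compose if the third one is close enough to the
second one. -/
theorem sp_comp (hgn : 2 < 2 * g + n) (hΓ : IsStable g Γ.toMGraph) {s s' s'' : Γ.Pos}
    (h1 : ∀ x, s.ν x ≠ 0 → s'.ν x ≠ 0) (h2 : ∀ x, s.ν x = 0 → s'.ν x ≠ 1 / 2)
    (h1' : ∀ x, s'.ν x ≠ 0 → s''.ν x ≠ 0) (h2' : ∀ x, s'.ν x = 0 → s''.ν x ≠ 1 / 2)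
    (h2'' : ∀ x, s.ν x = 0 → s''.ν x ≠ 1 / 2)
    (h : ∀ x, s'.ν x ≠ 0 → s'.ν x ≠ 1 / 2 → (s''.ν x < 1 / 2 ↔ s'.ν x < 1 / 2)) :
    s.sp s'' = s.sp s' ∘ s'.sp s'' := by
  funext z
  refine (s''.isSubdiv hgn hΓ).map_ext (s''.isQS hgn hΓ) (sp_r h2'')
    (sp_i fun x hx => h1' x (h1 x hx)) ?_ ?_ ?_ z
  · intro z
    rw [Function.comp_apply, sp_r h2', sp_r h2]
    rfl
  · intro z
    rw [Function.comp_apply, sp_i h1', sp_i h1]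
    rfl
  · intro x
    change s.spOld s'' x = s.sp s' (s'.spOld s'' x)
    by_cases hc : Contr s'.ν s''.ν x
    · have h0 : s.ν x = 0 := by by_contra h0; exact h1 x h0 hc.1
      rw [spOld_contr hc, spOld_contr ⟨h0, hc.2⟩]
      exact (spOld_fix (Γ.i_r x)).symm
    · rw [spOld_not hc]
      change s.spOld s'' x = s.spOld s' x
      have hiff : Contr s.ν s''.ν x ↔ Contr s.ν s'.ν x := by
        unfold Contr
        refine and_congr_right fun h0 => ?_
        by_cases h0' : s'.ν x = 0
        · refine iff_of_false (fun h3 => hc ⟨h0', h3⟩) fun h3 => h3.1.ne' h0'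
        · rw [h x h0' (h2 x h0)]
          have h3 := lt_of_le_of_ne (s'.frac x).1 (Ne.symm h0')
          have h4 := lt_of_le_of_ne (s''.frac x).1 (Ne.symm (h1' x h0'))
          simp only [h3, h4]
      by_cases hc' : Contr s.ν s'.ν x
      · rw [spOld_contr hc', spOld_contr (hiff.2 hc')]
      · rw [spOld_not hc', spOld_not (hiff.not.2 hc')]

end Pos

end TCurve


open TCurve

variable {g n : ℕ} {φ : UnivStab g n} {Γ : TCurve n} {T : Type u} [TopologicalSpace T]

open Classical in
/-- A continuous family over `T` of semistable divisors on subdivisions of `Γ`. -/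
structure DivFam (φ : UnivStab g n) (Γ : TCurve n) (hΓ : IsStable g Γ.toMGraph) (T : Type u)
    [TopologicalSpace T] where
  s : T → Γ.Pos
  D : T → Γ.V → ℤ
  near : ∀ t, ∀ ε > 0, ε ≤ 1 / 4 → ∀ᶠ t' in 𝓝 t, IsNear (D t) (s t).ν (D t') (s t').ν ε
  sum : ∀ t, ∑ v, D t v + ∑ x with Γ.Or x, (if (s t).ν x = 0 then 0 else 1) = φ.deg
  ss : ∀ t, IsSSData (φ.val Γ.toMGraph hΓ) (D t) (s t).ν

namespace DivFam

variable {hΓ : IsStable g Γ.toMGraph} (E : DivFam φ Γ hΓ T)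

theorem exists_small (t : T) : ∃ ε, IsSmall (E.s t).ν ε := by
  obtain ⟨ε, -, h⟩ := exists_isSmall (E.s t).frac one_pos
  exact ⟨ε, h⟩

/-- A neighbourhood of `t` on which the divisors specialize to the one at `t`. -/
def nhd (t : T) : Set T :=
  interior {t' | IsNear (E.D t) (E.s t).ν (E.D t') (E.s t').ν (E.exists_small t).choose}

theorem isNear {t t' : T} (h : t' ∈ E.nhd t) :
    IsNear (E.D t) (E.s t).ν (E.D t') (E.s t').ν (E.exists_small t).choose := by
  have h1 : t' ∈ {t' | IsNear (E.D t) (E.s t).ν (E.D t') (E.s t').ν (E.exists_small t).choose} :=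
    interior_subset h
  exact h1

theorem ne_zero {t t' : T} (h : t' ∈ E.nhd t) : ∀ x, (E.s t).ν x ≠ 0 → (E.s t').ν x ≠ 0 :=
  (E.isNear h).ne_zero (E.exists_small t).choose_spec

theorem ne_half {t t' : T} (h : t' ∈ E.nhd t) : ∀ x, (E.s t).ν x = 0 → (E.s t').ν x ≠ 1 / 2 :=
  (E.isNear h).ne_half (E.exists_small t).choose_spec.le

theorem mem_nhd (t : T) : t ∈ E.nhd t := by
  have h := (E.exists_small t).choose_spec
  exact mem_interior_iff_mem_nhds.2 (E.near t _ h.pos h.le)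

/-- Positions other than the midpoint stay on the same side of it. -/
theorem eventually_half (t : T) : ∀ᶠ t' in 𝓝 t, ∀ x, (E.s t).ν x ≠ 0 → (E.s t).ν x ≠ 1 / 2 →
    ((E.s t').ν x < 1 / 2 ↔ (E.s t).ν x < 1 / 2) := by
  refine Filter.eventually_all.2 fun x => ?_
  by_cases hx : (E.s t).ν x = 1 / 2
  · exact Filter.Eventually.of_forall fun _ _ h => absurd hx h
  · have h0 : 0 < |(E.s t).ν x - 1 / 2| := abs_pos.2 (sub_ne_zero.2 hx)
    filter_upwards [E.near t _ (lt_min h0 (by norm_num)) (min_le_right _ (1 / 4))] with t' h h1 _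
    have h2 := (h.ne x h1).trans_le (min_le_left _ _)
    rw [abs_lt] at h2
    rcases lt_or_gt_of_ne hx with h3 | h3
    · rw [abs_of_neg (by linarith)] at h2
      exact iff_of_true (by linarith) h3
    · rw [abs_of_pos (by linarith)] at h2
      exact iff_of_false (by linarith) (by linarith)

/-- The family of curves associated with a family of divisors. -/
noncomputable def toFam (hgn : 2 < 2 * g + n) : Fam n T where
  curve t := (E.s t).curve
  nhd := E.nhd
  isOpen_nhd _ := isOpen_interior
  mem_nhd := E.mem_nhd
  sp t t' _ := (E.s t).sp (E.s t')
  sp_mor _ _ h := Pos.isMor_sp (E.ne_zero h) (E.ne_half h)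
  sp_comp t t' h := by
    filter_upwards [E.eventually_half t'] with t'' hh h₁ h₂
    exact Pos.sp_comp hgn hΓ (E.ne_zero h) (E.ne_half h) (E.ne_zero h₁) (E.ne_half h₁)
      (E.ne_half h₂) hh
  sp_len t ε hε := by
    obtain ⟨M, hM⟩ := (Set.finite_range Γ.len).bddAbove
    have hM' : ∀ x, Γ.len x ≤ max M 0 := fun x => (hM ⟨x, rfl⟩).trans (le_max_left _ _)
    have hM0 : 0 ≤ max M 0 := le_max_right _ _
    have hδ : 0 < min (1 / 4) (ε / (max M 0 + 1)) := lt_min (by norm_num) (by positivity)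
    filter_upwards [E.near t _ hδ (min_le_left _ _)] with t' hn h y
    refine Pos.abs_len_sub_lt (E.ne_zero h) hM' (min_le_left _ _) hδ ?_ hn.ne hn.zero y
    calc _ ≤ ε / (max M 0 + 1) * max M 0 := mul_le_mul_of_nonneg_right (min_le_right _ _) hM0
      _ < ε / (max M 0 + 1) * (max M 0 + 1) :=
        mul_lt_mul_of_pos_left (by linarith) (by positivity)
      _ = ε := div_mul_cancel₀ _ (by positivity)

/-- The family of curves with divisors associated with a family of divisors. -/
noncomputable def toJFam (hgn : 2 < 2 * g + n) : JFam φ T where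
  toFam := E.toFam hgn
  qs t := (E.s t).isQS hgn hΓ
  D t := (E.s t).div (E.D t)
  ss t := by
    have h1 : (fun v => (E.s t).div (E.D t) ((TCurve.isSubdiv ((E.s t).stabIso hgn hΓ)).vert v)) =
        E.D t := funext fun v => (E.s t).div_vert hgn hΓ (E.D t) v
    refine semistable_of_isSSData ((E.s t).stabIso hgn hΓ) hΓ ((E.s t).div_exc hΓ _) ?_ ?_
    · classical
      have h2 : ∀ ν, ν = (E.s t).ν →
          ∑ v, E.D t v + ∑ x with Γ.Or x, (if ν x = 0 then 0 else 1) = φ.deg := by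
        rintro _ rfl
        exact E.sum t
      exact (congrArg (fun f : Γ.V → ℤ => ∑ v, f v + _) h1).trans
        (h2 _ ((E.s t).param_stabIso hgn hΓ))
    · rw [h1, (E.s t).param_stabIso]
      exact E.ss t
  push t t' h v := by
    have hs := Pos.isSpec hgn hΓ (E.ne_zero h) (E.ne_half h)
    obtain ⟨w | x, rfl⟩ := (((E.s t).isSubdiv hgn hΓ).vertEquiv
      ((E.s t).isQS hgn hΓ)).surjective v
    · refine Eq.trans ?_ (hs.sum_fibre_vert ((E.s t').isQS hgn hΓ)
        ((E.s t').div_exc hΓ (E.D t')) w).symm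
      rw [Pos.div_vert _ hgn hΓ, ← (E.isNear h).div]
      exact (E.s t).div_vert hgn hΓ (E.D t) w
    · exact Eq.trans ((E.s t).div_exc hΓ _ _ (((E.s t).isSubdiv hgn hΓ).exc_mid x.2.2))
        (hs.sum_fibre_mid ((E.s t').isQS hgn hΓ) ((E.s t').div_exc hΓ (E.D t')) x.2.2).symm

/-- The point of the fibre associated with a family of divisors. -/
noncomputable def toFibre (hgn : 2 < 2 * g + n) : FibreOver φ Γ hΓ T :=
  CostructuredArrow.mk (Y := E.toJFam hgn)
    (show Fam.Iso (E.toJFam hgn).stab.toFam (constFam Γ hΓ T).toFam from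
      { iso := fun t => (E.s t).stabIso hgn hΓ
        comm := fun t => Filter.Eventually.of_forall fun t' h _ y => by
          obtain ⟨x, rfl⟩ := ((E.s t').stabIso hgn hΓ).toEquiv.symm.surjective y
          refine Eq.trans ?_ (((E.s t').stabIso hgn hΓ).toEquiv.apply_symm_apply x).symm
          exact ((E.s t).stabIso hgn hΓ).toEquiv.eq_symm_apply.1
            (Subtype.ext ((Pos.isSpec hgn hΓ (E.ne_zero h) (E.ne_half h)).stabFun_eq x)) })

/-- The class of the divisor of the associated point of the fibre. -/
theorem picClass_toFibre (hgn : 2 < 2 * g + n) (t : T) :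
    picClass (E.toFibre hgn) t = Γ.clsHom (Γ.divOf (E.D t) (E.s t).ν) := by
  have h1 : (E.toFibre hgn).pos t = (E.s t).ν := (E.s t).param_stabIso hgn hΓ
  have h2 : (E.toFibre hgn).div t = E.D t := funext fun v => (E.s t).div_vert hgn hΓ (E.D t) v
  rw [FibreOver.picClass_eq, h1, h2]

end DivFam

/-- Every continuous map to the tropical Picard group arises from a family of divisors. -/
theorem exists_divFam (hgn : 2 < 2 * g + n) (hφ : φ.IsGeneral) (hΓ : IsStable g Γ.toMGraph)
    (f : C(T, Γ.PicDeg φ.deg)) : ∃ E : DivFam φ Γ hΓ T,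
      ∀ t, Γ.clsHom (Γ.divOf (E.D t) (E.s t).ν) = f t := by
  obtain ⟨π⟩ := nonempty_paths hΓ.conn
  obtain ⟨ϖ⟩ := nonempty_periodMap hΓ.conn
  have hsum := FibreOver.sum_val_eq (φ := φ) hΓ π
  -- the flows `μ t` need not depend continuously on `t`, but they do so modulo integral cycles
  have h : ∀ t, ∃ μ, Γ.IsFlow μ ∧ IsSS (φ.val Γ.toMGraph hΓ) (π.baseDiv φ.deg) μ ∧
      ϖ.toTorus μ = ajPic π ϖ (f t) := fun t => by
    obtain ⟨η, hη, ht⟩ := ϖ.exists_toTorus (ajPic π ϖ (f t))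
    obtain ⟨k, hk⟩ := exists_isSS hΓ.conn hsum hη
    refine ⟨_, hη.add (grad_isFlow k), hk, ?_⟩
    have h1 : (fun x => η x + Γ.grad k x) = η + Γ.grad k := rfl
    rw [h1, map_add, ϖ.toTorus_grad, add_zero, ht]
  choose μ hμ hss ht using h
  have hcont : Continuous fun t => ajPic π ϖ (f t : Γ.Pic) :=
    (continuous_ajPic π ϖ).comp (continuous_subtype_val.comp f.continuous)
  refine ⟨⟨fun t => ⟨fun x => Int.fract (μ t x), isFrac_fract (hμ t), fun x hx => ?_⟩,
    fun t => flowDiv (π.baseDiv φ.deg) (μ t), fun t ε hε hε' => ?_, fun t => ?_, fun t =>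
      (isSS_iff (hμ t)).1 (hss t)⟩, fun t => ?_⟩
  · rw [(hμ t).eq_zero hx, Int.fract_zero]
  · obtain ⟨δ, hδε, hδ⟩ := exists_isSmall (isFrac_fract (hμ t)) hε
    have h1 := exists_cycle_near ϖ hΓ.conn hsum (isGen hgn hφ hΓ) (hμ t) (hss t) hδ.pos
    rw [ht] at h1
    filter_upwards [hcont.continuousAt.eventually h1] with t' h2
    obtain ⟨c, hc, hlt⟩ := h2 (μ t') (hμ t') (hss t') (ht t')
    have h3 := isNear_of_flow (D₀ := π.baseDiv φ.deg) (μ' := fun x => μ t' x + (-c x : ℤ)) hδ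
      fun x => by push_cast; rw [← sub_eq_add_neg]; exact hlt x
    rw [flowDiv_add_cycle hc.neg] at h3
    simp only [Int.fract_add_intCast] at h3
    exact ⟨fun x hx => (h3.ne x hx).trans_le hδε, fun x hx => (h3.zero x hx).imp
      (fun h => h.trans_le hδε) fun h => by linarith, h3.div⟩
  · have := degHom_divOf_baseDiv π φ.deg (hμ t)
    rwa [degHom_divOf] at this
  · exact (clsHom_divOf_baseDiv π φ.deg (hμ t)).trans
      (eq_of_ajPic_eq π ϖ (f t).2 (hμ t) (ht t)).symm

/-! ### The fibre and the tropical Picard group -/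

/-- The functor sending a point of the fibre to the family of the classes of its divisors. -/
noncomputable def picFunctor {g n : ℕ} (φ : UnivStab g n) (Γ : TCurve n)
    (hΓ : MGraph.IsStable g Γ.toMGraph) (T : Type u) [TopologicalSpace T] :
    FibreOver φ Γ hΓ T ⥤ Discrete C(T, Γ.PicDeg φ.deg) where
  obj F := ⟨FibreOver.toPic F⟩
  map f := Discrete.eqToHom (ContinuousMap.ext fun t =>
    Subtype.ext (FibreOver.picClass_eq_of_hom f t))

/-- The fibre over `T` is equivalent to the set of continuous maps to the tropical Picard group:
points of the fibre are rigid, determined by the classes of their divisors, and realize all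
continuous families of classes. -/
theorem isEquivalence_picFunctor {g n : ℕ} (hgn : 2 < 2 * g + n) {φ : UnivStab g n}
    (hφ : φ.IsGeneral) (Γ : TCurve n) (hΓ : MGraph.IsStable g Γ.toMGraph) (T : Type u)
    [TopologicalSpace T] : (picFunctor φ Γ hΓ T).IsEquivalence where
  faithful := ⟨fun _ => FibreOver.hom_ext _ _⟩
  full := ⟨fun {F F'} a => by
    have h : ∀ t, picClass F t = picClass F' t := fun t =>
      congrArg (fun k : C(T, Γ.PicDeg φ.deg) => (k t : Γ.Pic)) (Discrete.eq_of_hom a)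
    obtain ⟨b⟩ := FibreOver.nonempty_hom
      (fun t => (FibreOver.eq_of_picClass_eq hgn hφ (h t)).1)
      (fun t => (FibreOver.eq_of_picClass_eq hgn hφ (h t)).2)
    exact ⟨b, Subsingleton.elim _ _⟩⟩
  essSurj := ⟨fun f => by
    obtain ⟨E, hE⟩ := exists_divFam hgn hφ hΓ f.as
    exact ⟨E.toFibre hgn, ⟨Discrete.eqToIso (ContinuousMap.ext fun t =>
      Subtype.ext ((E.picClass_toFibre hgn t).trans (hE t)))⟩⟩⟩

/-- The fibre of `|Φ^trop| : |J^trop_{g,n}(φ)| → |M^trop_{g,n}|` over the point `Γ` is represented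
by the topological space `Pic^{|φ|}(Γ)`, the equivalence being the canonical one, which sends a
point of the fibre to the class of the associated divisor on `Γ`; and `Pic^{|φ|}(Γ)` is a real
torus of dimension `b₁(Γ)`. -/
theorem corollaryC {g n : ℕ} (hgn : 2 < 2 * g + n) (φ : UnivStab g n) (hφ : φ.IsGeneral)
    (Γ : TCurve n) (hΓ : MGraph.IsStable g Γ.toMGraph) :
    (∃ Ψ : ∀ (T : Type u) [TopologicalSpace T],
        FibreOver φ Γ hΓ T ⥤ Discrete C(T, Γ.PicDeg φ.deg),
      (∀ (T : Type u) [TopologicalSpace T], (Ψ T).IsEquivalence) ∧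
      (∀ (T : Type u) [TopologicalSpace T] (F : FibreOver φ Γ hΓ T) (t : T),
        (((Ψ T).obj F).as t : Γ.Pic) = picClass F t) ∧
      (∀ (S T : Type u) [TopologicalSpace S] [TopologicalSpace T] (f : C(S, T))
        (F : FibreOver φ Γ hΓ T), ((Ψ S).obj (F.pullback f)).as = ((Ψ T).obj F).as.comp f)) ∧
    Nonempty (Γ.PicDeg φ.deg ≃ₜ (Fin Γ.b1 → UnitAddCircle)) := by
  refine ⟨⟨fun T _ => picFunctor φ Γ hΓ T, fun T _ => isEquivalence_picFunctor hgn hφ Γ hΓ T,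
    fun T _ F t => rfl, fun S T _ _ f F => rfl⟩, ?_⟩
  obtain ⟨π⟩ := TCurve.nonempty_paths hΓ.conn
  obtain ⟨ϖ⟩ := TCurve.nonempty_periodMap hΓ.conn
  exact ⟨TCurve.picHomeo π ϖ φ.deg⟩
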